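/- Let $e(x)=e^{2\pi i x}$. For a finite set $\mathcal H$ of integers and $r\ge 1$ let $$\mathfrak S_r(\mathcal H)=\prod_{p\nmid r}\frac{1-\nu_{\mathcal H}(p)/p}{(1-1/p)^{|\mathcal H|}},\qquad \mathfrak S_{0,r}(\mathcal H)=\sum_{\mathcal J\subseteq\mathcal H}(-1)^{|\mathcal H\setminus\mathcal J|}\,\mathfrak S_r(\mathcal J),$$ where $p$ runs over primes and $\nu_{\mathcal H}(p)$ is the number of residue classes mod $p$ occupied by $\mathcal H$. For an integer $h\ge 1$ and residue classes $c_1,\dots,c_k$ mod $r$ let $$R_k(h;r,c_1,\dots,c_k)=\sum_{\substack{1\le h_1,\dots,h_k\le h\ \text{distinct}\\ h_i\equiv c_i \bmod r\ \forall i}}\mathfrak S_{0,r}(\{h_1,\dots,h_k\}),\qquad E_{r,c}(\alpha)=\sum_{\substack{1\le m\le h\\ m\equiv c\bmod r}}e(m\alpha),$$ $$V_2(Q,h;r,c_1,c_2)=\sum_{\substack{q_1,q_2\mid Q\\ q_i>1,\ (q_i,r)=1}}\frac{\mu(q_1)\mu(q_2)}{\phi(q_1)\phi(q_2)}\sum_{\substack{1\le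 a_i\le q_i,\ (a_i,q_i)=1\\ a_1/q_1+a_2/q_2\in\mathbb Z}}E_{r,c_1}\!\left(\frac{a_1}{q_1}\right)E_{r,c_2}\!\left(\frac{a_2}{q_2}\right).$$ Put $\mathcal C_\ell=\{i: c_i\equiv \ell \bmod r\}$ for $\ell$ mod $r$. A partition $\mathcal P$ of $\{1,\dots,k\}$ refines $\{\mathcal C_\ell\}$, written $\mathcal P\preceq\{\mathcal C_\ell\}$, if each of its parts is contained in some $\mathcal C_\ell$. Let $\mathcal B(X)$ be the set of perfect matchings of a finite set $X$. **Theorem.** Fix integers $r\ge 1$ and $k\ge 1$. (1) For every $\varepsilon>0$, all classes $c_1,\dots,c_k$ mod $r$, all integers $h\ge 3$, and $Q=\prod_{p\le y,\ p\nmid r}p$ with any integer $y$ satisfying $h^2\le y\le h^{k+1}$, $$R_k(h;r,c_1,\dots,c_k)=\sum_{0\le j\le k/2}(-1)^j\sum_{\mathcal P}\Bigl(\frac hr\sum_{\substack{d\mid Q\\ d>1}}\frac{\mu(d)^2}{\phi(d)}\Bigr)^{j}\sum_{\sigma\in\mathcal B(X_{\mathcal P})}\ \prod_{\{i_1,i_2\}\in\sigma}V_2(Q,h;r,c_{i_1},c_{i_2})+O_{r,k,\varepsilon}\bigl(h^{k/2-1/(7k)+\varepsilon}\bigr),$$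 where $\mathcal P$ runs over the partitions $\mathcal P\preceq\{\mathcal C_\ell\}$ of $\{1,\dots,k\}$ into $j$ two-element sets and $k-2j$ singletons, and $X_{\mathcal P}$ is the set of the $i$ with $\{i\}\in\mathcal P$. (2) Let $\#\tilde{\mathcal B}(c_1,\dots,c_k)$ be the number of perfect matchings of $\{1,\dots,k\}$ all of whose pairs $\{i,j\}$ satisfy $c_i\equiv c_j \bmod r$. Then for all classes $c_1,\dots,c_k$ mod $r$ and all integers $h\ge 3$ $$R_k(h;r,c_1,\dots,c_k)=\#\tilde{\mathcal B}(c_1,\dots,c_k)\left(\frac1r\Bigl(-h\,\frac{\phi(r)}{r}\log h+C_0(r)\,h\Bigr)\right)^{k/2}+O_{r,k}\bigl(h^{k/2}(\log h)^{k/2-1}\bigr),$$ where $C_0(r)=\frac{\phi(r)}{r}\bigl(\log\frac{r}{2\pi}-\gamma_0-\sum_{p\mid r}\frac{\log p}{p-1}\bigr)$ and $\gamma_0$ is the Euler--Mascheroni constant. (For odd $k$ the count $\#\tilde{\mathcal B}$ is $0$ and the first term is read as $0$.) -/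

import Mathlib

open scoped Classical in
/-- `ν_H(p)`: the number of residue classes modulo `p` occupied by the elements of `H`. -/
noncomputable def nuRes (H : Finset ℕ) (p : ℕ) : ℕ :=
  (H.image (fun n : ℕ => (n : ZMod p))).card

/-- The local factor at `p` of the singular series of `H`. -/
noncomputable def localFactor (H : Finset ℕ) (p : ℕ) : ℝ :=
  (1 - (nuRes H p : ℝ) / (p : ℝ)) / (1 - 1 / (p : ℝ)) ^ H.card

theorem one_sub_pow_bound (x : ℝ) (h0 : 0 ≤ x) (h1 : x ≤ 1) (n : ℕ) :
    0 ≤ (1 - x) ^ n - (1 - n * x) ∧ (1 - x) ^ n - (1 - n * x) ≤ (n : ℝ) ^ 2 * x ^ 2 := by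
  induction n with
  | zero => simp
  | succ n ih =>
    obtain ⟨ih1, ih2⟩ := ih
    have key : (1 - x) ^ (n + 1) - (1 - ((n + 1 : ℕ) : ℝ) * x)
        = n * x ^ 2 + ((1 - x) ^ n - (1 - n * x)) * (1 - x) := by
      push_cast
      ring
    have hn : (0 : ℝ) ≤ n := Nat.cast_nonneg n
    have hx2 : 0 ≤ x ^ 2 := sq_nonneg x
    have hm : 0 ≤ ((1 - x) ^ n - (1 - n * x)) * (1 - x) := mul_nonneg ih1 (by linarith)
    have hm2 : ((1 - x) ^ n - (1 - n * x)) * (1 - x) ≤ (n : ℝ) ^ 2 * x ^ 2 := by nlinarith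
    rw [key]
    push_cast
    refine ⟨by positivity, ?_⟩
    nlinarith [mul_nonneg hn hx2]

theorem nuRes_eq_card (H : Finset ℕ) (p : ℕ) (hp : H.sup id < p) : nuRes H p = H.card := by
  classical
  unfold nuRes
  refine (Finset.card_image_of_injOn ?_)
  intro a ha b hb hab
  have ha' : a < p := lt_of_le_of_lt (Finset.le_sup (f := id) ha) hp
  have hb' : b < p := lt_of_le_of_lt (Finset.le_sup (f := id) hb) hp
  have := (ZMod.natCast_eq_natCast_iff' a b p).1 hab
  rwa [Nat.mod_eq_of_lt ha', Nat.mod_eq_of_lt hb'] at this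

/-- The product defining the singular series converges unconditionally. -/
theorem multipliable_singSeries (r : ℕ) (H : Finset ℕ) :
    Multipliable (fun p : {p : ℕ // p.Prime ∧ ¬ p ∣ r} => localFactor H p) := by
  have hs : Summable (fun p : {p : ℕ // p.Prime ∧ ¬ p ∣ r} => localFactor H p - 1) := by
    have hb : Summable (fun p : {p : ℕ // p.Prime ∧ ¬ p ∣ r} =>
        ((H.card : ℝ) ^ 2 * 2 ^ H.card) * (1 / ((p : ℕ) : ℝ) ^ 2)) :=
      ((Real.summable_one_div_nat_pow.2 one_lt_two).subtype _).mul_left _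
    refine hb.of_norm_bounded_eventually ?_
    have hfin : {p : {p : ℕ // p.Prime ∧ ¬ p ∣ r} | (p : ℕ) ≤ H.sup id}.Finite :=
      (Set.finite_Iic (H.sup id)).preimage Subtype.val_injective.injOn
    filter_upwards [hfin.compl_mem_cofinite] with p hp
    have hp' : H.sup id < (p : ℕ) := by simpa using hp
    have hp2 : (2 : ℝ) ≤ ((p : ℕ) : ℝ) := by exact_mod_cast p.2.1.two_le
    set x : ℝ := 1 / ((p : ℕ) : ℝ) with hx
    have hx0 : 0 ≤ x := by positivity
    have hx1 : x ≤ 1 / 2 := one_div_le_one_div_of_le two_pos hp2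
    obtain ⟨b1, b2⟩ := one_sub_pow_bound x hx0 (by linarith) H.card
    have hpow : (1 / 2 : ℝ) ^ H.card ≤ (1 - x) ^ H.card :=
      pow_le_pow_left₀ (by norm_num) (by linarith) _
    have hpos : 0 < (1 - x) ^ H.card := lt_of_lt_of_le (by positivity) hpow
    have e : localFactor H p - 1 = -((1 - x) ^ H.card - (1 - H.card * x)) / (1 - x) ^ H.card := by
      rw [localFactor, nuRes_eq_card H p hp', div_eq_mul_one_div (H.card : ℝ), ← hx]
      field_simp
      ring
    rw [e, norm_div, norm_neg, Real.norm_of_nonneg b1, Real.norm_of_nonneg hpos.le,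
      div_le_iff₀ hpos]
    have hone : 1 ≤ 2 ^ H.card * (1 - x) ^ H.card := by
      rw [← mul_pow]
      exact one_le_pow₀ (by linarith)
    have hxx : 1 / ((p : ℕ) : ℝ) ^ 2 = x ^ 2 := by rw [hx]; ring
    rw [hxx]
    calc _ ≤ (H.card : ℝ) ^ 2 * x ^ 2 * 1 := by linarith
      _ ≤ (H.card : ℝ) ^ 2 * x ^ 2 * (2 ^ H.card * (1 - x) ^ H.card) := by gcongr
      _ = _ := by ring
  simpa using Real.multipliable_one_add_of_summable hs

/-- The singular series `𝔖_r(H)` away from `r`: the product of the local factors over the primes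
`p ∤ r`. The product is unconditionally convergent, see `multipliable_singSeries`. -/
noncomputable def singSeries (r : ℕ) (H : Finset ℕ) : ℝ :=
  ∏' p : {p : ℕ // p.Prime ∧ ¬ p ∣ r}, localFactor H p

/-- `𝔖_{0,r}(H) = ∑_{J ⊆ H} (-1)^{|H \ J|} 𝔖_r(J)`. -/
noncomputable def singSeriesAlt (r : ℕ) (H : Finset ℕ) : ℝ :=
  ∑ J ∈ H.powerset, (-1 : ℝ) ^ (H \ J).card * singSeries r J

open scoped Classical in
/-- `R_k(h; r, c_1, …, c_k)`: the sum of `𝔖_{0,r}({h_1, …, h_k})` over the pairwise distinct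
`h_1, …, h_k ∈ [1, h]` with `h_i ≡ c_i (mod r)` for every `i`. -/
noncomputable def sumR {k : ℕ} (r h : ℕ) (c : Fin k → ZMod r) : ℝ :=
  ∑ d ∈ (Fintype.piFinset fun _ : Fin k => Finset.Icc 1 h).filter
      (fun d : Fin k → ℕ => Function.Injective d ∧ ∀ i, ((d i : ℕ) : ZMod r) = c i),
    singSeriesAlt r (Finset.univ.image d)

open scoped Classical in
/-- `E_{r,c}(α) = ∑_{1 ≤ m ≤ h, m ≡ c (mod r)} e(mα)`, where `e(x) = exp(2πix)`. -/
noncomputable def expSum (r h : ℕ) (c : ZMod r) (α : ℝ) : ℂ :=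
  ∑ m ∈ (Finset.Icc 1 h).filter (fun m : ℕ => (m : ZMod r) = c),
    Complex.exp (2 * Real.pi * Complex.I * ((m : ℂ) * (α : ℂ)))

open scoped Classical in
/-- `V_k(q, h; r, c_1, …, c_k)`: the sum over `1 < q_i ∣ q` with `(q_i, r) = 1`, of
`∏ μ(q_i)/φ(q_i)` times the sum over `1 ≤ a_i ≤ q_i` with `(a_i, q_i) = 1` and `∑ a_i/q_i ∈ ℤ`, of
`∏ E_{r,c_i}(a_i/q_i)`. -/
noncomputable def sumV {k : ℕ} (q h r : ℕ) (c : Fin k → ZMod r) : ℂ :=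
  ∑ Q ∈ Fintype.piFinset (fun _ : Fin k =>
      q.divisors.filter (fun d : ℕ => 1 < d ∧ Nat.Coprime d r)),
    (∏ i, (ArithmeticFunction.moebius (Q i) : ℂ) / (Nat.totient (Q i) : ℂ)) *
      ∑ a ∈ (Fintype.piFinset (fun i : Fin k =>
          (Finset.Icc 1 (Q i)).filter (fun a : ℕ => Nat.Coprime a (Q i)))).filter
          (fun a => ∃ n : ℤ, ∑ i, (a i : ℚ) / (Q i : ℚ) = (n : ℚ)),
        ∏ i, expSum r h (c i) ((a i : ℝ) / (Q i : ℝ))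

/-- The product of all primes `p ≤ y` not dividing `r`. -/
def primeProd (r y : ℕ) : ℕ :=
  ∏ p ∈ (Finset.Icc 1 y).filter (fun p : ℕ => p.Prime ∧ ¬ p ∣ r), p

/-- `∑_{d ∣ q, d > 1} μ(d)^2 / φ(d)`. -/
noncomputable def sumInvTotient (q : ℕ) : ℝ :=
  ∑ d ∈ q.divisors.filter (fun d : ℕ => 1 < d),
    ((ArithmeticFunction.moebius d : ℤ) : ℝ) ^ 2 / (Nat.totient d : ℝ)

open scoped Classical in
/-- The perfect matchings of a finite set `X` of indices. An unordered pair is represented by the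
ordered pair `(i, j)` with `i < j`. -/
noncomputable def perfectMatchings {k : ℕ} (X : Finset (Fin k)) :
    Finset (Finset (Fin k × Fin k)) :=
  (X ×ˢ X).powerset.filter (fun σ =>
    (∀ p ∈ σ, p.1 < p.2) ∧ ∀ i ∈ X, ∃! j, j ∈ X ∧ ((i, j) ∈ σ ∨ (j, i) ∈ σ))

open scoped Classical in
/-- The class `C_ℓ = {i : c_i ≡ ℓ (mod r)}`. -/
noncomputable def resClass {k r : ℕ} (c : Fin k → ZMod r) (l : ZMod r) : Finset (Fin k) :=
  Finset.univ.filter (fun i => c i = l)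

/-- The partition `P` of the index set refines `{C_ℓ}`. -/
def RefinesClasses {k r : ℕ} (c : Fin k → ZMod r)
    (P : Finpartition (Finset.univ : Finset (Fin k))) : Prop :=
  ∀ S ∈ P.parts, ∃ l : ZMod r, S ⊆ resClass c l

open scoped Classical in
/-- The partitions of the index set refining `{C_ℓ}` that consist of `j` sets with two elements
and otherwise of singletons. -/
noncomputable def pairSinglePartitions {k r : ℕ} (c : Fin k → ZMod r) (j : ℕ) :
    Finset (Finpartition (Finset.univ : Finset (Fin k))) :=
  Finset.univ.filter (fun P => RefinesClasses c P ∧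
    (∀ S ∈ P.parts, S.card = 1 ∨ S.card = 2) ∧
    (P.parts.filter (fun S => S.card = 2)).card = j)

open scoped Classical in
/-- The indices that form a singleton of the partition `P`. -/
noncomputable def singletonIndices {k : ℕ} (P : Finpartition (Finset.univ : Finset (Fin k))) :
    Finset (Fin k) :=
  Finset.univ.filter (fun i => {i} ∈ P.parts)

/-- The main term, for a modulus `Q`: a singleton `{i}` of a partition is identified with `i`, so
that `c({i}) = c_i`, and the matchings are those of the set of singletons. -/
noncomputable def mainTerm {k : ℕ} (Q h r : ℕ) (c : Fin k → ZMod r) : ℂ :=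
  ∑ j ∈ Finset.range (k / 2 + 1), (-1 : ℂ) ^ j *
    ∑ P ∈ pairSinglePartitions c j,
      (((h : ℝ) / (r : ℝ) * sumInvTotient Q : ℝ) : ℂ) ^ j *
        ∑ σ ∈ perfectMatchings (singletonIndices P),
          ∏ p ∈ σ, sumV Q h r ![c p.1, c p.2]

open scoped Classical in
/-- The number of perfect matchings of the indices all of whose pairs `(i, j)` have `c_i = c_j`. -/
noncomputable def numEqualPairings {k r : ℕ} (c : Fin k → ZMod r) : ℕ :=
  ((perfectMatchings (Finset.univ : Finset (Fin k))).filter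
    (fun σ => ∀ p ∈ σ, c p.1 = c p.2)).card

/-- `C_0(r) = (φ(r)/r) (log (r/2π) - γ - ∑_{p ∣ r} log p / (p - 1))`. -/
noncomputable def constC0 (r : ℕ) : ℝ :=
  (Nat.totient r : ℝ) / (r : ℝ) *
    (Real.log ((r : ℝ) / (2 * Real.pi)) - Real.eulerMascheroniConstant -
      ∑ p ∈ r.primeFactors, Real.log (p : ℝ) / ((p : ℝ) - 1))

open Finset


/-! ### The fundamental lemma of Montgomery and Vaughan. -/

section FundamentalLemma

variable {ι : Type*} [Fintype ι] [DecidableEq ι]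

/-! For squarefree `Q` coprime to `r`, let f be the indicator of the units mod `Q`, scaled to mean 1
and centred (`unitVar`). Expanding the product, the average over n mod `Q` of ∏ f(n + h_i) is the
alternating singular series with its Euler product cut to the primes of `Q`
(`mixedMoment_univ_empty`), and the tail of the product costs little
(`abs_sumR_sub_mixedMoment_le`). So R_k is close to an average of sums of such products over
distinct h_i, and the theorem says that the class sums X_c(n) = ∑ f(n + m), over m ≤ h with m ≡ c
mod r, have nearly Gaussian mixed moments.

Gaussian moments. The Fourier coefficients of f are μ(q)/φ(q) at the fractions a/q, so a moment of
the X_c is a sum over tuples of nonzero frequencies with sum zero (`sum_prod_classVar`). After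
dividing frequencies by r, the coefficients are at most min(h, 1/‖α‖)/φ(q). Two cancelling
frequencies split off a covariance V_2, which gives the recursion of Wick's formula
(`norm_suppSum_sub_le_of_bounds`). The heart of the matter is that tuples without a cancelling pair
save a power of h over the size h^(k/2) (`sum_freeTuples_le`). The fundamental lemma alone gives
h^(k/2) up to divisor sums. A frequency farther than 1/H from the integers saves √(H/h) in mean
square. A frequency within 1/H has denominator at least H, and each prime of it divides another
denominator, so it shares a divisor at least D with one of them once D^(k-1) ≤ H. If both of these
frequencies are within 1/H and do not cancel, their numerators can be counted directly, which bounds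
the contribution by a factor h/(H√D) (`sum_closeTuples_le`). The choice H = h^(1-2/(7k)), D =
h^(6/(7k)) makes both factors h^(-1/(7k)).

Distinctness. Since f² is a linear polynomial in f with constant term Q/φ(Q) - 1, a coincidence h_i
= h_j removes both variables and leaves about (Q/φ(Q) - 1)h/r. Passing from free to distinct indices
one at a time subtracts this number from the covariance of every pair in a common class
(`abs_mixedMoment_sub_matchSum_le`). Expanding the matching sum of the corrected covariances
produces exactly the sum over partitions in the statement (`mainTerm_eq_matchSum`). The moments are
computed at the cutoff h^(k+1), where truncation is harmless; every cutoff y ≥ h^2 is then reached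
because the corrected covariance is close to R_2, which does not depend on the cutoff.

Part (2). The singular series of a pair expands over divisors d of `Q` with weights whose sum over d
≤ h is (φ(r)/r) log h + O(1). Hence the corrected covariance is -(h/r)(φ(r)/r) log h + O(h) for
equal classes and O(h) otherwise (`abs_correctedCov_sub_log_le`). The relative error 1/log h is the
one in the statement, and the constant C_0(r) only matters at that order. -/

theorem sum_hyperplane_prod_erase {A : Type*} [AddCommGroup A] [Fintype A] [DecidableEq A]
    (j : ι) (f : ι → A → ℝ) :
    ∑ α : ι → A with ∑ i, α i = 0, ∏ l ∈ univ.erase j, f l (α l)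
      = ∏ l ∈ univ.erase j, ∑ a, f l a := by
  -- Coordinate `j` is pinned to 0 with weight 1, so the right side becomes a full sum over a box;
  -- the bijection below restores the coordinate `j` as minus the sum of the others.
  have key := Finset.prod_univ_sum (fun l : ι => if l = j then ({0} : Finset A) else univ)
    (fun l a => if l = j then (1 : ℝ) else f l a)
  have e1 : ∏ l, ∑ a ∈ (if l = j then ({0} : Finset A) else univ), (if l = j then (1 : ℝ) else f l a)
      = ∏ l ∈ univ.erase j, ∑ a, f l a := by
    rw [← Finset.mul_prod_erase univ _ (mem_univ j)]
    simp only [if_true, sum_singleton, one_mul]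
    refine prod_congr rfl fun l hl => ?_
    simp [ne_of_mem_erase hl]
  rw [← e1, key]
  refine Finset.sum_bij' (fun α _ => Function.update α j 0)
    (fun α _ => Function.update α j (-∑ l ∈ univ.erase j, α l)) ?_ ?_ ?_ ?_ ?_
  · intro α hα
    rw [Fintype.mem_piFinset]
    intro l
    by_cases h : l = j
    · subst h; simp
    · simp [h]
  · intro α hα
    simp only [mem_filter, mem_univ, true_and]
    rw [← Finset.add_sum_erase univ _ (mem_univ j)]
    simp only [Function.update_self]
    rw [neg_add_eq_zero]
    refine sum_congr rfl fun l hl => ?_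
    simp [ne_of_mem_erase hl]
  · intro α hα
    simp only [mem_filter, mem_univ, true_and] at hα
    rw [← Finset.add_sum_erase univ _ (mem_univ j)] at hα
    funext l
    by_cases h : l = j
    · subst h
      simp only [Function.update_self]
      rw [eq_comm, eq_neg_iff_add_eq_zero, ← hα]
      congr 1
      refine sum_congr rfl fun m hm => ?_
      simp [ne_of_mem_erase hm]
    · simp [h]
  · intro α hα
    rw [Fintype.mem_piFinset] at hα
    funext l
    by_cases h : l = j
    · subst h
      have := hα l
      simp at this
      simp [this]
    · simp [h]
  · intro α hα
    rw [← Finset.mul_prod_erase univ _ (mem_univ j)]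
    simp only [if_true, one_mul]
    refine prod_congr rfl fun l hl => ?_
    simp [ne_of_mem_erase hl]

theorem prod_eq_mul_mul_prod_erase_erase {M : Type*} [CommMonoid M] {i j : ι} (hij : i ≠ j)
    (f : ι → M) : ∏ l, f l = f i * f j * ∏ l ∈ (univ.erase j).erase i, f l := by
  rw [← Finset.mul_prod_erase univ _ (mem_univ j),
    ← Finset.mul_prod_erase (univ.erase j) _ (mem_erase.2 ⟨hij, mem_univ i⟩)]
  rw [← mul_assoc, mul_comm (f j)]

/-- Cauchy–Schwarz in two of the variables, and the trivial bound in the other ones. -/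
theorem sum_hyperplane_prod_le {A : Type*} [AddCommGroup A] [Fintype A] [DecidableEq A]
    {i j : ι} (hij : i ≠ j) (G : ι → A → ℝ) (hG : ∀ l a, 0 ≤ G l a) :
    ∑ α : ι → A with ∑ i, α i = 0, ∏ l, G l (α l)
      ≤ √(∑ a, G i a ^ 2) * √(∑ a, G j a ^ 2) * ∏ l ∈ (univ.erase j).erase i, ∑ a, G l a := by
  set W : ℝ := ∏ l ∈ (univ.erase j).erase i, ∑ a, G l a with hW
  have hW0 : 0 ≤ W := prod_nonneg fun l _ => sum_nonneg fun a _ => hG l a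
  set w : (ι → A) → ℝ := fun α => ∏ l ∈ (univ.erase j).erase i, G l (α l) with hw
  have hw0 : ∀ α, 0 ≤ w α := fun α => prod_nonneg fun l _ => hG l _
  have h1 : ∀ i j : ι, i ≠ j → ∑ α : ι → A with ∑ i, α i = 0,
      G i (α i) ^ 2 * ∏ l ∈ (univ.erase j).erase i, G l (α l)
      = (∑ a, G i a ^ 2) * ∏ l ∈ (univ.erase j).erase i, ∑ a, G l a := by
    intro i j hij
    have := sum_hyperplane_prod_erase (A := A) j (fun l a => if l = i then G i a ^ 2 else G l a)
    have e : ∀ F : ι → ℝ, ∏ l ∈ univ.erase j, F l = F i * ∏ l ∈ (univ.erase j).erase i, F l :=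
      fun F => (Finset.mul_prod_erase (univ.erase j) _ (mem_erase.2 ⟨hij, mem_univ i⟩)).symm
    rw [e] at this
    simp only [e, if_true] at this
    refine Eq.trans (sum_congr rfl fun α _ => ?_) (this.trans ?_)
    · congr 1
      refine prod_congr rfl fun l hl => ?_
      simp [ne_of_mem_erase hl]
    · congr 1
      refine prod_congr rfl fun l hl => ?_
      simp [ne_of_mem_erase hl]
  have hcomm : (univ.erase i).erase j = (univ.erase j).erase i := erase_right_comm
  have h2 := h1 j i hij.symm
  rw [hcomm] at h2
  have h1 := h1 i j hij
  -- Each of the two factors at `i` and `j` takes half of the common weight `w`. In each square only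
  -- one of the two variables survives, and the hyperplane condition eliminates the other.
  calc ∑ α : ι → A with ∑ i, α i = 0, ∏ l, G l (α l)
      = ∑ α : ι → A with ∑ i, α i = 0, √(G i (α i) ^ 2 * w α) * √(G j (α j) ^ 2 * w α) := by
        refine sum_congr rfl fun α _ => ?_
        rw [prod_eq_mul_mul_prod_erase_erase hij, Real.sqrt_mul (sq_nonneg _),
          Real.sqrt_mul (sq_nonneg _), Real.sqrt_sq (hG _ _), Real.sqrt_sq (hG _ _)]
        have := Real.mul_self_sqrt (hw0 α)
        calc _ = G i (α i) * G j (α j) * w α := rfl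
          _ = G i (α i) * G j (α j) * (√(w α) * √(w α)) := by rw [this]
          _ = _ := by ring
    _ ≤ √(∑ α : ι → A with ∑ i, α i = 0, G i (α i) ^ 2 * w α) *
        √(∑ α : ι → A with ∑ i, α i = 0, G j (α j) ^ 2 * w α) :=
        Real.sum_sqrt_mul_sqrt_le _ (fun α => mul_nonneg (sq_nonneg _) (hw0 α))
          (fun α => mul_nonneg (sq_nonneg _) (hw0 α))
    _ = √((∑ a, G i a ^ 2) * W) * √((∑ a, G j a ^ 2) * W) := by rw [h1, h2]
    _ = _ := by
        rw [Real.sqrt_mul (sum_nonneg fun a _ => sq_nonneg _),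
          Real.sqrt_mul (sum_nonneg fun a _ => sq_nonneg _)]
        have := Real.mul_self_sqrt hW0
        calc _ = √(∑ a, G i a ^ 2) * √(∑ a, G j a ^ 2) * (√W * √W) := by ring
          _ = _ := by rw [this]

theorem sum_le_sqrt_card_mul {A : Type*} (s : Finset A) (f : A → ℝ) :
    ∑ a ∈ s, f a ≤ √(s.card * ∑ a ∈ s, f a ^ 2) := by
  refine Real.le_sqrt_of_sq_le ?_
  exact sq_sum_le_card_mul_sum_sq

/-- If `p` divides some `q i`, it divides another `q j`, and Cauchy–Schwarz in these two variables
produces √p·√p, which pays for the factor on the left. A further variable either ranges over at most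
`p` values or is confined to 0. If `p` divides no `q i`, only the zero tuple counts. -/
theorem fundamental_prime (p : ℕ) [hp : Fact p.Prime] (q : ι → ℕ)
    (hq : ∀ i, p ∣ q i → ∃ j ≠ i, p ∣ q j) (G : ι → ZMod p → ℝ) (hG : ∀ l a, 0 ≤ G l a)
    (hs : ∀ l a, G l a ≠ 0 → q l • a = 0) :
    (p.gcd (univ.lcm q) : ℝ) * ∑ α : ι → ZMod p with ∑ i, α i = 0, ∏ l, G l (α l)
      ≤ ∏ l, √((p.gcd (q l) : ℝ) * ∑ a, G l a ^ 2) := by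
  have hs' : ∀ l, ¬ p ∣ q l → ∀ a, a ≠ 0 → G l a = 0 := by
    intro l hl a ha
    by_contra h
    have := hs l a h
    rw [nsmul_eq_mul, mul_eq_zero, ZMod.natCast_eq_zero_iff] at this
    tauto
  have hl1 : ∀ l, ∑ a, G l a ≤ √((p.gcd (q l) : ℝ) * ∑ a, G l a ^ 2) := by
    intro l
    by_cases h : p ∣ q l
    · rw [Nat.gcd_eq_left h]
      have := sum_le_sqrt_card_mul univ (G l)
      simpa [ZMod.card] using this
    · have e : ∀ m, 0 < m → ∑ a, G l a ^ m = G l 0 ^ m := fun m hm =>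
        Finset.sum_eq_single 0 (fun a _ ha => by rw [hs' l h a ha, zero_pow hm.ne']) (by simp)
      have e1 := e 1 one_pos
      simp only [pow_one] at e1
      rw [e1, e 2 two_pos, ((Nat.Prime.coprime_iff_not_dvd hp.1).2 h), Nat.cast_one, one_mul,
        Real.sqrt_sq (hG _ _)]
  by_cases hex : ∃ i, p ∣ q i
  · obtain ⟨i, hi⟩ := hex
    obtain ⟨j, hji, hj⟩ := hq i hi
    have hL : p.gcd (univ.lcm q) = p := Nat.gcd_eq_left (hi.trans (dvd_lcm (mem_univ i)))
    rw [hL, prod_eq_mul_mul_prod_erase_erase hji.symm, Nat.gcd_eq_left hi, Nat.gcd_eq_left hj,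
      Real.sqrt_mul (Nat.cast_nonneg _), Real.sqrt_mul (Nat.cast_nonneg _)]
    have hb := sum_hyperplane_prod_le hji.symm G hG
    have hpp : √(p : ℝ) * √(p : ℝ) = p := Real.mul_self_sqrt (Nat.cast_nonneg _)
    calc _ ≤ (p : ℝ) * (√(∑ a, G i a ^ 2) * √(∑ a, G j a ^ 2) *
          ∏ l ∈ (univ.erase j).erase i, ∑ a, G l a) := by gcongr
      _ ≤ (p : ℝ) * (√(∑ a, G i a ^ 2) * √(∑ a, G j a ^ 2) *
          ∏ l ∈ (univ.erase j).erase i, √((p.gcd (q l) : ℝ) * ∑ a, G l a ^ 2)) := by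
        gcongr with l _
        · intro l _
          exact sum_nonneg fun a _ => hG l a
        · exact hl1 l
      _ = _ := by nth_rewrite 1 [← hpp]; ring
  · push Not at hex
    have hL : ∀ l, p.gcd (q l) = 1 := fun l => ((Nat.Prime.coprime_iff_not_dvd hp.1).2 (hex l))
    have hL1 : p.gcd (univ.lcm q) ≤ 1 := by
      have : p.Coprime (univ.lcm q) := by
        rw [Nat.Prime.coprime_iff_not_dvd hp.1]
        intro h
        have hd : univ.lcm q ∣ ∏ i, q i := Finset.lcm_dvd fun i _ => dvd_prod_of_mem q (mem_univ i)
        obtain ⟨i, _, hi⟩ := (Prime.dvd_finsetProd_iff hp.1.prime _).1 (h.trans hd)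
        exact hex i hi
      exact this.le
    have h0 : ∑ α : ι → ZMod p with ∑ i, α i = 0, ∏ l, G l (α l) = ∏ l, G l 0 := by
      rw [Finset.sum_eq_single (0 : ι → ZMod p)]
      · rfl
      · intro α _ hα
        obtain ⟨l, hl⟩ := Function.ne_iff.1 hα
        exact prod_eq_zero (mem_univ l) (hs' l (hex l) _ hl)
      · intro h
        simp at h
    rw [h0]
    have hn : 0 ≤ ∏ l, G l 0 := prod_nonneg fun l _ => hG l 0
    calc _ ≤ 1 * ∏ l, G l 0 := by
          gcongr
          exact_mod_cast hL1
      _ ≤ ∏ l, √((p.gcd (q l) : ℝ) * ∑ a, G l a ^ 2) := by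
          rw [one_mul]
          refine prod_le_prod (fun l _ => hG l 0) fun l _ => ?_
          refine le_trans ?_ (hl1 l)
          exact single_le_sum (f := fun a => G l a) (fun a _ => hG l a) (mem_univ 0)

/-- Both sides are multiplicative over coprime factors of the modulus once each `q l` is replaced by
its gcd with the modulus; this form keeps `q` fixed in the induction. -/
theorem fundamental_aux (Q : ℕ) : Squarefree Q → ∀ (_ : NeZero Q) (q : ι → ℕ)
    (_ : ∀ p, p.Prime → p ∣ Q → ∀ i, p ∣ q i → ∃ j ≠ i, p ∣ q j) (G : ι → ZMod Q → ℝ)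
    (_ : ∀ l a, 0 ≤ G l a) (_ : ∀ l a, G l a ≠ 0 → q l • a = 0),
    (Q.gcd (univ.lcm q) : ℝ) * ∑ α : ι → ZMod Q with ∑ i, α i = 0, ∏ l, G l (α l)
      ≤ ∏ l, √((Q.gcd (q l) : ℝ) * ∑ a, G l a ^ 2) := by
  induction Q using Nat.recOnPrimeCoprime with
  | zero => intro h; simp at h
  | prime_pow p n hp =>
    intro hsq hne q hq G hG hs
    have hn : n = 0 ∨ n = 1 := by
      by_contra hcon
      push Not at hcon
      have h2 : 2 ≤ n := by omega
      have := hsq p ((pow_two p).symm ▸ pow_dvd_pow p h2)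
      exact hp.one_lt.ne' (Nat.isUnit_iff.1 this)
    rcases hn with rfl | rfl
    · have hsub : ∀ a : ZMod (p ^ 0), a = 0 := by
        rw [pow_zero]
        exact fun a => Subsingleton.elim a 0
      have hu : (univ : Finset (ZMod (p ^ 0))) = {0} :=
        eq_singleton_iff_unique_mem.2 ⟨mem_univ _, fun a _ => hsub a⟩
      have hu' : ((univ : Finset (ι → ZMod (p ^ 0))).filter fun α => ∑ i, α i = 0) = {0} := by
        ext a
        simp only [mem_filter, mem_univ, true_and, mem_singleton]
        exact ⟨fun _ => funext fun i => hsub _, fun _ => hsub _⟩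
      rw [hu', hu]
      simp only [sum_singleton, pow_zero, Nat.gcd_one_left, Nat.cast_one, one_mul, Pi.zero_apply]
      refine prod_le_prod (fun l _ => hG l 0) fun l _ => ?_
      rw [Real.sqrt_sq (hG l 0)]
    · have : Fact (p ^ 1).Prime := ⟨by rwa [pow_one]⟩
      exact fundamental_prime (p ^ 1) q (fun i hi => hq _ this.1 dvd_rfl i hi) G hG hs
  | coprime a b ha hb hab iha ihb =>
    intro hsq hne q hq G hG hs
    have : NeZero a := ⟨by omega⟩
    have : NeZero b := ⟨by omega⟩
    have hsa : Squarefree a := hsq.squarefree_of_dvd (dvd_mul_right a b)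
    have hsb : Squarefree b := hsq.squarefree_of_dvd (dvd_mul_left b a)
    set e := ZMod.chineseRemainder hab with he
    set G1 : ι → ZMod a → ZMod b → ℝ := fun l x y => G l (e.symm (x, y)) with hG1
    have hsupp : ∀ l x y, G1 l x y ≠ 0 → q l • x = 0 ∧ q l • y = 0 := by
      intro l x y h
      have h1 := congrArg e (hs l _ h)
      rw [map_nsmul, e.apply_symm_apply, map_zero] at h1
      exact ⟨congrArg Prod.fst h1, congrArg Prod.snd h1⟩
    -- The bound modulo `a`, with the components modulo `b` frozen, is itself a product of functions
    -- of these components; the case `b` is applied to these functions.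
    set G2 : ι → ZMod b → ℝ := fun l y => √((a.gcd (q l) : ℝ) * ∑ x, G1 l x y ^ 2) with hG2
    have hA : ∀ β : ι → ZMod b, (a.gcd (univ.lcm q) : ℝ) *
        ∑ α : ι → ZMod a with ∑ i, α i = 0, ∏ l, G1 l (α l) (β l) ≤ ∏ l, G2 l (β l) := fun β =>
      iha hsa inferInstance q (fun p hp hpa => hq p hp (hpa.mul_right b))
        (fun l x => G1 l x (β l)) (fun l x => hG _ _) (fun l x h => (hsupp l x _ h).1)
    have hB := ihb hsb inferInstance q (fun p hp hpb => hq p hp (hpb.mul_left a)) G2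
      (fun l y => Real.sqrt_nonneg _) (fun l y h => by
        by_contra hcon
        apply h
        have : ∀ x, G1 l x y = 0 := fun x => by
          by_contra h'
          exact hcon (hsupp l x y h').2
        simp [hG2, this])
    have hS : ∑ α : ι → ZMod (a * b) with ∑ i, α i = 0, ∏ l, G l (α l)
        = ∑ β : ι → ZMod b with ∑ i, β i = 0, ∑ α : ι → ZMod a with ∑ i, α i = 0,
          ∏ l, G1 l (α l) (β l) := by
      rw [← Finset.sum_product']
      refine Finset.sum_bij' (fun α _ => (fun i => (e (α i)).2, fun i => (e (α i)).1))
        (fun γ _ i => e.symm (γ.2 i, γ.1 i)) ?_ ?_ ?_ ?_ ?_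
      · intro α hα
        simp only [mem_filter, mem_univ, true_and] at hα
        have := congrArg e hα
        rw [map_sum, map_zero] at this
        have h1 := congrArg Prod.fst this
        have h2 := congrArg Prod.snd this
        rw [Prod.fst_sum] at h1
        rw [Prod.snd_sum] at h2
        simp only [mem_product, mem_filter, mem_univ, true_and]
        exact ⟨h2, h1⟩
      · intro γ hγ
        simp only [mem_product, mem_filter, mem_univ, true_and] at hγ ⊢
        rw [← map_sum, map_eq_zero_iff _ e.symm.injective]
        ext
        · rw [Prod.fst_sum]; exact hγ.2
        · rw [Prod.snd_sum]; exact hγ.1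
      · intro α _
        funext i
        simp
      · intro γ _
        simp
      · intro α _
        simp [hG1]
    have hsum : ∀ l, ∑ c, G l c ^ 2 = ∑ y, ∑ x, G1 l x y ^ 2 := by
      intro l
      rw [Finset.sum_comm, ← Fintype.sum_prod_type' (f := fun x y => G1 l x y ^ 2)]
      refine Fintype.sum_equiv e.toEquiv _ _ fun c => ?_
      simp [hG1]
    rw [hS, Nat.Coprime.mul_gcd hab, Nat.cast_mul, mul_comm (_ : ℝ) (b.gcd _ : ℝ), mul_assoc,
      mul_sum]
    calc _ ≤ (b.gcd (univ.lcm q) : ℝ) * ∑ β : ι → ZMod b with ∑ i, β i = 0, ∏ l, G2 l (β l) := by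
          gcongr with β _
          exact hA β
      _ ≤ _ := hB
      _ = _ := by
        refine prod_congr rfl fun l _ => ?_
        congr 1
        rw [Nat.Coprime.mul_gcd hab, hsum, Nat.cast_mul, mul_comm (a.gcd (q l) : ℝ), mul_assoc]
        congr 1
        rw [mul_sum]
        refine sum_congr rfl fun y _ => ?_
        exact Real.sq_sqrt (mul_nonneg (Nat.cast_nonneg _) (sum_nonneg fun x _ => sq_nonneg _))

/-- The fundamental lemma of Montgomery and Vaughan, for a squarefree modulus. -/
theorem fundamental_lemma {Q : ℕ} [NeZero Q] (hQ : Squarefree Q) (q : ι → ℕ) (hqQ : ∀ i, q i ∣ Q)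
    (hq : ∀ p, p.Prime → ∀ i, p ∣ q i → ∃ j ≠ i, p ∣ q j) (G : ι → ZMod Q → ℝ)
    (hG : ∀ l a, 0 ≤ G l a) (hs : ∀ l a, G l a ≠ 0 → q l • a = 0) :
    ((univ.lcm q : ℕ) : ℝ) * ∑ α : ι → ZMod Q with ∑ i, α i = 0, ∏ l, G l (α l)
      ≤ ∏ l, √((q l : ℝ) * ∑ a, G l a ^ 2) := by
  have := fundamental_aux Q hQ inferInstance q (fun p hp _ => hq p hp) G hG hs
  rw [Nat.gcd_eq_right (Finset.lcm_dvd fun i _ => hqQ i)] at this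
  simpa only [Nat.gcd_eq_right (hqQ _)] using this

end FundamentalLemma

/-! ### Counting pairs of numerators. -/

section IntegerCounts

theorem card_le_card_mul_of_fiber {A B : Type*} [DecidableEq B] (S : Finset A) (T : Finset B)
    (f : A → B) (hf : ∀ a ∈ S, f a ∈ T) (c : ℝ)
    (hc : ∀ b ∈ T, ((S.filter fun a => f a = b).card : ℝ) ≤ c) :
    (S.card : ℝ) ≤ T.card * c := by
  rw [Finset.card_eq_sum_card_fiberwise (f := f) (t := T) (by exact fun a ha => hf a ha)]
  push_cast
  calc _ ≤ ∑ b ∈ T, c := sum_le_sum hc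
    _ = _ := by simp

theorem card_int_le_of_dvd_sub (S : Finset ℤ) (A : ℝ) (m : ℕ) (hm : 0 < m) (hA : 0 ≤ A)
    (h1 : ∀ a ∈ S, |(a : ℝ)| ≤ A) (h2 : ∀ a ∈ S, ∀ b ∈ S, (m : ℤ) ∣ a - b) :
    (S.card : ℝ) ≤ 1 + 2 * A / m := by
  have hm' : (0 : ℝ) < m := by exact_mod_cast hm
  rcases S.eq_empty_or_nonempty with rfl | hne
  · simp; positivity
  set a0 := S.min' hne with ha0
  have ha0S : a0 ∈ S := S.min'_mem hne
  have hmap : ∀ a ∈ S, ((a - a0) / m).toNat ∈ range (⌊2 * A / m⌋₊ + 1) := by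
    intro a ha
    obtain ⟨t, ht⟩ := h2 a ha a0 ha0S
    have hle : a0 ≤ a := S.min'_le a ha
    have hmz : (0 : ℤ) < m := by exact_mod_cast hm
    rw [ht, Int.mul_ediv_cancel_left _ hmz.ne', mem_range, Nat.lt_succ_iff]
    have ht0 : 0 ≤ t := by
      by_contra hcon
      push Not at hcon
      nlinarith
    apply Nat.le_floor
    rw [le_div_iff₀ hm']
    have e : ((t.toNat : ℕ) : ℝ) = (t : ℝ) := by
      have := Int.toNat_of_nonneg ht0
      exact_mod_cast congrArg (fun z : ℤ => (z : ℝ)) this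
    rw [e]
    have h3 := abs_le.1 (h1 a ha)
    have h4 := abs_le.1 (h1 a0 ha0S)
    have h5 : ((a - a0 : ℤ) : ℝ) = ((m * t : ℤ) : ℝ) := by rw [ht]
    push_cast at h5
    nlinarith
  have hinj : Set.InjOn (fun a => ((a - a0) / m).toNat) (S : Set ℤ) := by
    intro a ha b hb hab
    obtain ⟨t, ht⟩ := h2 a ha a0 ha0S
    obtain ⟨s, hs⟩ := h2 b hb a0 ha0S
    have hla : a0 ≤ a := S.min'_le a ha
    have hlb : a0 ≤ b := S.min'_le b hb
    have hmz : (0 : ℤ) < m := by exact_mod_cast hm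
    simp only at hab
    rw [ht, hs, Int.mul_ediv_cancel_left _ hmz.ne', Int.mul_ediv_cancel_left _ hmz.ne'] at hab
    have ht0 : 0 ≤ t := by
      by_contra hcon
      push Not at hcon
      nlinarith
    have hs0 : 0 ≤ s := by
      by_contra hcon
      push Not at hcon
      nlinarith
    have : t = s := by omega
    subst this
    linarith
  have hc := Finset.card_le_card_of_injOn _ hmap hinj
  rw [card_range] at hc
  have hfl : (⌊2 * A / m⌋₊ : ℝ) ≤ 2 * A / m := Nat.floor_le (by positivity)
  have hc' : (S.card : ℝ) ≤ ((⌊2 * A / m⌋₊ + 1 : ℕ) : ℝ) := by exact_mod_cast hc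
  push_cast at hc'
  linarith

theorem card_int_nonzero_le (S : Finset ℤ) (A : ℝ) (g : ℕ) (hg : 0 < g) (hA : 0 ≤ A)
    (h0 : ∀ a ∈ S, a ≠ 0) (h1 : ∀ a ∈ S, |(a : ℝ)| ≤ A) (h2 : ∀ a ∈ S, (g : ℤ) ∣ a) :
    (S.card : ℝ) ≤ 2 * A / g := by
  have hg' : (0 : ℝ) < g := by exact_mod_cast hg
  have hgz : (0 : ℤ) < g := by exact_mod_cast hg
  set N : ℕ := ⌊A / g⌋₊ with hN
  set T : Finset ℤ := (Finset.Icc (-(N : ℤ)) N).erase 0 with hT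
  have hmap : ∀ a ∈ S, a / g ∈ T := by
    intro a ha
    obtain ⟨t, rfl⟩ := h2 a ha
    rw [Int.mul_ediv_cancel_left _ hgz.ne', hT, mem_erase, mem_Icc]
    have ht : t ≠ 0 := by
      rintro rfl
      exact h0 _ ha (mul_zero _)
    refine ⟨ht, abs_le.1 ?_⟩
    have h3 := h1 _ ha
    push_cast at h3
    rw [abs_mul, abs_of_pos hg'] at h3
    have h4 : (t.natAbs : ℝ) ≤ A / g := by
      rw [le_div_iff₀ hg', Nat.cast_natAbs, Int.cast_abs]
      linarith
    have h5 : t.natAbs ≤ N := Nat.le_floor h4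
    rw [← Int.natCast_natAbs]
    exact_mod_cast h5
  have hinj : Set.InjOn (fun a : ℤ => a / g) (S : Set ℤ) := by
    intro a ha b hb hab
    obtain ⟨t, rfl⟩ := h2 a ha
    obtain ⟨s, rfl⟩ := h2 b hb
    simp only [Int.mul_ediv_cancel_left _ hgz.ne'] at hab
    rw [hab]
  have hc := Finset.card_le_card_of_injOn _ hmap hinj
  have hTc : T.card = 2 * N := by
    rw [hT, card_erase_of_mem (by simp), Int.card_Icc]
    omega
  rw [hTc] at hc
  have hfl : (N : ℝ) ≤ A / g := Nat.floor_le (by positivity)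
  have hc' : (S.card : ℝ) ≤ ((2 * N : ℕ) : ℝ) := by exact_mod_cast hc
  push_cast at hc'
  calc (S.card : ℝ) ≤ 2 * N := hc'
    _ ≤ 2 * (A / g) := by linarith
    _ = _ := by ring

/-- The conditions on the numerators of two fractions with denominators `x u` and `x v` whose sum
is nonzero and has a denominator dividing `u v`. -/
def IsNumPair (x u v : ℕ) (H : ℝ) (z : ℤ × ℤ) : Prop :=
  z.1 ≠ 0 ∧ z.2 ≠ 0 ∧ |(z.1 : ℝ)| * H ≤ x * u ∧ |(z.2 : ℝ)| * H ≤ x * v ∧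
    (x : ℤ) ∣ z.1 * v + z.2 * u ∧ z.1 * v + z.2 * u ≠ 0

theorem IsNumPair.swap {x u v : ℕ} {H : ℝ} {z : ℤ × ℤ} (h : IsNumPair x u v H z) :
    IsNumPair x v u H z.swap := by
  obtain ⟨h1, h2, h3, h4, h5, h6⟩ := h
  refine ⟨h2, h1, h4, h3, ?_, ?_⟩
  · simpa [add_comm] using h5
  · simpa [add_comm] using h6

/-- There are at most 2xu/H choices of the first numerator. As `x` is coprime to `u`, each fixes the
second one modulo `x`, leaving 1 + 2v/H choices, and `H ≤ v` absorbs the 1. -/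
theorem card_numPair_le_of_le_right {x u v : ℕ} {H : ℝ} (hx : 0 < x) (hH : 1 ≤ H)
    (hxu : x.Coprime u) (hv : H ≤ v) (S : Finset (ℤ × ℤ)) (hS : ∀ z ∈ S, IsNumPair x u v H z) :
    (S.card : ℝ) ≤ 6 * (x * u * v) / H ^ 2 := by
  classical
  have hH0 : 0 < H := by linarith
  have hx' : (0 : ℝ) < x := by exact_mod_cast hx
  have h1 := card_le_card_mul_of_fiber S (S.image Prod.fst) Prod.fst
    (fun a ha => mem_image_of_mem _ ha) (3 * v / H) (by
      intro a _
      have hfib : ((S.filter fun z => z.1 = a).card : ℝ)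
          = (((S.filter fun z => z.1 = a).image Prod.snd).card : ℝ) := by
        rw [Finset.card_image_of_injOn]
        intro z hz w hw hzw
        simp only [coe_filter, Set.mem_ofPred_eq] at hz hw
        exact Prod.ext (hz.2.trans hw.2.symm) hzw
      rw [hfib]
      refine (card_int_le_of_dvd_sub _ (x * v / H) x hx (by positivity) ?_ ?_).trans ?_
      · intro b hb
        simp only [mem_image, mem_filter] at hb
        obtain ⟨z, ⟨hz, -⟩, rfl⟩ := hb
        rw [le_div_iff₀ hH0]
        exact (hS z hz).2.2.2.1
      · intro b hb c hc
        simp only [mem_image, mem_filter] at hb hc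
        obtain ⟨z, ⟨hz, hz1⟩, rfl⟩ := hb
        obtain ⟨w, ⟨hw, hw1⟩, rfl⟩ := hc
        have h5 := dvd_sub (hS z hz).2.2.2.2.1 (hS w hw).2.2.2.2.1
        rw [hz1, hw1] at h5
        have h6 : (x : ℤ) ∣ (u : ℤ) * (z.2 - w.2) := by
          have e : (a * v + z.2 * u) - (a * v + w.2 * u) = (u : ℤ) * (z.2 - w.2) := by ring
          rwa [e] at h5
        exact IsCoprime.dvd_of_dvd_mul_left (Nat.isCoprime_iff_coprime.2 hxu) h6
      · have : 2 * ((x : ℝ) * v / H) / x = 2 * v / H := by field_simp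
        rw [this]
        have : 1 ≤ (v : ℝ) / H := by rwa [le_div_iff₀ hH0, one_mul]
        calc 1 + 2 * (v : ℝ) / H ≤ v / H + 2 * v / H := by linarith
          _ = _ := by ring)
  have h2 := card_int_nonzero_le (S.image Prod.fst) (x * u / H) 1 one_pos (by positivity) (by
      intro a ha
      obtain ⟨z, hz, rfl⟩ := mem_image.1 ha
      exact (hS z hz).1) (by
      intro a ha
      obtain ⟨z, hz, rfl⟩ := mem_image.1 ha
      rw [le_div_iff₀ hH0]
      exact (hS z hz).2.2.1) (by simp)
  calc (S.card : ℝ) ≤ _ := h1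
    _ ≤ (2 * (x * u / H) / (1 : ℕ)) * (3 * v / H) := by gcongr
    _ = _ := by push_cast; field_simp; ring

theorem card_numPair_le_of_le_left {x u v : ℕ} {H : ℝ} (hx : 0 < x) (hH : 1 ≤ H)
    (hxv : x.Coprime v) (hu : H ≤ u) (S : Finset (ℤ × ℤ)) (hS : ∀ z ∈ S, IsNumPair x u v H z) :
    (S.card : ℝ) ≤ 6 * (x * u * v) / H ^ 2 := by
  classical
  have := card_numPair_le_of_le_right hx hH hxv hu (S.image Prod.swap) (by
    intro z hz
    obtain ⟨w, hw, rfl⟩ := mem_image.1 hz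
    exact (hS w hw).swap)
  rw [Finset.card_image_of_injective _ Prod.swap_injective] at this
  calc _ ≤ _ := this
    _ = _ := by ring

/-- With g = gcd(u, v), the quotient n = (z₁v + z₂u)/x is a nonzero multiple of g of size at most
2uv/H, so it takes at most 4uv/(Hg) values. For given n the numerator z₂ is fixed modulo v/g, and `H
≤ x g` absorbs the 1 in 1 + 2xg/H. -/
theorem card_numPair_le_of_le_gcd {x u v : ℕ} {H : ℝ} (hx : 0 < x) (hu : 0 < u) (hv : 0 < v)
    (hH : 1 ≤ H) (hxu : x.Coprime u) (hg : H ≤ x * u.gcd v) (S : Finset (ℤ × ℤ))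
    (hS : ∀ z ∈ S, IsNumPair x u v H z) :
    (S.card : ℝ) ≤ 12 * (x * u * v) / H ^ 2 := by
  classical
  have hH0 : 0 < H := by linarith
  have hx' : (0 : ℝ) < x := by exact_mod_cast hx
  have hxz : (0 : ℤ) < x := by exact_mod_cast hx
  have hu' : (0 : ℝ) < u := by exact_mod_cast hu
  have hv' : (0 : ℝ) < v := by exact_mod_cast hv
  have hvz : (0 : ℤ) < v := by exact_mod_cast hv
  set g := u.gcd v with hgdef
  have hg0 : 0 < g := Nat.gcd_pos_of_pos_left _ hu
  have hg0' : (0 : ℝ) < g := by exact_mod_cast hg0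
  obtain ⟨u', hu'e⟩ := Nat.gcd_dvd_left u v
  obtain ⟨v', hv'e⟩ := Nat.gcd_dvd_right u v
  rw [← hgdef] at hu'e hv'e
  have hcop : v'.Coprime u' := by
    have := Nat.coprime_div_gcd_div_gcd (m := u) (n := v) hg0
    rw [← hgdef] at this
    nth_rewrite 1 [hu'e] at this
    nth_rewrite 1 [hv'e] at this
    rw [Nat.mul_div_cancel_left _ hg0, Nat.mul_div_cancel_left _ hg0] at this
    exact this.symm
  have hv'0 : 0 < v' := by
    rcases Nat.eq_zero_or_pos v' with h | h
    · rw [h, mul_zero] at hv'e; omega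
    · exact h
  have hv'r : (v : ℝ) = g * v' := by exact_mod_cast hv'e
  have hv'0r : (0 : ℝ) < v' := by exact_mod_cast hv'0
  set f : ℤ × ℤ → ℤ := fun z => (z.1 * v + z.2 * u) / x with hf
  have hfx : ∀ z ∈ S, x * f z = z.1 * v + z.2 * u := fun z hz =>
    Int.mul_ediv_cancel' (hS z hz).2.2.2.2.1
  have h1 := card_le_card_mul_of_fiber S (S.image f) f
    (fun a ha => mem_image_of_mem _ ha) (3 * (x * g) / H) (by
      intro n _
      have hfib : ((S.filter fun z => f z = n).card : ℝ)
          = (((S.filter fun z => f z = n).image Prod.snd).card : ℝ) := by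
        rw [Finset.card_image_of_injOn]
        intro z hz w hw hzw
        simp only [coe_filter, Set.mem_ofPred_eq] at hz hw
        have e1 := hfx z hz.1
        have e2 := hfx w hw.1
        rw [hz.2] at e1
        rw [hw.2, e1] at e2
        rw [hzw] at e2
        have : z.1 * v = w.1 * v := by linarith
        exact Prod.ext (mul_right_cancel₀ hvz.ne' this) hzw
      rw [hfib]
      refine (card_int_le_of_dvd_sub _ (x * v / H) v' hv'0 (by positivity) ?_ ?_).trans ?_
      · intro b hb
        simp only [mem_image, mem_filter] at hb
        obtain ⟨z, ⟨hz, -⟩, rfl⟩ := hb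
        rw [le_div_iff₀ hH0]
        exact (hS z hz).2.2.2.1
      · intro b hb c hc
        simp only [mem_image, mem_filter] at hb hc
        obtain ⟨z, ⟨hz, hz1⟩, rfl⟩ := hb
        obtain ⟨w, ⟨hw, hw1⟩, rfl⟩ := hc
        have e1 := hfx z hz
        have e2 := hfx w hw
        rw [hz1] at e1
        rw [hw1, e1] at e2
        have hgz : (g : ℤ) ≠ 0 := by exact_mod_cast hg0.ne'
        have e3 : (v' : ℤ) * (w.1 - z.1) = u' * (z.2 - w.2) := by
          apply mul_left_cancel₀ hgz
          have a1 : (v : ℤ) = g * v' := by exact_mod_cast hv'e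
          have a2 : (u : ℤ) = g * u' := by exact_mod_cast hu'e
          rw [a1, a2] at e2
          linear_combination -e2
        have : (v' : ℤ) ∣ u' * (z.2 - w.2) := ⟨_, e3.symm⟩
        exact IsCoprime.dvd_of_dvd_mul_left (Nat.isCoprime_iff_coprime.2 hcop) this
      · have : 2 * ((x : ℝ) * v / H) / v' = 2 * (x * g) / H := by
          rw [hv'r]; field_simp
        rw [this]
        have : 1 ≤ ((x : ℝ) * g) / H := by rwa [le_div_iff₀ hH0, one_mul]
        calc 1 + 2 * ((x : ℝ) * g) / H ≤ (x * g) / H + 2 * (x * g) / H := by linarith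
          _ = _ := by ring)
  have h2 := card_int_nonzero_le (S.image f) (2 * (u * v) / H) g hg0 (by positivity) (by
      intro a ha
      obtain ⟨z, hz, rfl⟩ := mem_image.1 ha
      intro h0
      have := hfx z hz
      rw [h0, mul_zero] at this
      exact (hS z hz).2.2.2.2.2 this.symm) (by
      intro a ha
      obtain ⟨z, hz, rfl⟩ := mem_image.1 ha
      rw [le_div_iff₀ hH0]
      obtain ⟨-, -, h3, h4, -⟩ := hS z hz
      have e : (x : ℝ) * f z = z.1 * v + z.2 * u := by exact_mod_cast hfx z hz
      have e2 : (x : ℝ) * |(f z : ℝ)| ≤ |(z.1 : ℝ)| * v + |(z.2 : ℝ)| * u := by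
        have e1 : (x : ℝ) * |(f z : ℝ)| = |(x : ℝ) * f z| := by rw [abs_mul, abs_of_pos hx']
        rw [e1, e]
        refine (abs_add_le _ _).trans ?_
        rw [abs_mul, abs_mul, abs_of_pos hu', abs_of_pos hv']
      refine le_of_mul_le_mul_left ?_ hx'
      calc (x : ℝ) * (|(f z : ℝ)| * H) = (x * |(f z : ℝ)|) * H := by ring
        _ ≤ (|(z.1 : ℝ)| * v + |(z.2 : ℝ)| * u) * H := by gcongr
        _ = (|(z.1 : ℝ)| * H) * v + (|(z.2 : ℝ)| * H) * u := by ring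
        _ ≤ (x * u) * v + (x * v) * u := by gcongr
        _ = _ := by ring) (by
      intro a ha
      obtain ⟨z, hz, rfl⟩ := mem_image.1 ha
      have hgx : IsCoprime (g : ℤ) (x : ℤ) :=
        Nat.isCoprime_iff_coprime.2 (Nat.Coprime.coprime_dvd_left (Nat.gcd_dvd_left u v) hxu.symm)
      refine hgx.dvd_of_dvd_mul_left ?_
      rw [hfx z hz]
      refine dvd_add (Dvd.dvd.mul_left ?_ _) (Dvd.dvd.mul_left ?_ _)
      · exact_mod_cast Nat.gcd_dvd_right u v
      · exact_mod_cast Nat.gcd_dvd_left u v)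
  calc (S.card : ℝ) ≤ _ := h1
    _ ≤ (2 * (2 * (u * v) / H) / g) * (3 * (x * g) / H) := by gcongr
    _ = _ := by field_simp; ring

theorem card_numPair_le {x u v : ℕ} {H : ℝ} (hx : 0 < x) (hu : 0 < u) (hv : 0 < v)
    (hH : 1 ≤ H) (hxu : x.Coprime u) (hxv : x.Coprime v)
    (hcase : H ≤ u ∨ H ≤ v ∨ H ≤ x * u.gcd v) (S : Finset (ℤ × ℤ))
    (hS : ∀ z ∈ S, IsNumPair x u v H z) :
    (S.card : ℝ) ≤ 12 * (x * u * v) / H ^ 2 := by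
  have h6 : 6 * ((x : ℝ) * u * v) / H ^ 2 ≤ 12 * (x * u * v) / H ^ 2 := by
    gcongr
    norm_num
  rcases hcase with h | h | h
  · exact (card_numPair_le_of_le_left hx hH hxv h S hS).trans h6
  · exact (card_numPair_le_of_le_right hx hH hxu h S hS).trans h6
  · exact card_numPair_le_of_le_gcd hx hu hv hH hxu h S hS

/-- When `x` also varies, the pair of numerators is chosen first, in 16X²uv/H² ways; then `x` is a
divisor of the nonzero number z₁v + z₂u. -/
theorem card_numTriple_le {X u v : ℕ} {H : ℝ} (hH : 1 ≤ H) {τ : ℝ} (hτ0 : 0 ≤ τ)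
    (hτ : ∀ N : ℕ, 0 < N → N ≤ 4 * X * u * v → (N.divisors.card : ℝ) ≤ τ)
    (S : Finset (ℕ × ℤ × ℤ))
    (hS : ∀ z ∈ S, z.1 < 2 * X ∧ IsNumPair z.1 u v H z.2) :
    (S.card : ℝ) ≤ τ * (16 * (X ^ 2 * u * v) / H ^ 2) := by
  classical
  have hH0 : 0 < H := by linarith
  have hle : ∀ z ∈ S, |(z.2.1 : ℝ)| ≤ 2 * X * u / H ∧ |(z.2.2 : ℝ)| ≤ 2 * X * v / H := by
    intro z hz
    obtain ⟨h1, -, -, h3, h4, -⟩ := hS z hz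
    have h1' : (z.1 : ℝ) ≤ 2 * X := by exact_mod_cast h1.le
    rw [le_div_iff₀ hH0, le_div_iff₀ hH0]
    exact ⟨h3.trans (by gcongr), h4.trans (by gcongr)⟩
  set A := S.image fun z => z.2.1 with hA
  set B := S.image fun z => z.2.2 with hB
  set T := (A ×ˢ B).filter fun w : ℤ × ℤ => w.1 * v + w.2 * u ≠ 0 ∧
    (w.1 * v + w.2 * u).natAbs ≤ 4 * X * u * v with hT
  have h1 := card_le_card_mul_of_fiber S T Prod.snd (by
    intro z hz
    rw [hT, mem_filter, mem_product]
    refine ⟨⟨mem_image_of_mem _ hz, mem_image_of_mem _ hz⟩, (hS z hz).2.2.2.2.2.2, ?_⟩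
    obtain ⟨b1, b2⟩ := hle z hz
    have hb : |((z.2.1 * v + z.2.2 * u : ℤ) : ℝ)| ≤ 4 * X * u * v := by
      push_cast
      calc _ ≤ |(z.2.1 : ℝ) * v| + |(z.2.2 : ℝ) * u| := abs_add_le _ _
        _ = |(z.2.1 : ℝ)| * v + |(z.2.2 : ℝ)| * u := by
          rw [abs_mul, abs_mul, Nat.abs_cast, Nat.abs_cast]
        _ ≤ (2 * X * u / H) * v + (2 * X * v / H) * u := by gcongr
        _ = (4 * X * u * v) / H := by ring
        _ ≤ 4 * X * u * v := div_le_self (by positivity) hH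
    have : ((z.2.1 * v + z.2.2 * u : ℤ).natAbs : ℝ) ≤ ((4 * X * u * v : ℕ) : ℝ) := by
      rw [Nat.cast_natAbs, Int.cast_abs]
      push_cast at hb ⊢
      exact hb
    exact_mod_cast this) τ (by
    intro w hw
    rw [hT, mem_filter] at hw
    refine le_trans ?_ (hτ (w.1 * v + w.2 * u).natAbs (Int.natAbs_pos.2 hw.2.1) hw.2.2)
    norm_cast
    refine Finset.card_le_card_of_injOn Prod.fst ?_ ?_
    · intro z hz
      simp only [coe_filter, Set.mem_ofPred_eq] at hz
      simp only [mem_coe, Nat.mem_divisors]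
      refine ⟨?_, (Int.natAbs_pos.2 hw.2.1).ne'⟩
      have := (hS z hz.1).2.2.2.2.2.1
      rw [hz.2] at this
      exact Int.natCast_dvd.1 this
    · intro z hz y hy hzy
      simp only [coe_filter, Set.mem_ofPred_eq] at hz hy
      exact Prod.ext hzy (hz.2.trans hy.2.symm))
  have hAc := card_int_nonzero_le A (2 * X * u / H) 1 one_pos (by positivity) (by
      intro a ha
      obtain ⟨z, hz, rfl⟩ := mem_image.1 ha
      exact (hS z hz).2.1) (by
      intro a ha
      obtain ⟨z, hz, rfl⟩ := mem_image.1 ha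
      exact (hle z hz).1) (by simp)
  have hBc := card_int_nonzero_le B (2 * X * v / H) 1 one_pos (by positivity) (by
      intro a ha
      obtain ⟨z, hz, rfl⟩ := mem_image.1 ha
      exact (hS z hz).2.2.1) (by
      intro a ha
      obtain ⟨z, hz, rfl⟩ := mem_image.1 ha
      exact (hle z hz).2) (by simp)
  have hTc : (T.card : ℝ) ≤ 16 * (X ^ 2 * u * v) / H ^ 2 := by
    calc (T.card : ℝ) ≤ ((A ×ˢ B).card : ℝ) := by exact_mod_cast card_filter_le _ _
      _ = A.card * B.card := by rw [card_product]; push_cast; rfl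
      _ ≤ (2 * (2 * X * u / H) / (1 : ℕ)) * (2 * (2 * X * v / H) / (1 : ℕ)) := by gcongr
      _ = _ := by push_cast; field_simp; ring
  calc (S.card : ℝ) ≤ T.card * τ := h1
    _ ≤ (16 * (X ^ 2 * u * v) / H ^ 2) * τ := by gcongr
    _ = _ := by ring

end IntegerCounts

/-! ### `ZMod Q` as fractions: numerators, distance to the integers, counts. -/

section Torsion

set_option linter.unusedSectionVars false

variable {Q : ℕ} [NeZero Q]

/-- The numerator of the fraction with denominator `q` that represents a `q`-torsion element of
`ZMod Q`, viewed inside `ℚ / ℤ`. -/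
def torsionNum (q : ℕ) (α : ZMod Q) : ℤ := (q * α.valMinAbs) / Q

theorem torsionNum_spec {q : ℕ} {α : ZMod Q} (h : q • α = 0) :
    (Q : ℤ) * torsionNum q α = q * α.valMinAbs := by
  apply Int.mul_ediv_cancel'
  rw [← ZMod.intCast_zmod_eq_zero_iff_dvd]
  push_cast
  rw [← nsmul_eq_mul, h]

theorem torsionNum_ne_zero {q : ℕ} (hq : 0 < q) {α : ZMod Q} (h : q • α = 0) (h0 : α ≠ 0) :
    torsionNum q α ≠ 0 := by
  intro hn
  have := torsionNum_spec h
  rw [hn, mul_zero, eq_comm, mul_eq_zero] at this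
  rcases this with h1 | h1
  · exact hq.ne' (by exact_mod_cast h1)
  · exact h0 ((ZMod.valMinAbs_eq_zero α).1 h1)

theorem torsionNum_inj {q : ℕ} (hq : 0 < q) {α β : ZMod Q} (hα : q • α = 0) (hβ : q • β = 0)
    (h : torsionNum q α = torsionNum q β) : α = β := by
  have h1 := torsionNum_spec hα
  have h2 := torsionNum_spec hβ
  rw [h, h2] at h1
  have hq' : (q : ℤ) ≠ 0 := by exact_mod_cast hq.ne'
  exact ZMod.injective_valMinAbs (mul_left_cancel₀ hq' h1.symm)

/-- The distance from `α / Q` to the nearest integer, times `Q`. -/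
def zabs (α : ZMod Q) : ℕ := α.valMinAbs.natAbs

theorem zabs_neg (α : ZMod Q) : zabs (-α) = zabs α := ZMod.natAbs_valMinAbs_neg α

theorem zabs_pos {α : ZMod Q} (h : α ≠ 0) : 0 < zabs α :=
  Int.natAbs_pos.2 fun h0 => h ((ZMod.valMinAbs_eq_zero α).1 h0)

theorem zabs_mul {q : ℕ} {α : ZMod Q} (h : q • α = 0) :
    (Q : ℝ) * |(torsionNum q α : ℝ)| = q * zabs α := by
  have h1 := congrArg (fun z : ℤ => |(z : ℝ)|) (torsionNum_spec h)
  push_cast at h1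
  rw [abs_mul, abs_mul, Nat.abs_cast, Nat.abs_cast] at h1
  rw [h1, zabs, Nat.cast_natAbs, Int.cast_abs]

theorem torsionNum_mul_le {q : ℕ} {α : ZMod Q} (h : q • α = 0) {H : ℝ}
    (hH : zabs α * H ≤ Q) : |(torsionNum q α : ℝ)| * H ≤ q := by
  have hQ : (0 : ℝ) < Q := by exact_mod_cast Nat.pos_of_ne_zero (NeZero.ne Q)
  refine le_of_mul_le_mul_left ?_ hQ
  calc (Q : ℝ) * (|(torsionNum q α : ℝ)| * H) = q * (zabs α * H) := by
        rw [← mul_assoc, zabs_mul h, mul_assoc]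
    _ ≤ q * Q := by gcongr
    _ = _ := mul_comm _ _

theorem div_zabs {q : ℕ} (hq : 0 < q) {α : ZMod Q} (h : q • α = 0) (h0 : α ≠ 0) :
    (Q : ℝ) / zabs α = q / |(torsionNum q α : ℝ)| := by
  have hz : (0 : ℝ) < zabs α := by exact_mod_cast zabs_pos h0
  have ht : 0 < |(torsionNum q α : ℝ)| := abs_pos.2 (by exact_mod_cast torsionNum_ne_zero hq h h0)
  rw [div_eq_div_iff hz.ne' ht.ne', zabs_mul h]

/-- Over the common denominator x u v, the sum has numerator z₁v + z₂u; that `u * v` kills it forces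
`x` to divide this numerator. -/
theorem isNumPair_of_torsion {x u v : ℕ} (hx : 0 < x) (hu : 0 < u) (hv : 0 < v) {H : ℝ}
    {α β : ZMod Q} (hα : (x * u) • α = 0) (hβ : (x * v) • β = 0) (hα0 : α ≠ 0) (hβ0 : β ≠ 0)
    (hαβ : α + β ≠ 0) (hs : (u * v) • (α + β) = 0) (hαH : zabs α * H ≤ Q)
    (hβH : zabs β * H ≤ Q) :
    IsNumPair x u v H (torsionNum (x * u) α, torsionNum (x * v) β) := by
  have hQ : (Q : ℤ) ≠ 0 := by exact_mod_cast NeZero.ne Q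
  have e1 := torsionNum_spec hα
  have e2 := torsionNum_spec hβ
  have e3 : (Q : ℤ) ∣ (u * v : ℕ) * (α.valMinAbs + β.valMinAbs) := by
    rw [← ZMod.intCast_zmod_eq_zero_iff_dvd]
    push_cast
    rw [← Nat.cast_mul, ← nsmul_eq_mul, hs]
  push_cast at e1 e2 e3
  refine ⟨torsionNum_ne_zero (by positivity) hα hα0, torsionNum_ne_zero (by positivity) hβ hβ0,
    ?_, ?_, ?_, ?_⟩
  · exact_mod_cast torsionNum_mul_le hα hαH
  · exact_mod_cast torsionNum_mul_le hβ hβH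
  · obtain ⟨n, hn⟩ := e3
    refine ⟨n, mul_left_cancel₀ hQ ?_⟩
    simp only
    linear_combination (v : ℤ) * e1 + (u : ℤ) * e2 + (x : ℤ) * hn
  · simp only
    intro h0
    apply hαβ
    have hc : ((x * u * v : ℕ) : ℤ) * (α.valMinAbs + β.valMinAbs) = 0 := by
      push_cast
      linear_combination -(v : ℤ) * e1 - (u : ℤ) * e2 + (Q : ℤ) * h0
    have hxuv : ((x * u * v : ℕ) : ℤ) ≠ 0 := by
      have : 0 < x * u * v := by positivity
      exact_mod_cast this.ne'
    have h2 := (mul_eq_zero.1 hc).resolve_left hxuv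
    have := congrArg (fun z : ℤ => (z : ZMod Q)) h2
    simpa using this

/-- The pairs of elements with denominators dividing `x u` and `x v`, both within `1 / H` of an
integer, whose sum is nonzero and has a denominator dividing `u v`. -/
def IsClosePair (x u v : ℕ) (H : ℝ) (z : ZMod Q × ZMod Q) : Prop :=
  (x * u) • z.1 = 0 ∧ (x * v) • z.2 = 0 ∧ z.1 ≠ 0 ∧ z.2 ≠ 0 ∧ z.1 + z.2 ≠ 0 ∧
    (u * v) • (z.1 + z.2) = 0 ∧ zabs z.1 * H ≤ Q ∧ zabs z.2 * H ≤ Q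

theorem card_closePair_le {x u v : ℕ} {H : ℝ} (hx : 0 < x) (hu : 0 < u) (hv : 0 < v)
    (hH : 1 ≤ H) (hxu : x.Coprime u) (hxv : x.Coprime v)
    (hcase : H ≤ u ∨ H ≤ v ∨ H ≤ x * u.gcd v) (S : Finset (ZMod Q × ZMod Q))
    (hS : ∀ z ∈ S, IsClosePair x u v H z) :
    (S.card : ℝ) ≤ 12 * (x * u * v) / H ^ 2 := by
  classical
  have := card_numPair_le hx hu hv hH hxu hxv hcase
    (S.image fun z => (torsionNum (x * u) z.1, torsionNum (x * v) z.2)) (by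
      intro w hw
      obtain ⟨z, hz, rfl⟩ := mem_image.1 hw
      obtain ⟨h1, h2, h3, h4, h5, h6, h7, h8⟩ := hS z hz
      exact isNumPair_of_torsion hx hu hv h1 h2 h3 h4 h5 h6 h7 h8)
  rwa [Finset.card_image_of_injOn] at this
  intro z hz w hw hzw
  obtain ⟨e1, e2⟩ := Prod.mk.inj hzw
  exact Prod.ext (torsionNum_inj (by positivity) (hS z hz).1 (hS w hw).1 e1)
    (torsionNum_inj (by positivity) (hS z hz).2.1 (hS w hw).2.1 e2)

theorem card_closeTriple_le {X u v : ℕ} {H : ℝ} (hu : 0 < u) (hv : 0 < v) (hH : 1 ≤ H)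
    {τ : ℝ} (hτ0 : 0 ≤ τ)
    (hτ : ∀ N : ℕ, 0 < N → N ≤ 4 * X * u * v → (N.divisors.card : ℝ) ≤ τ)
    (S : Finset (ℕ × ZMod Q × ZMod Q))
    (hS : ∀ z ∈ S, 0 < z.1 ∧ z.1 < 2 * X ∧ IsClosePair z.1 u v H z.2) :
    (S.card : ℝ) ≤ τ * (16 * (X ^ 2 * u * v) / H ^ 2) := by
  classical
  have := card_numTriple_le hH hτ0 hτ
    (S.image fun z => (z.1, torsionNum (z.1 * u) z.2.1, torsionNum (z.1 * v) z.2.2)) (by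
      intro w hw
      obtain ⟨z, hz, rfl⟩ := mem_image.1 hw
      obtain ⟨h0, hX, h1, h2, h3, h4, h5, h6, h7, h8⟩ := hS z hz
      exact ⟨hX, isNumPair_of_torsion h0 hu hv h1 h2 h3 h4 h5 h6 h7 h8⟩)
  rwa [Finset.card_image_of_injOn] at this
  intro z hz w hw hzw
  obtain ⟨e1, e2⟩ := Prod.mk.inj hzw
  obtain ⟨e2, e3⟩ := Prod.mk.inj e2
  obtain ⟨h0, -, hz1, hz2, -⟩ := hS z hz
  obtain ⟨-, -, hw1, hw2, -⟩ := hS w hw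
  rw [← e1] at e2 e3 hw1 hw2
  exact Prod.ext e1 (Prod.ext (torsionNum_inj (by positivity) hz1 hw1 e2)
    (torsionNum_inj (by positivity) hz2 hw2 e3))

/-- Differences killed by `d` are multiples of Q/d, so the representatives lie in one class modulo
Q/d inside [-Q/H, Q/H]. -/
theorem card_close_le {d : ℕ} (hd : 0 < d) (hdQ : d ∣ Q) {H : ℝ} (hH : 0 < H)
    (S : Finset (ZMod Q)) (h1 : ∀ a ∈ S, zabs a * H ≤ Q)
    (h2 : ∀ a ∈ S, ∀ b ∈ S, d • (a - b) = 0) : (S.card : ℝ) ≤ 1 + 2 * d / H := by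
  classical
  obtain ⟨m, hm⟩ := hdQ
  have hQ : 0 < Q := Nat.pos_of_ne_zero (NeZero.ne Q)
  have hm0 : 0 < m := by
    rcases Nat.eq_zero_or_pos m with h | h
    · rw [h, mul_zero] at hm; omega
    · exact h
  have := card_int_le_of_dvd_sub (S.image ZMod.valMinAbs) (Q / H) m hm0 (by positivity) (by
    intro a ha
    obtain ⟨z, hz, rfl⟩ := mem_image.1 ha
    rw [le_div_iff₀ hH]
    have := h1 z hz
    rwa [zabs, Nat.cast_natAbs, Int.cast_abs] at this) (by
    intro a ha b hb
    obtain ⟨z, hz, rfl⟩ := mem_image.1 ha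
    obtain ⟨w, hw, rfl⟩ := mem_image.1 hb
    have h3 : (Q : ℤ) ∣ d * (z.valMinAbs - w.valMinAbs) := by
      rw [← ZMod.intCast_zmod_eq_zero_iff_dvd]
      push_cast
      rw [← nsmul_eq_mul, h2 z hz w hw]
    have h4 : (Q : ℤ) = d * m := by exact_mod_cast hm
    rw [h4] at h3
    exact (mul_dvd_mul_iff_left (by exact_mod_cast hd.ne')).1 h3)
  rw [Finset.card_image_of_injective _ ZMod.injective_valMinAbs] at this
  refine this.trans (le_of_eq ?_)
  have h4 : (Q : ℝ) = d * m := by exact_mod_cast hm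
  have hm' : (m : ℝ) ≠ 0 := by exact_mod_cast hm0.ne'
  rw [h4]
  field_simp

/-- A torsion element is determined by its numerator, so each absolute value of a numerator occurs
at most twice. -/
theorem sum_torsion_le {q : ℕ} (hq : 0 < q) (S : Finset (ZMod Q))
    (hS : ∀ α ∈ S, q • α = 0 ∧ α ≠ 0) (f : ℕ → ℝ) (hf : ∀ a, 0 ≤ f a) :
    ∑ α ∈ S, f (torsionNum q α).natAbs ≤ 2 * ∑ a ∈ Icc 1 q, f a := by
  classical
  have hQ : (0 : ℝ) < Q := by exact_mod_cast Nat.pos_of_ne_zero (NeZero.ne Q)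
  have hmap : ∀ α ∈ S, (torsionNum q α).natAbs ∈ Icc 1 q := by
    intro α hα
    obtain ⟨h1, h2⟩ := hS α hα
    rw [mem_Icc]
    refine ⟨Int.natAbs_pos.2 (torsionNum_ne_zero hq h1 h2), ?_⟩
    have h3 : (zabs α : ℝ) * 1 ≤ Q := by
      rw [mul_one]
      exact_mod_cast (ZMod.natAbs_valMinAbs_le α).trans (Nat.div_le_self _ _)
    have := torsionNum_mul_le h1 h3
    rw [mul_one] at this
    have h4 : ((torsionNum q α).natAbs : ℝ) ≤ q := by
      rwa [Nat.cast_natAbs, Int.cast_abs]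
    exact_mod_cast h4
  rw [← Finset.sum_fiberwise_of_maps_to hmap, mul_sum]
  refine sum_le_sum fun a _ => ?_
  rw [Finset.sum_congr rfl (g := fun _ => f a) (by
    intro α hα
    rw [(mem_filter.1 hα).2]), sum_const, nsmul_eq_mul]
  refine mul_le_mul_of_nonneg_right ?_ (hf a)
  have : (S.filter fun α => (torsionNum q α).natAbs = a).card ≤ ({(a : ℤ), -(a : ℤ)} : Finset ℤ).card := by
    refine Finset.card_le_card_of_injOn (torsionNum q) ?_ ?_
    · intro α hα
      simp only [coe_filter, Set.mem_ofPred_eq] at hα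
      simp only [coe_insert, coe_singleton, Set.mem_insert_iff, Set.mem_singleton_iff]
      omega
    · intro α hα β hβ h
      simp only [coe_filter, Set.mem_ofPred_eq] at hα hβ
      exact torsionNum_inj hq (hS α hα.1).1 (hS β hβ.1).1 h
  exact_mod_cast this.trans (Finset.card_le_two)

theorem sum_inv_sq_tail (N : ℕ) {t : ℝ} (ht : 0 < t) :
    ∑ a ∈ (Icc 1 N).filter (fun a : ℕ => t < (a : ℝ)), 1 / (a : ℝ) ^ 2 ≤ 2 / t := by
  set a0 : ℕ := ⌊t⌋₊ + 1 with ha0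
  have h0 : t < a0 := by exact_mod_cast Nat.lt_floor_add_one t
  have hsub : (Icc 1 N).filter (fun a : ℕ => t < (a : ℝ)) ⊆ Ico a0 (a0 + N) := by
    intro a ha
    rw [mem_filter, mem_Icc] at ha
    rw [mem_Ico]
    have : ⌊t⌋₊ < a := by
      rw [Nat.floor_lt ht.le]
      exact ha.2
    omega
  -- Telescoping, from 1/m² ≤ 2/m - 2/(m+1) for m ≥ 1.
  have htel : ∀ n : ℕ, ∑ a ∈ Ico a0 (a0 + n), 1 / (a : ℝ) ^ 2 ≤ 2 / (a0 : ℝ) - 2 / ((a0 + n : ℕ) : ℝ) := by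
    intro n
    induction n with
    | zero => simp
    | succ n ih =>
      rw [← add_assoc, Finset.sum_Ico_succ_top (by omega)]
      set m : ℝ := ((a0 + n : ℕ) : ℝ) with hm
      have hm1 : 1 ≤ m := by
        rw [hm]
        exact_mod_cast (by omega : 1 ≤ a0 + n)
      have e : ((a0 + n + 1 : ℕ) : ℝ) = m + 1 := by rw [hm]; push_cast; ring
      rw [e]
      have : 1 / m ^ 2 ≤ 2 / m - 2 / (m + 1) := by
        rw [div_sub_div _ _ (by positivity) (by positivity), div_le_div_iff₀ (by positivity)
          (by positivity)]
        nlinarith [mul_nonneg (sub_nonneg.2 hm1) (sq_nonneg m), sq_nonneg m]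
      linarith
  calc _ ≤ ∑ a ∈ Ico a0 (a0 + N), 1 / (a : ℝ) ^ 2 :=
        sum_le_sum_of_subset_of_nonneg hsub fun a _ _ => by positivity
    _ ≤ 2 / (a0 : ℝ) - 2 / ((a0 + N : ℕ) : ℝ) := htel N
    _ ≤ 2 / (a0 : ℝ) := by
      have : (0 : ℝ) ≤ 2 / ((a0 + N : ℕ) : ℝ) := by positivity
      linarith
    _ ≤ 2 / t := by gcongr

/-- `min(h, 1 / ‖α / Q‖)`. -/
noncomputable def fejer (h : ℝ) (α : ZMod Q) : ℝ := min h (Q / zabs α)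

theorem fejer_nonneg {h : ℝ} (hh : 0 ≤ h) (α : ZMod Q) : 0 ≤ fejer h α :=
  le_min hh (by positivity)

theorem fejer_neg (h : ℝ) (α : ZMod Q) : fejer h (-α) = fejer h α := by
  rw [fejer, fejer, zabs_neg]

theorem div_zabs_le {q : ℕ} (hq : 0 < q) {α : ZMod Q} (h : q • α = 0) (h0 : α ≠ 0) :
    (Q : ℝ) / zabs α ≤ q := by
  rw [div_zabs hq h h0]
  refine div_le_self (Nat.cast_nonneg _) ?_
  have := Int.one_le_abs (torsionNum_ne_zero hq h h0)
  exact_mod_cast this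

/-- The distance of a/q to 0 exceeds 1/H exactly when |a| > q/H, and the tail of ∑ (q/a)² beyond
that point is of order qH. -/
theorem sum_fejer_tail_sq_le {q : ℕ} (hq : 0 < q) {H : ℝ} (hH : 0 < H) (S : Finset (ZMod Q))
    (hS : ∀ α ∈ S, q • α = 0 ∧ α ≠ 0 ∧ (Q : ℝ) < zabs α * H) :
    ∑ α ∈ S, ((Q : ℝ) / zabs α) ^ 2 ≤ 4 * (q * H) := by
  have hq' : (0 : ℝ) < q := by exact_mod_cast hq
  have hQ : (0 : ℝ) < Q := by exact_mod_cast Nat.pos_of_ne_zero (NeZero.ne Q)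
  have h1 := sum_torsion_le hq S (fun α hα => ⟨(hS α hα).1, (hS α hα).2.1⟩)
    (fun a => if (q : ℝ) / H < a then ((q : ℝ) / a) ^ 2 else 0)
    (fun a => by split_ifs <;> positivity)
  calc _ = ∑ α ∈ S, (if (q : ℝ) / H < ((torsionNum q α).natAbs : ℕ) then
        ((q : ℝ) / ((torsionNum q α).natAbs : ℕ)) ^ 2 else 0) := by
        refine sum_congr rfl fun α hα => ?_
        obtain ⟨h1, h2, h3⟩ := hS α hα
        rw [Nat.cast_natAbs, Int.cast_abs, if_pos, div_zabs hq h1 h2]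
        rw [div_lt_iff₀ hH]
        refine lt_of_mul_lt_mul_left ?_ hQ.le
        rw [← mul_assoc, zabs_mul h1, mul_assoc, mul_comm]
        gcongr
    _ ≤ _ := h1
    _ = 2 * (q ^ 2 * ∑ a ∈ (Icc 1 q).filter (fun a : ℕ => (q : ℝ) / H < (a : ℝ)), 1 / (a : ℝ) ^ 2) := by
        congr 1
        rw [sum_filter, mul_sum]
        refine sum_congr rfl fun a _ => ?_
        split_ifs
        · rw [div_pow]; ring
        · simp
    _ ≤ 2 * (q ^ 2 * (2 / (q / H))) := by
        gcongr
        exact sum_inv_sq_tail q (by positivity)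
    _ = _ := by field_simp; ring

theorem card_torsion_close_le {q : ℕ} (hq : 0 < q) {H : ℝ} (hH : 0 < H) (S : Finset (ZMod Q))
    (hS : ∀ α ∈ S, q • α = 0 ∧ α ≠ 0 ∧ zabs α * H ≤ Q) :
    (S.card : ℝ) ≤ 2 * q / H := by
  classical
  have := card_int_nonzero_le (S.image (torsionNum q)) (q / H) 1 one_pos (by positivity) (by
      intro a ha
      obtain ⟨z, hz, rfl⟩ := mem_image.1 ha
      exact torsionNum_ne_zero hq (hS z hz).1 (hS z hz).2.1) (by
      intro a ha
      obtain ⟨z, hz, rfl⟩ := mem_image.1 ha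
      rw [le_div_iff₀ hH]
      exact torsionNum_mul_le (hS z hz).1 (hS z hz).2.2) (by simp)
  rw [Finset.card_image_of_injOn] at this
  · refine this.trans (le_of_eq ?_)
    push_cast
    ring
  · intro z hz w hw hzw
    exact torsionNum_inj hq (hS z hz).1 (hS w hw).1 hzw

/-- Splitting at distance 1/h: at most 2q/h elements are closer, each contributing at most h², and
the tail bound with H = h covers the others. -/
theorem sum_fejer_sq_le {q : ℕ} (hq : 0 < q) {h : ℝ} (hh : 0 < h) (S : Finset (ZMod Q))
    (hS : ∀ α ∈ S, q • α = 0 ∧ α ≠ 0) :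
    ∑ α ∈ S, fejer h α ^ 2 ≤ 6 * (q * h) := by
  have hQ : (0 : ℝ) < Q := by exact_mod_cast Nat.pos_of_ne_zero (NeZero.ne Q)
  rw [← Finset.sum_filter_add_sum_filter_not S fun α => zabs α * h ≤ Q]
  have h1 : ∑ α ∈ S with zabs α * h ≤ Q, fejer h α ^ 2 ≤ 2 * (q * h) := by
    have hc := card_torsion_close_le hq hh (S.filter fun α => zabs α * h ≤ Q) (by
      intro α hα
      rw [mem_filter] at hα
      exact ⟨(hS α hα.1).1, (hS α hα.1).2, hα.2⟩)
    calc _ ≤ ∑ α ∈ S with zabs α * h ≤ Q, h ^ 2 := by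
          refine sum_le_sum fun α _ => ?_
          exact pow_le_pow_left₀ (fejer_nonneg hh.le α) (min_le_left _ _) 2
      _ = (S.filter fun α => zabs α * h ≤ Q).card * h ^ 2 := by simp
      _ ≤ (2 * q / h) * h ^ 2 := by gcongr
      _ = _ := by field_simp
  have h2 : ∑ α ∈ S with ¬ zabs α * h ≤ Q, fejer h α ^ 2 ≤ 4 * (q * h) := by
    have hc := sum_fejer_tail_sq_le hq hh (S.filter fun α => ¬ zabs α * h ≤ Q) (by
      intro α hα
      rw [mem_filter, not_le] at hα
      exact ⟨(hS α hα.1).1, (hS α hα.1).2, hα.2⟩)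
    refine le_trans (sum_le_sum fun α _ => ?_) hc
    exact pow_le_pow_left₀ (fejer_nonneg hh.le α) (min_le_right _ _) 2
  linarith

end Torsion

/-! ### Divisor sums that absorb the factors q/φ(q). -/

theorem le_totient_mul_card_divisors (n : ℕ) : n ≤ n.totient * n.divisors.card := by
  induction n using Nat.recOnPrimeCoprime with
  | zero => simp
  | prime_pow p n hp =>
    rcases n with _ | n
    · simp
    · rw [Nat.totient_prime_pow_succ hp, Nat.divisors_prime_pow hp, card_map, card_range, pow_succ,
        mul_assoc]
      refine Nat.mul_le_mul_left _ ?_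
      have := hp.two_le
      calc p ≤ (p - 1) * 2 := by omega
        _ ≤ _ := Nat.mul_le_mul_left _ (by omega)
  | coprime a b ha hb hab iha ihb =>
    rw [Nat.totient_mul hab, Nat.Coprime.card_divisors_mul hab]
    calc a * b ≤ (a.totient * a.divisors.card) * (b.totient * b.divisors.card) :=
        Nat.mul_le_mul iha ihb
      _ = _ := by ring

theorem div_totient_le (n : ℕ) : (n : ℝ) / n.totient ≤ n.divisors.card := by
  rcases Nat.eq_zero_or_pos n with rfl | hn
  · simp
  · rw [div_le_iff₀ (by exact_mod_cast Nat.totient_pos.2 hn), mul_comm]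
    exact_mod_cast le_totient_mul_card_divisors n

theorem card_divisors_le_of_dvd {m n : ℕ} (hn : n ≠ 0) (h : m ∣ n) :
    m.divisors.card ≤ n.divisors.card := card_le_card (Nat.divisors_subset_of_dvd hn h)

/-- `∑_{d ∣ Q} τ(d) ^ m / d`. -/
noncomputable def divSum (m Q : ℕ) : ℝ := ∑ d ∈ Q.divisors, (d.divisors.card : ℝ) ^ m / d

theorem divSum_nonneg (m Q : ℕ) : 0 ≤ divSum m Q := sum_nonneg fun _ _ => by positivity

theorem divSum_mono {m n : ℕ} (h : m ≤ n) (Q : ℕ) : divSum m Q ≤ divSum n Q := by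
  refine sum_le_sum fun d hd => ?_
  have : 1 ≤ (d.divisors.card : ℝ) := by
    exact_mod_cast card_pos.2 ⟨1, Nat.one_mem_divisors.2 (Nat.pos_of_mem_divisors hd).ne'⟩
  gcongr

/-! ### Sums over tuples of frequencies with sum zero. -/

section TupleSums

set_option linter.unusedSectionVars false

variable {ι : Type*} [Fintype ι] [DecidableEq ι]

/-- All entries of a tuple with least common multiple L divide L, so there are at most τ(L)^|ι| such
tuples. -/
theorem sum_lcm_le {Q : ℕ} (hQ : Q ≠ 0) (m : ℕ) :
    ∑ q ∈ Fintype.piFinset (fun _ : ι => Q.divisors),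
      ((univ.lcm q).divisors.card : ℝ) ^ m / ((univ.lcm q : ℕ) : ℝ)
      ≤ divSum (m + Fintype.card ι) Q := by
  have hmap : ∀ q ∈ Fintype.piFinset (fun _ : ι => Q.divisors), univ.lcm q ∈ Q.divisors := by
    intro q hq
    rw [Fintype.mem_piFinset] at hq
    exact Nat.mem_divisors.2 ⟨Finset.lcm_dvd fun i _ => (Nat.mem_divisors.1 (hq i)).1, hQ⟩
  rw [← Finset.sum_fiberwise_of_maps_to hmap]
  refine sum_le_sum fun L hL => ?_
  rw [Finset.sum_congr rfl (g := fun _ => (L.divisors.card : ℝ) ^ m / (L : ℝ)) (by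
    intro q hq
    rw [(mem_filter.1 hq).2]), sum_const, nsmul_eq_mul]
  have hc : ((Fintype.piFinset (fun _ : ι => Q.divisors)).filter fun q => univ.lcm q = L).card
      ≤ L.divisors.card ^ Fintype.card ι := by
    have : ((Fintype.piFinset (fun _ : ι => Q.divisors)).filter fun q => univ.lcm q = L)
        ⊆ Fintype.piFinset (fun _ : ι => L.divisors) := by
      intro q hq
      rw [Fintype.mem_piFinset]
      intro i
      rw [Nat.mem_divisors]
      refine ⟨?_, (Nat.pos_of_mem_divisors hL).ne'⟩
      rw [← (mem_filter.1 hq).2]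
      exact dvd_lcm (mem_univ i)
    refine (card_le_card this).trans (le_of_eq ?_)
    rw [Fintype.card_piFinset, prod_const, card_univ]
  calc _ ≤ ((L.divisors.card ^ Fintype.card ι : ℕ) : ℝ) * ((L.divisors.card : ℝ) ^ m / L) := by
        gcongr
    _ = _ := by push_cast; ring

variable {Q : ℕ} [NeZero Q]

theorem addOrderOf_dvd_modulus (α : ZMod Q) : addOrderOf α ∣ Q := by
  have := addOrderOf_dvd_card (x := α)
  rwa [ZMod.card] at this

theorem addOrderOf_pos_zmod (α : ZMod Q) : 0 < addOrderOf α :=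
  Nat.pos_of_dvd_of_pos (addOrderOf_dvd_modulus α) (Nat.pos_of_ne_zero (NeZero.ne Q))

/-- The product of the other `q j` kills every entry but `α i`, hence also `α i`, so its order
divides that product. This supplies the hypothesis of the fundamental lemma. -/
theorem exists_dvd_of_sum_eq_zero {α : ι → ZMod Q} (hα : ∑ i, α i = 0) (q : ι → ℕ) (i : ι)
    (hq : ∀ j ≠ i, q j • α j = 0) {p : ℕ} (hp : p.Prime) (hpi : p ∣ addOrderOf (α i)) :
    ∃ j ≠ i, p ∣ q j := by
  set m := ∏ j ∈ univ.erase i, q j with hm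
  have h1 : m • α i = 0 := by
    have h2 := congrArg (fun z => m • z) hα
    simp only [smul_sum, smul_zero] at h2
    rw [← Finset.add_sum_erase univ _ (mem_univ i), Finset.sum_eq_zero, add_zero] at h2
    · exact h2
    · intro j hj
      obtain ⟨t, ht⟩ := Finset.dvd_prod_of_mem q hj
      rw [hm, ht, mul_comm, mul_nsmul', hq j (ne_of_mem_erase hj), smul_zero]
  have h2 : p ∣ m := hpi.trans (addOrderOf_dvd_of_nsmul_eq_zero h1)
  obtain ⟨j, hj, hpj⟩ := (Prime.dvd_finsetProd_iff hp.prime _).1 h2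
  exact ⟨j, ne_of_mem_erase hj, hpj⟩

/-- The tuples with sum zero whose nonzero entries are those with an index in `B`. -/
def suppTuples (Q : ℕ) [NeZero Q] (B : Finset ι) : Finset (ι → ZMod Q) :=
  univ.filter fun α => ∑ i, α i = 0 ∧ ∀ i, α i ≠ 0 ↔ i ∈ B

theorem sqrt_mul_sum_sq_div_totient_le {q : ℕ} (hqQ : q ∣ Q) {f : ZMod Q → ℝ} {A : ℝ}
    (hf : ∑ a with addOrderOf a = q, f a ^ 2 ≤ q * A) :
    √((q : ℝ) * ∑ a, (if addOrderOf a = q then f a / (addOrderOf a).totient else 0) ^ 2)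
      ≤ q.divisors.card * √A := by
  have hq : 0 < q := Nat.pos_of_dvd_of_pos hqQ (Nat.pos_of_ne_zero (NeZero.ne Q))
  have e : ∑ a : ZMod Q, (if addOrderOf a = q then f a / (addOrderOf a).totient else 0) ^ 2
      = (∑ a with addOrderOf a = q, f a ^ 2) / (q.totient : ℝ) ^ 2 := by
    rw [sum_div, sum_filter]
    refine sum_congr rfl fun a _ => ?_
    split_ifs with h
    · rw [h, div_pow]
    · simp
  rw [e]
  have h1 : (q : ℝ) * ((∑ a with addOrderOf a = q, f a ^ 2) / (q.totient : ℝ) ^ 2)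
      ≤ ((q : ℝ) / q.totient) ^ 2 * A := by
    calc _ ≤ (q : ℝ) * ((q * A) / (q.totient : ℝ) ^ 2) := by gcongr
      _ = _ := by ring
  calc _ ≤ √(((q : ℝ) / q.totient) ^ 2 * A) := Real.sqrt_le_sqrt h1
    _ = (q : ℝ) / q.totient * √A := by
      rw [Real.sqrt_mul (sq_nonneg _), Real.sqrt_sq (by positivity)]
    _ ≤ _ := by gcongr; exact div_totient_le q

/-- The fundamental lemma is applied for each tuple of orders. The weights 1/φ turn each square root
into at most τ(q)√A, the gain 1/lcm remains, and the sum over tuples of orders becomes a divisor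
sum. -/
theorem sum_suppTuples_le (hQ : Squarefree Q) (B : Finset ι) (f : ι → ZMod Q → ℝ)
    (hf : ∀ i a, 0 ≤ f i a) (A : ι → ℝ)
    (hfA : ∀ i ∈ B, ∀ q, q ∣ Q → 1 < q → ∑ a with addOrderOf a = q, f i a ^ 2 ≤ q * A i) :
    ∑ α ∈ suppTuples Q B, ∏ i ∈ B, f i (α i) / (addOrderOf (α i)).totient
      ≤ divSum (2 * Fintype.card ι) Q * ∏ i ∈ B, √(A i) := by
  have hQ0 : Q ≠ 0 := NeZero.ne Q
  set ord : (ι → ZMod Q) → ι → ℕ := fun α i => addOrderOf (α i) with hord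
  have hmap : ∀ α ∈ suppTuples Q B, ord α ∈ Fintype.piFinset (fun _ : ι => Q.divisors) := by
    intro α _
    rw [Fintype.mem_piFinset]
    exact fun i => Nat.mem_divisors.2 ⟨addOrderOf_dvd_modulus _, hQ0⟩
  rw [← Finset.sum_fiberwise_of_maps_to hmap]
  have hP : 0 ≤ ∏ i ∈ B, √(A i) := prod_nonneg fun i _ => Real.sqrt_nonneg _
  calc _ ≤ ∑ q ∈ Fintype.piFinset (fun _ : ι => Q.divisors),
        ((univ.lcm q).divisors.card : ℝ) ^ Fintype.card ι / ((univ.lcm q : ℕ) : ℝ)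
          * ∏ i ∈ B, √(A i) := ?_
    _ ≤ _ := by
      rw [← sum_mul, two_mul]
      gcongr
      exact sum_lcm_le hQ0 _
  refine sum_le_sum fun q hq => ?_
  rw [Fintype.mem_piFinset] at hq
  have hqQ : ∀ i, q i ∣ Q := fun i => (Nat.mem_divisors.1 (hq i)).1
  have hLQ : univ.lcm q ∣ Q := Finset.lcm_dvd fun i _ => hqQ i
  have hL0 : univ.lcm q ≠ 0 := ne_zero_of_dvd_ne_zero hQ0 hLQ
  have hLpos : (0 : ℝ) < ((univ.lcm q : ℕ) : ℝ) := by exact_mod_cast Nat.pos_of_ne_zero hL0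
  -- The condition that each prime occurs twice among the orders is read off from an actual tuple
  -- `α₀`, so empty classes are set aside.
  rcases Finset.eq_empty_or_nonempty ((suppTuples Q B).filter fun α => ord α = q) with he | ⟨α₀, h₀⟩
  · rw [he, sum_empty]
    positivity
  rw [mem_filter, suppTuples, mem_filter] at h₀
  obtain ⟨⟨-, h₀s, h₀B⟩, h₀q⟩ := h₀
  have hqB : ∀ i ∈ B, 1 < q i := by
    intro i hi
    rw [← h₀q]
    have h1 := addOrderOf_pos_zmod (α₀ i)
    have h2 : addOrderOf (α₀ i) ≠ 1 := fun h => (h₀B i).2 hi (AddMonoid.addOrderOf_eq_one_iff.1 h)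
    simp only [hord]
    omega
  have hqB' : ∀ i ∉ B, q i = 1 := by
    intro i hi
    rw [← h₀q]
    have : α₀ i = 0 := by
      by_contra h
      exact hi ((h₀B i).1 h)
    simp [hord, this]
  -- Indices outside `B` carry the indicator of 0, with order 1, so they are invisible in the
  -- fundamental lemma.
  set G : ι → ZMod Q → ℝ := fun i a =>
    if i ∈ B then (if addOrderOf a = q i then f i a / (addOrderOf a).totient else 0)
    else (if a = 0 then 1 else 0) with hG
  have hG0 : ∀ i a, 0 ≤ G i a := by
    intro i a
    simp only [hG]
    have := hf i a
    split_ifs <;> positivity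
  have hFL := fundamental_lemma hQ q hqQ (by
    intro p hp i hpi
    refine exists_dvd_of_sum_eq_zero h₀s q i (fun j _ => ?_) hp ?_
    · rw [← h₀q]; exact addOrderOf_nsmul_eq_zero _
    · rw [← h₀q] at hpi; exact hpi) G hG0 (by
    intro i a h
    simp only [hG] at h
    split_ifs at h with h1 h2 h3
    · rw [← h2]; exact addOrderOf_nsmul_eq_zero _
    · exact absurd rfl h
    · rw [h3, smul_zero]
    · exact absurd rfl h)
  have hsum : ∑ α ∈ suppTuples Q B with ord α = q,
      ∏ i ∈ B, f i (α i) / (addOrderOf (α i)).totient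
      ≤ ∑ α : ι → ZMod Q with ∑ i, α i = 0, ∏ i, G i (α i) := by
    have hsub : ((suppTuples Q B).filter fun α => ord α = q)
        ⊆ univ.filter fun α : ι → ZMod Q => ∑ i, α i = 0 := by
      intro α hα
      simp only [suppTuples, mem_filter, mem_univ, true_and] at hα ⊢
      exact hα.1.1
    refine le_trans (le_of_eq (sum_congr rfl fun α hα => ?_))
      (sum_le_sum_of_subset_of_nonneg hsub fun α _ _ => prod_nonneg fun i _ => hG0 i _)
    simp only [suppTuples, mem_filter, mem_univ, true_and] at hα
    obtain ⟨⟨h1, h2⟩, h3⟩ := hα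
    rw [← Finset.prod_subset (subset_univ B)]
    · refine prod_congr rfl fun i hi => ?_
      have : addOrderOf (α i) = q i := by rw [← h3]
      simp only [hG, if_pos hi, if_pos this]
    · intro i _ hi
      have : α i = 0 := by
        by_contra h
        exact hi ((h2 i).1 h)
      simp [hG, hi, this]
  have hprod : ∏ i, √((q i : ℝ) * ∑ a, G i a ^ 2)
      ≤ ((univ.lcm q).divisors.card : ℝ) ^ Fintype.card ι * ∏ i ∈ B, √(A i) := by
    have hτ : (1 : ℝ) ≤ (univ.lcm q).divisors.card := by
      exact_mod_cast card_pos.2 ⟨1, Nat.one_mem_divisors.2 hL0⟩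
    calc _ ≤ ∏ i, (((univ.lcm q).divisors.card : ℝ) * (if i ∈ B then √(A i) else 1)) := by
          refine prod_le_prod (fun i _ => Real.sqrt_nonneg _) fun i _ => ?_
          by_cases hi : i ∈ B
          · simp only [hG, if_pos hi]
            refine (sqrt_mul_sum_sq_div_totient_le (hqQ i)
              (hfA i hi (q i) (hqQ i) (hqB i hi))).trans ?_
            gcongr
            exact dvd_lcm (mem_univ i)
          · simp only [hG, if_neg hi, hqB' i hi]
            simpa using hτ
      _ = _ := by
        rw [prod_mul_distrib, prod_const, card_univ, Finset.prod_ite_mem, univ_inter]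
  rw [div_mul_eq_mul_div, le_div_iff₀ hLpos, mul_comm]
  calc _ ≤ _ := mul_le_mul_of_nonneg_left hsum hLpos.le
    _ ≤ _ := hFL
    _ ≤ _ := hprod

/-- Change of variables: the sum of the entries `i` and `j` is placed at `i`, the entry at `j`
becomes 0, and the old entry at `i` becomes an inner summation variable. -/
theorem sum_hyperplane_merge {i j : ι} (hij : i ≠ j) (P : ZMod Q → ZMod Q → ℝ)
    (f : ι → ZMod Q → ℝ) :
    ∑ α : ι → ZMod Q with ∑ l, α l = 0,
        P (α i) (α j) * ∏ l ∈ (univ.erase j).erase i, f l (α l)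
      = ∑ α : ι → ZMod Q with ∑ l, α l = 0, (∑ a, P a (α i - a)) * (if α j = 0 then 1 else 0) *
        ∏ l ∈ (univ.erase j).erase i, f l (α l) := by
  have hadd : ∀ F : ι → ZMod Q, ∑ l, F l = F i + F j + ∑ l ∈ (univ.erase j).erase i, F l := by
    intro F
    rw [← Finset.add_sum_erase univ _ (mem_univ j),
      ← Finset.add_sum_erase (univ.erase j) _ (mem_erase.2 ⟨hij, mem_univ i⟩)]
    abel
  have e1 : ∑ α : ι → ZMod Q with ∑ l, α l = 0, (∑ a, P a (α i - a)) *
        (if α j = 0 then 1 else 0) * ∏ l ∈ (univ.erase j).erase i, f l (α l)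
      = ∑ z ∈ (univ.filter fun α : ι → ZMod Q => ∑ l, α l = 0 ∧ α j = 0) ×ˢ (univ : Finset (ZMod Q)),
        P z.2 (z.1 i - z.2) * ∏ l ∈ (univ.erase j).erase i, f l (z.1 l) := by
    rw [sum_product, ← filter_filter, sum_filter]
    rw [sum_filter]
    rw [sum_filter]
    refine sum_congr rfl fun α _ => ?_
    split_ifs <;> simp [sum_mul]
  rw [e1]
  refine Finset.sum_bij' (fun α _ => (Function.update (Function.update α i (α i + α j)) j 0, α i))
    (fun z _ => Function.update (Function.update z.1 i z.2) j (z.1 i - z.2)) ?_ ?_ ?_ ?_ ?_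
  · intro α hα
    simp only [mem_filter, mem_univ, true_and] at hα
    simp only [mem_product, mem_filter, mem_univ, true_and, and_true, Function.update_self]
    rw [hadd] at hα ⊢
    refine Eq.trans ?_ hα
    rw [Function.update_self, Function.update_of_ne hij, Function.update_self, add_zero]
    congr 1
    refine sum_congr rfl fun l hl => ?_
    rw [mem_erase, mem_erase] at hl
    rw [Function.update_of_ne hl.2.1, Function.update_of_ne hl.1]
  · intro z hz
    simp only [mem_product, mem_filter, mem_univ, true_and, and_true] at hz ⊢
    obtain ⟨h1, h2⟩ := hz
    rw [hadd] at h1 ⊢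
    refine Eq.trans ?_ h1
    rw [h2]
    rw [Function.update_self, Function.update_of_ne hij, Function.update_self]
    congr 1
    · abel
    refine sum_congr rfl fun l hl => ?_
    rw [mem_erase, mem_erase] at hl
    rw [Function.update_of_ne hl.2.1, Function.update_of_ne hl.1]
  · intro α _
    funext l
    by_cases h1 : l = j
    · subst h1
      simp [hij]
    · by_cases h2 : l = i
      · subst h2
        simp [h1]
      · simp [h1, h2]
  · intro z hz
    simp only [mem_product, mem_filter, mem_univ, true_and, and_true] at hz
    refine Prod.ext ?_ ?_
    · funext l
      by_cases h1 : l = j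
      · subst h1
        simp [hz.2]
      · by_cases h2 : l = i
        · subst h2
          simp [h1]
        · simp [h1, h2]
    · simp [hij]
  · intro α _
    simp only
    rw [Function.update_of_ne hij, Function.update_self, add_sub_cancel_left]
    congr 1
    refine prod_congr rfl fun l hl => ?_
    rw [mem_erase, mem_erase] at hl
    rw [Function.update_of_ne hl.2.1, Function.update_of_ne hl.1]

/-- Used to bound the mean square of the number of pairs in `E` with a given sum. -/
theorem sum_card_sq_le {A B : Type*} [Fintype B] [DecidableEq B] (E : Finset A) (s : A → B) {c : ℝ}
    (hc : ∀ b, ((E.filter fun z => s z = b).card : ℝ) ≤ c) :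
    ∑ b, ((E.filter fun z => s z = b).card : ℝ) ^ 2 ≤ c * E.card := by
  have h1 : (E.card : ℝ) = ∑ b, ((E.filter fun z => s z = b).card : ℝ) := by
    rw [Finset.card_eq_sum_card_fiberwise (f := s) (t := univ) (by intro a _; simp)]
    push_cast
    rfl
  rw [h1, mul_sum]
  refine sum_le_sum fun b _ => ?_
  rw [sq]
  exact mul_le_mul_of_nonneg_right (hc b) (Nat.cast_nonneg _)

end TupleSums

/-! ### Two frequencies treated as one variable. -/

section PairSums

set_option linter.unusedSectionVars false

variable {ι : Type*} [Fintype ι] [DecidableEq ι] {Q : ℕ} [NeZero Q]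

/-- The fundamental lemma with two of the variables tied by a set `E` of pairs. -/
theorem fundamental_lemma_pair (hQ : Squarefree Q) {i j : ι} (hij : i ≠ j) (q : ι → ℕ)
    (hqQ : ∀ l, q l ∣ Q) (hqi : q i = 1) (hqj : q j = 1) {M : ℕ} (hM : M ∣ univ.lcm q)
    (E : Finset (ZMod Q × ZMod Q)) (hE : ∀ z ∈ E, M • (z.1 + z.2) = 0) {c : ℝ}
    (hc : ∀ β, ((E.filter fun z => z.1 + z.2 = β).card : ℝ) ≤ c)
    (f : ι → ZMod Q → ℝ) (hf : ∀ l a, 0 ≤ f l a)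
    (hfq : ∀ l, l ≠ i → l ≠ j → ∀ a, f l a ≠ 0 → addOrderOf a = q l) (C : ι → ℝ)
    (hC : ∀ l, l ≠ i → l ≠ j → √((q l : ℝ) * ∑ a, f l a ^ 2) ≤ C l) :
    ((univ.lcm q : ℕ) : ℝ) * ∑ α : ι → ZMod Q with ∑ l, α l = 0,
        (if (α i, α j) ∈ E then 1 else 0) * ∏ l ∈ (univ.erase j).erase i, f l (α l)
      ≤ √(M * (c * E.card)) * ∏ l ∈ (univ.erase j).erase i, C l := by
  have hCn : 0 ≤ ∏ l ∈ (univ.erase j).erase i, C l := by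
    refine prod_nonneg fun l hl => ?_
    rw [mem_erase, mem_erase] at hl
    exact (Real.sqrt_nonneg _).trans (hC l hl.1 hl.2.1)
  -- A contributing tuple is needed as a witness for the condition on primes; without one the sum
  -- vanishes.
  by_cases hne : ∃ α : ι → ZMod Q, ∑ l, α l = 0 ∧ (α i, α j) ∈ E ∧
      ∀ l, l ≠ i → l ≠ j → f l (α l) ≠ 0
  swap
  · rw [Finset.sum_eq_zero, mul_zero]
    · positivity
    intro α hα
    simp only [mem_filter, mem_univ, true_and] at hα
    by_contra hcon
    apply hne
    have h1 := left_ne_zero_of_mul hcon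
    have h2 := right_ne_zero_of_mul hcon
    rw [prod_ne_zero_iff] at h2
    refine ⟨α, hα, ?_, fun l hl1 hl2 => h2 l (by simp [hl1, hl2])⟩
    by_contra h
    simp [h] at h1
  obtain ⟨α₀, hα₀, hα₀E, hα₀f⟩ := hne
  have hα₀q : ∀ l, l ≠ i → l ≠ j → addOrderOf (α₀ l) = q l := fun l h1 h2 =>
    hfq l h1 h2 _ (hα₀f l h1 h2)
  -- The merged variable α_i + α_j sits at index `i` and is killed by `M`; since `M` divides the lcm
  -- of the other orders, the lcm on the left is unchanged.
  set q' := Function.update q i M with hq'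
  have hq'i : q' i = M := Function.update_self _ _ _
  have hq'l : ∀ l, l ≠ i → q' l = q l := fun l hl => Function.update_of_ne hl _ _
  have hlcm : univ.lcm q' = univ.lcm q := by
    apply Nat.dvd_antisymm
    · refine Finset.lcm_dvd fun l _ => ?_
      by_cases h : l = i
      · rw [h, hq'i]; exact hM
      · rw [hq'l l h]; exact dvd_lcm (mem_univ l)
    · refine Finset.lcm_dvd fun l _ => ?_
      by_cases h : l = i
      · rw [h, hqi]; exact one_dvd _
      · rw [← hq'l l h]; exact dvd_lcm (mem_univ l)
  have hlQ : univ.lcm q ∣ Q := Finset.lcm_dvd fun l _ => hqQ l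
  -- After merging, the function at `i` counts the pairs in `E` with the given sum, and the one at
  -- `j` is the indicator of 0.
  set G : ι → ZMod Q → ℝ := fun l a =>
    if l = i then ((E.filter fun z => z.1 + z.2 = a).card : ℝ) else
      if l = j then (if a = 0 then 1 else 0) else f l a with hG
  have hGi : ∀ a, G i a = ((E.filter fun z => z.1 + z.2 = a).card : ℝ) := fun a => if_pos rfl
  have hGj : ∀ a, G j a = if a = 0 then 1 else 0 := fun a => (if_neg hij.symm).trans (if_pos rfl)
  have hGl : ∀ l ∈ (univ.erase j).erase i, ∀ a, G l a = f l a := by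
    intro l hl a
    rw [mem_erase, mem_erase] at hl
    exact (if_neg hl.1).trans (if_neg hl.2.1)
  have hG0 : ∀ l a, 0 ≤ G l a := by
    intro l a
    rw [hG]
    dsimp only
    split_ifs
    exacts [Nat.cast_nonneg _, zero_le_one, le_rfl, hf l a]
  have hFL := fundamental_lemma hQ q' (by
    intro l
    by_cases h : l = i
    · rw [h, hq'i]; exact hM.trans hlQ
    · rw [hq'l l h]; exact hqQ l) (by
    intro p hp l hpl
    by_cases h : l = i
    · subst h
      rw [hq'i] at hpl
      have hpp : p ∣ ∏ m, q m := (hpl.trans hM).trans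
        (Finset.lcm_dvd fun m _ => Finset.dvd_prod_of_mem q (mem_univ m))
      obtain ⟨m, _, hm⟩ := (Prime.dvd_finsetProd_iff hp.prime _).1 hpp
      have hml : m ≠ l := by
        rintro rfl
        rw [hqi] at hm
        exact hp.one_lt.ne' (Nat.dvd_one.1 hm)
      exact ⟨m, hml, by rwa [hq'l m hml]⟩
    · rw [hq'l l h] at hpl
      have hlj : l ≠ j := by
        rintro rfl
        rw [hqj] at hpl
        exact hp.one_lt.ne' (Nat.dvd_one.1 hpl)
      -- The merged witness still has sum zero, so a prime dividing the order of another entry must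
      -- divide some other term of `q'`.
      set γ : ι → ZMod Q := Function.update (Function.update α₀ i (α₀ i + α₀ j)) j 0 with hγ
      have hγj : γ j = 0 := Function.update_self _ _ _
      have hγi : γ i = α₀ i + α₀ j := by
        rw [hγ, Function.update_of_ne hij, Function.update_self]
      have hγl : ∀ m, m ≠ i → m ≠ j → γ m = α₀ m := fun m h1 h2 => by
        rw [hγ, Function.update_of_ne h2, Function.update_of_ne h1]
      have hadd : ∀ F : ι → ZMod Q, ∑ l, F l = F i + F j + ∑ l ∈ (univ.erase j).erase i, F l := by
        intro F
        rw [← Finset.add_sum_erase univ _ (mem_univ j),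
          ← Finset.add_sum_erase (univ.erase j) _ (mem_erase.2 ⟨hij, mem_univ i⟩)]
        abel
      have hγs : ∑ m, γ m = 0 := by
        rw [hadd] at hα₀ ⊢
        refine Eq.trans ?_ hα₀
        rw [hγi, hγj, add_zero]
        congr 1
        refine sum_congr rfl fun m hm => ?_
        rw [mem_erase, mem_erase] at hm
        exact hγl m hm.1 hm.2.1
      refine exists_dvd_of_sum_eq_zero hγs q' l (fun m hm => ?_) hp ?_
      · by_cases hmi : m = i
        · rw [hmi, hq'i, hγi]; exact hE _ hα₀E
        · by_cases hmj : m = j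
          · rw [hmj, hγj, smul_zero]
          · rw [hq'l m hmi, hγl m hmi hmj, ← hα₀q m hmi hmj]
            exact addOrderOf_nsmul_eq_zero _
      · rw [hγl l h hlj, hα₀q l h hlj]; exact hpl) G hG0 (by
    intro l a h
    by_cases hli : l = i
    · subst hli
      rw [hGi, Nat.cast_ne_zero, ← Nat.pos_iff_ne_zero, card_pos] at h
      obtain ⟨z, hz⟩ := h
      rw [mem_filter] at hz
      rw [hq'i, ← hz.2]
      exact hE z hz.1
    · by_cases hlj : l = j
      · subst hlj
        rw [hGj] at h
        have : a = 0 := by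
          by_contra h0
          simp [h0] at h
        rw [this, smul_zero]
      · rw [hGl l (by simp [hli, hlj])] at h
        rw [hq'l l hli, ← hfq l hli hlj a h]
        exact addOrderOf_nsmul_eq_zero _)
  rw [hlcm] at hFL
  have hcount : ∀ β : ZMod Q, (∑ a, if (a, β - a) ∈ E then (1 : ℝ) else 0)
      = ((E.filter fun z => z.1 + z.2 = β).card : ℝ) := by
    intro β
    rw [Finset.sum_boole]
    congr 1
    refine Finset.card_bij (fun a _ => (a, β - a)) ?_ ?_ ?_
    · intro a ha
      rw [mem_filter] at ha ⊢
      exact ⟨ha.2, by simp⟩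
    · intro a _ b _ h
      exact congrArg Prod.fst h
    · intro z hz
      rw [mem_filter] at hz
      have : β - z.1 = z.2 := by rw [← hz.2]; abel
      exact ⟨z.1, by rw [mem_filter, this]; exact ⟨mem_univ _, hz.1⟩, by rw [this]⟩
  rw [sum_hyperplane_merge hij (fun a b => if (a, b) ∈ E then (1 : ℝ) else 0) f]
  have hL : ∑ α : ι → ZMod Q with ∑ l, α l = 0,
      (∑ a, if (a, α i - a) ∈ E then (1 : ℝ) else 0) * (if α j = 0 then 1 else 0) *
        ∏ l ∈ (univ.erase j).erase i, f l (α l)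
      = ∑ α : ι → ZMod Q with ∑ l, α l = 0, ∏ l, G l (α l) := by
    refine sum_congr rfl fun α _ => ?_
    rw [prod_eq_mul_mul_prod_erase_erase hij, hcount, hGi, hGj]
    congr 1
    exact prod_congr rfl fun l hl => (hGl l hl _).symm
  rw [hL]
  refine hFL.trans ?_
  rw [prod_eq_mul_mul_prod_erase_erase hij]
  have hj1 : √((q' j : ℝ) * ∑ a, G j a ^ 2) = 1 := by
    rw [hq'l j hij.symm, hqj]
    simp [hGj]
  rw [hj1, mul_one, hq'i]
  refine mul_le_mul ?_ ?_ (prod_nonneg fun _ _ => Real.sqrt_nonneg _) (Real.sqrt_nonneg _)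
  · refine Real.sqrt_le_sqrt ?_
    gcongr
    simp only [hGi]
    exact sum_card_sq_le E _ hc
  · refine prod_le_prod (fun l _ => Real.sqrt_nonneg _) fun l hl => ?_
    have hl' := hl
    rw [mem_erase, mem_erase] at hl'
    rw [hq'l l hl'.1]
    simp only [hGl l hl]
    exact hC l hl'.1 hl'.2.1

/-- How the orders of two entries of a tuple with sum zero relate to the orders of the others. -/
theorem addOrderOf_pair_structure (hQ : Squarefree Q) {a b : ZMod Q} {R : ℕ}
    (hR : R • (a + b) = 0) :
    ∃ x : ℕ, addOrderOf a = x * (addOrderOf a).gcd R ∧ addOrderOf b = x * (addOrderOf b).gcd R ∧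
      x.Coprime R ∧ Nat.lcm ((addOrderOf a).gcd R) ((addOrderOf b).gcd R) • (a + b) = 0 := by
  have ha := addOrderOf_pos_zmod a
  have hb := addOrderOf_pos_zmod b
  -- `R • a` and `R • b` are negatives of each other, so the parts of the two orders outside `R`
  -- coincide; this common part is `x`.
  have e : addOrderOf (R • a) = addOrderOf (R • b) := by
    rw [smul_add, add_eq_zero_iff_eq_neg] at hR
    rw [hR, addOrderOf_neg]
  have ea : addOrderOf (R • a) = addOrderOf a / (addOrderOf a).gcd R :=
    addOrderOf_nsmul a
  have eb : addOrderOf (R • b) = addOrderOf b / (addOrderOf b).gcd R :=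
    addOrderOf_nsmul b
  set x := addOrderOf a / (addOrderOf a).gcd R with hx
  have hxa : addOrderOf a = x * (addOrderOf a).gcd R :=
    (Nat.div_mul_cancel (Nat.gcd_dvd_left _ _)).symm
  have hxb : addOrderOf b = x * (addOrderOf b).gcd R := by
    rw [ea, eb] at e
    rw [e]
    exact (Nat.div_mul_cancel (Nat.gcd_dvd_left _ _)).symm
  have hsq : Squarefree (addOrderOf a) := hQ.squarefree_of_dvd (addOrderOf_dvd_modulus a)
  -- The order of `a` is squarefree, so `x` is coprime to its cofactor gcd(ord a, R), which any
  -- common divisor of `x` and `R` divides.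
  have hcop : x.Coprime R := by
    have h1 : x.Coprime ((addOrderOf a).gcd R) := by
      rw [hxa] at hsq
      exact Nat.coprime_of_squarefree_mul hsq
    have h2 : x.gcd R ∣ (addOrderOf a).gcd R :=
      Nat.gcd_dvd_gcd_of_dvd_left _ ⟨_, hxa⟩
    exact Nat.eq_one_of_dvd_coprimes h1 (Nat.gcd_dvd_left _ _) h2
  refine ⟨x, hxa, hxb, hcop, ?_⟩
  rw [← addOrderOf_dvd_iff_nsmul_eq_zero]
  -- The order of `a + b` divides both `R` and x·lcm(u, v), where u and v are the gcds with `R`;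
  -- being coprime to `x`, it divides the lcm.
  have h1 : addOrderOf (a + b) ∣ R := addOrderOf_dvd_of_nsmul_eq_zero hR
  have h2 : addOrderOf (a + b) ∣ x * Nat.lcm ((addOrderOf a).gcd R) ((addOrderOf b).gcd R) := by
    rw [addOrderOf_dvd_iff_nsmul_eq_zero, smul_add]
    have h3 : addOrderOf a ∣ x * Nat.lcm ((addOrderOf a).gcd R) ((addOrderOf b).gcd R) := by
      nth_rewrite 1 [hxa]
      exact Nat.mul_dvd_mul_left _ (Nat.dvd_lcm_left _ _)
    have h4 : addOrderOf b ∣ x * Nat.lcm ((addOrderOf a).gcd R) ((addOrderOf b).gcd R) := by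
      nth_rewrite 1 [hxb]
      exact Nat.mul_dvd_mul_left _ (Nat.dvd_lcm_right _ _)
    rw [addOrderOf_dvd_iff_nsmul_eq_zero.1 h3, addOrderOf_dvd_iff_nsmul_eq_zero.1 h4, add_zero]
  exact (Nat.Coprime.coprime_dvd_left h1 hcop.symm).dvd_of_dvd_mul_left h2

end PairSums

/-! ### Sums over tuples with two distinguished entries and fixed other orders. -/

section PairBound

set_option linter.unusedSectionVars false

variable {ι : Type*} [Fintype ι] [DecidableEq ι] {Q : ℕ} [NeZero Q]

/-- The orders of the entries of `α` other than those with indices `i` and `j`. -/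
noncomputable def restOrders (i j : ι) (α : ι → ZMod Q) (l : ι) : ℕ :=
  if l = i ∨ l = j then 1 else addOrderOf (α l)

theorem restOrders_dvd (i j : ι) (α : ι → ZMod Q) (l : ι) : restOrders i j α l ∣ Q := by
  unfold restOrders
  split_ifs
  · exact one_dvd _
  · exact addOrderOf_dvd_modulus _

theorem lcm_restOrders_nsmul {i j : ι} (hij : i ≠ j) {α : ι → ZMod Q} (hα : ∑ l, α l = 0) :
    (univ.lcm (restOrders i j α)) • (α i + α j) = 0 := by
  have hadd : α i + α j = -∑ l ∈ (univ.erase j).erase i, α l := by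
    rw [eq_neg_iff_add_eq_zero, ← hα, ← Finset.add_sum_erase univ _ (mem_univ j),
      ← Finset.add_sum_erase (univ.erase j) _ (mem_erase.2 ⟨hij, mem_univ i⟩)]
    abel
  rw [hadd, smul_neg, smul_sum, neg_eq_zero]
  refine sum_eq_zero fun l hl => ?_
  rw [mem_erase, mem_erase] at hl
  rw [← addOrderOf_dvd_iff_nsmul_eq_zero]
  refine dvd_trans ?_ (dvd_lcm (mem_univ l))
  rw [restOrders, if_neg (by tauto)]

/-- Common frame for the two cases below: the orders of the other entries are fixed, the
distinguished pair lies in `E`, and its weight is replaced by the uniform bound `w`, so that only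
|E| and the fibre bound `c` are still to be estimated. -/
theorem sum_fiber_le (hQ : Squarefree Q) {B : Finset ι} {i j : ι} (hij : i ≠ j) (q : ι → ℕ)
    {M : ℕ} (hM : M ∣ univ.lcm q) (E : Finset (ZMod Q × ZMod Q))
    (hE : ∀ z ∈ E, M • (z.1 + z.2) = 0) {c : ℝ}
    (hc : ∀ β, ((E.filter fun z => z.1 + z.2 = β).card : ℝ) ≤ c)
    (f : ι → ZMod Q → ℝ) (hf : ∀ l a, 0 ≤ f l a) (A : ι → ℝ)
    (hfA : ∀ l ∈ B, ∀ q, q ∣ Q → 1 < q → ∑ a with addOrderOf a = q, f l a ^ 2 ≤ q * A l)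
    {w : ℝ} (hw : 0 ≤ w) (T : Finset (ι → ZMod Q)) (hTB : T ⊆ suppTuples Q B)
    (hTq : ∀ α ∈ T, restOrders i j α = q) (hTE : ∀ α ∈ T, (α i, α j) ∈ E)
    (hTw : ∀ α ∈ T, 1 / ((addOrderOf (α i)).totient : ℝ) *
      (1 / ((addOrderOf (α j)).totient : ℝ)) ≤ w) :
    ∑ α ∈ T, 1 / ((addOrderOf (α i)).totient : ℝ) * (1 / ((addOrderOf (α j)).totient : ℝ)) *
        ∏ l ∈ (B.erase j).erase i, f l (α l) / (addOrderOf (α l)).totient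
      ≤ w * √(M * (c * E.card)) * (((univ.lcm q).divisors.card : ℝ) ^ Fintype.card ι /
          ((univ.lcm q : ℕ) : ℝ)) * ∏ l ∈ (B.erase j).erase i, √(A l) := by
  have hPA : 0 ≤ ∏ l ∈ (B.erase j).erase i, √(A l) := prod_nonneg fun i _ => Real.sqrt_nonneg _
  rcases T.eq_empty_or_nonempty with rfl | ⟨α₀, h₀⟩
  · rw [sum_empty]; positivity
  have h₀q := hTq α₀ h₀
  have h₀B := hTB h₀
  rw [suppTuples, mem_filter] at h₀B
  obtain ⟨-, h₀s, h₀B⟩ := h₀B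
  have hqQ : ∀ l, q l ∣ Q := fun l => by rw [← h₀q]; exact restOrders_dvd i j α₀ l
  have hqi : q i = 1 := by rw [← h₀q]; simp [restOrders]
  have hqj : q j = 1 := by rw [← h₀q]; simp [restOrders]
  have hql : ∀ l, l ≠ i → l ≠ j → q l = addOrderOf (α₀ l) := fun l h1 h2 => by
    rw [← h₀q, restOrders, if_neg (by tauto)]
  have hLQ : univ.lcm q ∣ Q := Finset.lcm_dvd fun i _ => hqQ i
  have hL0 : univ.lcm q ≠ 0 := ne_zero_of_dvd_ne_zero (NeZero.ne Q) hLQ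
  have hLpos : (0 : ℝ) < ((univ.lcm q : ℕ) : ℝ) := by exact_mod_cast Nat.pos_of_ne_zero hL0
  have hτ : (1 : ℝ) ≤ (univ.lcm q).divisors.card := by
    exact_mod_cast card_pos.2 ⟨1, Nat.one_mem_divisors.2 hL0⟩
  have hqB' : ∀ l ∉ B, q l = 1 := by
    intro l hl
    by_cases h1 : l = i
    · rw [h1, hqi]
    by_cases h2 : l = j
    · rw [h2, hqj]
    rw [hql l h1 h2]
    have : α₀ l = 0 := by
      by_contra h
      exact hl ((h₀B l).1 h)
    simp [this]
  have hqB : ∀ l ∈ B, l ≠ i → l ≠ j → 1 < q l := by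
    intro l hl h1 h2
    rw [hql l h1 h2]
    have h3 := addOrderOf_pos_zmod (α₀ l)
    have h4 : addOrderOf (α₀ l) ≠ 1 := fun h => (h₀B l).2 hl (AddMonoid.addOrderOf_eq_one_iff.1 h)
    omega
  set G : ι → ZMod Q → ℝ := fun l a =>
    if l ∈ B then (if addOrderOf a = q l then f l a / (addOrderOf a).totient else 0)
    else (if a = 0 then 1 else 0) with hG
  have hG0 : ∀ l a, 0 ≤ G l a := by
    intro l a
    rw [hG]
    dsimp only
    split_ifs
    exacts [div_nonneg (hf l a) (Nat.cast_nonneg _), le_rfl, zero_le_one, le_rfl]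
  have hFL := fundamental_lemma_pair hQ hij q hqQ hqi hqj hM E hE hc G hG0 (by
    intro l h1 h2 a h
    rw [hG] at h
    dsimp only at h
    split_ifs at h with h3 h4 h5
    · exact h4
    · exact absurd rfl h
    · rw [h5, hqB' l h3, addOrderOf_zero]
    · exact absurd rfl h)
    (fun l => ((univ.lcm q).divisors.card : ℝ) * (if l ∈ B then √(A l) else 1)) (by
    intro l h1 h2
    by_cases hl : l ∈ B
    · simp only [hG, if_pos hl]
      refine (sqrt_mul_sum_sq_div_totient_le (hqQ l)
        (hfA l hl (q l) (hqQ l) (hqB l hl h1 h2))).trans ?_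
      gcongr
      exact dvd_lcm (mem_univ l)
    · simp only [hG, if_neg hl, hqB' l hl]
      simpa using hτ)
  have hprod : ∏ l ∈ (univ.erase j).erase i,
      (((univ.lcm q).divisors.card : ℝ) * (if l ∈ B then √(A l) else 1))
      ≤ ((univ.lcm q).divisors.card : ℝ) ^ Fintype.card ι *
        ∏ l ∈ (B.erase j).erase i, √(A l) := by
    rw [prod_mul_distrib, prod_const]
    have e : ∏ l ∈ (univ.erase j).erase i, (if l ∈ B then √(A l) else 1)
        = ∏ l ∈ (B.erase j).erase i, √(A l) := by
      rw [← Finset.prod_filter]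
      congr 1
      ext l
      simp only [mem_filter, mem_erase, mem_univ, and_true]
      tauto
    rw [e]
    gcongr
    exact card_le_univ _
  have hsum : ∑ α ∈ T, 1 / ((addOrderOf (α i)).totient : ℝ) *
        (1 / ((addOrderOf (α j)).totient : ℝ)) *
        ∏ l ∈ (B.erase j).erase i, f l (α l) / (addOrderOf (α l)).totient
      ≤ w * ∑ α : ι → ZMod Q with ∑ l, α l = 0,
        (if (α i, α j) ∈ E then 1 else 0) * ∏ l ∈ (univ.erase j).erase i, G l (α l) := by
    rw [mul_sum]
    have hsub : T ⊆ univ.filter fun α : ι → ZMod Q => ∑ i, α i = 0 := by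
      intro α hα
      have := hTB hα
      simp only [suppTuples, mem_filter, mem_univ, true_and] at this ⊢
      exact this.1
    refine le_trans (sum_le_sum fun α hα => ?_) (sum_le_sum_of_subset_of_nonneg hsub fun α _ _ =>
      mul_nonneg hw (mul_nonneg (by split_ifs <;> norm_num) (prod_nonneg fun l _ => hG0 l _)))
    have hα2 := hTB hα
    simp only [suppTuples, mem_filter, mem_univ, true_and] at hα2
    rw [if_pos (hTE α hα), one_mul]
    have e : ∏ l ∈ (univ.erase j).erase i, G l (α l)
        = ∏ l ∈ (B.erase j).erase i, f l (α l) / (addOrderOf (α l)).totient := by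
      symm
      refine Finset.prod_subset_one_on_sdiff ?_ ?_ ?_
      · exact erase_subset_erase _ (erase_subset_erase _ (subset_univ _))
      · intro l hl
        simp only [mem_sdiff, mem_erase, mem_univ, and_true] at hl
        have hlB : l ∉ B := by tauto
        have : α l = 0 := by
          by_contra h
          exact hlB ((hα2.2 l).1 h)
        rw [hG]
        dsimp only
        rw [if_neg hlB, if_pos this]
      · intro l hl
        rw [mem_erase, mem_erase] at hl
        have : addOrderOf (α l) = q l := by
          rw [← hTq α hα, restOrders, if_neg (by tauto)]
        rw [hG]
        dsimp only
        rw [if_pos hl.2.2, if_pos this]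
    rw [e]
    refine mul_le_mul_of_nonneg_right (hTw α hα) (prod_nonneg fun l _ => ?_)
    exact div_nonneg (hf l _) (Nat.cast_nonneg _)
  have hFL2 : ∑ α : ι → ZMod Q with ∑ l, α l = 0,
        (if (α i, α j) ∈ E then 1 else 0) * ∏ l ∈ (univ.erase j).erase i, G l (α l)
      ≤ √(M * (c * E.card)) * (((univ.lcm q).divisors.card : ℝ) ^ Fintype.card ι *
        ∏ l ∈ (B.erase j).erase i, √(A l)) / ((univ.lcm q : ℕ) : ℝ) := by
    rw [le_div_iff₀ hLpos, mul_comm]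
    refine hFL.trans ?_
    gcongr
  calc _ ≤ _ := hsum
    _ ≤ w * _ := mul_le_mul_of_nonneg_left hFL2 hw
    _ = _ := by ring

theorem one_div_totient_mul_le {x u v : ℕ} (hx : 0 < x) (hu : 0 < u) (hv : 0 < v)
    (hxu : x.Coprime u) (hxv : x.Coprime v) :
    1 / ((x * u).totient : ℝ) * (1 / ((x * v).totient : ℝ)) ≤
      (x.divisors.card : ℝ) ^ 2 * (u.divisors.card * v.divisors.card) / (x ^ 2 * (u * v)) := by
  have key : ∀ n : ℕ, 0 < n → 1 / (n.totient : ℝ) ≤ n.divisors.card / n := by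
    intro n hn
    have h1 := div_totient_le n
    have hn' : (0 : ℝ) < n := by exact_mod_cast hn
    rw [le_div_iff₀ hn', one_div_mul_eq_div]
    exact h1
  calc _ ≤ (((x * u).divisors.card : ℝ) / (x * u : ℕ)) * (((x * v).divisors.card : ℝ) / (x * v : ℕ)) := by
        exact mul_le_mul (key _ (by positivity)) (key _ (by positivity)) (by positivity)
          (by positivity)
    _ = _ := by
        rw [Nat.Coprime.card_divisors_mul hxu, Nat.Coprime.card_divisors_mul hxv]
        push_cast
        field_simp

/-- Two pairs with the same sum have opposite differences in the two entries, so the difference of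
the first entries is killed by x u and x v, hence by x·gcd(u, v). -/
theorem card_fiber_le {x u v : ℕ} (hx : 0 < x) (hu : 0 < u) (hxu : x * u ∣ Q)
    {H : ℝ} (hH : 0 < H) (S : Finset (ZMod Q × ZMod Q)) (β : ZMod Q)
    (hS : ∀ z ∈ S, IsClosePair x u v H z ∧ z.1 + z.2 = β) :
    (S.card : ℝ) ≤ 1 + 2 * (x * u.gcd v) / H := by
  classical
  have hg : 0 < u.gcd v := Nat.gcd_pos_of_pos_left _ hu
  have h1 := card_close_le (d := x * u.gcd v) (by positivity)
    ((Nat.mul_dvd_mul_left x (Nat.gcd_dvd_left u v)).trans hxu) hH (S.image Prod.fst) (by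
      intro a ha
      obtain ⟨z, hz, rfl⟩ := mem_image.1 ha
      exact (hS z hz).1.2.2.2.2.2.2.1) (by
      intro a ha b hb
      obtain ⟨z, hz, rfl⟩ := mem_image.1 ha
      obtain ⟨w, hw, rfl⟩ := mem_image.1 hb
      obtain ⟨⟨z1, z2, -⟩, z3⟩ := hS z hz
      obtain ⟨⟨w1, w2, -⟩, w3⟩ := hS w hw
      rw [← addOrderOf_dvd_iff_nsmul_eq_zero, ← Nat.gcd_mul_left]
      refine Nat.dvd_gcd ?_ ?_
      · rw [addOrderOf_dvd_iff_nsmul_eq_zero, smul_sub, z1, w1, sub_zero]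
      · have : z.1 - w.1 = w.2 - z.2 := by
          rw [sub_eq_sub_iff_add_eq_add, z3, add_comm, w3]
        rw [this, addOrderOf_dvd_iff_nsmul_eq_zero, smul_sub, z2, w2, sub_zero])
  rw [Finset.card_image_of_injOn] at h1
  · push_cast at h1
    exact h1
  · intro z hz w hw hzw
    have h2 : z.1 + z.2 = w.1 + w.2 := (hS z hz).2.trans (hS w hw).2.symm
    rw [hzw] at h2
    exact Prod.ext hzw (add_left_cancel h2)

end PairBound

/-! ### Pairs of close frequencies: fixed `x` and dyadic ranges of `x`. -/

section PairBound

set_option linter.unusedSectionVars false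

variable {ι : Type*} [Fintype ι] [DecidableEq ι] {Q : ℕ} [NeZero Q]

theorem mul_chain_le {w S b c F P : ℝ} (hw : 0 ≤ w) (hF : 0 ≤ F) (hP : 0 ≤ P) (hS : S ≤ b)
    (hwb : w * b ≤ c) : w * S * F * P ≤ c * F * P :=
  mul_le_mul_of_nonneg_right (mul_le_mul_of_nonneg_right
    ((mul_le_mul_of_nonneg_left hS hw).trans hwb) hF) hP

/-- Both `D ≤ H` and `D ≤ x·gcd(u, v)` bound the fibre size by 3x·gcd(u, v)/D; the gcd then combines
with the lcm to u v, and D stays in the denominator. -/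
theorem sqrt_pairs_separated_le {x u v : ℕ} (hx : 0 < x) (hu : 0 < u) (hv : 0 < v) {H D n : ℝ}
    (hn0 : 0 ≤ n) (hD : 1 ≤ D) (hDH : D ≤ H) (hDx : D ≤ x * u.gcd v) (hn : n ≤ 12 * (x * u * v) / H ^ 2) :
    √((Nat.lcm u v : ℕ) * ((1 + 2 * (x * u.gcd v) / H) * n)) ≤ 6 * (x * (u * v)) / (H * √D) := by
  have hH : 0 < H := by linarith
  have hD0 : 0 < D := by linarith
  have hg : 0 < u.gcd v := Nat.gcd_pos_of_pos_left _ hu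
  have hgl : (u.gcd v : ℝ) * (u.lcm v : ℕ) = u * v := by exact_mod_cast Nat.gcd_mul_lcm u v
  apply Real.sqrt_le_iff.2
  refine ⟨by positivity, ?_⟩
  have h1 : 1 + 2 * ((x : ℝ) * u.gcd v) / H ≤ 3 * (x * u.gcd v) / D := by
    have a1 : 1 ≤ ((x : ℝ) * u.gcd v) / D := by rwa [le_div_iff₀ hD0, one_mul]
    have a2 : 2 * ((x : ℝ) * u.gcd v) / H ≤ 2 * (x * u.gcd v) / D := by gcongr
    calc _ ≤ ((x : ℝ) * u.gcd v) / D + 2 * (x * u.gcd v) / D := add_le_add a1 a2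
      _ = _ := by ring
  calc _ ≤ (Nat.lcm u v : ℝ) * ((3 * (x * u.gcd v) / D) * (12 * (x * u * v) / H ^ 2)) := by
        gcongr
    _ = 36 * x ^ 2 * ((u.gcd v : ℝ) * (u.lcm v : ℕ)) * (u * v) / (D * H ^ 2) := by
        field_simp; ring
    _ = _ := by
        rw [hgl, div_pow, mul_pow H, Real.sq_sqrt hD0.le]
        ring

/-- The saving √D comes from `D ≤ 2X·gcd(u, v)`, the gcd combining with the lcm to u v as for fixed
x. -/
theorem sqrt_pairs_dyadic_le {X x u v : ℕ} (hX : 0 < X) (hx : x < 2 * X) (hu : 0 < u) (hv : 0 < v)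
    {H D n τ : ℝ} (hτ : 1 ≤ τ) (hD : 1 ≤ D) (hH : 0 < H) (hDx : D ≤ x * u.gcd v)
    (hn : n ≤ τ * (16 * (X ^ 2 * u * v) / H ^ 2)) :
    √((Nat.lcm u v : ℕ) * ((3 * X) * n)) ≤ 10 * τ * (X ^ 2 * (u * v)) / (H * √D) := by
  have hD0 : 0 < D := by linarith
  have hg : 0 < u.gcd v := Nat.gcd_pos_of_pos_left _ hu
  have hgl : (u.gcd v : ℝ) * (u.lcm v : ℕ) = u * v := by exact_mod_cast Nat.gcd_mul_lcm u v
  have hXg : D ≤ 2 * X * u.gcd v := by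
    refine hDx.trans ?_
    have : (x : ℝ) ≤ 2 * X := by exact_mod_cast hx.le
    gcongr
  apply Real.sqrt_le_iff.2
  refine ⟨by positivity, ?_⟩
  have hX' : (0 : ℝ) < X := by exact_mod_cast hX
  calc _ ≤ (Nat.lcm u v : ℝ) * ((3 * X) * (τ * (16 * (X ^ 2 * u * v) / H ^ 2))) := by
        gcongr
    _ = 48 * τ * X ^ 3 * (u.lcm v : ℕ) * (u * v) * D / (D * H ^ 2) := by
        field_simp; ring
    _ ≤ 48 * τ * X ^ 3 * (u.lcm v : ℕ) * (u * v) * (2 * X * u.gcd v) / (D * H ^ 2) := by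
        gcongr
    _ = 96 * τ * X ^ 4 * ((u.gcd v : ℝ) * (u.lcm v : ℕ)) * (u * v) / (D * H ^ 2) := by ring
    _ = (96 * τ) * (X ^ 4 * (u * v) ^ 2 / (D * H ^ 2)) := by rw [hgl]; ring
    _ ≤ (100 * τ ^ 2) * (X ^ 4 * (u * v) ^ 2 / (D * H ^ 2)) := by
        gcongr
        · norm_num
        · nlinarith
    _ = _ := by
        rw [div_pow, mul_pow H, Real.sq_sqrt hD0.le]
        ring

/-- The tuples supported on `B` whose entries at `i` and `j` are close to an integer, do not cancel
each other, and have orders with a large common divisor. -/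
noncomputable def closeTuples (B : Finset ι) (i j : ι) (H D : ℝ) : Finset (ι → ZMod Q) :=
  (suppTuples Q B).filter fun α => zabs (α i) * H ≤ Q ∧ zabs (α j) * H ≤ Q ∧ α i + α j ≠ 0 ∧
    D ≤ (addOrderOf (α i)).gcd (addOrderOf (α j))

/-- Here u and v are the parts of the two orders shared with the remaining orders, and x is their
common remaining part; the large common divisor of the two orders is x·gcd(u, v). -/
theorem closeTuples_structure (hQ : Squarefree Q) {B : Finset ι} {i j : ι} (hij : i ≠ j)
    (hi : i ∈ B) (hj : j ∈ B) {H D : ℝ} {α : ι → ZMod Q} (hα : α ∈ closeTuples B i j H D) :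
    ∃ x u v : ℕ, addOrderOf (α i) = x * u ∧ addOrderOf (α j) = x * v ∧
      u = (addOrderOf (α i)).gcd (univ.lcm (restOrders i j α)) ∧
      v = (addOrderOf (α j)).gcd (univ.lcm (restOrders i j α)) ∧
      0 < x ∧ 0 < u ∧ 0 < v ∧ x.Coprime u ∧ x.Coprime v ∧ u ∣ univ.lcm (restOrders i j α) ∧
      v ∣ univ.lcm (restOrders i j α) ∧ D ≤ x * u.gcd v ∧ IsClosePair x u v H (α i, α j) ∧
      Nat.lcm u v • (α i + α j) = 0 := by
  rw [closeTuples, mem_filter, suppTuples, mem_filter] at hα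
  obtain ⟨⟨-, hs, hB⟩, h1, h2, h3, h4⟩ := hα
  set R := univ.lcm (restOrders i j α) with hR
  obtain ⟨x, ha, hb, hc, hl⟩ := addOrderOf_pair_structure hQ (lcm_restOrders_nsmul hij hs)
  rw [← hR] at ha hb hc hl
  set u := (addOrderOf (α i)).gcd R with hu
  set v := (addOrderOf (α j)).gcd R with hv
  have hpa := addOrderOf_pos_zmod (α i)
  have hpb := addOrderOf_pos_zmod (α j)
  have hu0 : 0 < u := Nat.gcd_pos_of_pos_left _ hpa
  have hv0 : 0 < v := Nat.gcd_pos_of_pos_left _ hpb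
  have hx0 : 0 < x := by
    rcases Nat.eq_zero_or_pos x with h | h
    · rw [h, zero_mul] at ha; omega
    · exact h
  have huR : u ∣ R := Nat.gcd_dvd_right _ _
  have hvR : v ∣ R := Nat.gcd_dvd_right _ _
  refine ⟨x, u, v, ha, hb, rfl, rfl, hx0, hu0, hv0, hc.coprime_dvd_right huR,
    hc.coprime_dvd_right hvR, huR, hvR, ?_, ⟨?_, ?_, (hB i).2 hi, (hB j).2 hj, h3, ?_, h1, h2⟩, hl⟩
  · rw [ha, hb, Nat.gcd_mul_left] at h4
    exact_mod_cast h4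
  · rw [← ha]; exact addOrderOf_nsmul_eq_zero _
  · rw [← hb]; exact addOrderOf_nsmul_eq_zero _
  · have : u.lcm v ∣ u * v := Nat.lcm_dvd (dvd_mul_right _ _) (dvd_mul_left _ _)
    obtain ⟨t, ht⟩ := this
    rw [ht, mul_comm, mul_nsmul', hl, smul_zero]

/-- If one of u, v, x·gcd(u, v) reaches H, the count 12xuv/H² holds for a single x. Against the
weight of order 1/(x²uv) a factor 1/x is left, which makes the sum over x | Q affordable. -/
theorem sum_separated_fiber_le (hQ : Squarefree Q) {B : Finset ι} {i j : ι} (hij : i ≠ j)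
    {H D : ℝ} (hD : 1 ≤ D) (hDH : D ≤ H)
    (f : ι → ZMod Q → ℝ) (hf : ∀ l a, 0 ≤ f l a) (A : ι → ℝ)
    (hfA : ∀ l ∈ B, ∀ q, q ∣ Q → 1 < q → ∑ a with addOrderOf a = q, f l a ^ 2 ≤ q * A l)
    (q : ι → ℕ) {x u v : ℕ} (hu : u ∣ univ.lcm q) (hv : v ∣ univ.lcm q)
    (T : Finset (ι → ZMod Q)) (hTB : T ⊆ suppTuples Q B)
    (hTq : ∀ α ∈ T, restOrders i j α = q)
    (hT : ∀ α ∈ T, addOrderOf (α i) = x * u ∧ addOrderOf (α j) = x * v ∧ 0 < x ∧ 0 < u ∧ 0 < v ∧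
      x.Coprime u ∧ x.Coprime v ∧ D ≤ x * u.gcd v ∧ IsClosePair x u v H (α i, α j) ∧
      Nat.lcm u v • (α i + α j) = 0 ∧ (H ≤ u ∨ H ≤ v ∨ H ≤ x * u.gcd v)) :
    ∑ α ∈ T, 1 / ((addOrderOf (α i)).totient : ℝ) * (1 / ((addOrderOf (α j)).totient : ℝ)) *
        ∏ l ∈ (B.erase j).erase i, f l (α l) / (addOrderOf (α l)).totient
      ≤ ((univ.lcm q).divisors.card : ℝ) ^ (Fintype.card ι + 2) / ((univ.lcm q : ℕ) : ℝ) *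
        ((x.divisors.card : ℝ) ^ 2 / x) *
          (6 / (H * √D) * ∏ l ∈ (B.erase j).erase i, √(A l)) := by
  have hPA : 0 ≤ ∏ l ∈ (B.erase j).erase i, √(A l) := prod_nonneg fun i _ => Real.sqrt_nonneg _
  have hH : 0 < H := by linarith
  rcases T.eq_empty_or_nonempty with rfl | ⟨α₀, h₀⟩
  · rw [sum_empty]; positivity
  obtain ⟨ha, hb, hx0, hu0, hv0, hxu, hxv, hDx, -, -, hcase⟩ := hT α₀ h₀
  have hq := hTq α₀ h₀
  have hLQ : univ.lcm q ∣ Q := Finset.lcm_dvd fun l _ => by rw [← hq]; exact restOrders_dvd i j α₀ l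
  have hL0 : univ.lcm q ≠ 0 := ne_zero_of_dvd_ne_zero (NeZero.ne Q) hLQ
  classical
  set E : Finset (ZMod Q × ZMod Q) := univ.filter fun z =>
    IsClosePair x u v H z ∧ Nat.lcm u v • (z.1 + z.2) = 0 with hE
  have hEn := card_closePair_le hx0 hu0 hv0 (hD.trans hDH) hxu hxv hcase E
    (fun z hz => (mem_filter.1 hz).2.1)
  have hxuQ : x * u ∣ Q := ha ▸ addOrderOf_dvd_modulus _
  set w : ℝ := (x.divisors.card : ℝ) ^ 2 * (u.divisors.card * v.divisors.card) /
    (x ^ 2 * (u * v)) with hw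
  have hmain := sum_fiber_le hQ hij q (Nat.lcm_dvd hu hv) E (fun z hz => (mem_filter.1 hz).2.2)
    (c := 1 + 2 * (x * u.gcd v) / H) (by
      intro β
      refine card_fiber_le hx0 hu0 hxuQ hH _ β fun z hz => ?_
      rw [mem_filter, mem_filter] at hz
      exact ⟨hz.1.2.1, hz.2⟩) f hf A hfA (w := w) (by positivity) T hTB hTq (by
      intro α hα
      obtain ⟨-, -, -, -, -, -, -, -, h1, h2, -⟩ := hT α hα
      exact mem_filter.2 ⟨mem_univ _, h1, h2⟩) (by
      intro α hα
      obtain ⟨h1, h2, -⟩ := hT α hα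
      rw [h1, h2]
      exact one_div_totient_mul_le hx0 hu0 hv0 hxu hxv)
  have hsq := sqrt_pairs_separated_le hx0 hu0 hv0 (Nat.cast_nonneg _) hD hDH hDx hEn
  set τ : ℝ := ((univ.lcm q).divisors.card : ℝ) with hτ
  have hτu : (u.divisors.card : ℝ) ≤ τ := by
    rw [hτ]
    exact_mod_cast card_divisors_le_of_dvd hL0 hu
  have hτv : (v.divisors.card : ℝ) ≤ τ := by
    rw [hτ]
    exact_mod_cast card_divisors_le_of_dvd hL0 hv
  have hx' : (0 : ℝ) < x := by exact_mod_cast hx0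
  have hu' : (0 : ℝ) < u := by exact_mod_cast hu0
  have hv' : (0 : ℝ) < v := by exact_mod_cast hv0
  have hDs : 0 < √D := Real.sqrt_pos.2 (by linarith)
  have hww : w * (6 * (x * (u * v)) / (H * √D)) ≤ τ ^ 2 * ((x.divisors.card : ℝ) ^ 2 / x) *
      (6 / (H * √D)) := by
    calc _ = (x.divisors.card : ℝ) ^ 2 / x * (u.divisors.card * v.divisors.card) *
          (6 / (H * √D)) := by rw [hw]; field_simp
      _ ≤ (x.divisors.card : ℝ) ^ 2 / x * (τ * τ) * (6 / (H * √D)) := by gcongr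
      _ = _ := by ring
  refine hmain.trans ((mul_chain_le (by positivity) (by positivity) hPA hsq hww).trans ?_)
  exact le_of_eq (by ring)

-- If u, v and x·gcd(u, v) are all below H, the count for a single x is spoilt by the additive 1, so
-- x is averaged over a dyadic range by means of the divisor bound. All numbers involved are then
-- polynomially bounded in h, so `τ₀` applies, and the powers of X cancel.
set_option maxHeartbeats 400000 in
theorem sum_dyadic_fiber_le (hQ : Squarefree Q) {B : Finset ι} {i j : ι} (hij : i ≠ j)
    {H D h τ₀ : ℝ} (hD : 1 ≤ D) (hH : 1 ≤ H) (hHh : H ≤ h) (hτ₀ : 1 ≤ τ₀)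
    (hdiv : ∀ N : ℕ, 0 < N → (N : ℝ) ≤ 4 * h ^ 3 → (N.divisors.card : ℝ) ≤ τ₀)
    (f : ι → ZMod Q → ℝ) (hf : ∀ l a, 0 ≤ f l a) (A : ι → ℝ)
    (hfA : ∀ l ∈ B, ∀ q, q ∣ Q → 1 < q → ∑ a with addOrderOf a = q, f l a ^ 2 ≤ q * A l)
    (q : ι → ℕ) {X u v : ℕ} (hu : u ∣ univ.lcm q) (hv : v ∣ univ.lcm q)
    (T : Finset (ι → ZMod Q)) (hTB : T ⊆ suppTuples Q B)
    (hTq : ∀ α ∈ T, restOrders i j α = q)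
    (hT : ∀ α ∈ T, ∃ x, X ≤ x ∧ x < 2 * X ∧ addOrderOf (α i) = x * u ∧ addOrderOf (α j) = x * v ∧
      0 < x ∧ 0 < u ∧ 0 < v ∧ x.Coprime u ∧ x.Coprime v ∧ D ≤ x * u.gcd v ∧
      IsClosePair x u v H (α i, α j) ∧
      Nat.lcm u v • (α i + α j) = 0 ∧ u < H ∧ v < H ∧ x * u.gcd v < H) :
    ∑ α ∈ T, 1 / ((addOrderOf (α i)).totient : ℝ) * (1 / ((addOrderOf (α j)).totient : ℝ)) *
        ∏ l ∈ (B.erase j).erase i, f l (α l) / (addOrderOf (α l)).totient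
      ≤ ((univ.lcm q).divisors.card : ℝ) ^ (Fintype.card ι + 2) / ((univ.lcm q : ℕ) : ℝ) *
          (10 * τ₀ ^ 3 / (H * √D) * ∏ l ∈ (B.erase j).erase i, √(A l)) := by
  have hPA : 0 ≤ ∏ l ∈ (B.erase j).erase i, √(A l) := prod_nonneg fun i _ => Real.sqrt_nonneg _
  have hH0 : 0 < H := by linarith
  rcases T.eq_empty_or_nonempty with rfl | ⟨α₀, h₀⟩
  · rw [sum_empty]; positivity
  obtain ⟨x, hXx, hxX, ha, hb, hx0, hu0, hv0, hxu, hxv, hDx, -, -, huH, hvH, hxH⟩ := hT α₀ h₀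
  have hX0 : 0 < X := by omega
  have hg0 : 0 < u.gcd v := Nat.gcd_pos_of_pos_left _ hu0
  have hq := hTq α₀ h₀
  have hLQ : univ.lcm q ∣ Q := Finset.lcm_dvd fun l _ => by rw [← hq]; exact restOrders_dvd i j α₀ l
  have hL0 : univ.lcm q ≠ 0 := ne_zero_of_dvd_ne_zero (NeZero.ne Q) hLQ
  have hlt : ∀ x : ℕ, (x : ℝ) * u.gcd v < H → (x : ℝ) < H := by
    intro x hx
    refine lt_of_le_of_lt ?_ hx
    have : (1 : ℝ) ≤ u.gcd v := by exact_mod_cast hg0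
    exact le_mul_of_one_le_right (Nat.cast_nonneg _) this
  have hXh : (X : ℝ) ≤ h := by
    have h1 : (X : ℝ) ≤ x := by exact_mod_cast hXx
    exact h1.trans ((hlt x hxH).le.trans hHh)
  have huh : (u : ℝ) ≤ h := huH.le.trans hHh
  have hvh : (v : ℝ) ≤ h := hvH.le.trans hHh
  classical
  set E : Finset (ZMod Q × ZMod Q) := univ.filter fun z =>
    ∃ x, X ≤ x ∧ x < 2 * X ∧ 0 < x ∧ addOrderOf z.1 = x * u ∧ IsClosePair x u v H z ∧
      x * u.gcd v < H ∧ Nat.lcm u v • (z.1 + z.2) = 0 with hE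
  have hEx : ∀ z ∈ E, X ≤ addOrderOf z.1 / u ∧ addOrderOf z.1 / u < 2 * X ∧
      0 < addOrderOf z.1 / u ∧ (addOrderOf z.1 / u) * u ∣ Q ∧
      IsClosePair (addOrderOf z.1 / u) u v H z ∧
      ((addOrderOf z.1 / u : ℕ) : ℝ) * u.gcd v < H := by
    intro z hz
    obtain ⟨-, x, h1, h2, h3, h4, h5, h6, h7⟩ := mem_filter.1 hz
    have : addOrderOf z.1 / u = x := by rw [h4, Nat.mul_div_cancel _ hu0]
    rw [this]
    exact ⟨h1, h2, h3, h4 ▸ addOrderOf_dvd_modulus _, h5, h6⟩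
  have hEn : (E.card : ℝ) ≤ τ₀ * (16 * (X ^ 2 * u * v) / H ^ 2) := by
    have := card_closeTriple_le hu0 hv0 hH (by linarith : 0 ≤ τ₀) (X := X) (by
      intro N hN hNX
      apply hdiv N hN
      have h1 : (N : ℝ) ≤ ((4 * X * u * v : ℕ) : ℝ) := by exact_mod_cast hNX
      refine h1.trans ?_
      push_cast
      have hh0 : 0 ≤ h := by linarith
      calc 4 * (X : ℝ) * u * v ≤ 4 * h * h * h := by gcongr
        _ = _ := by ring) (E.image fun z => (addOrderOf z.1 / u, z)) (by
      intro w hw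
      obtain ⟨z, hz, rfl⟩ := mem_image.1 hw
      obtain ⟨h1, h2, h3, h4, h5, h6⟩ := hEx z hz
      exact ⟨h3, h2, h5⟩)
    rwa [Finset.card_image_of_injective] at this
    intro z w hzw
    exact (Prod.mk.inj hzw).2
  -- For each of the X values of x the fibre has at most 1 + 2x·gcd(u, v)/H ≤ 3 elements.
  have hc : ∀ β, ((E.filter fun z => z.1 + z.2 = β).card : ℝ) ≤ 3 * X := by
    intro β
    have := card_le_card_mul_of_fiber (E.filter fun z => z.1 + z.2 = β) (Ico X (2 * X))
      (fun z => addOrderOf z.1 / u) (by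
        intro z hz
        obtain ⟨h1, h2, -⟩ := hEx z (mem_filter.1 hz).1
        exact mem_Ico.2 ⟨h1, h2⟩) 3 (by
        intro y _
        rcases ((E.filter fun z => z.1 + z.2 = β).filter fun z => addOrderOf z.1 / u = y).eq_empty_or_nonempty
          with he | ⟨w, hw⟩
        · rw [he]; simp
        rw [mem_filter, mem_filter] at hw
        obtain ⟨-, -, h3, h4, -, h6⟩ := hEx w hw.1.1
        rw [hw.2] at h3 h4 h6
        refine (card_fiber_le (v := v) h3 hu0 h4 hH0 _ β fun z hz => ?_).trans ?_
        · rw [mem_filter, mem_filter] at hz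
          obtain ⟨-, -, -, -, h5, -⟩ := hEx z hz.1.1
          rw [hz.2] at h5
          exact ⟨h5, hz.1.2⟩
        · have : 2 * ((y : ℝ) * u.gcd v) / H ≤ 2 := by
            rw [div_le_iff₀ hH0]
            linarith
          linarith)
    refine this.trans (le_of_eq ?_)
    rw [Nat.card_Ico]
    have : 2 * X - X = X := by omega
    rw [this]
    ring
  set w : ℝ := τ₀ ^ 2 * (u.divisors.card * v.divisors.card) /
    (X ^ 2 * (u * v)) with hw
  have hX' : (0 : ℝ) < X := by exact_mod_cast hX0
  have hu' : (0 : ℝ) < u := by exact_mod_cast hu0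
  have hv' : (0 : ℝ) < v := by exact_mod_cast hv0
  have hmain := sum_fiber_le hQ hij q (Nat.lcm_dvd hu hv) E (by
      intro z hz
      obtain ⟨-, x, h1, h2, h3, h4, h5, h6, h7⟩ := mem_filter.1 hz
      exact h7)
    hc f hf A hfA (w := w) (by positivity) T hTB hTq (by
      intro α hα
      obtain ⟨x, h1, h2, h3, -, h4, -, -, -, -, -, h5, h6, -, -, h7⟩ := hT α hα
      exact mem_filter.2 ⟨mem_univ _, x, h1, h2, h4, h3, h5, h7, h6⟩) (by
      intro α hα
      obtain ⟨x, h1, h2, h3, h3', h4, -, -, hxu, hxv, -, h5, h6, -, -, h7⟩ := hT α hα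
      rw [h3, h3']
      refine (one_div_totient_mul_le h4 hu0 hv0 hxu hxv).trans ?_
      have hxd : (x.divisors.card : ℝ) ≤ τ₀ := by
        apply hdiv x h4
        have a1 : (x : ℝ) ≤ h := (hlt x h7).le.trans hHh
        have a2 : 1 ≤ h := hH.trans hHh
        calc (x : ℝ) ≤ h := a1
          _ = h * 1 := (mul_one h).symm
          _ ≤ h * (4 * h ^ 2) := by
            gcongr
            nlinarith
          _ = _ := by ring
      have h1' : (X : ℝ) ≤ x := by exact_mod_cast h1
      rw [hw]
      gcongr)
  have hsq := sqrt_pairs_dyadic_le hX0 hxX hu0 hv0 hτ₀ hD hH0 hDx hEn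
  set τ : ℝ := ((univ.lcm q).divisors.card : ℝ) with hτ
  have hτu : (u.divisors.card : ℝ) ≤ τ := by
    rw [hτ]
    exact_mod_cast card_divisors_le_of_dvd hL0 hu
  have hτv : (v.divisors.card : ℝ) ≤ τ := by
    rw [hτ]
    exact_mod_cast card_divisors_le_of_dvd hL0 hv
  have hDs : 0 < √D := Real.sqrt_pos.2 (by linarith)
  have hww : w * (10 * τ₀ * (X ^ 2 * (u * v)) / (H * √D)) ≤ τ ^ 2 *
      (10 * τ₀ ^ 3 / (H * √D)) := by
    calc _ = (u.divisors.card * v.divisors.card) *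
          (10 * τ₀ ^ 3 / (H * √D)) := by rw [hw]; field_simp
      _ ≤ (τ * τ) * (10 * τ₀ ^ 3 / (H * √D)) := by gcongr
      _ = _ := by ring
  refine hmain.trans ((mul_chain_le (by positivity) (by positivity) hPA hsq hww).trans ?_)
  exact le_of_eq (by ring)

end PairBound

/-! ### All pairs of close frequencies with a large common divisor. -/

section UnpairedBound

set_option linter.unusedSectionVars false

variable {ι : Type*} [Fintype ι] [DecidableEq ι] {Q : ℕ} [NeZero Q]

/-- Tuples are grouped by the orders of the other entries and by (u, v, x) in the separated case, or
by (u, v) and the dyadic range of x otherwise. As u and v divide the lcm of the other orders,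
summing over them costs two more divisor functions. -/
theorem sum_closeTuples_le (hQ : Squarefree Q) {B : Finset ι} {i j : ι} (hij : i ≠ j)
    (hi : i ∈ B) (hj : j ∈ B) {H D h τ₀ : ℝ} (hD : 1 ≤ D) (hDH : D ≤ H) (hHh : H ≤ h)
    (hτ₀ : 1 ≤ τ₀)
    (hdiv : ∀ N : ℕ, 0 < N → (N : ℝ) ≤ 4 * h ^ 3 → (N.divisors.card : ℝ) ≤ τ₀)
    (f : ι → ZMod Q → ℝ) (hf : ∀ l a, 0 ≤ f l a) (A : ι → ℝ)
    (hfA : ∀ l ∈ B, ∀ q, q ∣ Q → 1 < q → ∑ a with addOrderOf a = q, f l a ^ 2 ≤ q * A l) :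
    ∑ α ∈ closeTuples B i j H D, 1 / ((addOrderOf (α i)).totient : ℝ) *
        (1 / ((addOrderOf (α j)).totient : ℝ)) *
        ∏ l ∈ (B.erase j).erase i, f l (α l) / (addOrderOf (α l)).totient
      ≤ (6 * divSum (2 * Fintype.card ι + 4) Q ^ 2 +
          10 * τ₀ ^ 3 * (Nat.log 2 ⌊H⌋₊ + 1) * divSum (2 * Fintype.card ι + 4) Q) / (H * √D) *
          ∏ l ∈ (B.erase j).erase i, √(A l) := by
  classical
  set K := divSum (2 * Fintype.card ι + 4) Q with hK
  have hK0 : 0 ≤ K := divSum_nonneg _ _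
  have hQ0 : Q ≠ 0 := NeZero.ne Q
  have hPA : 0 ≤ ∏ l ∈ (B.erase j).erase i, √(A l) := prod_nonneg fun i _ => Real.sqrt_nonneg _
  set PA := ∏ l ∈ (B.erase j).erase i, √(A l) with hPAdef
  have hH0 : 0 < H := by linarith
  set Rr : (ι → ZMod Q) → ℕ := fun α => univ.lcm (restOrders i j α) with hRr
  set uu : (ι → ZMod Q) → ℕ := fun α => (addOrderOf (α i)).gcd (Rr α) with huu
  set vv : (ι → ZMod Q) → ℕ := fun α => (addOrderOf (α j)).gcd (Rr α) with hvv
  set xx : (ι → ZMod Q) → ℕ := fun α => addOrderOf (α i) / uu α with hxx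
  have hst : ∀ α ∈ closeTuples B i j H D, addOrderOf (α i) = xx α * uu α ∧
      addOrderOf (α j) = xx α * vv α ∧ 0 < xx α ∧ 0 < uu α ∧ 0 < vv α ∧
      (xx α).Coprime (uu α) ∧ (xx α).Coprime (vv α) ∧ uu α ∣ Rr α ∧ vv α ∣ Rr α ∧
      D ≤ xx α * (uu α).gcd (vv α) ∧ IsClosePair (xx α) (uu α) (vv α) H (α i, α j) ∧
      Nat.lcm (uu α) (vv α) • (α i + α j) = 0 := by
    intro α hα
    obtain ⟨x, u, v, h1, h2, h3, h4, h5, h6, h7, h8, h9, h10, h11, h12, h13, h14⟩ :=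
      closeTuples_structure hQ hij hi hj hα
    have e1 : uu α = u := h3.symm
    have e2 : vv α = v := h4.symm
    have e3 : xx α = x := by
      simp only [hxx, e1]
      rw [h1, Nat.mul_div_cancel _ h6]
    rw [e1, e2, e3]
    exact ⟨h1, h2, h5, h6, h7, h8, h9, h10, h11, h12, h13, h14⟩
  have hRQ : ∀ q ∈ Fintype.piFinset (fun _ : ι => Q.divisors), univ.lcm q ∣ Q := by
    intro q hq
    rw [Fintype.mem_piFinset] at hq
    exact Finset.lcm_dvd fun l _ => (Nat.mem_divisors.1 (hq l)).1
  have hrest : ∀ α : ι → ZMod Q, restOrders i j α ∈ Fintype.piFinset (fun _ : ι => Q.divisors) := by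
    intro α
    rw [Fintype.mem_piFinset]
    exact fun l => Nat.mem_divisors.2 ⟨restOrders_dvd i j α l, hQ0⟩
  have hR0 : ∀ α : ι → ZMod Q, Rr α ≠ 0 := fun α => ne_zero_of_dvd_ne_zero hQ0 (hRQ _ (hrest α))
  have hclB : closeTuples B i j H D ⊆ suppTuples Q B := filter_subset _ _
  set F : (ι → ZMod Q) → ℝ := fun α => 1 / ((addOrderOf (α i)).totient : ℝ) *
        (1 / ((addOrderOf (α j)).totient : ℝ)) *
        ∏ l ∈ (B.erase j).erase i, f l (α l) / (addOrderOf (α l)).totient with hF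
  set cond : (ι → ZMod Q) → Prop := fun α =>
    H ≤ uu α ∨ H ≤ vv α ∨ H ≤ xx α * (uu α).gcd (vv α) with hcond
  have hsumR : ∑ q ∈ Fintype.piFinset (fun _ : ι => Q.divisors),
      ((univ.lcm q).divisors.card : ℝ) ^ 2 * (((univ.lcm q).divisors.card : ℝ) ^
        (Fintype.card ι + 2) / ((univ.lcm q : ℕ) : ℝ)) ≤ K := by
    have := sum_lcm_le (ι := ι) hQ0 (Fintype.card ι + 4)
    rw [show Fintype.card ι + 4 + Fintype.card ι = 2 * Fintype.card ι + 4 by ring] at this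
    refine le_trans (le_of_eq (sum_congr rfl fun q _ => ?_)) this
    ring
  have hP : ∑ α ∈ (closeTuples B i j H D).filter cond, F α ≤ 6 * K ^ 2 / (H * √D) * PA := by
    set J := (Fintype.piFinset (fun _ : ι => Q.divisors)).sigma fun q =>
      (univ.lcm q).divisors ×ˢ (univ.lcm q).divisors ×ˢ Q.divisors with hJ
    set key : (ι → ZMod Q) → (Σ _ : ι → ℕ, ℕ × ℕ × ℕ) := fun α =>
      ⟨restOrders i j α, (uu α, vv α, xx α)⟩ with hkey
    have hmap : ∀ α ∈ (closeTuples B i j H D).filter cond, key α ∈ J := by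
      intro α hα
      obtain ⟨h1, h2, h3, h4, h5, h6, h7, h8, h9, -⟩ := hst α (mem_filter.1 hα).1
      rw [hJ, mem_sigma]
      refine ⟨hrest α, ?_⟩
      rw [mem_product, mem_product, Nat.mem_divisors, Nat.mem_divisors, Nat.mem_divisors]
      exact ⟨⟨h8, hR0 α⟩, ⟨h9, hR0 α⟩, (Dvd.intro _ h1.symm).trans (addOrderOf_dvd_modulus _), hQ0⟩
    rw [← Finset.sum_fiberwise_of_maps_to hmap, hJ, sum_sigma]
    calc _ ≤ ∑ q ∈ Fintype.piFinset (fun _ : ι => Q.divisors),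
          ∑ y ∈ (univ.lcm q).divisors ×ˢ (univ.lcm q).divisors ×ˢ Q.divisors,
          ((univ.lcm q).divisors.card : ℝ) ^ (Fintype.card ι + 2) / ((univ.lcm q : ℕ) : ℝ) *
            ((y.2.2.divisors.card : ℝ) ^ 2 / y.2.2) * (6 / (H * √D) * PA) := by
          refine sum_le_sum fun q _ => sum_le_sum fun y hy => ?_
          rw [mem_product, mem_product, Nat.mem_divisors, Nat.mem_divisors] at hy
          refine sum_separated_fiber_le hQ hij hD hDH f hf A hfA q hy.1.1 hy.2.1.1 _
            ((filter_subset _ _).trans ((filter_subset _ _).trans hclB)) ?_ ?_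
          · intro α hα
            have := (mem_filter.1 hα).2
            exact congrArg Sigma.fst this
          · intro α hα
            obtain ⟨hα1, hα2⟩ := mem_filter.1 hα
            obtain ⟨hα0, hαc⟩ := mem_filter.1 hα1
            have e : (uu α, vv α, xx α) = y := by
              rw [hkey] at hα2
              simpa using (Sigma.mk.inj hα2).2
            obtain ⟨h1, h2, h3, h4, h5, h6, h7, -, -, h8, h9, h10⟩ := hst α hα0
            rw [← e]
            exact ⟨h1, h2, h3, h4, h5, h6, h7, h8, h9, h10, hαc⟩
      _ = ∑ q ∈ Fintype.piFinset (fun _ : ι => Q.divisors), ((univ.lcm q).divisors.card : ℝ) ^ 2 *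
          (((univ.lcm q).divisors.card : ℝ) ^ (Fintype.card ι + 2) / ((univ.lcm q : ℕ) : ℝ)) *
            (divSum 2 Q * (6 / (H * √D) * PA)) := by
          refine sum_congr rfl fun q _ => ?_
          simp only [sum_product, sum_const, nsmul_eq_mul]
          rw [divSum, sum_mul, mul_sum, mul_sum, mul_sum]
          refine sum_congr rfl fun x _ => ?_
          ring
      _ ≤ K * (divSum 2 Q * (6 / (H * √D) * PA)) := by
          rw [← sum_mul]
          have := divSum_nonneg 2 Q
          gcongr
      _ ≤ K * (K * (6 / (H * √D) * PA)) := by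
          gcongr
          exact divSum_mono (by omega) Q
      _ = _ := by ring
  have hC : ∑ α ∈ (closeTuples B i j H D).filter (fun α => ¬ cond α), F α
      ≤ 10 * τ₀ ^ 3 * (Nat.log 2 ⌊H⌋₊ + 1) * K / (H * √D) * PA := by
    -- Only the dyadic block of x is recorded; the number of blocks gives the factor `Nat.log 2 ⌊H⌋₊
    -- + 1`.
    set J := (Fintype.piFinset (fun _ : ι => Q.divisors)).sigma fun q =>
      (univ.lcm q).divisors ×ˢ (univ.lcm q).divisors ×ˢ range (Nat.log 2 ⌊H⌋₊ + 1) with hJ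
    set key : (ι → ZMod Q) → (Σ _ : ι → ℕ, ℕ × ℕ × ℕ) := fun α =>
      ⟨restOrders i j α, (uu α, vv α, Nat.log 2 (xx α))⟩ with hkey
    have hxH : ∀ α ∈ (closeTuples B i j H D).filter (fun α => ¬ cond α),
        uu α < H ∧ vv α < H ∧ xx α * (uu α).gcd (vv α) < H ∧ xx α ≤ ⌊H⌋₊ := by
      intro α hα
      obtain ⟨hα0, hαc⟩ := mem_filter.1 hα
      rw [hcond] at hαc
      simp only [not_or, not_le] at hαc
      obtain ⟨h1, h2, h3, h4, -⟩ := hst α hα0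
      refine ⟨hαc.1, hαc.2.1, hαc.2.2, Nat.le_floor ?_⟩
      refine le_trans ?_ hαc.2.2.le
      have : (1 : ℝ) ≤ (uu α).gcd (vv α) := by exact_mod_cast Nat.gcd_pos_of_pos_left _ h4
      exact le_mul_of_one_le_right (Nat.cast_nonneg _) this
    have hmap : ∀ α ∈ (closeTuples B i j H D).filter (fun α => ¬ cond α), key α ∈ J := by
      intro α hα
      obtain ⟨h1, h2, h3, h4, h5, h6, h7, h8, h9, -⟩ := hst α (mem_filter.1 hα).1
      rw [hJ, mem_sigma]
      refine ⟨hrest α, ?_⟩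
      rw [mem_product, mem_product, Nat.mem_divisors, Nat.mem_divisors, mem_range]
      exact ⟨⟨h8, hR0 α⟩, ⟨h9, hR0 α⟩, Nat.lt_succ_of_le (show Nat.log 2 (xx α) ≤ Nat.log 2 ⌊H⌋₊ from
        Nat.log_mono_right (hxH α hα).2.2.2)⟩
    rw [← Finset.sum_fiberwise_of_maps_to hmap, hJ, sum_sigma]
    calc _ ≤ ∑ q ∈ Fintype.piFinset (fun _ : ι => Q.divisors),
          ∑ y ∈ (univ.lcm q).divisors ×ˢ (univ.lcm q).divisors ×ˢ range (Nat.log 2 ⌊H⌋₊ + 1),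
          ((univ.lcm q).divisors.card : ℝ) ^ (Fintype.card ι + 2) / ((univ.lcm q : ℕ) : ℝ) *
            (10 * τ₀ ^ 3 / (H * √D) * PA) := by
          refine sum_le_sum fun q _ => sum_le_sum fun y hy => ?_
          rw [mem_product, mem_product, Nat.mem_divisors, Nat.mem_divisors] at hy
          refine sum_dyadic_fiber_le hQ hij hD (hD.trans hDH) hHh hτ₀ hdiv f hf A hfA q
            (X := 2 ^ y.2.2) hy.1.1 hy.2.1.1 _
            ((filter_subset _ _).trans ((filter_subset _ _).trans hclB)) ?_ ?_
          · intro α hα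
            have := (mem_filter.1 hα).2
            exact congrArg Sigma.fst this
          · intro α hα
            obtain ⟨hα1, hα2⟩ := mem_filter.1 hα
            obtain ⟨hα0, hαc⟩ := mem_filter.1 hα1
            have e : (uu α, vv α, Nat.log 2 (xx α)) = y := by
              rw [hkey] at hα2
              simpa using (Sigma.mk.inj hα2).2
            obtain ⟨h1, h2, h3, h4, h5, h6, h7, -, -, h8, h9, h10⟩ := hst α hα0
            obtain ⟨b1, b2, b3, -⟩ := hxH α hα1
            rw [← e]
            refine ⟨xx α, Nat.pow_log_le_self 2 h3.ne', ?_, h1, h2, h3, h4, h5, h6, h7, h8, h9, h10,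
              b1, b2, b3⟩
            have := Nat.lt_pow_succ_log_self (b := 2) one_lt_two (xx α)
            rw [pow_succ] at this
            simpa [mul_comm] using this
      _ = ∑ q ∈ Fintype.piFinset (fun _ : ι => Q.divisors), ((univ.lcm q).divisors.card : ℝ) ^ 2 *
          (((univ.lcm q).divisors.card : ℝ) ^ (Fintype.card ι + 2) / ((univ.lcm q : ℕ) : ℝ)) *
            ((Nat.log 2 ⌊H⌋₊ + 1) * (10 * τ₀ ^ 3 / (H * √D) * PA)) := by
          refine sum_congr rfl fun q _ => ?_
          rw [sum_const, nsmul_eq_mul, card_product, card_product, card_range]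
          push_cast
          ring
      _ ≤ K * ((Nat.log 2 ⌊H⌋₊ + 1) * (10 * τ₀ ^ 3 / (H * √D) * PA)) := by
          rw [← sum_mul]
          gcongr
      _ = _ := by ring
  rw [← Finset.sum_filter_add_sum_filter_not _ cond]
  refine (add_le_add hP hC).trans (le_of_eq ?_)
  ring

end UnpairedBound

/-! ### Tuples without cancelling pairs save a power of h. -/

section FreeTuples

set_option linter.unusedSectionVars false

variable {ι : Type*} [Fintype ι] [DecidableEq ι] {Q : ℕ} [NeZero Q]

theorem sum_union_le_of_nonneg {A : Type*} [DecidableEq A] (S T : Finset A) {f : A → ℝ}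
    (hf : ∀ a, 0 ≤ f a) : ∑ a ∈ S ∪ T, f a ≤ ∑ a ∈ S, f a + ∑ a ∈ T, f a := by
  rw [← sum_union_inter]
  exact le_add_of_nonneg_right (sum_nonneg fun a _ => hf a)

theorem sum_biUnion_le_of_nonneg {A J : Type*} [DecidableEq A] [DecidableEq J] (S : Finset J)
    (T : J → Finset A) {f : A → ℝ} (hf : ∀ a, 0 ≤ f a) :
    ∑ a ∈ S.biUnion T, f a ≤ ∑ j ∈ S, ∑ a ∈ T j, f a := by
  induction S using Finset.induction_on with
  | empty => simp
  | insert j S hj ih =>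
    rw [biUnion_insert, sum_insert hj]
    exact (sum_union_le_of_nonneg _ _ hf).trans (by gcongr)

/-- The weight bounding the Fourier coefficients. -/
noncomputable def fejerWeight (h : ℝ) (α : ZMod Q) : ℝ := fejer h α / (addOrderOf α).totient

theorem fejerWeight_nonneg {h : ℝ} (hh : 0 ≤ h) (α : ZMod Q) : 0 ≤ fejerWeight h α :=
  div_nonneg (fejer_nonneg hh α) (Nat.cast_nonneg _)

theorem sum_fejer_sq_addOrderOf_le {h : ℝ} (hh : 0 < h) {q : ℕ} (hq1 : 1 < q) :
    ∑ a : ZMod Q with addOrderOf a = q, fejer h a ^ 2 ≤ q * (6 * h) := by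
  refine (sum_fejer_sq_le (q := q) (by omega) hh _ ?_).trans (le_of_eq (by ring))
  intro α hα
  rw [mem_filter] at hα
  refine ⟨hα.2 ▸ addOrderOf_nsmul_eq_zero _, ?_⟩
  rintro rfl
  rw [addOrderOf_zero] at hα
  omega

theorem sum_suppTuples_fejerWeight_le (hQ : Squarefree Q) (B : Finset ι) {h : ℝ} (hh : 0 < h) :
    ∑ α ∈ suppTuples Q B, ∏ i ∈ B, fejerWeight h (α i)
      ≤ divSum (2 * Fintype.card ι) Q * √(6 * h) ^ B.card := by
  have := sum_suppTuples_le hQ B (fun _ => fejer h) (fun _ => fejer_nonneg hh.le) (fun _ => 6 * h)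
    fun _ _ _ _ hq1 => sum_fejer_sq_addOrderOf_le hh hq1
  rwa [prod_const] at this

/-- The tuples supported on `B` no two of whose entries cancel. -/
noncomputable def freeTuples (Q : ℕ) [NeZero Q] (B : Finset ι) : Finset (ι → ZMod Q) :=
  (suppTuples Q B).filter fun α => ∀ i ∈ B, ∀ j ∈ B, i ≠ j → α i + α j ≠ 0

/-- Every prime of the squarefree order of `α i` divides the order of some other entry, because the
sum is zero; it then divides the corresponding gcd. -/
theorem addOrderOf_dvd_prod_gcd (hQ : Squarefree Q) {B : Finset ι} {α : ι → ZMod Q}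
    (hα : α ∈ suppTuples Q B) (i : ι) :
    addOrderOf (α i) ∣ ∏ j ∈ B.erase i, (addOrderOf (α i)).gcd (addOrderOf (α j)) := by
  rw [suppTuples, mem_filter] at hα
  obtain ⟨-, hs, hB⟩ := hα
  have hsq := hQ.squarefree_of_dvd (addOrderOf_dvd_modulus (α i))
  conv_lhs => rw [← Nat.prod_primeFactors_of_squarefree hsq]
  refine Finset.prod_primes_dvd _ (fun p hp => (Nat.prime_of_mem_primeFactors hp).prime) ?_
  intro p hp
  have hpp := Nat.prime_of_mem_primeFactors hp
  have hpd := Nat.dvd_of_mem_primeFactors hp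
  obtain ⟨j, hj, hpj⟩ := exists_dvd_of_sum_eq_zero hs (fun j => addOrderOf (α j)) i
    (fun j _ => addOrderOf_nsmul_eq_zero _) hpp hpd
  have hjB : j ∈ B := by
    rw [← hB]
    intro h0
    rw [h0, addOrderOf_zero] at hpj
    exact hpp.one_lt.ne' (Nat.dvd_one.1 hpj)
  exact (Nat.dvd_gcd hpd hpj).trans (dvd_prod_of_mem _ (mem_erase.2 ⟨hj, hjB⟩))

theorem le_addOrderOf_of_zabs_mul_le {H : ℝ} {α : ZMod Q} (h0 : α ≠ 0) (h : zabs α * H ≤ Q) :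
    H ≤ addOrderOf α := by
  refine le_trans ?_ (div_zabs_le (addOrderOf_pos_zmod α) (addOrderOf_nsmul_eq_zero α) h0)
  rw [le_div_iff₀ (by exact_mod_cast zabs_pos h0)]
  linarith

/-- A nonzero fraction within 1/H of an integer has denominator at least H. It divides the product
of its gcds with the other denominators, so these gcds cannot all be below D. -/
theorem exists_le_gcd_addOrderOf (hQ : Squarefree Q) {B : Finset ι} {α : ι → ZMod Q}
    (hα : α ∈ suppTuples Q B) {i : ι} (hi : i ∈ B) (hB : 2 ≤ B.card) {H D : ℝ}
    (hDH : D ^ (B.card - 1) ≤ H) (hz : zabs (α i) * H ≤ Q) :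
    ∃ j ∈ B.erase i, D ≤ (addOrderOf (α i)).gcd (addOrderOf (α j)) := by
  by_contra! hcon
  have h0 : α i ≠ 0 := by
    rw [suppTuples, mem_filter] at hα
    exact (hα.2.2 i).2 hi
  have h1 := le_addOrderOf_of_zabs_mul_le h0 hz
  have hne : (B.erase i).Nonempty := by
    rw [← card_pos, card_erase_of_mem hi]; omega
  have hpos : ∀ j, 0 < (addOrderOf (α i)).gcd (addOrderOf (α j)) := fun j =>
    Nat.gcd_pos_of_pos_left _ (addOrderOf_pos_zmod _)
  have h2 : ((addOrderOf (α i) : ℕ) : ℝ)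
      ≤ ∏ j ∈ B.erase i, (((addOrderOf (α i)).gcd (addOrderOf (α j)) : ℕ) : ℝ) := by
    rw [← Nat.cast_prod]
    exact_mod_cast Nat.le_of_dvd (prod_pos fun j _ => hpos j) (addOrderOf_dvd_prod_gcd hQ hα i)
  have h3 : ∏ j ∈ B.erase i, (((addOrderOf (α i)).gcd (addOrderOf (α j)) : ℕ) : ℝ)
      < ∏ j ∈ B.erase i, D :=
    prod_lt_prod_of_nonempty (fun j _ => by exact_mod_cast hpos j) hcon hne
  rw [prod_const, card_erase_of_mem hi] at h3
  linarith

/-- At the index `i` the mean square drops from 6h to 4H by the tail bound, whence the factor √(H/h)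
in the general estimate for tuple sums. -/
theorem sum_filter_far_le (hQ : Squarefree Q) {B : Finset ι} {i : ι} (hi : i ∈ B) {h H : ℝ}
    (hH : 0 < H) (hHh : H ≤ h) :
    ∑ α ∈ (suppTuples Q B).filter (fun α => ¬ zabs (α i) * H ≤ Q), ∏ l ∈ B, fejerWeight h (α l)
      ≤ divSum (2 * Fintype.card ι) Q * (√(H / h) * √(6 * h) ^ B.card) := by
  have hh : 0 < h := hH.trans_le hHh
  set f : ι → ZMod Q → ℝ := fun l a =>
    if l = i then (if zabs a * H ≤ Q then 0 else fejer h a) else fejer h a with hf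
  have hf0 : ∀ l a, 0 ≤ f l a := by
    intro l a
    have := fejer_nonneg (Q := Q) hh.le a
    rw [hf]
    dsimp only
    split_ifs <;> first | exact le_rfl | exact this
  have key := sum_suppTuples_le hQ B f hf0 (fun l => if l = i then 4 * H else 6 * h) (by
    intro l _ q _ hq1
    by_cases hli : l = i
    · simp only [hf, hli, if_true]
      have e : ∑ a : ZMod Q with addOrderOf a = q, (if zabs a * H ≤ Q then 0 else fejer h a) ^ 2
          ≤ ∑ a ∈ (univ.filter fun a : ZMod Q => addOrderOf a = q).filter
            (fun a => ¬ zabs a * H ≤ Q), ((Q : ℝ) / zabs a) ^ 2 := by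
        rw [sum_filter (p := fun a : ZMod Q => ¬ zabs a * H ≤ Q)]
        refine sum_le_sum fun a _ => ?_
        by_cases hz : zabs a * H ≤ Q
        · simp [hz]
        · simp only [hz, not_false_eq_true, if_true, if_false]
          exact pow_le_pow_left₀ (fejer_nonneg hh.le a) (min_le_right _ _) 2
      refine e.trans ((sum_fejer_tail_sq_le (q := q) (by omega) hH _ ?_).trans
        (le_of_eq (by ring)))
      intro a ha
      rw [mem_filter, mem_filter] at ha
      refine ⟨ha.1.2 ▸ addOrderOf_nsmul_eq_zero _, ?_, not_le.1 ha.2⟩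
      rintro rfl
      have := ha.1.2
      rw [addOrderOf_zero] at this
      omega
    · simp only [hf, hli, if_false]
      exact sum_fejer_sq_addOrderOf_le hh hq1)
  have hlhs : ∑ α ∈ (suppTuples Q B).filter (fun α => ¬ zabs (α i) * H ≤ Q),
      ∏ l ∈ B, fejerWeight h (α l) ≤
      ∑ α ∈ suppTuples Q B, ∏ l ∈ B, f l (α l) / (addOrderOf (α l)).totient := by
    rw [sum_filter]
    refine sum_le_sum fun α _ => ?_
    by_cases hz : ¬ zabs (α i) * H ≤ Q
    · rw [if_pos hz]
      refine le_of_eq (prod_congr rfl fun l _ => ?_)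
      rw [fejerWeight]
      congr 1
      by_cases hli : l = i
      · subst hli
        simp [hf, hz]
      · simp [hf, hli]
    · rw [if_neg hz]
      exact prod_nonneg fun l _ => div_nonneg (hf0 _ _) (Nat.cast_nonneg _)
  refine hlhs.trans (key.trans ?_)
  have := divSum_nonneg (2 * Fintype.card ι) Q
  gcongr
  rw [← mul_prod_erase _ _ hi]
  have e : ∏ x ∈ B.erase i, √(if x = i then 4 * H else 6 * h) = √(6 * h) ^ (B.card - 1) := by
    rw [← card_erase_of_mem hi, ← prod_const]
    refine prod_congr rfl fun l hl => ?_
    rw [if_neg (ne_of_mem_erase hl)]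
  have hc : B.card = (B.card - 1) + 1 := by
    have := card_pos.2 ⟨i, hi⟩; omega
  rw [e, if_pos rfl]
  conv_rhs => rw [hc, pow_succ, mul_comm (√(6 * h) ^ _), ← mul_assoc, ← Real.sqrt_mul (by positivity)]
  rw [show H / h * (6 * h) = 6 * H by field_simp]
  gcongr
  norm_num

theorem mul_le_sq_mul {a b h x y P : ℝ} (ha : 0 ≤ a) (hb : 0 ≤ b) (hax : a ≤ h * x)
    (hby : b ≤ h * y) (hP : 0 ≤ P) : b * (a * P) ≤ h ^ 2 * (x * y * P) :=
  calc b * (a * P) ≤ (h * y) * (h * x * P) := by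
        have := hb.trans hby
        gcongr
    _ = _ := by ring

theorem fejerWeight_le (h : ℝ) (α : ZMod Q) :
    fejerWeight h α ≤ h * (1 / ((addOrderOf α).totient : ℝ)) := by
  rw [fejerWeight, mul_one_div]
  gcongr
  exact min_le_left _ _

theorem six_mul_sq_add_le {K κ L : ℝ} (hK0 : 0 ≤ K) (hK : K ≤ κ) (hL : L ≤ κ)
    (hκ : 1 ≤ κ) : 6 * K ^ 2 + 10 * κ ^ 3 * L * K ≤ 16 * κ ^ 5 := by
  have a1 : K ^ 2 ≤ κ ^ 5 :=
    (pow_le_pow_left₀ hK0 hK 2).trans (pow_le_pow_right₀ hκ (by norm_num))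
  have a2 : 10 * κ ^ 3 * L * K ≤ 10 * κ ^ 3 * κ * κ := by gcongr
  linarith [a2, show 10 * κ ^ 3 * κ * κ = 10 * κ ^ 5 by ring]

/-- The two close weights are bounded trivially by h/φ each. The resulting h², against the
normalization 6h of two square roots, costs h/6, so the saving 1/(H√D) becomes h/(H√D). -/
theorem sum_closeTuples_fejerWeight_le (hQ : Squarefree Q) {B : Finset ι} {i j : ι} (hij : i ≠ j)
    (hi : i ∈ B) (hjB : j ∈ B) {H D h κ : ℝ} (hD : 1 ≤ D) (hDH : D ≤ H) (hHh : H ≤ h)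
    (hκ : 1 ≤ κ)
    (hdiv : ∀ N : ℕ, 0 < N → (N : ℝ) ≤ 4 * h ^ 3 → (N.divisors.card : ℝ) ≤ κ)
    (hlog : (Nat.log 2 ⌊H⌋₊ + 1 : ℝ) ≤ κ) (hK : divSum (2 * Fintype.card ι + 4) Q ≤ κ) :
    ∑ α ∈ closeTuples (Q := Q) B i j H D, ∏ l ∈ B, fejerWeight h (α l)
      ≤ 3 * κ ^ 5 * (h / H / √D) * √(6 * h) ^ B.card := by
  have hD0 : 0 < D := by linarith
  have hH : 0 < H := by linarith
  have hh : 0 < h := by linarith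
  have hB : 2 ≤ B.card := by
    have : ({i, j} : Finset ι) ⊆ B := by
      intro l hl
      rcases mem_insert.1 hl with rfl | hl
      · exact hi
      · exact mem_singleton.1 hl ▸ hjB
    simpa [card_pair hij] using card_le_card this
  set S := √(6 * h) ^ B.card with hS
  have hS0 : 0 ≤ S := by positivity
  have key := sum_closeTuples_le (ι := ι) (Q := Q) hQ hij hi hjB hD hDH hHh hκ hdiv
    (fun _ => fejer (Q := Q) h) (fun _ a => fejer_nonneg hh.le a) (fun _ => 6 * h)
    fun _ _ _ _ hq1 => sum_fejer_sq_addOrderOf_le hh hq1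
  set K := divSum (2 * Fintype.card ι + 4) Q with hKdef
  have hK0 : 0 ≤ K := divSum_nonneg _ _
  have hcard : ((B.erase j).erase i).card = B.card - 2 := by
    rw [card_erase_of_mem (mem_erase.2 ⟨hij, hi⟩), card_erase_of_mem hjB]; omega
  rw [prod_const, hcard] at key
  have h1 : ∑ α ∈ closeTuples (Q := Q) B i j H D, ∏ l ∈ B, fejerWeight h (α l) ≤
      h ^ 2 * ∑ α ∈ closeTuples (Q := Q) B i j H D, 1 / ((addOrderOf (α i)).totient : ℝ) *
      (1 / ((addOrderOf (α j)).totient : ℝ)) *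
      ∏ l ∈ (B.erase j).erase i, fejer h (α l) / (addOrderOf (α l)).totient := by
    rw [mul_sum]
    refine sum_le_sum fun α _ => ?_
    rw [← mul_prod_erase _ _ hjB, ← mul_prod_erase _ _ (mem_erase.2 ⟨hij, hi⟩)]
    have hp : 0 ≤ ∏ l ∈ (B.erase j).erase i, fejerWeight h (α l) :=
      prod_nonneg fun l _ => fejerWeight_nonneg hh.le _
    exact mul_le_sq_mul (fejerWeight_nonneg hh.le _) (fejerWeight_nonneg hh.le _)
      (fejerWeight_le h _) (fejerWeight_le h _) hp
  refine h1.trans ((mul_le_mul_of_nonneg_left key (sq_nonneg h)).trans ?_)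
  have h2 := six_mul_sq_add_le hK0 hK hlog hκ
  have h3 : S = 6 * h * √(6 * h) ^ (B.card - 2) := by
    rw [hS, ← Nat.sub_add_cancel hB, pow_add, Real.sq_sqrt (by positivity)]
    simp
    ring
  have hsD : 0 < √D := Real.sqrt_pos.2 hD0
  calc _ ≤ h ^ 2 * (16 * κ ^ 5 / (H * √D) * √(6 * h) ^ (B.card - 2)) := by gcongr
    _ = 16 / 6 * κ ^ 5 * (h / H / √D) * S := by rw [h3]; field_simp
    _ ≤ _ := by gcongr; norm_num

/-- Fix an index i. Either its entry is far, or it shares a divisor at least D with an entry j; then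
either entry j is far, or the pair (i, j) is close and, the tuple being free, does not cancel. -/
theorem sum_freeTuples_le (hQ : Squarefree Q) {B : Finset ι} (hB : 2 ≤ B.card)
    {H D h κ : ℝ} (hD : 1 ≤ D) (hDH : D ^ (B.card - 1) ≤ H) (hHh : H ≤ h) (hκ : 1 ≤ κ)
    (hdiv : ∀ N : ℕ, 0 < N → (N : ℝ) ≤ 4 * h ^ 3 → (N.divisors.card : ℝ) ≤ κ)
    (hlog : (Nat.log 2 ⌊H⌋₊ + 1 : ℝ) ≤ κ) (hK : divSum (2 * Fintype.card ι + 4) Q ≤ κ) :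
    ∑ α ∈ freeTuples Q B, ∏ i ∈ B, fejerWeight h (α i)
      ≤ 3 * B.card * κ ^ 5 * √(6 * h) ^ B.card * (√(H / h) + h / H / √D) := by
  classical
  have hDH' : D ≤ H := le_trans (le_self_pow₀ hD (by omega)) hDH
  have hH : 0 < H := by linarith
  have hh : 0 < h := by linarith
  have hD0 : 0 < D := by linarith
  obtain ⟨i, hi⟩ : B.Nonempty := card_pos.1 (by omega)
  have hw : ∀ α : ι → ZMod Q, 0 ≤ ∏ l ∈ B, fejerWeight h (α l) := fun α =>
    prod_nonneg fun l _ => fejerWeight_nonneg hh.le _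
  have hsub : freeTuples Q B ⊆ (suppTuples Q B).filter (fun α => ¬ zabs (α i) * H ≤ Q) ∪
      (B.erase i).biUnion fun j => (suppTuples Q B).filter (fun α => ¬ zabs (α j) * H ≤ Q) ∪
        closeTuples B i j H D := by
    intro α hα
    obtain ⟨hα1, hα2⟩ := mem_filter.1 hα
    by_cases hzi : zabs (α i) * H ≤ Q
    · obtain ⟨j, hj, hjD⟩ := exists_le_gcd_addOrderOf hQ hα1 hi hB hDH hzi
      refine mem_union_right _ (mem_biUnion.2 ⟨j, hj, ?_⟩)
      by_cases hzj : zabs (α j) * H ≤ Q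
      · exact mem_union_right _ (mem_filter.2 ⟨hα1, hzi, hzj,
          hα2 i hi j (mem_of_mem_erase hj) (ne_of_mem_erase hj).symm, hjD⟩)
      · exact mem_union_left _ (mem_filter.2 ⟨hα1, hzj⟩)
    · exact mem_union_left _ (mem_filter.2 ⟨hα1, hzi⟩)
  set S := √(6 * h) ^ B.card with hS
  have hS0 : 0 ≤ S := by positivity
  have hfar : ∀ j ∈ B, ∑ α ∈ (suppTuples Q B).filter (fun α => ¬ zabs (α j) * H ≤ Q),
      ∏ l ∈ B, fejerWeight h (α l) ≤ κ ^ 5 * (√(H / h) * S) := by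
    intro j hj
    refine (sum_filter_far_le hQ hj hH hHh).trans ?_
    gcongr
    exact (divSum_mono (by omega) Q).trans (hK.trans (le_self_pow₀ hκ (by omega)))
  have hclose : ∀ j ∈ B.erase i, ∑ α ∈ closeTuples (Q := Q) B i j H D,
      ∏ l ∈ B, fejerWeight h (α l) ≤ 3 * κ ^ 5 * (h / H / √D) * S := fun j hj =>
    sum_closeTuples_fejerWeight_le hQ (ne_of_mem_erase hj).symm hi (mem_of_mem_erase hj) hD hDH'
      hHh hκ hdiv hlog hK
  have hb : 0 ≤ h / H / √D := by positivity
  have ha : 0 ≤ √(H / h) := Real.sqrt_nonneg _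
  have hkk : 0 ≤ κ ^ 5 := by positivity
  have hcard : ((B.erase i).card : ℝ) + 1 = B.card := by
    exact_mod_cast card_erase_add_one hi
  calc _ ≤ ∑ α ∈ (suppTuples Q B).filter (fun α => ¬ zabs (α i) * H ≤ Q) ∪
      (B.erase i).biUnion fun j => (suppTuples Q B).filter (fun α => ¬ zabs (α j) * H ≤ Q) ∪
        closeTuples B i j H D, ∏ l ∈ B, fejerWeight h (α l) :=
        sum_le_sum_of_subset_of_nonneg hsub fun α _ _ => hw α
    _ ≤ κ ^ 5 * (√(H / h) * S) + ∑ j ∈ B.erase i, (κ ^ 5 * (√(H / h) * S) +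
        3 * κ ^ 5 * (h / H / √D) * S) := by
        refine (sum_union_le_of_nonneg _ _ fun α => hw α).trans (add_le_add (hfar i hi) ?_)
        refine (sum_biUnion_le_of_nonneg _ _ fun α => hw α).trans (sum_le_sum fun j hj => ?_)
        exact (sum_union_le_of_nonneg _ _ fun α => hw α).trans
          (add_le_add (hfar j (mem_of_mem_erase hj)) (hclose j hj))
    _ ≤ (((B.erase i).card : ℝ) + 1) * (κ ^ 5 * (√(H / h) * S) +
        3 * κ ^ 5 * (h / H / √D) * S) := by
        rw [sum_const, nsmul_eq_mul]
        have : 0 ≤ 3 * κ ^ 5 * (h / H / √D) * S := by positivity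
        linarith
    _ ≤ _ := by
        rw [hcard]
        have : 0 ≤ κ ^ 5 * (√(H / h) * S) := by positivity
        have hc : (0 : ℝ) ≤ B.card := Nat.cast_nonneg _
        calc _ ≤ (B.card : ℝ) * (3 * (κ ^ 5 * (√(H / h) * S)) + 3 * κ ^ 5 * (h / H / √D) * S) := by
              refine mul_le_mul_of_nonneg_left ?_ hc
              linarith
          _ = _ := by ring

end FreeTuples

/-! ### The Wick recursion for moments. -/

section Wick

set_option linter.unusedSectionVars false

variable {ι : Type*} [Fintype ι] [DecidableEq ι] {Q : ℕ} [NeZero Q]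

theorem mem_suppTuples {B : Finset ι} {α : ι → ZMod Q} :
    α ∈ suppTuples Q B ↔ ∑ i, α i = 0 ∧ ∀ i, α i ≠ 0 ↔ i ∈ B := by
  simp [suppTuples]

theorem sum_update_update {i j : ι} (hij : i ≠ j) (γ : ι → ZMod Q) (hi : γ i = 0) (hj : γ j = 0)
    (a : ZMod Q) :
    ∑ l, Function.update (Function.update γ i a) j (-a) l = ∑ l, γ l := by
  rw [← add_sum_erase univ _ (mem_univ j), ← add_sum_erase univ γ (mem_univ j),
    ← add_sum_erase _ _ (mem_erase.2 ⟨hij, mem_univ i⟩),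
    ← add_sum_erase _ γ (mem_erase.2 ⟨hij, mem_univ i⟩), Function.update_self,
    Function.update_of_ne hij, Function.update_self, hi, hj, zero_add, zero_add, ← add_assoc,
    neg_add_cancel, zero_add]
  refine sum_congr rfl fun l hl => ?_
  rw [Function.update_of_ne (ne_of_mem_erase (mem_of_mem_erase hl)),
    Function.update_of_ne (ne_of_mem_erase hl)]

/-- A tuple in which the entries `i` and `j` cancel is a sum-zero tuple on the other indices
together with one free nonzero frequency. -/
theorem sum_suppTuples_cancel {M : Type*} [AddCommMonoid M] {B : Finset ι} {i j : ι} (hij : i ≠ j)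
    (hi : i ∈ B) (hj : j ∈ B) (F : (ι → ZMod Q) → M) :
    ∑ α ∈ (suppTuples Q B).filter (fun α => α i + α j = 0), F α =
      ∑ γ ∈ suppTuples Q ((B.erase j).erase i), ∑ a ∈ univ.erase (0 : ZMod Q),
        F (Function.update (Function.update γ i a) j (-a)) := by
  rw [← sum_product']
  symm
  refine sum_bij' (fun x _ => Function.update (Function.update x.1 i x.2) j (-x.2))
    (fun α _ => (Function.update (Function.update α i 0) j 0, α i)) ?_ ?_ ?_ ?_ ?_
  · rintro ⟨γ, a⟩ hx
    obtain ⟨h1, h2⟩ := mem_product.1 hx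
    obtain ⟨hs, hB⟩ := mem_suppTuples.1 h1
    have ha : a ≠ 0 := ne_of_mem_erase h2
    have hγi : γ i = 0 := by
      by_contra h
      exact absurd ((hB i).1 h) (notMem_erase _ _)
    have hγj : γ j = 0 := by
      by_contra h
      exact absurd (mem_of_mem_erase ((hB j).1 h)) (notMem_erase _ _)
    refine mem_filter.2 ⟨mem_suppTuples.2 ⟨?_, ?_⟩, ?_⟩
    · rw [sum_update_update hij γ hγi hγj, hs]
    · intro l
      by_cases hlj : l = j
      · subst hlj
        simp [ha, hj]
      · by_cases hli : l = i
        · subst hli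
          simp [hlj, ha, hi]
        · simp [hlj, hli, hB l]
    · simp [hij]
  · intro α hα
    obtain ⟨hα1, hα2⟩ := mem_filter.1 hα
    obtain ⟨hs, hB⟩ := mem_suppTuples.1 hα1
    refine mem_product.2 ⟨mem_suppTuples.2 ⟨?_, ?_⟩, ?_⟩
    · have h3 := sum_update_update hij (Function.update (Function.update α i 0) j 0)
        (by simp [hij]) (by simp) (α i)
      rw [← h3, ← hs]
      refine sum_congr rfl fun l _ => ?_
      by_cases hlj : l = j
      · subst hlj
        simp [← eq_neg_of_add_eq_zero_right hα2]
      · by_cases hli : l = i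
        · subst hli
          simp [hlj]
        · simp [hlj, hli]
    · intro l
      by_cases hlj : l = j
      · subst hlj
        simp
      · by_cases hli : l = i
        · subst hli
          simp [hlj]
        · simp [hlj, hli, hB l]
    · exact mem_erase.2 ⟨(hB i).2 hi, mem_univ _⟩
  · rintro ⟨γ, a⟩ hx
    obtain ⟨h1, h2⟩ := mem_product.1 hx
    obtain ⟨hs, hB⟩ := mem_suppTuples.1 h1
    have hγi : γ i = 0 := by
      by_contra h
      exact absurd ((hB i).1 h) (notMem_erase _ _)
    have hγj : γ j = 0 := by
      by_contra h
      exact absurd (mem_of_mem_erase ((hB j).1 h)) (notMem_erase _ _)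
    refine Prod.ext ?_ (by simp [hij])
    funext l
    by_cases hlj : l = j
    · subst hlj
      simp [hγj]
    · by_cases hli : l = i
      · subst hli
        simp [hlj, hγi]
      · simp [hlj, hli]
  · intro α hα
    obtain ⟨-, hα2⟩ := mem_filter.1 hα
    funext l
    by_cases hlj : l = j
    · subst hlj
      simp [← eq_neg_of_add_eq_zero_right hα2]
    · by_cases hli : l = i
      · subst hli
        simp [hlj]
      · simp [hlj, hli]
  · rintro ⟨γ, a⟩ _
    rfl

theorem prod_update_update {M : Type*} [CommMonoid M] {B : Finset ι} {i j : ι} (hij : i ≠ j)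
    (hi : i ∈ B) (hj : j ∈ B) (g : ι → ZMod Q → M) (γ : ι → ZMod Q) (a b : ZMod Q) :
    ∏ l ∈ B, g l (Function.update (Function.update γ i a) j b l) =
      g i a * g j b * ∏ l ∈ (B.erase j).erase i, g l (γ l) := by
  rw [← mul_prod_erase _ _ hj, ← mul_prod_erase _ _ (mem_erase.2 ⟨hij, hi⟩), ← mul_assoc]
  congr 1
  · rw [Function.update_self, Function.update_of_ne hij, Function.update_self, mul_comm]
  · refine prod_congr rfl fun l hl => ?_
    rw [Function.update_of_ne (ne_of_mem_erase (mem_of_mem_erase hl)),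
      Function.update_of_ne (ne_of_mem_erase hl)]

/-- The moment of the coefficient functions `a i`, `i ∈ B`. -/
noncomputable def suppSum (Q : ℕ) [NeZero Q] (a : ι → ZMod Q → ℂ) (B : Finset ι) : ℂ :=
  ∑ α ∈ suppTuples Q B, ∏ i ∈ B, a i (α i)

/-- The covariance of two coefficient functions. -/
noncomputable def pairSum (a : ι → ZMod Q → ℂ) (i j : ι) : ℂ :=
  ∑ x ∈ univ.erase (0 : ZMod Q), a i x * a j (-x)

theorem sum_suppTuples_cancel_prod {M : Type*} [CommSemiring M] {B : Finset ι} {i j : ι}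
    (hij : i ≠ j) (hi : i ∈ B) (hj : j ∈ B) (g : ι → ZMod Q → M) :
    ∑ α ∈ (suppTuples Q B).filter (fun α => α i + α j = 0), ∏ l ∈ B, g l (α l) =
      (∑ x ∈ univ.erase (0 : ZMod Q), g i x * g j (-x)) *
        ∑ γ ∈ suppTuples Q ((B.erase j).erase i), ∏ l ∈ (B.erase j).erase i, g l (γ l) := by
  rw [sum_suppTuples_cancel hij hi hj, mul_sum]
  refine sum_congr rfl fun γ _ => ?_
  rw [sum_mul]
  exact sum_congr rfl fun a _ => prod_update_update hij hi hj g γ a (-a)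

/-- The tuples whose entry at `m` is cancelled by no other entry. -/
noncomputable def loneTuples (Q : ℕ) [NeZero Q] (B : Finset ι) (m : ι) : Finset (ι → ZMod Q) :=
  (suppTuples Q B).filter fun α => ∀ j ∈ B, m ≠ j → α m + α j ≠ 0

theorem suppTuples_eq_empty_of_card_eq_one {B : Finset ι} (hB : B.card = 1) :
    suppTuples Q B = ∅ := by
  obtain ⟨m, rfl⟩ := card_eq_one.1 hB
  refine eq_empty_of_forall_notMem fun α hα => ?_
  obtain ⟨hs, hB⟩ := mem_suppTuples.1 hα
  rw [← add_sum_erase univ _ (mem_univ m), sum_eq_zero, add_zero] at hs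
  · exact (hB m).2 (mem_singleton_self m) hs
  · intro l hl
    by_contra h
    exact ne_of_mem_erase hl (mem_singleton.1 ((hB l).1 h))

theorem sum_loneTuples_cancel_le {w : ZMod Q → ℝ} (hw : ∀ a, 0 ≤ w a) (hwneg : ∀ a, w (-a) = w a)
    {B : Finset ι} {m i j : ι} (hmi : m ≠ i) (hmj : m ≠ j) (hij : i ≠ j) (hi : i ∈ B)
    (hj : j ∈ B) :
    ∑ α ∈ (loneTuples Q B m).filter (fun α => α i + α j = 0), ∏ l ∈ B, w (α l) ≤
      (∑ a ∈ univ.erase (0 : ZMod Q), w a ^ 2) *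
        ∑ γ ∈ loneTuples Q ((B.erase j).erase i) m, ∏ l ∈ (B.erase j).erase i, w (γ l) := by
  set B' := (B.erase j).erase i with hB'
  rw [loneTuples, filter_comm, sum_filter, sum_suppTuples_cancel hij hi hj, mul_sum, loneTuples,
    sum_filter (s := suppTuples Q B')]
  refine sum_le_sum fun γ _ => ?_
  by_cases hγ : ∀ l ∈ B', m ≠ l → γ m + γ l ≠ 0
  · rw [if_pos hγ, sum_mul]
    refine sum_le_sum fun a _ => ?_
    have : ∏ l ∈ B, w (Function.update (Function.update γ i a) j (-a) l)
        = w a ^ 2 * ∏ l ∈ B', w (γ l) := by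
      rw [prod_update_update hij hi hj (fun _ => w), hwneg, sq]
    split_ifs
    · exact this.le
    · exact mul_nonneg (sq_nonneg _) (prod_nonneg fun _ _ => hw _)
  · rw [if_neg hγ]
    refine (sum_eq_zero fun a _ => if_neg fun h => hγ fun l hl hml => ?_).le
    have h1 := h l (mem_of_mem_erase (mem_of_mem_erase hl)) hml
    rwa [Function.update_of_ne hmj, Function.update_of_ne hmi,
      Function.update_of_ne (ne_of_mem_erase (mem_of_mem_erase hl)),
      Function.update_of_ne (ne_of_mem_erase hl)] at h1

/-- A lone tuple that is not free has a cancelling pair avoiding `m`; removing it leaves a lone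
tuple on two indices fewer. -/
theorem sum_loneTuples_le_add {w : ZMod Q → ℝ} (hw : ∀ a, 0 ≤ w a) (hwneg : ∀ a, w (-a) = w a)
    {B : Finset ι} {m : ι} (hm : m ∈ B) :
    ∑ α ∈ loneTuples Q B m, ∏ l ∈ B, w (α l) ≤ ∑ α ∈ freeTuples Q B, ∏ l ∈ B, w (α l) +
      ∑ p ∈ ((B.erase m) ×ˢ (B.erase m)).filter (fun p => p.1 ≠ p.2),
        (∑ a ∈ univ.erase (0 : ZMod Q), w a ^ 2) *
          ∑ γ ∈ loneTuples Q ((B.erase p.2).erase p.1) m,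
            ∏ l ∈ (B.erase p.2).erase p.1, w (γ l) := by
  classical
  have hpos : ∀ α : ι → ZMod Q, 0 ≤ ∏ l ∈ B, w (α l) := fun α => prod_nonneg fun _ _ => hw _
  set P := ((B.erase m) ×ˢ (B.erase m)).filter (fun p => p.1 ≠ p.2) with hP
  have hsub : loneTuples Q B m ⊆ freeTuples Q B ∪ P.biUnion fun p =>
      (loneTuples Q B m).filter (fun α => α p.1 + α p.2 = 0) := by
    intro α hα
    by_cases hf : ∀ i ∈ B, ∀ j ∈ B, i ≠ j → α i + α j ≠ 0
    · exact mem_union_left _ (mem_filter.2 ⟨(mem_filter.1 hα).1, hf⟩)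
    · push Not at hf
      obtain ⟨i, hi, j, hj, hij, h0⟩ := hf
      have hlone := (mem_filter.1 hα).2
      have him : i ≠ m := by
        rintro rfl
        exact hlone j hj hij h0
      have hjm : j ≠ m := by
        rintro rfl
        exact hlone i hi hij.symm (by rw [add_comm]; exact h0)
      refine mem_union_right _ (mem_biUnion.2 ⟨(i, j), ?_, mem_filter.2 ⟨hα, h0⟩⟩)
      exact mem_filter.2 ⟨mem_product.2 ⟨mem_erase.2 ⟨him, hi⟩, mem_erase.2 ⟨hjm, hj⟩⟩, hij⟩
  refine (sum_le_sum_of_subset_of_nonneg hsub fun α _ _ => hpos α).trans ?_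
  refine (sum_union_le_of_nonneg _ _ hpos).trans (add_le_add le_rfl ?_)
  refine (sum_biUnion_le_of_nonneg _ _ hpos).trans (sum_le_sum fun p hp => ?_)
  obtain ⟨h1, h2⟩ := mem_filter.1 hp
  obtain ⟨h3, h4⟩ := mem_product.1 h1
  exact sum_loneTuples_cancel_le hw hwneg (ne_of_mem_erase h3).symm (ne_of_mem_erase h4).symm h2
    (mem_of_mem_erase h3) (mem_of_mem_erase h4)

/-- Iterating the removal of cancelling pairs ends in a free tuple, so the saving `δ` survives at
the cost of a factor 1 + |ι|²M per round. -/
theorem sum_loneTuples_le {w : ZMod Q → ℝ} (hw : ∀ a, 0 ≤ w a) (hwneg : ∀ a, w (-a) = w a)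
    {M S δ : ℝ} (hM : 1 ≤ M) (hS : 0 ≤ S) (hδ : 0 ≤ δ)
    (hT : ∀ B : Finset ι, 2 ≤ B.card → ∑ α ∈ freeTuples Q B, ∏ l ∈ B, w (α l) ≤ δ * M * S ^ B.card)
    (hV : ∑ a ∈ univ.erase (0 : ZMod Q), w a ^ 2 ≤ M * S ^ 2) (n : ℕ) :
    ∀ (B : Finset ι) (m : ι), m ∈ B → B.card = n → ∑ α ∈ loneTuples Q B m, ∏ l ∈ B, w (α l) ≤
      δ * M * (1 + (Fintype.card ι : ℝ) ^ 2 * M) ^ n * S ^ n := by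
  induction n using Nat.strong_induction_on with
  | _ n ih =>
    intro B m hm hB
    set N : ℝ := (Fintype.card ι : ℝ) with hN
    have hN0 : 0 ≤ N := Nat.cast_nonneg _
    have hG : 1 ≤ 1 + N ^ 2 * M := by
      have : 0 ≤ N ^ 2 * M := by positivity
      linarith
    set G := 1 + N ^ 2 * M with hGdef
    have hn1 : 1 ≤ n := hB ▸ card_pos.2 ⟨m, hm⟩
    rcases hn1.eq_or_lt with h1 | h2
    · have : loneTuples Q B m = ∅ := by
        rw [loneTuples, suppTuples_eq_empty_of_card_eq_one (by omega), filter_empty]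
      rw [this, sum_empty]
      positivity
    obtain ⟨n', rfl⟩ : ∃ n', n = n' + 2 := ⟨n - 2, by omega⟩
    have hT' := hT B (by omega)
    rw [hB] at hT'
    refine (sum_loneTuples_le_add hw hwneg hm).trans ?_
    have hstep : ∑ p ∈ ((B.erase m) ×ˢ (B.erase m)).filter (fun p => p.1 ≠ p.2),
        (∑ a ∈ univ.erase (0 : ZMod Q), w a ^ 2) *
          ∑ γ ∈ loneTuples Q ((B.erase p.2).erase p.1) m,
            ∏ l ∈ (B.erase p.2).erase p.1, w (γ l) ≤
        N ^ 2 * (M * S ^ 2 * (δ * M * G ^ n' * S ^ n')) := by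
      have hb : ∀ p ∈ ((B.erase m) ×ˢ (B.erase m)).filter (fun p => p.1 ≠ p.2),
          (∑ a ∈ univ.erase (0 : ZMod Q), w a ^ 2) *
          ∑ γ ∈ loneTuples Q ((B.erase p.2).erase p.1) m,
            ∏ l ∈ (B.erase p.2).erase p.1, w (γ l) ≤ M * S ^ 2 * (δ * M * G ^ n' * S ^ n') := by
        intro p hp
        obtain ⟨h1, h2⟩ := mem_filter.1 hp
        obtain ⟨h3, h4⟩ := mem_product.1 h1
        have h5 := ih n' (by omega) ((B.erase p.2).erase p.1) m
          (mem_erase.2 ⟨(ne_of_mem_erase h3).symm, mem_erase.2 ⟨(ne_of_mem_erase h4).symm, hm⟩⟩) (by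
            rw [card_erase_of_mem (mem_erase.2 ⟨h2, mem_of_mem_erase h3⟩),
              card_erase_of_mem (mem_of_mem_erase h4)]
            omega)
        have h6 : 0 ≤ ∑ γ ∈ loneTuples Q ((B.erase p.2).erase p.1) m,
            ∏ l ∈ (B.erase p.2).erase p.1, w (γ l) :=
          sum_nonneg fun _ _ => prod_nonneg fun _ _ => hw _
        gcongr
      refine (sum_le_card_nsmul _ _ _ hb).trans ?_
      rw [nsmul_eq_mul]
      have hc : (((((B.erase m) ×ˢ (B.erase m)).filter fun p => p.1 ≠ p.2).card : ℕ) : ℝ)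
          ≤ N ^ 2 := by
        have h1 := card_filter_le ((B.erase m) ×ˢ (B.erase m)) (fun p => p.1 ≠ p.2)
        rw [card_product] at h1
        have h2 : (B.erase m).card ≤ Fintype.card ι := card_le_univ _
        rw [hN, sq]
        exact_mod_cast h1.trans (Nat.mul_le_mul h2 h2)
      gcongr
    calc _ ≤ δ * M * S ^ (n' + 2) + N ^ 2 * (M * S ^ 2 * (δ * M * G ^ n' * S ^ n')) :=
          add_le_add hT' hstep
      _ = δ * M * S ^ (n' + 2) * (1 + N ^ 2 * M * G ^ n') := by ring
      _ ≤ δ * M * S ^ (n' + 2) * G ^ (n' + 2) := by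
          gcongr
          have h1 : 1 ≤ G ^ n' := one_le_pow₀ hG
          calc 1 + N ^ 2 * M * G ^ n' ≤ G ^ n' + N ^ 2 * M * G ^ n' := by gcongr
            _ = G ^ (n' + 1) := by rw [pow_succ, hGdef]; ring
            _ ≤ _ := pow_le_pow_right₀ hG (by omega)
      _ = _ := by ring

/-- If two entries both cancel the entry at `m`, the removed frequency is determined by the rest. A
sum of squares of size M S² is thus replaced by a single square, at most `Λ`. -/
theorem sum_suppTuples_double_cancel_le {w : ZMod Q → ℝ} (hw : ∀ a, 0 ≤ w a)
    (hwneg : ∀ a, w (-a) = w a) {Λ : ℝ} (hΛ0 : 0 ≤ Λ) (hΛ : ∀ a, a ≠ 0 → w a ^ 2 ≤ Λ) {B : Finset ι} {m i j : ι}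
    (hmi : m ≠ i) (hmj : m ≠ j) (hij : i ≠ j) (hm : m ∈ B) (hj : j ∈ B) :
    ∑ α ∈ (suppTuples Q B).filter (fun α => α m + α i = 0 ∧ α m + α j = 0), ∏ l ∈ B, w (α l) ≤
      Λ * ∑ γ ∈ suppTuples Q ((B.erase j).erase m), ∏ l ∈ (B.erase j).erase m, w (γ l) := by
  have e : (suppTuples Q B).filter (fun α => α m + α i = 0 ∧ α m + α j = 0) =
      ((suppTuples Q B).filter (fun α => α m + α j = 0)).filter (fun α => α m + α i = 0) := by
    ext α
    simp only [mem_filter]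
    tauto
  rw [e, sum_filter, sum_suppTuples_cancel hmj hm hj, mul_sum]
  refine sum_le_sum fun γ _ => ?_
  have hp : 0 ≤ ∏ l ∈ (B.erase j).erase m, w (γ l) := prod_nonneg fun _ _ => hw _
  have h1 : ∀ a ∈ univ.erase (0 : ZMod Q),
      (if Function.update (Function.update γ m a) j (-a) m +
        Function.update (Function.update γ m a) j (-a) i = 0 then
        ∏ l ∈ B, w (Function.update (Function.update γ m a) j (-a) l) else 0) ≤
      if a = -γ i then Λ * ∏ l ∈ (B.erase j).erase m, w (γ l) else 0 := by
    intro a ha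
    rw [Function.update_of_ne hmj, Function.update_self, Function.update_of_ne hij,
      Function.update_of_ne hmi.symm, prod_update_update hmj hm hj (fun _ => w), hwneg, ← sq]
    simp only [← eq_neg_iff_add_eq_zero]
    split_ifs
    · exact mul_le_mul_of_nonneg_right (hΛ a (ne_of_mem_erase ha)) hp
    · exact le_rfl
  refine (sum_le_sum h1).trans ?_
  rw [sum_ite_eq']
  split_ifs with h
  · exact le_rfl
  · exact mul_nonneg hΛ0 hp

/-- The sum over j counts a tuple once for each index cancelling the entry at `m`. The difference
therefore weights a tuple by 1 minus the number of these indices: exactly one gives 0, none gives a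
lone tuple, two or more give a double cancellation. -/
theorem norm_suppSum_sub_le {a : ι → ZMod Q → ℂ} {w : ZMod Q → ℝ} (hw : ∀ a, 0 ≤ w a)
    (hwneg : ∀ a, w (-a) = w a) (haw : ∀ i x, ‖a i x‖ ≤ w x) {Λ : ℝ} (hΛ0 : 0 ≤ Λ) (hΛ : ∀ x, x ≠ 0 → w x ^ 2 ≤ Λ)
    {B : Finset ι} {m : ι} (hm : m ∈ B) :
    ‖suppSum Q a B - ∑ j ∈ B.erase m, pairSum a m j * suppSum Q a ((B.erase j).erase m)‖ ≤
      ∑ α ∈ loneTuples Q B m, ∏ l ∈ B, w (α l) +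
      ∑ p ∈ ((B.erase m) ×ˢ (B.erase m)).filter (fun p => p.1 ≠ p.2),
        Λ * ∑ γ ∈ suppTuples Q ((B.erase p.2).erase m), ∏ l ∈ (B.erase p.2).erase m, w (γ l) := by
  classical
  have hpos : ∀ α : ι → ZMod Q, 0 ≤ ∏ l ∈ B, w (α l) := fun α => prod_nonneg fun _ _ => hw _
  set J : (ι → ZMod Q) → Finset ι := fun α => (B.erase m).filter fun j => α m + α j = 0 with hJ
  set P := ((B.erase m) ×ˢ (B.erase m)).filter (fun p => p.1 ≠ p.2) with hP
  have e1 : ∑ j ∈ B.erase m, pairSum a m j * suppSum Q a ((B.erase j).erase m) =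
      ∑ α ∈ suppTuples Q B, ((J α).card : ℂ) * ∏ l ∈ B, a l (α l) := by
    calc _ = ∑ j ∈ B.erase m, ∑ α ∈ suppTuples Q B,
          if α m + α j = 0 then ∏ l ∈ B, a l (α l) else 0 := by
          refine sum_congr rfl fun j hj => ?_
          rw [← sum_filter, sum_suppTuples_cancel_prod (ne_of_mem_erase hj).symm hm
            (mem_of_mem_erase hj)]
          rfl
      _ = _ := by
          rw [sum_comm]
          refine sum_congr rfl fun α _ => ?_
          rw [← sum_filter, sum_const, nsmul_eq_mul]
  have hα : ∀ α ∈ suppTuples Q B, ‖(1 - ((J α).card : ℂ)) * ∏ l ∈ B, a l (α l)‖ ≤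
      (if ∀ j ∈ B, m ≠ j → α m + α j ≠ 0 then ∏ l ∈ B, w (α l) else 0) +
      ∑ p ∈ P, if α m + α p.1 = 0 ∧ α m + α p.2 = 0 then ∏ l ∈ B, w (α l) else 0 := by
    intro α _
    rw [norm_mul, norm_prod]
    have hprod : ∏ l ∈ B, ‖a l (α l)‖ ≤ ∏ l ∈ B, w (α l) :=
      prod_le_prod (fun _ _ => norm_nonneg _) fun l _ => haw l _
    have hp := hpos α
    by_cases hlone : ∀ j ∈ B, m ≠ j → α m + α j ≠ 0
    · have hJ0 : J α = ∅ := by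
        refine eq_empty_of_forall_notMem fun j hj => ?_
        obtain ⟨h1, h2⟩ := mem_filter.1 hj
        exact hlone j (mem_of_mem_erase h1) (ne_of_mem_erase h1).symm h2
      rw [if_pos hlone, hJ0]
      have : 0 ≤ ∑ p ∈ P, if α m + α p.1 = 0 ∧ α m + α p.2 = 0 then ∏ l ∈ B, w (α l) else 0 :=
        sum_nonneg fun p _ => by split_ifs <;> [exact hp; exact le_rfl]
      simpa using hprod.trans (le_add_of_nonneg_right this)
    · rw [if_neg hlone, zero_add, ← sum_filter, sum_const, nsmul_eq_mul]
      push Not at hlone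
      obtain ⟨j, hj, hmj, h0⟩ := hlone
      have hjJ : j ∈ J α := mem_filter.2 ⟨mem_erase.2 ⟨hmj.symm, hj⟩, h0⟩
      have hc1 : 1 ≤ (J α).card := card_pos.2 ⟨j, hjJ⟩
      -- With one cancelling index j fixed, each further one i gives a distinct pair (i, j) counted
      -- in the error.
      have hc2 : (J α).card - 1 ≤ (P.filter fun p => α m + α p.1 = 0 ∧ α m + α p.2 = 0).card := by
        rw [← card_erase_of_mem hjJ]
        refine card_le_card_of_injOn (fun i => (i, j)) ?_ (fun _ _ _ _ h => (Prod.mk.inj h).1)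
        intro i hi
        obtain ⟨hij, hiJ⟩ := mem_erase.1 hi
        obtain ⟨h1, h2⟩ := mem_filter.1 hiJ
        exact mem_filter.2 ⟨mem_filter.2 ⟨mem_product.2 ⟨h1, (mem_filter.1 hjJ).1⟩, hij⟩, h2, h0⟩
      have hn : ‖(1 - ((J α).card : ℂ))‖ = (((J α).card - 1 : ℕ) : ℝ) := by
        rw [norm_sub_rev, Nat.cast_sub hc1, ← Nat.cast_one, ← Nat.cast_sub hc1,
          ← Nat.cast_sub hc1, Complex.norm_natCast]
      rw [hn]
      have : (((J α).card - 1 : ℕ) : ℝ) ≤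
          ((P.filter fun p => α m + α p.1 = 0 ∧ α m + α p.2 = 0).card : ℝ) := by exact_mod_cast hc2
      gcongr
  rw [e1, suppSum, ← sum_sub_distrib]
  calc _ ≤ ∑ α ∈ suppTuples Q B, ‖(1 - ((J α).card : ℂ)) * ∏ l ∈ B, a l (α l)‖ := by
        refine (norm_sum_le _ _).trans (le_of_eq (sum_congr rfl fun α _ => ?_))
        rw [sub_mul, one_mul]
    _ ≤ _ := (sum_le_sum hα)
    _ = ∑ α ∈ loneTuples Q B m, ∏ l ∈ B, w (α l) + ∑ p ∈ P,
        ∑ α ∈ (suppTuples Q B).filter (fun α => α m + α p.1 = 0 ∧ α m + α p.2 = 0),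
          ∏ l ∈ B, w (α l) := by
        rw [sum_add_distrib, ← sum_filter, sum_comm, loneTuples]
        congr 1
        exact sum_congr rfl fun p _ => (sum_filter _ _).symm
    _ ≤ _ := by
        refine add_le_add le_rfl (sum_le_sum fun p hp => ?_)
        obtain ⟨h1, h2⟩ := mem_filter.1 hp
        obtain ⟨h3, h4⟩ := mem_product.1 h1
        exact sum_suppTuples_double_cancel_le hw hwneg hΛ0 hΛ (ne_of_mem_erase h3).symm
          (ne_of_mem_erase h4).symm h2 hm (mem_of_mem_erase h4)

/-- The Wick recursion for the moments, with the error term made explicit. -/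
theorem norm_suppSum_sub_le_of_bounds {a : ι → ZMod Q → ℂ} {w : ZMod Q → ℝ} (hw : ∀ a, 0 ≤ w a)
    (hwneg : ∀ a, w (-a) = w a) (haw : ∀ i x, ‖a i x‖ ≤ w x) {M S δ : ℝ} (hM : 1 ≤ M) (hS : 0 ≤ S)
    (hδ : 0 ≤ δ) (hΛ : ∀ x, x ≠ 0 → w x ^ 2 ≤ δ * S ^ 2)
    (hZ : ∀ B : Finset ι, ∑ α ∈ suppTuples Q B, ∏ l ∈ B, w (α l) ≤ M * S ^ B.card)
    (hT : ∀ B : Finset ι, 2 ≤ B.card → ∑ α ∈ freeTuples Q B, ∏ l ∈ B, w (α l) ≤ δ * M * S ^ B.card)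
    (hV : ∑ a ∈ univ.erase (0 : ZMod Q), w a ^ 2 ≤ M * S ^ 2) {B : Finset ι} {m : ι} (hm : m ∈ B) :
    ‖suppSum Q a B - ∑ j ∈ B.erase m, pairSum a m j * suppSum Q a ((B.erase j).erase m)‖ ≤
      2 * δ * M * (1 + (Fintype.card ι : ℝ) ^ 2 * M) ^ (Fintype.card ι + 1) * S ^ B.card := by
  set N : ℝ := (Fintype.card ι : ℝ) with hN
  have hN0 : 0 ≤ N := Nat.cast_nonneg _
  have hG : 1 ≤ 1 + N ^ 2 * M := by
    have : 0 ≤ N ^ 2 * M := by positivity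
    linarith
  set G := 1 + N ^ 2 * M with hGdef
  refine (norm_suppSum_sub_le hw hwneg haw (by positivity) hΛ hm).trans ?_
  have h1 := sum_loneTuples_le hw hwneg hM hS hδ hT hV _ B m hm rfl
  rw [← hN, ← hGdef] at h1
  have hcard : B.card ≤ Fintype.card ι := card_le_univ _
  have h2 : δ * M * G ^ B.card * S ^ B.card ≤ δ * M * G ^ (Fintype.card ι + 1) * S ^ B.card := by
    gcongr
    · omega
  have h3 : ∑ p ∈ ((B.erase m) ×ˢ (B.erase m)).filter (fun p => p.1 ≠ p.2),
        δ * S ^ 2 * ∑ γ ∈ suppTuples Q ((B.erase p.2).erase m),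
          ∏ l ∈ (B.erase p.2).erase m, w (γ l) ≤ N ^ 2 * (δ * M * S ^ B.card) := by
    have hb : ∀ p ∈ ((B.erase m) ×ˢ (B.erase m)).filter (fun p => p.1 ≠ p.2),
        δ * S ^ 2 * ∑ γ ∈ suppTuples Q ((B.erase p.2).erase m),
          ∏ l ∈ (B.erase p.2).erase m, w (γ l) ≤ δ * M * S ^ B.card := by
      intro p hp
      obtain ⟨h4, h5⟩ := mem_product.1 (mem_filter.1 hp).1
      have hc : ((B.erase p.2).erase m).card + 2 = B.card := by
        have e1 := card_erase_add_one (mem_of_mem_erase h5)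
        have e2 := card_erase_add_one (mem_erase.2 ⟨(ne_of_mem_erase h5).symm, hm⟩)
        omega
      calc _ ≤ δ * S ^ 2 * (M * S ^ ((B.erase p.2).erase m).card) := by gcongr; exact hZ _
        _ = δ * M * S ^ (((B.erase p.2).erase m).card + 2) := by ring
        _ = _ := by rw [hc]
    refine (sum_le_card_nsmul _ _ _ hb).trans ?_
    rw [nsmul_eq_mul]
    have hc : (((((B.erase m) ×ˢ (B.erase m)).filter fun p => p.1 ≠ p.2).card : ℕ) : ℝ)
        ≤ N ^ 2 := by
      have h1 := card_filter_le ((B.erase m) ×ˢ (B.erase m)) (fun p => p.1 ≠ p.2)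
      rw [card_product] at h1
      have h2 : (B.erase m).card ≤ Fintype.card ι := card_le_univ _
      rw [hN, sq]
      exact_mod_cast h1.trans (Nat.mul_le_mul h2 h2)
    gcongr
  have h4 : N ^ 2 * (δ * M * S ^ B.card) ≤ δ * M * G ^ (Fintype.card ι + 1) * S ^ B.card := by
    have : N ^ 2 ≤ G ^ (Fintype.card ι + 1) := by
      refine le_trans ?_ (le_self_pow₀ hG (by omega))
      nlinarith [sq_nonneg N]
    calc _ = δ * M * N ^ 2 * S ^ B.card := by ring
      _ ≤ _ := by gcongr
  linarith [show 2 * δ * M * G ^ (Fintype.card ι + 1) * S ^ B.card =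
    δ * M * G ^ (Fintype.card ι + 1) * S ^ B.card +
      δ * M * G ^ (Fintype.card ι + 1) * S ^ B.card by ring]

end Wick

/-! ### Fourier expansion of the centred unit indicator and of its class sums. -/

section Fourier

set_option linter.unusedSectionVars false

theorem pow_zero_or_one_of_squarefree {p n : ℕ} (hp : p.Prime) (h : Squarefree (p ^ n)) :
    n = 0 ∨ n = 1 := by
  by_contra hcon
  push Not at hcon
  have h2 : 2 ≤ n := by omega
  have := h p ((pow_two p).symm ▸ pow_dvd_pow p h2)
  exact hp.one_lt.ne' (Nat.isUnit_iff.1 this)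

/-- The Fourier coefficients of the normalized indicator function of the units. -/
noncomputable def unitCoeff {A : Type*} [AddMonoid A] (α : A) : ℂ :=
  (ArithmeticFunction.moebius (addOrderOf α) : ℂ) / ((addOrderOf α).totient : ℂ)

theorem sum_unitCoeff_mul_prime (p : ℕ) [hp : Fact p.Prime] (ψ : AddChar (ZMod p) ℂ)
    (hψ : ψ.IsPrimitive) (x : ZMod p) :
    ∑ α : ZMod p, unitCoeff α * ψ (α * x) = if x = 0 then 0 else (p : ℂ) / (p.totient : ℂ) := by
  classical
  have hp1 : (p : ℂ) - 1 ≠ 0 := by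
    have := hp.1.one_lt
    rw [sub_ne_zero]
    exact_mod_cast this.ne'
  have htot : ((p.totient : ℕ) : ℂ) = p - 1 := by
    rw [Nat.totient_prime hp.1, Nat.cast_sub hp.1.one_le, Nat.cast_one]
  have h0 : ∀ α ∈ univ.erase (0 : ZMod p), unitCoeff α * ψ (α * x) = -1 / ((p : ℂ) - 1) * ψ (α * x) := by
    intro α hα
    have : addOrderOf α = p := addOrderOf_eq_prime (by simp) (ne_of_mem_erase hα)
    rw [unitCoeff, this, ArithmeticFunction.moebius_apply_prime hp.1, htot]
    push_cast
    ring
  have hs := AddChar.sum_mulShift x hψ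
  rw [ZMod.card, ← add_sum_erase _ _ (mem_univ (0 : ZMod p)), zero_mul, AddChar.map_zero_eq_one] at hs
  rw [← add_sum_erase _ _ (mem_univ (0 : ZMod p)), sum_congr rfl h0, ← mul_sum, zero_mul,
    AddChar.map_zero_eq_one]
  have hs' := eq_sub_of_add_eq' hs
  have h1 : (unitCoeff (0 : ZMod p)) = 1 := by
    simp [unitCoeff]
  rw [hs', h1, htot]
  split_ifs
  · field_simp
    simp
  · field_simp
    push_cast
    ring

theorem unitCoeff_prodMk {a b : ℕ} [NeZero a] [NeZero b] (hab : a.Coprime b) (x : ZMod a)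
    (y : ZMod b) : unitCoeff (x, y) = unitCoeff x * unitCoeff y := by
  have hc : (addOrderOf x).Coprime (addOrderOf y) :=
    Nat.Coprime.of_dvd (addOrderOf_dvd_modulus x) (addOrderOf_dvd_modulus y) hab
  rw [unitCoeff, Prod.addOrderOf_mk, hc.lcm_eq_mul,
    ArithmeticFunction.isMultiplicative_moebius.map_mul_of_coprime hc, Nat.totient_mul hc,
    unitCoeff, unitCoeff]
  push_cast
  ring

/-- Ramanujan's expansion of the indicator of the units. Under the Chinese remainder theorem the
coefficients and the character factor, so it reduces to a prime modulus, where the coefficients are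
1 at 0 and -1/(p-1) elsewhere. -/
theorem sum_unitCoeff_mul (Q : ℕ) : Squarefree Q → ∀ (_ : NeZero Q) (ψ : AddChar (ZMod Q) ℂ)
    (_ : ψ.IsPrimitive) (x : ZMod Q) [Decidable (IsUnit x)],
    ∑ α : ZMod Q, unitCoeff α * ψ (α * x) = if IsUnit x then (Q : ℂ) / (Q.totient : ℂ) else 0 := by
  induction Q using Nat.recOnPrimeCoprime with
  | zero => intro h; simp at h
  | prime_pow p n hp =>
    intro hsq hne ψ hψ x hd
    rcases pow_zero_or_one_of_squarefree hp hsq with rfl | rfl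
    · have hsub : ∀ a : ZMod (p ^ 0), a = 0 := by
        rw [pow_zero]
        exact fun a => Subsingleton.elim a 0
      have hu : (univ : Finset (ZMod (p ^ 0))) = {0} :=
        eq_singleton_iff_unique_mem.2 ⟨mem_univ _, fun a _ => hsub a⟩
      -- Modulo 1 the only element is 0, and it is a unit.
      have hx : IsUnit x := ⟨⟨0, 0, (hsub _).trans (hsub _).symm, (hsub _).trans (hsub _).symm⟩,
        (hsub x).symm⟩
      rw [hu, sum_singleton, if_pos hx, zero_mul, AddChar.map_zero_eq_one, unitCoeff]
      erw [addOrderOf_zero]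
      simp
    · have : Fact (p ^ 1).Prime := ⟨by rwa [pow_one]⟩
      rw [sum_unitCoeff_mul_prime (p ^ 1) ψ hψ x]
      simp only [isUnit_iff_ne_zero]
      by_cases hx : x = 0 <;> simp [hx]
  | coprime a b ha hb hab iha ihb =>
    intro hsq hne ψ hψ x hd
    classical
    have : NeZero a := ⟨by omega⟩
    have : NeZero b := ⟨by omega⟩
    have hsa : Squarefree a := hsq.squarefree_of_dvd (dvd_mul_right a b)
    have hsb : Squarefree b := hsq.squarefree_of_dvd (dvd_mul_left b a)
    set e := ZMod.chineseRemainder hab with he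
    have hcomp : ∀ {c d : ZMod a × ZMod b}, ψ (e.symm (c * d)) =
        ψ (e.symm (c.1 * d.1, 0)) * ψ (e.symm (0, c.2 * d.2)) := by
      intro c d
      rw [← AddChar.map_add_eq_mul, ← map_add]
      congr 2
      ext <;> simp
    let ψ₁ : AddChar (ZMod a) ℂ :=
      { toFun := fun z => ψ (e.symm (z, 0))
        map_zero_eq_one' := by
          change ψ (e.symm 0) = 1
          rw [map_zero, AddChar.map_zero_eq_one]
        map_add_eq_mul' := fun y z => by
          rw [← AddChar.map_add_eq_mul, ← map_add, Prod.mk_add_mk, add_zero] }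
    let ψ₂ : AddChar (ZMod b) ℂ :=
      { toFun := fun z => ψ (e.symm (0, z))
        map_zero_eq_one' := by
          change ψ (e.symm 0) = 1
          rw [map_zero, AddChar.map_zero_eq_one]
        map_add_eq_mul' := fun y z => by
          rw [← AddChar.map_add_eq_mul, ← map_add, Prod.mk_add_mk, add_zero] }
    have hψ₁ : ψ₁.IsPrimitive := by
      intro c hc h1
      refine hψ (a := e.symm (c, 0)) ?_ ?_
      · rw [Ne, map_eq_zero_iff _ e.symm.injective]
        exact fun h => hc (Prod.mk.inj h).1
      · ext y
        have h2 := DFunLike.congr_fun h1 (e y).1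
        rw [AddChar.mulShift_apply, AddChar.one_apply] at h2 ⊢
        rw [← e.symm_apply_apply y, ← map_mul, hcomp]
        change ψ₁ _ * ψ₂ _ = 1
        rw [h2, zero_mul, AddChar.map_zero_eq_one, one_mul]
    have hψ₂ : ψ₂.IsPrimitive := by
      intro c hc h1
      refine hψ (a := e.symm (0, c)) ?_ ?_
      · rw [Ne, map_eq_zero_iff _ e.symm.injective]
        exact fun h => hc (Prod.mk.inj h).2
      · ext y
        have h2 := DFunLike.congr_fun h1 (e y).2
        rw [AddChar.mulShift_apply, AddChar.one_apply] at h2 ⊢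
        rw [← e.symm_apply_apply y, ← map_mul, hcomp]
        change ψ₁ _ * ψ₂ _ = 1
        rw [h2, zero_mul, AddChar.map_zero_eq_one, one_mul]
    have hunit : IsUnit x ↔ IsUnit (e x).1 ∧ IsUnit (e x).2 := by
      rw [← Prod.isUnit_iff, MulEquiv.isUnit_map e]
    have h1 := iha hsa ‹_› ψ₁ hψ₁ (e x).1
    have h2 := ihb hsb ‹_› ψ₂ hψ₂ (e x).2
    calc ∑ α : ZMod (a * b), unitCoeff α * ψ (α * x)
        = ∑ c : ZMod a × ZMod b, unitCoeff c.1 * ψ₁ (c.1 * (e x).1) *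
            (unitCoeff c.2 * ψ₂ (c.2 * (e x).2)) := by
          refine Fintype.sum_equiv e.toEquiv _ _ fun α => ?_
          have e1 : unitCoeff α = unitCoeff (e α).1 * unitCoeff (e α).2 := by
            rw [← unitCoeff_prodMk hab, Prod.mk.eta, unitCoeff, unitCoeff,
              addOrderOf_injective e.toAddMonoidHom e.injective α |>.symm]
            rfl
          have e2 : ψ (α * x) = ψ₁ ((e α).1 * (e x).1) * ψ₂ ((e α).2 * (e x).2) := by
            rw [← e.symm_apply_apply (α * x), map_mul e, hcomp]
            rfl
          rw [e1, e2]
          change _ = unitCoeff (e α).1 * ψ₁ ((e α).1 * (e x).1) *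
            (unitCoeff (e α).2 * ψ₂ ((e α).2 * (e x).2))
          ring
      _ = (∑ c, unitCoeff c * ψ₁ (c * (e x).1)) * ∑ c, unitCoeff c * ψ₂ (c * (e x).2) := by
          rw [sum_mul_sum, Fintype.sum_prod_type]
      _ = _ := by
          rw [h1, h2, Nat.totient_mul hab]
          simp only [hunit]
          by_cases hx1 : IsUnit (e x).1 <;> by_cases hx2 : IsUnit (e x).2 <;> simp [hx1, hx2]
          ring

/-- The exponential sum over the residue class `c` modulo `r` with frequency in `ZMod Q`. -/
noncomputable def classSum {Q : ℕ} [NeZero Q] (r h : ℕ) (c : ZMod r) (α : ZMod Q) : ℂ :=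
  ∑ m ∈ (Icc 1 h).filter (fun m : ℕ => (m : ZMod r) = c), ZMod.stdAddChar (α * (m : ZMod Q))

variable {Q : ℕ} [NeZero Q]

/-- |e(t) - 1| = 2|sin πt| ≥ 4‖t‖ by concavity of the sine. -/
theorem le_norm_stdAddChar_sub_one (α : ZMod Q) :
    4 * ((zabs α : ℝ) / Q) ≤ ‖(ZMod.stdAddChar α : ℂ) - 1‖ := by
  have hQ : (0 : ℝ) < Q := by exact_mod_cast Nat.pos_of_ne_zero (NeZero.ne Q)
  have e : (ZMod.stdAddChar α : ℂ) =
      Complex.exp (Complex.I * ((2 * Real.pi * α.valMinAbs / Q : ℝ) : ℂ)) := by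
    conv_lhs => rw [← ZMod.coe_valMinAbs α]
    rw [ZMod.stdAddChar_coe]
    congr 1
    push_cast
    ring
  rw [e, Complex.norm_exp_I_mul_ofReal_sub_one, Real.norm_eq_abs, abs_mul, abs_two]
  have hz : |((α.valMinAbs : ℤ) : ℝ)| = zabs α := by
    rw [zabs, Nat.cast_natAbs, Int.cast_abs]
  have hle : (zabs α : ℝ) ≤ Q / 2 := by
    have := ZMod.natAbs_valMinAbs_le α
    have h2 : zabs α * 2 ≤ Q := by
      rw [zabs]; omega
    have h3 : (zabs α : ℝ) * 2 ≤ Q := by exact_mod_cast h2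
    linarith
  have habs : |Real.sin (2 * Real.pi * α.valMinAbs / Q / 2)| =
      |Real.sin (Real.pi * (zabs α / Q))| := by
    rw [← hz]
    rcases abs_choice ((α.valMinAbs : ℤ) : ℝ) with h | h
    · rw [h]; congr 2; ring
    · rw [h, ← abs_neg, ← Real.sin_neg]; congr 2; ring
  rw [habs]
  have h1 := Real.mul_le_sin (x := Real.pi * (zabs α / Q)) (by positivity) (by
    have : (zabs α : ℝ) / Q ≤ 1 / 2 := by rw [div_le_iff₀ hQ]; linarith
    nlinarith [Real.pi_pos])
  have h2 : 2 / Real.pi * (Real.pi * (zabs α / Q)) = 2 * (zabs α / Q) := by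
    field_simp
  rw [h2] at h1
  have := h1.trans (le_abs_self _)
  linarith

theorem card_Ioc_filter_class_le_one {r : ℕ} (a : ℕ) (c : ZMod r) [DecidableEq (ZMod r)] :
    ((Ioc a (a + r)).filter (fun m : ℕ => (m : ZMod r) = c)).card ≤ 1 := by
  rw [card_le_one]
  intro x hx y hy
  rw [mem_filter, mem_Ioc] at hx hy
  have h := (ZMod.natCast_eq_natCast_iff x y r).1 (hx.2.trans hy.2.symm)
  rcases le_total x y with hxy | hxy
  · have := (Nat.modEq_iff_dvd' hxy).1 h
    rcases Nat.eq_zero_or_pos (y - x) with h0 | h0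
    · omega
    · have := Nat.le_of_dvd h0 this; omega
  · have := (Nat.modEq_iff_dvd' hxy).1 h.symm
    rcases Nat.eq_zero_or_pos (x - y) with h0 | h0
    · omega
    · have := Nat.le_of_dvd h0 this; omega

/-- The summand over the class is multiplied by e(αr) under m ↦ m + r, so the sum telescopes to two
blocks of length r. -/
theorem one_sub_mul_classSum {r : ℕ} (h : ℕ) (c : ZMod r) (α : ZMod Q) :
    (1 - ZMod.stdAddChar (α * (r : ZMod Q))) * classSum r h c α =
      ∑ m ∈ (Ioc 0 (0 + r)).filter (fun m : ℕ => (m : ZMod r) = c),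
        ZMod.stdAddChar (α * (m : ZMod Q)) -
      ∑ m ∈ (Ioc h (h + r)).filter (fun m : ℕ => (m : ZMod r) = c),
        ZMod.stdAddChar (α * (m : ZMod Q)) := by
  set f : ℕ → ℂ := fun m => if (m : ZMod r) = c then ZMod.stdAddChar (α * (m : ZMod Q)) else 0 with hf
  have hshift : ∀ m, f (m + r) = ZMod.stdAddChar (α * (r : ZMod Q)) * f m := by
    intro m
    simp only [hf, Nat.cast_add, ZMod.natCast_self, add_zero]
    split_ifs
    · rw [mul_add, AddChar.map_add_eq_mul, mul_comm]
    · simp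
  rw [classSum, sum_filter, sum_filter, sum_filter]
  change (1 - ZMod.stdAddChar (α * (r : ZMod Q))) * ∑ m ∈ Icc 1 h, f m =
    ∑ m ∈ Ioc 0 (0 + r), f m - ∑ m ∈ Ioc h (h + r), f m
  induction h with
  | zero => simp
  | succ h ih =>
    rw [sum_Icc_succ_top (by omega), mul_add, ih]
    have h1 : ∑ m ∈ Ioc h (h + 1 + r), f m = f (h + 1) + ∑ m ∈ Ioc (h + 1) (h + 1 + r), f m := by
      rw [← sum_Ioc_consecutive f (Nat.le_succ h) (by omega), Nat.Ioc_succ_singleton, sum_singleton]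
    have h2 : ∑ m ∈ Ioc h (h + 1 + r), f m = ∑ m ∈ Ioc h (h + r), f m + f (h + 1 + r) := by
      rw [show h + 1 + r = (h + r) + 1 by ring, sum_Ioc_succ_top (by omega)]
    have h3 := hshift (h + 1)
    have h4 := h1.symm.trans h2
    rw [h3] at h4
    linear_combination h4

theorem norm_sum_stdAddChar_le (S : Finset ℕ) (α : ZMod Q) :
    ‖∑ m ∈ S, (ZMod.stdAddChar (α * (m : ZMod Q)) : ℂ)‖ ≤ S.card := by
  refine (norm_sum_le _ _).trans ?_
  simp

/-- After telescoping, each boundary block contains at most one term of the class, so the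
geometric-series bound holds with the frequency multiplied by r. -/
theorem norm_classSum_le {r : ℕ} (h : ℕ) (c : ZMod r) {β : ZMod Q} (hβ : β * (r : ZMod Q) ≠ 0) :
    ‖classSum r h c β‖ ≤ fejer h (β * (r : ZMod Q)) := by
  have hQ : (0 : ℝ) < Q := by exact_mod_cast Nat.pos_of_ne_zero (NeZero.ne Q)
  refine le_min ?_ ?_
  · refine (norm_sum_stdAddChar_le _ _).trans ?_
    exact_mod_cast (card_filter_le _ _).trans (by simp)
  · have hz : (0 : ℝ) < zabs (β * (r : ZMod Q)) := by exact_mod_cast zabs_pos hβ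
    have h1 := congrArg norm (one_sub_mul_classSum h c β)
    rw [norm_mul, norm_sub_rev] at h1
    have h2 : ‖∑ m ∈ (Ioc 0 (0 + r)).filter (fun m : ℕ => (m : ZMod r) = c),
        ZMod.stdAddChar (β * (m : ZMod Q)) -
      ∑ m ∈ (Ioc h (h + r)).filter (fun m : ℕ => (m : ZMod r) = c),
        (ZMod.stdAddChar (β * (m : ZMod Q)) : ℂ)‖ ≤ 1 + 1 := by
      refine (norm_sub_le _ _).trans (add_le_add ?_ ?_) <;>
      · refine (norm_sum_stdAddChar_le _ _).trans ?_
        exact_mod_cast card_Ioc_filter_class_le_one _ c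
    rw [← h1] at h2
    have h3 := le_norm_stdAddChar_sub_one (β * (r : ZMod Q))
    have h4 : 4 * ((zabs (β * (r : ZMod Q)) : ℝ) / Q) * ‖classSum r h c β‖ ≤ 2 := by
      refine le_trans ?_ (h2.trans (by norm_num))
      gcongr
    rw [le_div_iff₀ hz]
    have h5 : (zabs (β * (r : ZMod Q)) : ℝ) / Q * ‖classSum r h c β‖ ≤ 1 := by linarith
    rw [div_mul_eq_mul_div, div_le_one hQ] at h5
    linarith

open scoped Classical in
/-- The normalized and centred indicator function of the units modulo `Q`. -/
noncomputable def unitVar (x : ZMod Q) : ℝ :=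
  (if IsUnit x then (Q : ℝ) / (Q.totient : ℝ) else 0) - 1

theorem unitVar_eq_sum (hQ : Squarefree Q) (x : ZMod Q) :
    ((unitVar x : ℝ) : ℂ) =
      ∑ α ∈ univ.erase (0 : ZMod Q), unitCoeff α * ZMod.stdAddChar (α * x) := by
  classical
  have h := sum_unitCoeff_mul Q hQ ‹_› ZMod.stdAddChar (ZMod.isPrimitive_stdAddChar Q) x
  rw [← add_sum_erase _ _ (mem_univ (0 : ZMod Q)), zero_mul, AddChar.map_zero_eq_one] at h
  have h1 : (unitCoeff (0 : ZMod Q)) = 1 := by simp [unitCoeff]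
  rw [h1, mul_one] at h
  rw [eq_sub_of_add_eq' h, unitVar]
  push_cast
  split_ifs <;> simp

/-- The sum of the centred indicator functions over a residue class in `[1, h]`. -/
noncomputable def classVar (r h : ℕ) (c : ZMod r) (n : ZMod Q) : ℝ :=
  ∑ m ∈ (Icc 1 h).filter (fun m : ℕ => (m : ZMod r) = c), unitVar (n + (m : ZMod Q))

theorem classVar_eq_sum (hQ : Squarefree Q) (r h : ℕ) (c : ZMod r) (n : ZMod Q) :
    ((classVar r h c n : ℝ) : ℂ) = ∑ α ∈ univ.erase (0 : ZMod Q),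
      unitCoeff α * classSum r h c α * ZMod.stdAddChar (α * n) := by
  rw [classVar, Complex.ofReal_sum]
  simp_rw [unitVar_eq_sum hQ, classSum, mul_sum, sum_mul]
  rw [sum_comm]
  refine sum_congr rfl fun α _ => sum_congr rfl fun m _ => ?_
  rw [mul_add, AddChar.map_add_eq_mul]
  ring

variable {ι : Type*} [Fintype ι] [DecidableEq ι]

theorem addChar_map_sum {A : Type*} [AddCommMonoid A] (ψ : AddChar A ℂ) (s : Finset ι) (f : ι → A) :
    ψ (∑ i ∈ s, f i) = ∏ i ∈ s, ψ (f i) := by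
  induction s using Finset.induction_on with
  | empty => simp
  | insert i s hi ih => rw [sum_insert hi, prod_insert hi, AddChar.map_add_eq_mul, ih]

/-- Orthogonality of the characters keeps exactly the tuples of frequencies with sum zero. -/
theorem sum_prod_fourier (g : ι → ZMod Q → ℂ) (B : Finset ι) :
    ∑ n : ZMod Q, ∏ i ∈ B, ∑ α ∈ univ.erase (0 : ZMod Q), g i α * ZMod.stdAddChar (α * n) =
      Q * suppSum Q g B := by
  classical
  set G : ι → ZMod Q → ℂ := fun i α =>
    if i ∈ B then (if α = 0 then 0 else g i α) else (if α = 0 then 1 else 0) with hG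
  have h1 : ∀ n : ZMod Q, ∏ i ∈ B, ∑ α ∈ univ.erase (0 : ZMod Q),
      g i α * ZMod.stdAddChar (α * n) = ∏ i, ∑ α, G i α * ZMod.stdAddChar (α * n) := by
    intro n
    rw [← prod_subset (subset_univ B)]
    · refine prod_congr rfl fun i hi => ?_
      rw [← add_sum_erase univ _ (mem_univ (0 : ZMod Q))]
      simp only [hG, hi, if_true, zero_mul, zero_add]
      exact sum_congr rfl fun α hα => by rw [if_neg (ne_of_mem_erase hα)]
    · intro i _ hi
      rw [← add_sum_erase univ _ (mem_univ (0 : ZMod Q))]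
      simp only [hG, hi, if_false, if_true, zero_mul, AddChar.map_zero_eq_one, one_mul]
      rw [sum_eq_zero, add_zero]
      intro α hα
      rw [if_neg (ne_of_mem_erase hα), zero_mul]
  have h2 : ∀ n : ZMod Q, ∏ i, ∑ α, G i α * ZMod.stdAddChar (α * n) =
      ∑ α : ι → ZMod Q, (∏ i, G i (α i)) * ZMod.stdAddChar (n * ∑ i, α i) := by
    intro n
    rw [prod_univ_sum, Fintype.piFinset_univ]
    refine sum_congr rfl fun α _ => ?_
    rw [prod_mul_distrib, mul_sum, addChar_map_sum]
    simp_rw [mul_comm n]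
  simp_rw [h1, h2]
  rw [sum_comm, suppSum, mul_sum, ← sum_subset (subset_univ (suppTuples Q B))]
  · refine sum_congr rfl fun α hα => ?_
    obtain ⟨hs, hB⟩ := mem_suppTuples.1 hα
    rw [hs]
    simp only [mul_zero, AddChar.map_zero_eq_one, mul_one, sum_const, card_univ, ZMod.card,
      nsmul_eq_mul]
    congr 1
    rw [← prod_subset (subset_univ B)]
    · refine prod_congr rfl fun i hi => ?_
      simp [hG, hi, (hB i).2 hi]
    · intro i _ hi
      have : α i = 0 := by
        by_contra h
        exact hi ((hB i).1 h)
      simp [hG, hi, this]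
  · intro α _ hα
    rw [← mul_sum]
    by_cases hs : ∑ i, α i = 0
    · have : ¬ ∀ i, α i ≠ 0 ↔ i ∈ B := fun h => hα (mem_suppTuples.2 ⟨hs, h⟩)
      push Not at this
      obtain ⟨i, hi⟩ := this
      have h0 : G i (α i) = 0 := by
        rcases hi with ⟨h1, h2⟩ | ⟨h1, h2⟩ <;> simp [hG, h1, h2]
      rw [prod_eq_zero (mem_univ i) h0, zero_mul]
    · rw [AddChar.sum_mulShift _ (ZMod.isPrimitive_stdAddChar Q), if_neg hs]
      simp

theorem sum_suppTuples_unit_mul {M : Type*} [AddCommMonoid M] (u : (ZMod Q)ˣ) (B : Finset ι)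
    (F : (ι → ZMod Q) → M) :
    ∑ α ∈ suppTuples Q B, F (fun i => u * α i) = ∑ α ∈ suppTuples Q B, F α := by
  refine sum_bij' (fun α _ i => u * α i) (fun α _ i => (u⁻¹ : (ZMod Q)ˣ) * α i) ?_ ?_ ?_ ?_ ?_
  · intro α hα
    obtain ⟨hs, hB⟩ := mem_suppTuples.1 hα
    refine mem_suppTuples.2 ⟨by rw [← mul_sum, hs, mul_zero], fun i => ?_⟩
    rw [Ne, Units.mul_right_eq_zero, ← hB]
  · intro α hα
    obtain ⟨hs, hB⟩ := mem_suppTuples.1 hα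
    refine mem_suppTuples.2 ⟨by rw [← mul_sum, hs, mul_zero], fun i => ?_⟩
    rw [Ne, Units.mul_right_eq_zero, ← hB]
  · intro α _; funext i; simp
  · intro α _; funext i; simp
  · intro α _; rfl

/-- Dilation by a unit preserves both the hyperplane and the supports. It allows the passage from
frequency α to α/r, after which the bound for the coefficients no longer involves r. -/
theorem suppSum_unit_mul (u : (ZMod Q)ˣ) (g : ι → ZMod Q → ℂ) (B : Finset ι) :
    suppSum Q (fun i x => g i (u * x)) B = suppSum Q g B :=
  sum_suppTuples_unit_mul u B fun α => ∏ i ∈ B, g i (α i)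

theorem addOrderOf_unit_mul (u : (ZMod Q)ˣ) (α : ZMod Q) : addOrderOf ((u : ZMod Q) * α) = addOrderOf α :=
  addOrderOf_injective (AddMonoidHom.mulLeft (u : ZMod Q)) (fun _ _ h => u.mul_right_inj.1 h) α

theorem norm_unitCoeff_le (α : ZMod Q) : ‖unitCoeff α‖ ≤ 1 / ((addOrderOf α).totient : ℝ) := by
  rw [unitCoeff, norm_div, Complex.norm_natCast]
  gcongr
  rw [Complex.norm_intCast]
  exact_mod_cast ArithmeticFunction.abs_moebius_le_one

/-- The Fourier coefficients of `classVar`, with the frequency divided by `r`. -/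
noncomputable def classCoeff {r : ℕ} (hr : r.Coprime Q) (h : ℕ) (c : ZMod r) (α : ZMod Q) : ℂ :=
  if α = 0 then 0 else unitCoeff α * classSum r h c ((((ZMod.unitOfCoprime r hr)⁻¹ : (ZMod Q)ˣ) : ZMod Q) * α)

theorem norm_classCoeff_le {r : ℕ} (hr : r.Coprime Q) (h : ℕ) (c : ZMod r) (α : ZMod Q) :
    ‖classCoeff hr h c α‖ ≤ fejerWeight h α := by
  rw [classCoeff]
  split_ifs with h0
  · rw [norm_zero]
    exact fejerWeight_nonneg (Nat.cast_nonneg h) α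
  · have e : (((ZMod.unitOfCoprime r hr)⁻¹ : (ZMod Q)ˣ) : ZMod Q) * α * (r : ZMod Q) = α := by
      rw [mul_comm, ← mul_assoc, ← ZMod.coe_unitOfCoprime r hr, Units.mul_inv, one_mul]
    have h1 := norm_classSum_le h c (β := (((ZMod.unitOfCoprime r hr)⁻¹ : (ZMod Q)ˣ) : ZMod Q) * α)
      (by rwa [e])
    rw [e] at h1
    rw [norm_mul, fejerWeight, mul_comm, div_eq_mul_one_div]
    have := norm_unitCoeff_le α
    have := fejer_nonneg (Nat.cast_nonneg (α := ℝ) h) α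
    gcongr

theorem sum_prod_classVar (hQ : Squarefree Q) {r : ℕ} (hr : r.Coprime Q) (h : ℕ) (c : ι → ZMod r)
    (B : Finset ι) :
    ((∑ n : ZMod Q, ∏ i ∈ B, classVar r h (c i) n : ℝ) : ℂ) =
      Q * suppSum Q (fun i => classCoeff hr h (c i)) B := by
  push_cast
  simp_rw [classVar_eq_sum hQ]
  rw [sum_prod_fourier, ← suppSum_unit_mul (ZMod.unitOfCoprime r hr)⁻¹]
  congr 1
  refine sum_congr rfl fun α hα => prod_congr rfl fun i hi => ?_
  simp only [classCoeff]
  rw [if_neg (((mem_suppTuples.1 hα).2 i).2 hi), unitCoeff, addOrderOf_unit_mul, ← unitCoeff]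

end Fourier

/-! ### The sums V_k as moments over `ZMod Q`. -/

section ReducedFractions

variable {Q : ℕ} [NeZero Q]

/-- The element of `ZMod Q` that corresponds to the fraction `a / q`, for `q ∣ Q`. -/
def fracElt (Q q a : ℕ) : ZMod Q := ((a * (Q / q) : ℕ) : ZMod Q)

/-- The numerator of `α / Q` in lowest terms. -/
noncomputable def fracNum (α : ZMod Q) : ℕ := α.val * addOrderOf α / Q

theorem fracNum_mul (α : ZMod Q) : fracNum α * (Q / addOrderOf α) = α.val := by
  have hQ : 0 < Q := Nat.pos_of_ne_zero (NeZero.ne Q)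
  obtain ⟨t, ht⟩ := addOrderOf_dvd_modulus α
  have hq := addOrderOf_pos_zmod α
  have h1 : Q ∣ α.val * addOrderOf α := by
    have := addOrderOf_nsmul_eq_zero α
    rw [← ZMod.natCast_zmod_val α, nsmul_eq_mul, ← Nat.cast_mul, ZMod.natCast_eq_zero_iff,
      ZMod.natCast_zmod_val, mul_comm] at this
    exact this
  obtain ⟨a, ha⟩ := h1
  have ht' : Q / addOrderOf α = t := Nat.div_eq_of_eq_mul_right hq ht
  rw [fracNum, ha, Nat.mul_div_cancel_left _ hQ, ht']
  refine Nat.eq_of_mul_eq_mul_right hq ?_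
  rw [ha]
  conv_rhs => rw [ht]
  ring

theorem fracElt_fracNum (α : ZMod Q) : fracElt Q (addOrderOf α) (fracNum α) = α := by
  rw [fracElt, fracNum_mul, ZMod.natCast_zmod_val]

theorem addOrderOf_fracElt {q a : ℕ} (hq : q ∣ Q) (ha : a.Coprime q) :
    addOrderOf (fracElt Q q a) = q := by
  have hQ : Q ≠ 0 := NeZero.ne Q
  obtain ⟨t, rfl⟩ := hq
  have hq0 : 0 < q := Nat.pos_of_ne_zero (left_ne_zero_of_mul hQ)
  have ht0 : 0 < t := Nat.pos_of_ne_zero (right_ne_zero_of_mul hQ)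
  rw [fracElt, ZMod.addOrderOf_coe _ hQ, Nat.mul_div_cancel_left _ hq0, Nat.gcd_mul_right,
    Nat.gcd_comm, ha.gcd_eq_one, one_mul, Nat.mul_div_cancel _ ht0]

theorem coprime_fracNum (α : ZMod Q) : (fracNum α).Coprime (addOrderOf α) := by
  have hQ : Q ≠ 0 := NeZero.ne Q
  have hq := addOrderOf_pos_zmod α
  have h2 := ZMod.addOrderOf_coe (fracNum α * (Q / addOrderOf α)) hQ
  change addOrderOf (fracElt Q _ _) = _ at h2
  rw [fracElt_fracNum] at h2
  obtain ⟨t, ht⟩ := addOrderOf_dvd_modulus α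
  have ht' : Q / addOrderOf α = t := Nat.div_eq_of_eq_mul_right hq ht
  have ht0 : 0 < t := Nat.pos_of_ne_zero (by rintro rfl; simp at ht; exact hQ ht)
  generalize fracNum α = a at *
  generalize addOrderOf α = q at *
  rw [ht'] at h2
  clear ht'
  subst ht
  rw [Nat.gcd_mul_right, Nat.mul_div_mul_right _ _ ht0] at h2
  have hdvd := Nat.gcd_dvd_left q a
  have h3 := Nat.div_mul_cancel hdvd
  rw [← h2] at h3
  have h4 : q.gcd a = 1 := Nat.eq_of_mul_eq_mul_left hq (by rw [h3, mul_one])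
  rw [Nat.Coprime, Nat.gcd_comm, h4]

theorem one_lt_addOrderOf {α : ZMod Q} (h : α ≠ 0) : 1 < addOrderOf α := by
  have h1 := addOrderOf_pos_zmod α
  have h2 : addOrderOf α ≠ 1 := fun h' => h (AddMonoid.addOrderOf_eq_one_iff.1 h')
  omega

theorem fracNum_mem {α : ZMod Q} (h : α ≠ 0) : fracNum α ∈ Icc 1 (addOrderOf α) := by
  have hQ : 0 < Q := Nat.pos_of_ne_zero (NeZero.ne Q)
  have h1 := coprime_fracNum α
  rw [mem_Icc]
  constructor
  · by_contra hcon
    have : fracNum α = 0 := by omega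
    rw [this, Nat.coprime_zero_left] at h1
    exact (one_lt_addOrderOf h).ne' h1
  · rw [fracNum]
    refine Nat.div_le_of_le_mul ?_
    exact Nat.mul_le_mul_right _ (ZMod.val_lt α).le

theorem fracNum_fracElt {q a : ℕ} (hq : q ∣ Q) (hq1 : 1 < q) (ha : a.Coprime q) (haq : a ≤ q) :
    fracNum (fracElt Q q a) = a := by
  have hQ : Q ≠ 0 := NeZero.ne Q
  rw [fracNum, addOrderOf_fracElt hq ha, fracElt]
  obtain ⟨t, rfl⟩ := hq
  have hq0 : 0 < q := by omega
  have ht0 : 0 < t := Nat.pos_of_ne_zero (right_ne_zero_of_mul hQ)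
  -- The numerator a = q is allowed by the range but excluded by coprimality, since q > 1.
  have hlt : a < q := by
    refine lt_of_le_of_ne haq ?_
    rintro rfl
    exact hq1.ne' ((Nat.coprime_self a).1 ha)
  rw [Nat.mul_div_cancel_left _ hq0, ZMod.val_natCast_of_lt (Nat.mul_lt_mul_of_pos_right hlt ht0),
    show a * t * q = a * (q * t) by ring, Nat.mul_div_cancel _ (Nat.pos_of_ne_zero hQ)]

theorem expSum_eq_classSum {r : ℕ} (h : ℕ) (c : ZMod r) {q a : ℕ} (hq : q ∣ Q) :
    expSum r h c ((a : ℝ) / (q : ℝ)) = classSum r h c (fracElt Q q a) := by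
  have hQ : Q ≠ 0 := NeZero.ne Q
  rw [expSum, classSum]
  refine sum_congr (by ext; simp) fun m _ => ?_
  obtain ⟨t, ht⟩ := hq
  have hq0 : q ≠ 0 := by rintro rfl; simp at ht; exact hQ ht
  have ht0 : t ≠ 0 := by rintro rfl; simp at ht; exact hQ ht
  have e : fracElt Q q a * (m : ZMod Q) = (((a * t * m : ℕ) : ℤ) : ZMod Q) := by
    rw [fracElt, ht, Nat.mul_div_cancel_left _ (Nat.pos_of_ne_zero hq0)]
    push_cast
    ring
  rw [e, ZMod.stdAddChar_coe]
  congr 1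
  rw [ht]
  have hq' : (q : ℂ) ≠ 0 := by exact_mod_cast hq0
  have ht' : (t : ℂ) ≠ 0 := by exact_mod_cast ht0
  push_cast
  field_simp

theorem sum_fracElt_eq_zero_iff {ι : Type*} (s : Finset ι) (q a : ι → ℕ) (hq : ∀ i, q i ∣ Q) :
    ∑ i ∈ s, fracElt Q (q i) (a i) = 0 ↔ ∃ n : ℤ, ∑ i ∈ s, (a i : ℚ) / (q i : ℚ) = (n : ℚ) := by
  have hQ : (Q : ℚ) ≠ 0 := by exact_mod_cast NeZero.ne Q
  have e : ∑ i ∈ s, (a i : ℚ) / (q i : ℚ) = ((∑ i ∈ s, a i * (Q / q i) : ℕ) : ℚ) / Q := by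
    rw [Nat.cast_sum, sum_div]
    refine sum_congr rfl fun i _ => ?_
    obtain ⟨t, ht⟩ := hq i
    have hq0 : q i ≠ 0 := by
      intro h0
      rw [h0, zero_mul] at ht
      exact NeZero.ne Q ht
    have ht0 : t ≠ 0 := by
      rintro rfl
      exact NeZero.ne Q (by simpa using ht)
    rw [ht, Nat.mul_div_cancel_left _ (Nat.pos_of_ne_zero hq0)]
    push_cast
    have : (q i : ℚ) ≠ 0 := by exact_mod_cast hq0
    have : (t : ℚ) ≠ 0 := by exact_mod_cast ht0
    field_simp
  rw [e]
  simp only [fracElt]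
  rw [← Nat.cast_sum, ZMod.natCast_eq_zero_iff]
  set S := ∑ i ∈ s, a i * (Q / q i)
  constructor
  · rintro ⟨n, hn⟩
    refine ⟨n, ?_⟩
    rw [hn]
    push_cast
    field_simp
  · rintro ⟨n, hn⟩
    rw [div_eq_iff hQ] at hn
    have hn' : (S : ℤ) = n * Q := by exact_mod_cast hn
    have : (Q : ℤ) ∣ S := ⟨n, by rw [hn', mul_comm]⟩
    exact_mod_cast this

/-- A nonzero element of `ZMod Q` is a reduced fraction whose denominator is its additive order; the
condition that the fractions add up to an integer is the condition of sum zero. Coprimality of the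
denominators to r is automatic. -/
theorem sumV_eq_suppSum {k r : ℕ} (hr : r.Coprime Q) (h : ℕ) (c : Fin k → ZMod r) :
    sumV Q h r c = suppSum Q (fun i α => unitCoeff α * classSum r h (c i) α) univ := by
  classical
  rw [sumV, suppSum]
  simp_rw [mul_sum]
  rw [sum_sigma']
  refine sum_bij' (fun x _ i => fracElt Q (x.1 i) (x.2 i))
    (fun α _ => ⟨fun i => addOrderOf (α i), fun i => fracNum (α i)⟩) ?_ ?_ ?_ ?_ ?_
  · rintro ⟨q, a⟩ hx
    obtain ⟨hq, ha⟩ := mem_sigma.1 hx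
    obtain ⟨ha, hs⟩ := mem_filter.1 ha
    simp only [Fintype.mem_piFinset, mem_filter, Nat.mem_divisors, mem_Icc] at hq ha
    refine mem_suppTuples.2 ⟨?_, fun i => ?_⟩
    · rw [sum_fracElt_eq_zero_iff _ _ _ fun i => (hq i).1.1]
      exact hs
    · refine iff_of_true (fun h0 => ?_) (mem_univ i)
      have := addOrderOf_fracElt (hq i).1.1 (ha i).2
      dsimp only at h0
      rw [h0, addOrderOf_zero] at this
      exact (hq i).2.1.ne this
  · intro α hα
    obtain ⟨hs, hB⟩ := mem_suppTuples.1 hα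
    have hne : ∀ i, α i ≠ 0 := fun i => (hB i).2 (mem_univ i)
    refine mem_sigma.2 ⟨?_, mem_filter.2 ⟨?_, ?_⟩⟩
    · simp only [Fintype.mem_piFinset, mem_filter, Nat.mem_divisors]
      exact fun i => ⟨⟨addOrderOf_dvd_modulus _, NeZero.ne Q⟩, one_lt_addOrderOf (hne i),
        (hr.coprime_dvd_right (addOrderOf_dvd_modulus _)).symm⟩
    · simp only [Fintype.mem_piFinset, mem_filter]
      exact fun i => ⟨fracNum_mem (hne i), coprime_fracNum _⟩
    · rw [← sum_fracElt_eq_zero_iff (Q := Q) _ _ _ fun i => addOrderOf_dvd_modulus (α i)]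
      simpa only [fracElt_fracNum] using hs
  · rintro ⟨q, a⟩ hx
    obtain ⟨hq, ha⟩ := mem_sigma.1 hx
    obtain ⟨ha, hs⟩ := mem_filter.1 ha
    simp only [Fintype.mem_piFinset, mem_filter, Nat.mem_divisors, mem_Icc] at hq ha
    have e1 : (fun i => addOrderOf (fracElt Q (q i) (a i))) = q :=
      funext fun i => addOrderOf_fracElt (hq i).1.1 (ha i).2
    have e2 : (fun i => fracNum (fracElt Q (q i) (a i))) = a :=
      funext fun i => fracNum_fracElt (hq i).1.1 (hq i).2.1 (ha i).2 (ha i).1.2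
    dsimp only
    rw [e1, e2]
  · intro α _
    funext i
    exact fracElt_fracNum _
  · rintro ⟨q, a⟩ hx
    obtain ⟨hq, ha⟩ := mem_sigma.1 hx
    obtain ⟨ha, hs⟩ := mem_filter.1 ha
    simp only [Fintype.mem_piFinset, mem_filter, Nat.mem_divisors, mem_Icc] at hq ha
    rw [← prod_mul_distrib]
    refine prod_congr rfl fun i _ => ?_
    dsimp only
    rw [expSum_eq_classSum h (c i) (hq i).1.1, unitCoeff, addOrderOf_fracElt (hq i).1.1 (ha i).2]

theorem sumV_pair_eq {r : ℕ} (hQ : Squarefree Q) (hr : r.Coprime Q) (h : ℕ) (c₁ c₂ : ZMod r) :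
    sumV Q h r ![c₁, c₂] =
      (((∑ n : ZMod Q, classVar r h c₁ n * classVar r h c₂ n) / Q : ℝ) : ℂ) := by
  have hQ0 : (Q : ℂ) ≠ 0 := by exact_mod_cast NeZero.ne Q
  rw [sumV_eq_suppSum hr]
  have h1 := sum_prod_fourier (fun (i : Fin 2) (α : ZMod Q) => unitCoeff α * classSum r h (![c₁, c₂] i) α)
    (univ : Finset (Fin 2))
  simp_rw [← classVar_eq_sum hQ, Fin.prod_univ_two] at h1
  rw [Complex.ofReal_div, Complex.ofReal_natCast, eq_div_iff hQ0, mul_comm, ← h1]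
  push_cast
  rfl

/-- For two indices, sum zero means that the entries cancel, so the covariance is the moment of
order two. -/
theorem pairSum_classCoeff {ι : Type*} [Fintype ι] [DecidableEq ι] {r : ℕ} (hQ : Squarefree Q)
    (hr : r.Coprime Q) (h : ℕ) (c : ι → ZMod r) (i j : ι) :
    pairSum (Q := Q) (fun i => classCoeff hr h (c i)) i j =
      (((∑ n : ZMod Q, classVar r h (c i) n * classVar r h (c j) n) / Q : ℝ) : ℂ) := by
  have hQ0 : (Q : ℂ) ≠ 0 := by exact_mod_cast NeZero.ne Q
  have h1 := sum_prod_classVar hQ hr h (![c i, c j]) (univ : Finset (Fin 2))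
  simp only [Fin.prod_univ_two, Matrix.cons_val_zero, Matrix.cons_val_one] at h1
  rw [Complex.ofReal_div, h1, Complex.ofReal_natCast, mul_div_cancel_left₀ _ hQ0, suppSum, pairSum]
  have h2 := sum_suppTuples_cancel (Q := Q) (B := (univ : Finset (Fin 2))) (i := 0) (j := 1)
    (by decide) (mem_univ _) (mem_univ _) fun (α : Fin 2 → ZMod Q) => ∏ l : Fin 2, classCoeff hr h (![c i, c j] l) (α l : ZMod Q)
  have h3 : ((univ : Finset (Fin 2)).erase 1).erase 0 = ∅ := by decide
  have h4 : suppTuples Q (∅ : Finset (Fin 2)) = {0} := by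
    ext α
    rw [mem_suppTuples, mem_singleton]
    constructor
    · rintro ⟨-, hB⟩
      funext l
      by_contra hl
      exact absurd ((hB l).1 hl) (notMem_empty l)
    · rintro rfl
      simp
  have h5 : (suppTuples Q (univ : Finset (Fin 2))).filter (fun α => α 0 + α 1 = 0) =
      suppTuples Q univ := by
    refine filter_true_of_mem fun α hα => ?_
    have := (mem_suppTuples.1 hα).1
    rwa [Fin.sum_univ_two] at this
  rw [h3, h4, sum_singleton, h5] at h2
  rw [h2]
  refine sum_congr rfl fun x _ => ?_
  simp [Fin.prod_univ_two]

end ReducedFractions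

/-! ### Perfect matchings and the shape of the main term. -/

section Matchings

variable {k : ℕ}

/-- The sum over the perfect matchings of `X` of the products of `g` over the pairs. -/
noncomputable def matchSum {R : Type*} [CommRing R] (g : Fin k → Fin k → R) (X : Finset (Fin k)) : R :=
  ∑ σ ∈ perfectMatchings X, ∏ p ∈ σ, g p.1 p.2

theorem mem_perfectMatchings {X : Finset (Fin k)} {σ : Finset (Fin k × Fin k)} :
    σ ∈ perfectMatchings X ↔ (∀ p ∈ σ, p.1 ∈ X ∧ p.2 ∈ X) ∧ (∀ p ∈ σ, p.1 < p.2) ∧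
      ∀ i ∈ X, ∃! j, j ∈ X ∧ ((i, j) ∈ σ ∨ (j, i) ∈ σ) := by
  classical
  rw [perfectMatchings, mem_filter, mem_powerset, subset_iff]
  simp only [mem_product]

/-- The pair `{i, j}`, listed in increasing order. -/
def sortPair (i j : Fin k) : Fin k × Fin k := (min i j, max i j)

theorem sortPair_comm (i j : Fin k) : sortPair i j = sortPair j i := by
  rw [sortPair, sortPair, min_comm, max_comm]

theorem sortPair_of_lt {i j : Fin k} (h : i < j) : sortPair i j = (i, j) := by
  rw [sortPair, min_eq_left h.le, max_eq_right h.le]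

theorem sortPair_eq_or (i j : Fin k) : sortPair i j = (i, j) ∨ sortPair i j = (j, i) := by
  rcases le_total i j with h | h
  · left; rw [sortPair, min_eq_left h, max_eq_right h]
  · right; rw [sortPair, min_eq_right h, max_eq_left h]

theorem mem_iff_sortPair_mem {σ : Finset (Fin k × Fin k)} (hσ : ∀ p ∈ σ, p.1 < p.2)
    {i j : Fin k} : (i, j) ∈ σ ∨ (j, i) ∈ σ ↔ sortPair i j ∈ σ := by
  constructor
  · rintro (h | h)
    · rwa [sortPair_of_lt (hσ _ h)]
    · rwa [sortPair_comm, sortPair_of_lt (hσ _ h)]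
  · intro h
    rcases sortPair_eq_or i j with e | e <;> rw [e] at h
    · exact Or.inl h
    · exact Or.inr h

theorem sortPair_eq_iff {i j a b : Fin k} :
    sortPair i j = sortPair a b ↔ (i = a ∧ j = b) ∨ (i = b ∧ j = a) := by
  constructor
  · intro h
    rcases sortPair_eq_or i j with e | e <;> rcases sortPair_eq_or a b with e' | e' <;>
      rw [e, e', Prod.mk.injEq] at h <;> tauto
  · rintro (⟨rfl, rfl⟩ | ⟨rfl, rfl⟩)
    · rfl
    · exact sortPair_comm _ _

theorem mem_perfectMatchings' {X : Finset (Fin k)} {σ : Finset (Fin k × Fin k)} :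
    σ ∈ perfectMatchings X ↔ (∀ p ∈ σ, p.1 ∈ X ∧ p.2 ∈ X) ∧ (∀ p ∈ σ, p.1 < p.2) ∧
      ∀ i ∈ X, ∃! j, sortPair i j ∈ σ := by
  rw [mem_perfectMatchings]
  refine and_congr_right fun h1 => and_congr_right fun h2 => forall₂_congr fun i _ => ?_
  refine existsUnique_congr fun j => ?_
  rw [mem_iff_sortPair_mem h2]
  refine ⟨fun h => h.2, fun h => ⟨?_, h⟩⟩
  rcases sortPair_eq_or i j with e | e <;> rw [e] at h
  · exact (h1 _ h).2
  · exact (h1 _ h).1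

theorem matchSum_empty {R : Type*} [CommRing R] (g : Fin k → Fin k → R) : matchSum g ∅ = 1 := by
  have : perfectMatchings (∅ : Finset (Fin k)) = {∅} := by
    ext σ
    rw [mem_perfectMatchings, mem_singleton]
    constructor
    · rintro ⟨h, -⟩
      exact eq_empty_of_forall_notMem fun p hp => notMem_empty _ (h p hp).1
    · rintro rfl
      simp
  rw [matchSum, this]
  simp

theorem matchSum_congr {R : Type*} [CommRing R] {g g' : Fin k → Fin k → R} {X : Finset (Fin k)}
    (h : ∀ i ∈ X, ∀ j ∈ X, g i j = g' i j) : matchSum g X = matchSum g' X := by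
  refine sum_congr rfl fun σ hσ => prod_congr rfl fun p hp => ?_
  have := (mem_perfectMatchings.1 hσ).1 p hp
  exact h _ this.1 _ this.2

theorem insert_mem_perfectMatchings {X : Finset (Fin k)} {m j : Fin k} (hm : m ∈ X)
    (hj : j ∈ X.erase m) {σ : Finset (Fin k × Fin k)}
    (hσ : σ ∈ perfectMatchings ((X.erase j).erase m)) :
    sortPair m j ∉ σ ∧ insert (sortPair m j) σ ∈ perfectMatchings X := by
  obtain ⟨hjm, hjX⟩ := mem_erase.1 hj
  obtain ⟨h1, h2, h3⟩ := mem_perfectMatchings'.1 hσ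
  have hX : ∀ {i}, i ∈ (X.erase j).erase m → i ≠ m ∧ i ≠ j ∧ i ∈ X := by
    intro i hi
    exact ⟨ne_of_mem_erase hi, ne_of_mem_erase (mem_of_mem_erase hi),
      mem_of_mem_erase (mem_of_mem_erase hi)⟩
  have hmem : ∀ {a b}, sortPair a b ∈ σ → a ∈ (X.erase j).erase m ∧ b ∈ (X.erase j).erase m := by
    intro a b hab
    rcases sortPair_eq_or a b with e | e <;> rw [e] at hab
    · exact h1 _ hab
    · exact (h1 _ hab).symm
  have hnot : sortPair m j ∉ σ := fun h => (hX (hmem h).1).1 rfl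
  refine ⟨hnot, mem_perfectMatchings'.2 ⟨?_, ?_, ?_⟩⟩
  · intro p hp
    rcases mem_insert.1 hp with rfl | hp
    · rcases sortPair_eq_or m j with e | e <;> rw [e]
      · exact ⟨hm, hjX⟩
      · exact ⟨hjX, hm⟩
    · exact ⟨(hX (h1 p hp).1).2.2, (hX (h1 p hp).2).2.2⟩
  · intro p hp
    rcases mem_insert.1 hp with rfl | hp
    · rw [sortPair]
      exact min_lt_max.2 hjm.symm
    · exact h2 p hp
  · intro i hi
    by_cases him : i = m
    · subst him
      refine ⟨j, mem_insert_self _ _, fun b hb => ?_⟩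
      rcases mem_insert.1 hb with e | hb
      · rcases sortPair_eq_iff.1 e with e | e
        · exact e.2
        · exact absurd e.1.symm hjm
      · exact absurd rfl (hX (hmem hb).1).1
    by_cases hij : i = j
    · subst hij
      refine ⟨m, by rw [sortPair_comm]; exact mem_insert_self _ _, fun b hb => ?_⟩
      rcases mem_insert.1 hb with e | hb
      · rcases sortPair_eq_iff.1 e with e | e
        · exact absurd e.1 him
        · exact e.2
      · exact absurd rfl (hX (hmem hb).1).2.1
    · obtain ⟨b, hb, hub⟩ := h3 i (mem_erase.2 ⟨him, mem_erase.2 ⟨hij, hi⟩⟩)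
      refine ⟨b, mem_insert_of_mem hb, fun b' hb' => ?_⟩
      rcases mem_insert.1 hb' with e | hb'
      · rcases sortPair_eq_iff.1 e with e | e
        · exact absurd e.1 him
        · exact absurd e.1 hij
      · exact hub b' hb'

theorem erase_mem_perfectMatchings {X : Finset (Fin k)} {m j : Fin k}
    {σ : Finset (Fin k × Fin k)} (hσ : σ ∈ perfectMatchings X) (hmj : sortPair m j ∈ σ) :
    j ∈ X.erase m ∧ σ.erase (sortPair m j) ∈ perfectMatchings ((X.erase j).erase m) := by
  obtain ⟨h1, h2, h3⟩ := mem_perfectMatchings'.1 hσ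
  have hmem : ∀ {a b}, sortPair a b ∈ σ → a ∈ X ∧ b ∈ X := by
    intro a b hab
    rcases sortPair_eq_or a b with e | e <;> rw [e] at hab
    · exact h1 _ hab
    · exact (h1 _ hab).symm
  have hne : ∀ {a b}, sortPair a b ∈ σ → a ≠ b := by
    intro a b hab e
    subst e
    have := h2 _ hab
    simp [sortPair] at this
  have huniq : ∀ {i a b}, sortPair i a ∈ σ → sortPair i b ∈ σ → a = b := fun ha hb =>
    (h3 _ (hmem ha).1).unique ha hb
  have hjm : sortPair j m ∈ σ := sortPair_comm m j ▸ hmj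
  have hkey : ∀ {a b}, sortPair a b ∈ σ.erase (sortPair m j) → a ≠ m ∧ a ≠ j := by
    intro a b hab
    obtain ⟨e, hab'⟩ := mem_erase.1 hab
    refine ⟨?_, ?_⟩
    · rintro rfl
      exact e (by rw [huniq hab' hmj])
    · rintro rfl
      rw [huniq hab' hjm, sortPair_comm] at e
      exact e rfl
  refine ⟨mem_erase.2 ⟨(hne hmj).symm, (hmem hmj).2⟩, mem_perfectMatchings'.2 ⟨?_, ?_, ?_⟩⟩
  · rintro ⟨a, b⟩ hp
    have hp' := mem_of_mem_erase hp
    have hs : sortPair a b = (a, b) := sortPair_of_lt (h2 _ hp')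
    have h4 := hkey (a := a) (b := b) (by rwa [hs])
    have h5 := hkey (a := b) (b := a) (by rwa [sortPair_comm b a, hs])
    have h6 := h1 _ hp'
    simp only [mem_erase]
    tauto
  · exact fun p hp => h2 p (mem_of_mem_erase hp)
  · intro i hi
    obtain ⟨him, hi⟩ := mem_erase.1 hi
    obtain ⟨hij, hi⟩ := mem_erase.1 hi
    obtain ⟨b, hb, hub⟩ := h3 i hi
    refine ⟨b, mem_erase.2 ⟨fun e => ?_, hb⟩, fun b' hb' => hub b' (mem_of_mem_erase hb')⟩
    rcases sortPair_eq_iff.1 e with e | e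
    · exact him e.1
    · exact hij e.1

/-- A perfect matching is determined by the partner of `m` together with a matching of the remaining
indices. This is the same recursion as Wick's. -/
theorem matchSum_recursion {R : Type*} [CommRing R] {g : Fin k → Fin k → R}
    (hg : ∀ i j, g i j = g j i) {X : Finset (Fin k)} {m : Fin k} (hm : m ∈ X) :
    matchSum g X = ∑ j ∈ X.erase m, g m j * matchSum g ((X.erase j).erase m) := by
  symm
  simp_rw [matchSum, mul_sum]
  rw [sum_sigma']
  refine sum_bij (fun x _ => insert (sortPair m x.1) x.2) ?_ ?_ ?_ ?_
  · rintro ⟨j, σ⟩ hx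
    obtain ⟨hj, hσ⟩ := mem_sigma.1 hx
    exact (insert_mem_perfectMatchings hm hj hσ).2
  · rintro ⟨j, σ⟩ hx ⟨j', σ'⟩ hx' heq
    obtain ⟨hj, hσ⟩ := mem_sigma.1 hx
    obtain ⟨hj', hσ'⟩ := mem_sigma.1 hx'
    dsimp only at heq hj hσ hj' hσ'
    obtain ⟨n1, p1⟩ := insert_mem_perfectMatchings hm hj hσ
    obtain ⟨n2, p2⟩ := insert_mem_perfectMatchings hm hj' hσ'
    obtain ⟨-, -, h3⟩ := mem_perfectMatchings'.1 p1
    have e : j = j' := (h3 m hm).unique (mem_insert_self _ _)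
      (by rw [heq]; exact mem_insert_self _ _)
    subst e
    have : σ = σ' := by
      rw [← erase_insert n1, heq, erase_insert n2]
    rw [this]
  · intro σ hσ
    obtain ⟨-, -, h3⟩ := mem_perfectMatchings'.1 hσ
    obtain ⟨j, hj, -⟩ := h3 m hm
    obtain ⟨h4, h5⟩ := erase_mem_perfectMatchings hσ hj
    exact ⟨⟨j, σ.erase (sortPair m j)⟩, mem_sigma.2 ⟨h4, h5⟩, insert_erase hj⟩
  · rintro ⟨j, σ⟩ hx
    obtain ⟨hj, hσ⟩ := mem_sigma.1 hx
    obtain ⟨n1, -⟩ := insert_mem_perfectMatchings hm hj hσ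
    rw [prod_insert n1]
    congr 1
    rcases sortPair_eq_or m j with e | e <;> rw [e]
    exact hg _ _

/-- The number of matchings is not counted: each step of the recursion costs one factor P ≥ k, hence
the exponent e + 1 per index. -/
theorem abs_matchSum_le {g : Fin k → Fin k → ℝ} (hg : ∀ i j, g i j = g j i) {P S : ℝ}
    (hkP : (k : ℝ) ≤ P) (hP : 1 ≤ P) (hS : 0 ≤ S) {e : ℕ} (n : ℕ) : ∀ (X : Finset (Fin k)),
    X.card = n → (∀ i ∈ X, ∀ j ∈ X, |g i j| ≤ P ^ e * S ^ 2) →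
    |matchSum g X| ≤ P ^ ((e + 1) * n) * S ^ n := by
  induction n using Nat.strong_induction_on with
  | _ n ih =>
    intro X hX hgX
    have hP0 : 0 ≤ P := by linarith
    rcases X.eq_empty_or_nonempty with rfl | ⟨m, hm⟩
    · rw [card_empty] at hX
      subst hX
      simp [matchSum_empty]
    rw [matchSum_recursion hg hm]
    rcases (show n = 1 ∨ 2 ≤ n by have := card_pos.2 ⟨m, hm⟩; omega) with h1 | h2
    · have : X.erase m = ∅ := by
        rw [← card_eq_zero, card_erase_of_mem hm]; omega
      rw [this, sum_empty, abs_zero]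
      positivity
    obtain ⟨n, rfl⟩ : ∃ n', n = n' + 2 := ⟨n - 2, by omega⟩
    have hb : ∀ j ∈ X.erase m, |g m j * matchSum g ((X.erase j).erase m)| ≤
        P ^ e * S ^ 2 * (P ^ ((e + 1) * n) * S ^ n) := by
      intro j hj
      obtain ⟨hjm, hjX⟩ := mem_erase.1 hj
      rw [abs_mul]
      have := ih n (by omega) ((X.erase j).erase m) (by
        rw [card_erase_of_mem (mem_erase.2 ⟨hjm.symm, hm⟩), card_erase_of_mem hjX]; omega)
        fun i hi j hj => hgX i (mem_of_mem_erase (mem_of_mem_erase hi)) j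
          (mem_of_mem_erase (mem_of_mem_erase hj))
      exact mul_le_mul (hgX m hm j hjX) this (abs_nonneg _) (by positivity)
    refine (abs_sum_le_sum_abs _ _).trans ((sum_le_card_nsmul _ _ _ hb).trans ?_)
    rw [nsmul_eq_mul]
    have hc : ((X.erase m).card : ℝ) ≤ P := by
      refine le_trans ?_ hkP
      have := card_le_univ (X.erase m)
      rw [Fintype.card_fin] at this
      exact_mod_cast this
    calc _ ≤ P * (P ^ e * S ^ 2 * (P ^ ((e + 1) * n) * S ^ n)) := by gcongr
      _ = P ^ ((e + 1) * n + (e + 1)) * S ^ (n + 2) := by ring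
      _ ≤ P ^ ((e + 1) * (n + 2)) * S ^ (n + 2) := by
          gcongr
          ring_nf
          omega

/-- The entries are exchanged one recursion step at a time, so an entrywise error `δ` relative to S²
yields the same relative error for the matching sums, up to powers of P. -/
theorem abs_matchSum_sub_le {g g' : Fin k → Fin k → ℝ} (hg : ∀ i j, g i j = g j i)
    (hg' : ∀ i j, g' i j = g' j i) {P S δ : ℝ} (hkP : (k : ℝ) ≤ P) (hP : 2 ≤ P) (hS : 0 ≤ S)
    (hδ : 0 ≤ δ) (hgb : ∀ i j, |g i j| ≤ P * S ^ 2) (hgb' : ∀ i j, |g' i j| ≤ P * S ^ 2)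
    (hgg : ∀ i j, |g i j - g' i j| ≤ δ * S ^ 2) (n : ℕ) : ∀ (X : Finset (Fin k)),
    X.card = n → |matchSum g X - matchSum g' X| ≤ δ * P ^ (3 * n) * S ^ n := by
  induction n using Nat.strong_induction_on with
  | _ n ih =>
    intro X hX
    have hP0 : 0 ≤ P := by linarith
    rcases X.eq_empty_or_nonempty with rfl | ⟨m, hm⟩
    · rw [matchSum_empty, matchSum_empty, sub_self, abs_zero]
      positivity
    rw [matchSum_recursion hg hm, matchSum_recursion hg' hm, ← sum_sub_distrib]
    rcases (show n = 1 ∨ 2 ≤ n by have := card_pos.2 ⟨m, hm⟩; omega) with h1 | h2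
    · have : X.erase m = ∅ := by
        rw [← card_eq_zero, card_erase_of_mem hm]; omega
      rw [this, sum_empty, abs_zero]
      positivity
    obtain ⟨n, rfl⟩ : ∃ n', n = n' + 2 := ⟨n - 2, by omega⟩
    have hb : ∀ j ∈ X.erase m, |g m j * matchSum g ((X.erase j).erase m) -
        g' m j * matchSum g' ((X.erase j).erase m)| ≤ δ * P ^ (3 * n + 2) * S ^ (n + 2) := by
      intro j hj
      obtain ⟨hjm, hjX⟩ := mem_erase.1 hj
      have hcard : ((X.erase j).erase m).card = n := by
        rw [card_erase_of_mem (mem_erase.2 ⟨hjm.symm, hm⟩), card_erase_of_mem hjX]; omega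
      have h1 := ih n (by omega) _ hcard
      have h2 := abs_matchSum_le hg hkP (by linarith) hS (e := 1) n _ hcard
        fun i _ j _ => by rw [pow_one]; exact hgb i j
      rw [show g m j * matchSum g ((X.erase j).erase m) - g' m j * matchSum g' ((X.erase j).erase m)
        = (g m j - g' m j) * matchSum g ((X.erase j).erase m) + g' m j *
          (matchSum g ((X.erase j).erase m) - matchSum g' ((X.erase j).erase m)) by ring]
      refine (abs_add_le _ _).trans ?_
      rw [abs_mul, abs_mul]
      calc _ ≤ δ * S ^ 2 * (P ^ ((1 + 1) * n) * S ^ n) + P * S ^ 2 * (δ * P ^ (3 * n) * S ^ n) := by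
            gcongr
            · exact hgg m j
            · exact hgb' m j
        _ ≤ δ * S ^ 2 * (P ^ (3 * n + 1) * S ^ n) + P * S ^ 2 * (δ * P ^ (3 * n) * S ^ n) := by
            gcongr
            · linarith
            · omega
        _ = 2 * (δ * P ^ (3 * n + 1) * S ^ (n + 2)) := by ring
        _ ≤ P * (δ * P ^ (3 * n + 1) * S ^ (n + 2)) := by gcongr
        _ = _ := by ring
    refine (abs_sum_le_sum_abs _ _).trans ((sum_le_card_nsmul _ _ _ hb).trans ?_)
    rw [nsmul_eq_mul]
    have hc : ((X.erase m).card : ℝ) ≤ P := by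
      refine le_trans ?_ hkP
      have := card_le_univ (X.erase m)
      rw [Fintype.card_fin] at this
      exact_mod_cast this
    calc _ ≤ P * (δ * P ^ (3 * n + 2) * S ^ (n + 2)) := by gcongr
      _ = δ * P ^ (3 * n + 3) * S ^ (n + 2) := by ring
      _ ≤ _ := by
          gcongr
          · linarith
          · omega

/-- The pairs of a partition, each listed in increasing order. -/
noncomputable def pairsOf (P : Finpartition (univ : Finset (Fin k))) : Finset (Fin k × Fin k) :=
  univ.filter fun p => p.1 < p.2 ∧ {p.1, p.2} ∈ P.parts

theorem card_pairsOf (P : Finpartition (univ : Finset (Fin k))) :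
    (pairsOf P).card = (P.parts.filter (fun S => S.card = 2)).card := by
  classical
  refine card_bij (fun p _ => {p.1, p.2}) ?_ ?_ ?_
  · rintro ⟨a, b⟩ hp
    obtain ⟨-, h1, h2⟩ := mem_filter.1 hp
    exact mem_filter.2 ⟨h2, card_pair h1.ne⟩
  · rintro ⟨a, b⟩ hp ⟨a', b'⟩ hp' h
    obtain ⟨-, h1, -⟩ := mem_filter.1 hp
    obtain ⟨-, h1', -⟩ := mem_filter.1 hp'
    dsimp only at h h1 h1'
    have h3 : a ∈ ({a', b'} : Finset (Fin k)) := h ▸ mem_insert_self _ _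
    have h4 : b ∈ ({a', b'} : Finset (Fin k)) := h ▸ mem_insert_of_mem (mem_singleton_self _)
    rw [mem_insert, mem_singleton] at h3 h4
    rw [Prod.mk.injEq]
    omega
  · intro S hS
    obtain ⟨hS, hc⟩ := mem_filter.1 hS
    obtain ⟨a, b, hab, rfl⟩ := card_eq_two.1 hc
    rcases lt_or_gt_of_ne hab with h | h
    · exact ⟨(a, b), mem_filter.2 ⟨mem_univ _, h, hS⟩, rfl⟩
    · exact ⟨(b, a), mem_filter.2 ⟨mem_univ _, h, by rwa [pair_comm]⟩, pair_comm _ _⟩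

theorem partition_ext_of_pairsOf {P P' : Finpartition (univ : Finset (Fin k))}
    (hP : ∀ S ∈ P.parts, S.card = 1 ∨ S.card = 2) (hP' : ∀ S ∈ P'.parts, S.card = 1 ∨ S.card = 2)
    (h : pairsOf P = pairsOf P') : P = P' := by
  have key : ∀ {P P' : Finpartition (univ : Finset (Fin k))},
      (∀ S ∈ P.parts, S.card = 1 ∨ S.card = 2) → (∀ S ∈ P'.parts, S.card = 1 ∨ S.card = 2) →
      pairsOf P = pairsOf P' → P.parts ⊆ P'.parts := by
    intro P P' hP hP' h
    have h2 : ∀ {P P' : Finpartition (univ : Finset (Fin k))}, pairsOf P = pairsOf P' →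
        ∀ S ∈ P.parts, S.card = 2 → S ∈ P'.parts := by
      intro P P' h S hS hc
      obtain ⟨a, b, hab, rfl⟩ := card_eq_two.1 hc
      rcases lt_or_gt_of_ne hab with hlt | hlt
      · have : (a, b) ∈ pairsOf P' := h ▸ mem_filter.2 ⟨mem_univ _, hlt, hS⟩
        exact (mem_filter.1 this).2.2
      · have : (b, a) ∈ pairsOf P' := h ▸ mem_filter.2 ⟨mem_univ _, hlt, by rwa [pair_comm]⟩
        have := (mem_filter.1 this).2.2
        rwa [pair_comm]
    intro S hS
    rcases hP S hS with hc | hc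
    · obtain ⟨a, rfl⟩ := card_eq_one.1 hc
      obtain ⟨T, hT, haT⟩ := P'.exists_mem (mem_univ a)
      rcases hP' T hT with hc' | hc'
      · obtain ⟨b, rfl⟩ := card_eq_one.1 hc'
        rw [mem_singleton] at haT
        rwa [haT]
      · have h3 := h2 h.symm T hT hc'
        have := P.eq_of_mem_parts h3 hS haT (mem_singleton_self a)
        rw [this] at hc'
        omega
    · exact h2 h S hS hc
  exact Finpartition.ext (Subset.antisymm (key hP hP' h) (key hP' hP h.symm))

theorem union_pairsOf_mem_perfectMatchings {P : Finpartition (univ : Finset (Fin k))}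
    (hP : ∀ S ∈ P.parts, S.card = 1 ∨ S.card = 2) {σ : Finset (Fin k × Fin k)}
    (hσ : σ ∈ perfectMatchings (singletonIndices P)) :
    Disjoint σ (pairsOf P) ∧ σ ∪ pairsOf P ∈ perfectMatchings univ := by
  classical
  obtain ⟨h1, h2, h3⟩ := mem_perfectMatchings'.1 hσ
  have hsing : ∀ {i}, i ∈ singletonIndices P ↔ {i} ∈ P.parts := by
    intro i; rw [singletonIndices, mem_filter]; simp
  have hpair : ∀ {a b}, sortPair a b ∈ pairsOf P ↔ a ≠ b ∧ {a, b} ∈ P.parts := by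
    intro a b
    rw [pairsOf, mem_filter]
    rcases lt_trichotomy a b with h | h | h
    · rw [sortPair_of_lt h]; simp [h, h.ne]
    · subst h; simp [sortPair]
    · rw [sortPair_comm, sortPair_of_lt h]; simp [h, h.ne', pair_comm]
  have hmem : ∀ {a b}, sortPair a b ∈ σ → {a} ∈ P.parts := by
    intro a b hab
    rcases sortPair_eq_or a b with e | e <;> rw [e] at hab
    · exact hsing.1 (h1 _ hab).1
    · exact hsing.1 (h1 _ hab).2
  have hexcl : ∀ {a b}, {a} ∈ P.parts → sortPair a b ∉ pairsOf P := by
    intro a b ha hab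
    obtain ⟨hne, hab⟩ := hpair.1 hab
    have := P.eq_of_mem_parts ha hab (mem_singleton_self a) (mem_insert_self a _)
    have hc := congrArg card this
    rw [card_singleton, card_pair hne] at hc
    omega
  refine ⟨disjoint_left.2 ?_, mem_perfectMatchings'.2 ⟨fun _ _ => ⟨mem_univ _, mem_univ _⟩, ?_, ?_⟩⟩
  · rintro ⟨a, b⟩ hp hp'
    have hs := sortPair_of_lt (h2 _ hp)
    rw [← hs] at hp hp'
    exact hexcl (hmem hp) hp'
  · intro p hp
    rcases mem_union.1 hp with hp | hp
    · exact h2 p hp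
    · exact (mem_filter.1 hp).2.1
  · intro i _
    by_cases hi : {i} ∈ P.parts
    · obtain ⟨j, hj, huj⟩ := h3 i (hsing.2 hi)
      refine ⟨j, mem_union_left _ hj, fun j' hj' => ?_⟩
      rcases mem_union.1 hj' with hj' | hj'
      · exact huj j' hj'
      · exact absurd hj' (hexcl hi)
    · obtain ⟨T, hT, hiT⟩ := P.exists_mem (mem_univ i)
      rcases hP T hT with hc | hc
      · obtain ⟨b, rfl⟩ := card_eq_one.1 hc
        rw [mem_singleton] at hiT
        exact absurd (hiT ▸ hT) hi
      · obtain ⟨b, hbT, hbi⟩ := exists_mem_ne (by omega : 1 < T.card) i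
        have hTe : T = {i, b} := by
          symm
          refine eq_of_subset_of_card_le ?_ (by rw [hc, card_pair hbi.symm])
          intro x hx
          rcases mem_insert.1 hx with rfl | hx
          · exact hiT
          · exact mem_singleton.1 hx ▸ hbT
        refine ⟨b, mem_union_right _ (hpair.2 ⟨hbi.symm, hTe ▸ hT⟩), fun b' hb' => ?_⟩
        rcases mem_union.1 hb' with hb' | hb'
        · exact absurd (hmem hb') hi
        · obtain ⟨hne, hb'⟩ := hpair.1 hb'
          have := P.eq_of_mem_parts hb' hT (mem_insert_self _ _) hiT
          have h4 : b' ∈ T := this ▸ mem_insert_of_mem (mem_singleton_self _)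
          rw [hTe, mem_insert, mem_singleton] at h4
          rcases h4 with h4 | h4
          · exact absurd h4.symm hne
          · exact h4

/-- The selected pairs `τ` become the two-element parts and all other indices become singletons,
which the rest of `σ` matches. This is the surjectivity needed to compare the two expansions of the
main term. -/
theorem exists_partition_of_subset {σ τ : Finset (Fin k × Fin k)}
    (hσ : σ ∈ perfectMatchings (univ : Finset (Fin k))) (hτ : τ ⊆ σ) :
    ∃ P : Finpartition (univ : Finset (Fin k)), (∀ S ∈ P.parts, S.card = 1 ∨ S.card = 2) ∧
      pairsOf P = τ ∧ σ \ τ ∈ perfectMatchings (singletonIndices P) := by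
  classical
  obtain ⟨-, h2, h3⟩ := mem_perfectMatchings'.1 hσ
  have h2' : ∀ p ∈ τ, p.1 < p.2 := fun p hp => h2 p (hτ hp)
  have huniq : ∀ {i a b}, sortPair i a ∈ σ → sortPair i b ∈ σ → a = b := fun ha hb =>
    (h3 _ (mem_univ _)).unique ha hb
  set parts : Finset (Finset (Fin k)) := τ.image (fun p => {p.1, p.2}) ∪
    (univ.filter fun i => ∀ j, sortPair i j ∉ τ).image (fun i => {i}) with hparts
  have hmem : ∀ {S}, S ∈ parts ↔ (∃ a b, a < b ∧ (a, b) ∈ τ ∧ S = {a, b}) ∨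
      ∃ i, (∀ j, sortPair i j ∉ τ) ∧ S = {i} := by
    intro S
    rw [hparts, mem_union, mem_image, mem_image]
    constructor
    · rintro (⟨⟨a, b⟩, h, rfl⟩ | ⟨i, h, rfl⟩)
      · exact Or.inl ⟨a, b, h2' _ h, h, rfl⟩
      · exact Or.inr ⟨i, (mem_filter.1 h).2, rfl⟩
    · rintro (⟨a, b, -, h, rfl⟩ | ⟨i, h, rfl⟩)
      · exact Or.inl ⟨(a, b), h, rfl⟩
      · exact Or.inr ⟨i, mem_filter.2 ⟨mem_univ _, h⟩, rfl⟩
  have hpm : ∀ {a b}, a ≠ b → (({a, b} : Finset (Fin k)) ∈ parts ↔ sortPair a b ∈ τ) := by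
    intro a b hab
    rw [hmem]
    constructor
    · rintro (⟨a', b', hlt, h, e⟩ | ⟨i, -, e⟩)
      · have : sortPair a b = sortPair a' b' := by
          rw [sortPair_eq_iff]
          have h3 : a ∈ ({a', b'} : Finset (Fin k)) := e ▸ mem_insert_self _ _
          have h4 : b ∈ ({a', b'} : Finset (Fin k)) := e ▸ mem_insert_of_mem (mem_singleton_self _)
          rw [mem_insert, mem_singleton] at h3 h4
          omega
        rwa [this, sortPair_of_lt hlt]
      · have := congrArg card e
        rw [card_pair hab, card_singleton] at this
        omega
    · intro h
      rcases lt_or_gt_of_ne hab with hlt | hlt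
      · rw [sortPair_of_lt hlt] at h
        exact Or.inl ⟨a, b, hlt, h, rfl⟩
      · rw [sortPair_comm, sortPair_of_lt hlt] at h
        exact Or.inl ⟨b, a, hlt, h, pair_comm _ _⟩
  have hsm : ∀ {i}, (({i} : Finset (Fin k)) ∈ parts ↔ ∀ j, sortPair i j ∉ τ) := by
    intro i
    rw [hmem]
    constructor
    · rintro (⟨a, b, hlt, -, e⟩ | ⟨i', h, e⟩)
      · have := congrArg card e
        rw [card_pair hlt.ne, card_singleton] at this
        omega
      · rwa [singleton_inj.1 e]
    · exact fun h => Or.inr ⟨i, h, rfl⟩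
  have hex : ∀ a ∈ (univ : Finset (Fin k)), ∃! t ∈ parts, a ∈ t := by
    intro i _
    by_cases hi : ∀ j, sortPair i j ∉ τ
    · refine ⟨{i}, ⟨hsm.2 hi, mem_singleton_self i⟩, ?_⟩
      rintro T ⟨hT, hiT⟩
      rcases hmem.1 hT with ⟨a, b, hlt, h, rfl⟩ | ⟨i', -, rfl⟩
      · rw [← sortPair_of_lt hlt] at h
        rcases mem_insert.1 hiT with rfl | hiT
        · exact absurd h (hi b)
        · rw [mem_singleton] at hiT
          subst hiT
          rw [sortPair_comm] at h
          exact absurd h (hi a)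
      · rw [mem_singleton.1 hiT]
    · push Not at hi
      obtain ⟨j, hj⟩ := hi
      have hij : i ≠ j := by
        rintro rfl
        have := h2' _ hj
        simp [sortPair] at this
      refine ⟨{i, j}, ⟨(hpm hij).2 hj, mem_insert_self _ _⟩, ?_⟩
      rintro T ⟨hT, hiT⟩
      rcases hmem.1 hT with ⟨a, b, hlt, h, rfl⟩ | ⟨i', h, rfl⟩
      · rw [← sortPair_of_lt hlt] at h
        rcases mem_insert.1 hiT with rfl | hiT
        · rw [huniq (hτ h) (hτ hj)]
        · rw [mem_singleton] at hiT
          subst hiT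
          rw [sortPair_comm] at h
          rw [huniq (hτ h) (hτ hj), pair_comm]
      · rw [mem_singleton] at hiT
        subst hiT
        exact absurd hj (h j)
  have hne : ∅ ∉ parts := by
    intro h
    rcases hmem.1 h with ⟨a, b, -, -, e⟩ | ⟨i, -, e⟩
    · exact (insert_ne_empty _ _) e.symm
    · exact (singleton_ne_empty _) e.symm
  set P := Finpartition.ofExistsUnique parts (fun _ _ => subset_univ _) hex hne with hPdef
  have hPp : P.parts = parts := rfl
  refine ⟨P, ?_, ?_, mem_perfectMatchings'.2 ⟨?_, ?_, ?_⟩⟩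
  · intro S hS
    rw [hPp] at hS
    rcases hmem.1 hS with ⟨a, b, hlt, -, rfl⟩ | ⟨i, -, rfl⟩
    · exact Or.inr (card_pair hlt.ne)
    · exact Or.inl (card_singleton _)
  · ext ⟨a, b⟩
    rw [pairsOf, mem_filter, hPp]
    constructor
    · rintro ⟨-, hlt, h⟩
      dsimp only at hlt h
      rwa [hpm hlt.ne, sortPair_of_lt hlt] at h
    · intro h
      have hlt := h2' _ h
      refine ⟨mem_univ _, hlt, ?_⟩
      dsimp only at hlt ⊢
      rwa [hpm hlt.ne, sortPair_of_lt hlt]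
  · rintro ⟨a, b⟩ hp
    obtain ⟨hp, hpτ⟩ := mem_sdiff.1 hp
    have hlt := h2 _ hp
    dsimp only at hlt
    rw [← sortPair_of_lt hlt] at hp hpτ
    rw [singletonIndices, mem_filter, mem_filter, hPp]
    dsimp only
    rw [hsm, hsm]
    refine ⟨⟨mem_univ _, fun j hj => ?_⟩, ⟨mem_univ _, fun j hj => ?_⟩⟩
    · rw [huniq (hτ hj) hp] at hj
      exact hpτ hj
    · rw [sortPair_comm] at hp hpτ
      rw [huniq (hτ hj) hp] at hj
      exact hpτ hj
  · exact fun p hp => h2 p (mem_sdiff.1 hp).1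
  · intro i hi
    rw [singletonIndices, mem_filter, hPp, hsm] at hi
    obtain ⟨j, hj, huj⟩ := h3 i (mem_univ i)
    exact ⟨j, mem_sdiff.2 ⟨hj, hi.2 j⟩, fun j' hj' => huj j' (mem_sdiff.1 hj').1⟩

theorem refinesClasses_iff {r : ℕ} {c : Fin k → ZMod r} {P : Finpartition (univ : Finset (Fin k))}
    (hP : ∀ S ∈ P.parts, S.card = 1 ∨ S.card = 2) :
    RefinesClasses c P ↔ ∀ p ∈ pairsOf P, c p.1 = c p.2 := by
  classical
  have hres : ∀ {i l}, i ∈ resClass c l ↔ c i = l := by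
    intro i l; rw [resClass, mem_filter]; simp
  constructor
  · rintro h ⟨a, b⟩ hp
    obtain ⟨-, -, hS⟩ := mem_filter.1 hp
    obtain ⟨l, hl⟩ := h _ hS
    exact (hres.1 (hl (mem_insert_self _ _))).trans
      (hres.1 (hl (mem_insert_of_mem (mem_singleton_self _)))).symm
  · intro h S hS
    rcases hP S hS with hc | hc
    · obtain ⟨a, rfl⟩ := card_eq_one.1 hc
      exact ⟨c a, singleton_subset_iff.2 (hres.2 rfl)⟩
    · obtain ⟨a, b, hab, rfl⟩ := card_eq_two.1 hc
      have hcab : c b = c a := by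
        rcases lt_or_gt_of_ne hab with hlt | hlt
        · exact (h (a, b) (mem_filter.2 ⟨mem_univ _, hlt, hS⟩)).symm
        · exact h (b, a) (mem_filter.2 ⟨mem_univ _, hlt, by rwa [pair_comm]⟩)
      refine ⟨c a, fun x hx => hres.2 ?_⟩
      rcases mem_insert.1 hx with rfl | hx
      · rfl
      · rw [mem_singleton.1 hx, hcab]

theorem card_le_half_of_subset {σ τ : Finset (Fin k × Fin k)} (hσ : σ ∈ perfectMatchings univ)
    (hτ : τ ⊆ σ) : τ.card ≤ k / 2 := by
  classical
  obtain ⟨-, h2, h3⟩ := mem_perfectMatchings'.1 hσ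
  have hdis : ∀ p ∈ τ, ∀ q ∈ τ, p ≠ q → Disjoint ({p.1, p.2} : Finset (Fin k)) {q.1, q.2} := by
    rintro ⟨a, b⟩ hp ⟨a', b'⟩ hq hne
    have hp' := hτ hp
    have hq' := hτ hq
    have e1 := sortPair_of_lt (h2 _ hp')
    have e2 := sortPair_of_lt (h2 _ hq')
    dsimp only at e1 e2
    rw [disjoint_left]
    intro x hx hx'
    rw [mem_insert, mem_singleton] at hx hx'
    obtain ⟨y, hy⟩ : ∃ y, sortPair x y = (a, b) := by
      rcases hx with rfl | rfl
      · exact ⟨b, e1⟩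
      · exact ⟨a, by rw [sortPair_comm, e1]⟩
    obtain ⟨z, hz⟩ : ∃ z, sortPair x z = (a', b') := by
      rcases hx' with rfl | rfl
      · exact ⟨b', e2⟩
      · exact ⟨a', by rw [sortPair_comm, e2]⟩
    have : y = z := (h3 x (mem_univ x)).unique (by rw [hy]; exact hp') (by rw [hz]; exact hq')
    exact hne (by rw [← hy, ← hz, this])
  have h1 := card_biUnion hdis
  rw [sum_congr rfl fun p hp => card_pair (h2 p (hτ hp)).ne, sum_const, smul_eq_mul] at h1
  have := card_le_univ (τ.biUnion fun p => ({p.1, p.2} : Finset (Fin k)))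
  rw [Fintype.card_fin] at this
  omega

-- Multiplying out ∏ (V_2 - D·1[c_i = c_j]) over a matching selects the subset of pairs that
-- contribute -D. These pairs are the two-element parts of a partition refining the classes, and the
-- others form a matching of its singletons.
open scoped Classical in
theorem mainTerm_eq_matchSum (Q h r : ℕ) (c : Fin k → ZMod r) :
    mainTerm Q h r c = matchSum (fun i j => sumV Q h r ![c i, c j] -
      if c i = c j then (((h : ℝ) / (r : ℝ) * sumInvTotient Q : ℝ) : ℂ) else 0) univ := by
  set D : ℂ := (((h : ℝ) / (r : ℝ) * sumInvTotient Q : ℝ) : ℂ) with hD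
  set V : Fin k × Fin k → ℂ := fun p => sumV Q h r ![c p.1, c p.2] with hV
  set E : Fin k × Fin k → ℂ := fun p => if c p.1 = c p.2 then -D else 0 with hE
  have hright : matchSum (fun i j => sumV Q h r ![c i, c j] - if c i = c j then D else 0)
      (univ : Finset (Fin k)) = ∑ σ ∈ perfectMatchings (univ : Finset (Fin k)),
        ∑ τ ∈ σ.powerset.filter (fun τ => ∀ p ∈ τ, c p.1 = c p.2),
          (-D) ^ τ.card * ∏ p ∈ σ \ τ, V p := by
    refine sum_congr rfl fun σ _ => ?_
    have h1 : ∏ p ∈ σ, (sumV Q h r ![c p.1, c p.2] - if c p.1 = c p.2 then D else 0) =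
        ∏ p ∈ σ, (E p + V p) := by
      refine prod_congr rfl fun p _ => ?_
      simp only [hE, hV]
      split_ifs <;> ring
    rw [h1, prod_add, sum_filter]
    refine sum_congr rfl fun τ _ => ?_
    split_ifs with hτ
    · rw [prod_congr rfl fun p hp => (show E p = -D by simp only [hE]; rw [if_pos (hτ p hp)]),
        prod_const]
    · push Not at hτ
      obtain ⟨p, hp, hne⟩ := hτ
      rw [prod_eq_zero hp (by simp only [hE]; rw [if_neg hne]), zero_mul]
  rw [hright, mainTerm]
  simp_rw [mul_sum]
  rw [sum_sigma', sum_sigma', sum_sigma']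
  refine sum_bij (fun x _ => ⟨x.2 ∪ pairsOf x.1.2, pairsOf x.1.2⟩) ?_ ?_ ?_ ?_
  · rintro ⟨⟨j, P⟩, σ⟩ hx
    obtain ⟨hjP, hσ⟩ := mem_sigma.1 hx
    obtain ⟨hj, hP⟩ := mem_sigma.1 hjP
    obtain ⟨-, hP1, hP2, hP3⟩ := mem_filter.1 hP
    exact mem_sigma.2 ⟨(union_pairsOf_mem_perfectMatchings hP2 hσ).2, mem_filter.2
      ⟨mem_powerset.2 subset_union_right, (refinesClasses_iff hP2).1 hP1⟩⟩
  · rintro ⟨⟨j, P⟩, σ⟩ hx ⟨⟨j', P'⟩, σ'⟩ hx' heq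
    obtain ⟨hjP, hσ⟩ := mem_sigma.1 hx
    obtain ⟨hj, hP⟩ := mem_sigma.1 hjP
    obtain ⟨-, hP1, hP2, hP3⟩ := mem_filter.1 hP
    obtain ⟨hjP', hσ'⟩ := mem_sigma.1 hx'
    obtain ⟨hj', hP'⟩ := mem_sigma.1 hjP'
    obtain ⟨-, hP1', hP2', hP3'⟩ := mem_filter.1 hP'
    dsimp only at *
    rw [Sigma.mk.injEq, heq_eq_eq] at heq
    have hPP := partition_ext_of_pairsOf hP2 hP2' heq.2
    subst hPP
    have hjj : j = j' := hP3.symm.trans hP3'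
    subst hjj
    have hd := (union_pairsOf_mem_perfectMatchings hP2 hσ).1
    have hd' := (union_pairsOf_mem_perfectMatchings hP2 hσ').1
    have : σ = σ' := by
      rw [← union_sdiff_cancel_right hd, heq.1, union_sdiff_cancel_right hd']
    rw [this]
  · rintro ⟨σ, τ⟩ hx
    obtain ⟨hσ, hτ⟩ := mem_sigma.1 hx
    obtain ⟨hτσ, hτc⟩ := mem_filter.1 hτ
    rw [mem_powerset] at hτσ
    dsimp only at *
    obtain ⟨P, hP1, hP2, hP3⟩ := exists_partition_of_subset hσ hτσ
    refine ⟨⟨⟨τ.card, P⟩, σ \ τ⟩, mem_sigma.2 ⟨mem_sigma.2 ⟨?_, ?_⟩, hP3⟩, ?_⟩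
    · rw [mem_range]
      have := card_le_half_of_subset hσ hτσ
      dsimp only
      omega
    · refine mem_filter.2 ⟨mem_univ _, ?_, hP1, ?_⟩
      · rw [refinesClasses_iff hP1, hP2]
        exact hτc
      · rw [← card_pairsOf, hP2]
    · dsimp only
      rw [hP2, sdiff_union_of_subset hτσ]
  · rintro ⟨⟨j, P⟩, σ⟩ hx
    obtain ⟨hjP, hσ⟩ := mem_sigma.1 hx
    obtain ⟨hj, hP⟩ := mem_sigma.1 hjP
    obtain ⟨-, hP1, hP2, hP3⟩ := mem_filter.1 hP
    dsimp only at *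
    rw [union_sdiff_cancel_right (union_pairsOf_mem_perfectMatchings hP2 hσ).1, card_pairsOf, hP3,
      neg_pow D, mul_assoc]

end Matchings

/-! ### From unrestricted sums to sums over distinct integers. -/

section DistinctSums

/-- The integers in `[1, h]` that lie in the residue class `c`. -/
noncomputable def classSet {r : ℕ} (h : ℕ) (c : ZMod r) : Finset ℕ :=
  (Icc 1 h).filter (fun m : ℕ => (m : ZMod r) = c)

theorem mem_classSet {r h : ℕ} {c : ZMod r} {m : ℕ} :
    m ∈ classSet h c ↔ (1 ≤ m ∧ m ≤ h) ∧ (m : ZMod r) = c := by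
  rw [classSet, mem_filter, mem_Icc]

theorem abs_card_classSet_sub_le {r : ℕ} (hr : 1 ≤ r) (h : ℕ) (c : ZMod r) :
    |((classSet h c).card : ℝ) - (h : ℝ) / r| ≤ 1 := by
  have : NeZero r := ⟨by omega⟩
  have hr' : (0 : ℚ) < r := by exact_mod_cast hr
  have e : classSet h c = (Ioc 0 h).filter (fun m : ℕ => m ≡ c.val [MOD r]) := by
    ext m
    rw [mem_classSet, mem_filter, mem_Ioc, ← ZMod.natCast_eq_natCast_iff, ZMod.natCast_zmod_val]
    rfl
  have h1 := Nat.Ioc_filter_modEq_card 0 h hr c.val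
  rw [← e] at h1
  have h2 : |((classSet h c).card : ℚ) - (h : ℚ) / r| ≤ 1 := by
    have a1 := Int.floor_le (((h : ℚ) - c.val) / r)
    have a2 := Int.lt_floor_add_one (((h : ℚ) - c.val) / r)
    have a3 := Int.floor_le ((((0 : ℕ) : ℚ) - c.val) / r)
    have a4 := Int.lt_floor_add_one ((((0 : ℕ) : ℚ) - c.val) / r)
    have a5 : ((h : ℚ) - c.val) / r - (((0 : ℕ) : ℚ) - c.val) / r = h / r := by
      field_simp
      push_cast
      ring
    have a6 : ((⌊((h : ℚ) - c.val) / r⌋ : ℤ) - ⌊(((0 : ℕ) : ℚ) - c.val) / r⌋) ≥ 0 := by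
      have : (((0 : ℕ) : ℚ) - c.val) / r ≤ ((h : ℚ) - c.val) / r := by
        gcongr
        simp
      have := Int.floor_le_floor this
      omega
    rw [max_eq_left a6] at h1
    have h3 : ((classSet h c).card : ℚ) =
        (⌊((h : ℚ) - c.val) / r⌋ : ℚ) - ⌊(((0 : ℕ) : ℚ) - c.val) / r⌋ := by exact_mod_cast h1
    rw [h3, ← a5, abs_le]
    constructor <;> linarith
  have h3 : |(((((classSet h c).card : ℚ) - (h : ℚ) / r : ℚ)) : ℝ)| ≤ 1 := by exact_mod_cast h2
  push_cast at h3
  exact h3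

variable {k : ℕ} {Q : ℕ} [NeZero Q] {r : ℕ}

open scoped Classical in
/-- The tuples of distinct integers in `[1, h]`, indexed by `A` and extended by zero, whose entries
lie in the given residue classes. -/
noncomputable def distinctTuples (h : ℕ) (c : Fin k → ZMod r) (A : Finset (Fin k)) :
    Finset (Fin k → ℕ) :=
  (Fintype.piFinset fun i => if i ∈ A then classSet h (c i) else {0}).filter
    fun d => Set.InjOn d A

theorem mem_distinctTuples {h : ℕ} {c : Fin k → ZMod r} {A : Finset (Fin k)} {d : Fin k → ℕ} :
    d ∈ distinctTuples h c A ↔ (∀ i ∈ A, d i ∈ classSet h (c i)) ∧ (∀ i ∉ A, d i = 0) ∧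
      Set.InjOn d A := by
  classical
  rw [distinctTuples, mem_filter, Fintype.mem_piFinset, ← and_assoc]
  refine and_congr_left fun _ => ⟨fun h => ⟨fun i hi => ?_, fun i hi => ?_⟩, fun h i => ?_⟩
  · simpa [hi] using h i
  · simpa [hi] using h i
  · by_cases hi : i ∈ A
    · simpa [hi] using h.1 i hi
    · simpa [hi] using h.2 i hi

theorem sum_distinctTuples_insert {M : Type*} [AddCommMonoid M] {h : ℕ} {c : Fin k → ZMod r}
    {A : Finset (Fin k)} {j : Fin k} (hj : j ∉ A) (F : (Fin k → ℕ) → M) :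
    ∑ d ∈ distinctTuples h c (insert j A), F d = ∑ d ∈ distinctTuples h c A,
      ∑ m ∈ (classSet h (c j)).filter (fun m => m ∉ A.image d), F (Function.update d j m) := by
  have hne : ∀ {i}, i ∈ A → i ≠ j := fun hi e => hj (e ▸ hi)
  rw [sum_sigma']
  refine sum_bij' (fun d _ => ⟨Function.update d j 0, d j⟩)
    (fun x _ => Function.update x.1 j x.2) ?_ ?_ ?_ ?_ ?_
  · intro d hd
    obtain ⟨h1, h2, h3⟩ := mem_distinctTuples.1 hd
    refine mem_sigma.2 ⟨mem_distinctTuples.2 ⟨fun i hi => ?_, fun i hi => ?_, ?_⟩,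
      mem_filter.2 ⟨h1 j (mem_insert_self _ _), ?_⟩⟩
    · dsimp only
      rw [Function.update_of_ne (hne hi)]
      exact h1 i (mem_insert_of_mem hi)
    · by_cases hij : i = j
      · subst hij; simp
      · dsimp only
        rw [Function.update_of_ne hij]
        exact h2 i (by simp [hij, hi])
    · intro a ha b hb hab
      dsimp only at hab
      rw [Function.update_of_ne (hne ha), Function.update_of_ne (hne hb)] at hab
      exact h3 (mem_insert_of_mem ha) (mem_insert_of_mem hb) hab
    · intro hmem
      obtain ⟨i, hi, hij⟩ := mem_image.1 hmem
      dsimp only at hij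
      rw [Function.update_of_ne (hne hi)] at hij
      exact hne hi (h3 (mem_insert_of_mem hi) (mem_insert_self _ _) hij)
  · rintro ⟨d, m⟩ hx
    obtain ⟨hd, hm⟩ := mem_sigma.1 hx
    obtain ⟨h1, h2, h3⟩ := mem_distinctTuples.1 hd
    obtain ⟨h4, h5⟩ := mem_filter.1 hm
    dsimp only at *
    have h6 : ∀ i ∈ A, d i ≠ m := fun i hi e => h5 (mem_image.2 ⟨i, hi, e⟩)
    refine mem_distinctTuples.2 ⟨fun i hi => ?_, fun i hi => ?_, ?_⟩
    · by_cases hij : i = j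
      · subst hij; simpa using h4
      · rw [Function.update_of_ne hij]
        exact h1 i (mem_of_mem_insert_of_ne hi hij)
    · rw [mem_insert, not_or] at hi
      rw [Function.update_of_ne hi.1]
      exact h2 i hi.2
    · intro a ha b hb hab
      by_cases haj : a = j <;> by_cases hbj : b = j
      · rw [haj, hbj]
      · subst haj
        rw [Function.update_self, Function.update_of_ne hbj] at hab
        exact absurd hab.symm (h6 b (mem_of_mem_insert_of_ne hb hbj))
      · subst hbj
        rw [Function.update_self, Function.update_of_ne haj] at hab
        exact absurd hab (h6 a (mem_of_mem_insert_of_ne ha haj))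
      · rw [Function.update_of_ne haj, Function.update_of_ne hbj] at hab
        exact h3 (mem_of_mem_insert_of_ne ha haj) (mem_of_mem_insert_of_ne hb hbj) hab
  · intro d _
    simp
  · rintro ⟨d, m⟩ hx
    obtain ⟨h1, h2, h3⟩ := mem_distinctTuples.1 (mem_sigma.1 hx).1
    dsimp only at *
    rw [Function.update_idem, Function.update_self, ← h2 j hj, Function.update_eq_self]
  · intro d _
    simp

theorem filter_mem_image_eq {h : ℕ} {c : Fin k → ZMod r} {A : Finset (Fin k)} {d : Fin k → ℕ}
    (hd : d ∈ distinctTuples h c A) (c₀ : ZMod r) :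
    (classSet h c₀).filter (fun m => m ∈ A.image d) = (A.filter fun i => c i = c₀).image d := by
  obtain ⟨h1, -, -⟩ := mem_distinctTuples.1 hd
  ext m
  simp only [mem_filter, mem_image]
  constructor
  · rintro ⟨hm, i, hi, rfl⟩
    exact ⟨i, ⟨hi, (mem_classSet.1 (h1 i hi)).2.symm.trans (mem_classSet.1 hm).2⟩, rfl⟩
  · rintro ⟨i, ⟨hi, rfl⟩, rfl⟩
    exact ⟨h1 i hi, i, hi, rfl⟩

/-- The sum of the products of the centred variables over the tuples of distinct integers. -/
noncomputable def distinctSum (h : ℕ) (c : Fin k → ZMod r) (A : Finset (Fin k)) (n : ZMod Q) : ℝ :=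
  ∑ d ∈ distinctTuples h c A, ∏ i ∈ A, unitVar (n + (d i : ZMod Q))

/-- The constant term Q/φ(Q) - 1 is what a pair of equal integers leaves behind, and the source of
the correction in the main term. -/
theorem unitVar_sq (x : ZMod Q) :
    unitVar x * unitVar x = ((Q : ℝ) / Q.totient - 2) * unitVar x + ((Q : ℝ) / Q.totient - 1) := by
  rw [unitVar]
  split_ifs <;> ring

/-- The integer at `i` no longer enters the product; it ranges over its class except for the values
already taken, which are those at the indices of the same class. -/
theorem sum_distinctTuples_prod_erase (h : ℕ) (c : Fin k → ZMod r) {A : Finset (Fin k)} {i : Fin k}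
    (hi : i ∈ A) (n : ZMod Q) :
    ∑ d ∈ distinctTuples h c A, ∏ l ∈ A.erase i, unitVar (n + (d l : ZMod Q)) =
      ((classSet h (c i)).card - (((A.erase i).filter fun l => c l = c i).card : ℝ)) *
        distinctSum h c (A.erase i) n := by
  conv_lhs => rw [← insert_erase hi]
  rw [sum_distinctTuples_insert (notMem_erase i A), distinctSum, mul_sum]
  refine sum_congr rfl fun d hd => ?_
  have e : ∀ m ∈ (classSet h (c i)).filter (fun m => m ∉ (A.erase i).image d),
      ∏ l ∈ (insert i (A.erase i)).erase i, unitVar (n + ((Function.update d i m l : ℕ) : ZMod Q)) =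
        ∏ l ∈ A.erase i, unitVar (n + (d l : ZMod Q)) := by
    intro m _
    rw [erase_insert (notMem_erase i A)]
    refine prod_congr rfl fun l hl => ?_
    rw [Function.update_of_ne (ne_of_mem_erase hl)]
  rw [sum_congr rfl e, sum_const, nsmul_eq_mul]
  congr 1
  have h1 := card_filter_add_card_filter_not (s := classSet h (c i))
    (fun m => m ∈ (A.erase i).image d)
  have h2 : ((classSet h (c i)).filter fun m => m ∈ (A.erase i).image d).card =
      ((A.erase i).filter fun l => c l = c i).card := by
    rw [filter_mem_image_eq hd, card_image_of_injOn]
    intro a ha b hb hab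
    exact (mem_distinctTuples.1 hd).2.2 (mem_filter.1 ha).1 (mem_filter.1 hb).1 hab
  rw [← h1, ← h2]
  push_cast
  ring

/-- A new integer either differs from all earlier ones or equals exactly one of them, necessarily in
the same class; in the second case the square is linearized. -/
theorem classVar_mul_distinctSum (h : ℕ) (c : Fin k → ZMod r) {A : Finset (Fin k)} {j : Fin k}
    (hj : j ∉ A) (n : ZMod Q) :
    classVar r h (c j) n * distinctSum h c A n = distinctSum h c (insert j A) n +
      ∑ i ∈ A.filter (fun i => c i = c j), (((Q : ℝ) / Q.totient - 2) * distinctSum h c A n +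
        ((Q : ℝ) / Q.totient - 1) *
          (((classSet h (c i)).card - (((A.erase i).filter fun l => c l = c i).card : ℝ)) *
            distinctSum h c (A.erase i) n)) := by
  have h1 : classVar r h (c j) n * distinctSum h c A n = ∑ d ∈ distinctTuples h c A,
      ∑ m ∈ classSet h (c j), unitVar (n + (m : ZMod Q)) *
        ∏ i ∈ A, unitVar (n + (d i : ZMod Q)) := by
    rw [classVar, distinctSum, ← classSet, sum_mul_sum, sum_comm]
  have h2 : distinctSum h c (insert j A) n = ∑ d ∈ distinctTuples h c A,
      ∑ m ∈ (classSet h (c j)).filter (fun m => m ∉ A.image d), unitVar (n + (m : ZMod Q)) *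
        ∏ i ∈ A, unitVar (n + (d i : ZMod Q)) := by
    rw [distinctSum, sum_distinctTuples_insert hj]
    refine sum_congr rfl fun d _ => sum_congr rfl fun m _ => ?_
    rw [prod_insert hj, Function.update_self]
    congr 1
    refine prod_congr rfl fun i hi => ?_
    rw [Function.update_of_ne (ne_of_mem_of_not_mem hi hj)]
  have h3 : ∀ d ∈ distinctTuples h c A, ∑ m ∈ (classSet h (c j)).filter (fun m => m ∈ A.image d),
      unitVar (n + (m : ZMod Q)) * ∏ i ∈ A, unitVar (n + (d i : ZMod Q)) =
      ∑ i ∈ A.filter (fun i => c i = c j), (((Q : ℝ) / Q.totient - 2) *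
        ∏ i ∈ A, unitVar (n + (d i : ZMod Q)) + ((Q : ℝ) / Q.totient - 1) *
        ∏ l ∈ A.erase i, unitVar (n + (d l : ZMod Q))) := by
    intro d hd
    rw [filter_mem_image_eq hd, sum_image]
    · refine sum_congr rfl fun i hi => ?_
      rw [← mul_prod_erase A _ (mem_filter.1 hi).1, ← mul_assoc, unitVar_sq]
      ring
    · intro a ha b hb hab
      exact (mem_distinctTuples.1 hd).2.2 (mem_filter.1 ha).1 (mem_filter.1 hb).1 hab
  rw [h1, h2]
  have h4 : ∀ d ∈ distinctTuples h c A, ∑ m ∈ classSet h (c j), unitVar (n + (m : ZMod Q)) *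
        ∏ i ∈ A, unitVar (n + (d i : ZMod Q)) = _ := fun d _ =>
    (sum_filter_not_add_sum_filter (classSet h (c j)) (fun m => m ∈ A.image d) _).symm
  rw [sum_congr rfl h4, sum_add_distrib]
  congr 1
  rw [sum_congr rfl h3, sum_comm]
  refine sum_congr rfl fun i hi => ?_
  rw [sum_add_distrib, ← mul_sum, ← mul_sum, sum_distinctTuples_prod_erase h c (mem_filter.1 hi).1]
  rfl

/-- The average of a product of a distinct sum over `A` and class sums over `B`. -/
noncomputable def mixedMoment (Q : ℕ) [NeZero Q] (h : ℕ) (c : Fin k → ZMod r)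
    (A B : Finset (Fin k)) : ℝ :=
  (∑ n : ZMod Q, distinctSum h c A n * ∏ i ∈ B, classVar r h (c i) n) / Q

theorem mixedMoment_insert (h : ℕ) (c : Fin k → ZMod r) {A B : Finset (Fin k)} {j : Fin k}
    (hjA : j ∉ A) (hjB : j ∉ B) :
    mixedMoment Q h c (insert j A) B = mixedMoment Q h c A (insert j B) -
      ∑ i ∈ A.filter (fun i => c i = c j), (((Q : ℝ) / Q.totient - 2) * mixedMoment Q h c A B +
        ((Q : ℝ) / Q.totient - 1) *
          (((classSet h (c i)).card - (((A.erase i).filter fun l => c l = c i).card : ℝ)) *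
            mixedMoment Q h c (A.erase i) B)) := by
  have e : ∀ n : ZMod Q, distinctSum h c (insert j A) n * ∏ i ∈ B, classVar r h (c i) n =
      distinctSum h c A n * ∏ i ∈ insert j B, classVar r h (c i) n -
      ∑ i ∈ A.filter (fun i => c i = c j), (((Q : ℝ) / Q.totient - 2) *
        (distinctSum h c A n * ∏ i ∈ B, classVar r h (c i) n) +
        ((Q : ℝ) / Q.totient - 1) *
          (((classSet h (c i)).card - (((A.erase i).filter fun l => c l = c i).card : ℝ)) *
            (distinctSum h c (A.erase i) n * ∏ i ∈ B, classVar r h (c i) n))) := by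
    intro n
    rw [prod_insert hjB, eq_sub_of_add_eq (classVar_mul_distinctSum h c hjA n).symm, sub_mul,
      sum_mul]
    congr 1
    · ring
    · refine sum_congr rfl fun i _ => ?_
      ring
  simp_rw [mixedMoment, e]
  rw [sum_sub_distrib, sub_div, sum_comm]
  congr 1
  rw [sum_div]
  refine sum_congr rfl fun i _ => ?_
  rw [sum_add_distrib, ← mul_sum, ← mul_sum, ← mul_sum]
  ring

/-- The covariance of two class sums. -/
noncomputable def classCov (Q : ℕ) [NeZero Q] {r : ℕ} (h : ℕ) (c₁ c₂ : ZMod r) : ℝ :=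
  (∑ n : ZMod Q, classVar r h c₁ n * classVar r h c₂ n) / Q

theorem classCov_comm (h : ℕ) (c₁ c₂ : ZMod r) : classCov Q h c₁ c₂ = classCov Q h c₂ c₁ := by
  simp_rw [classCov, mul_comm]

/-- The covariance, corrected by `D` when both indices belong to `A` and to the same class. -/
noncomputable def correctedCov (Q : ℕ) [NeZero Q] (h : ℕ) (c : Fin k → ZMod r) (D : ℝ)
    (A : Finset (Fin k)) (i j : Fin k) : ℝ :=
  classCov Q h (c i) (c j) - if i ∈ A ∧ j ∈ A ∧ c i = c j then D else 0

theorem correctedCov_comm (h : ℕ) (c : Fin k → ZMod r) (D : ℝ) (A : Finset (Fin k)) (i j : Fin k) :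
    correctedCov Q h c D A i j = correctedCov Q h c D A j i := by
  rw [correctedCov, correctedCov, classCov_comm]
  congr 1
  by_cases h1 : i ∈ A <;> by_cases h2 : j ∈ A <;> simp [h1, h2, eq_comm]

/-- Making `j` a distinct index changes only the entries {i, j} with i in `A` and in the same class,
and the recursion at `j` is linear in these. It mirrors the recursion of the mixed moments. -/
theorem matchSum_correctedCov_insert (h : ℕ) (c : Fin k → ZMod r) (D : ℝ) {A B : Finset (Fin k)}
    {j : Fin k} (hAB : Disjoint A B) (hjA : j ∉ A) (hjB : j ∉ B) :
    matchSum (correctedCov Q h c D (insert j A)) (insert j A ∪ B) =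
      matchSum (correctedCov Q h c D A) (A ∪ insert j B) -
        ∑ i ∈ A.filter (fun i => c i = c j),
          D * matchSum (correctedCov Q h c D (A.erase i)) (A.erase i ∪ B) := by
  classical
  have hjX : j ∉ A ∪ B := by simp [hjA, hjB]
  have hX : insert j A ∪ B = insert j (A ∪ B) := insert_union j A B
  have hX' : A ∪ insert j B = insert j (A ∪ B) := union_insert j A B
  rw [hX, hX', matchSum_recursion (correctedCov_comm h c D _) (mem_insert_self j _),
    matchSum_recursion (correctedCov_comm h c D _) (mem_insert_self j _), erase_insert hjX]
  have hY : ∀ i ∈ A ∪ B, ((insert j (A ∪ B)).erase i).erase j = (A ∪ B).erase i := by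
    intro i _
    rw [erase_right_comm, erase_insert hjX]
  have h1 : ∀ i ∈ A ∪ B, matchSum (correctedCov Q h c D (insert j A)) ((A ∪ B).erase i) =
      matchSum (correctedCov Q h c D A) ((A ∪ B).erase i) := by
    intro i _
    refine matchSum_congr fun a ha b hb => ?_
    have ha' : a ≠ j := fun e => hjX (e ▸ mem_of_mem_erase ha)
    have hb' : b ≠ j := fun e => hjX (e ▸ mem_of_mem_erase hb)
    simp [correctedCov, ha', hb']
  have h2 : ∀ i ∈ A, matchSum (correctedCov Q h c D (A.erase i)) (A.erase i ∪ B) =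
      matchSum (correctedCov Q h c D A) ((A ∪ B).erase i) := by
    intro i hi
    have hiB : i ∉ B := disjoint_left.1 hAB hi
    rw [erase_union_distrib, erase_eq_of_notMem hiB]
    refine matchSum_congr fun a ha b hb => ?_
    have ha' : a ≠ i := by
      rintro rfl
      rcases mem_union.1 ha with ha | ha
      · exact notMem_erase _ _ ha
      · exact hiB ha
    have hb' : b ≠ i := by
      rintro rfl
      rcases mem_union.1 hb with hb | hb
      · exact notMem_erase _ _ hb
      · exact hiB hb
    simp [correctedCov, ha', hb']
  have h3 : ∑ i ∈ A.filter (fun i => c i = c j),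
      D * matchSum (correctedCov Q h c D (A.erase i)) (A.erase i ∪ B) =
      ∑ i ∈ A ∪ B, if i ∈ A ∧ c i = c j then
        D * matchSum (correctedCov Q h c D A) ((A ∪ B).erase i) else 0 := by
    have hf : (A ∪ B).filter (fun i => i ∈ A ∧ c i = c j) = A.filter (fun i => c i = c j) := by
      ext i
      simp only [mem_filter, mem_union]
      tauto
    rw [← sum_filter, hf]
    exact sum_congr rfl fun i hi => by rw [h2 i (mem_filter.1 hi).1]
  rw [h3, ← sum_sub_distrib]
  refine sum_congr rfl fun i hi => ?_
  rw [hY i hi, h1 i hi]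
  by_cases hiA : i ∈ A
  · by_cases hc : c i = c j
    · simp [correctedCov, hiA, hc, hjA]
      ring
    · have hc' : ¬ c j = c i := fun e => hc e.symm
      simp [correctedCov, hiA, hc, hc', hjA]
  · have hij : i ≠ j := fun e => hjX (e ▸ hi)
    simp [correctedCov, hiA, hjA, hij]

end DistinctSums

/-! ### Mixed moments compared with matching sums. -/

section MixedMoments

variable {k : ℕ} {Q : ℕ} [NeZero Q] {r : ℕ}

/-- The moments satisfy the recursion of the matching sums up to an error, and induction on the size
of the index set propagates it. -/
theorem abs_moment_sub_matchSum_le {V : Finset (Fin k) → ℝ} {g : Fin k → Fin k → ℝ}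
    (hg : ∀ i j, g i j = g j i) {P S δ : ℝ} (hkP : (k : ℝ) ≤ P) (hP : 2 ≤ P) (hS : 0 ≤ S)
    (hδ : 0 ≤ δ) (hgb : ∀ i j, |g i j| ≤ P * S ^ 2) (hV0 : V ∅ = 1)
    (hV : ∀ B, ∀ m ∈ B, |V B - ∑ j ∈ B.erase m, g m j * V ((B.erase j).erase m)| ≤
      δ * P * S ^ B.card) (n : ℕ) :
    ∀ B : Finset (Fin k), B.card = n → |V B - matchSum g B| ≤ δ * P ^ (3 * n) * S ^ n := by
  induction n using Nat.strong_induction_on with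
  | _ n ih =>
    intro B hB
    have hP0 : 0 ≤ P := by linarith
    rcases B.eq_empty_or_nonempty with rfl | ⟨m, hm⟩
    · rw [hV0, matchSum_empty, sub_self, abs_zero]
      positivity
    have h1 := hV B m hm
    rw [matchSum_recursion hg hm]
    have hb : ∀ j ∈ B.erase m, |g m j * V ((B.erase j).erase m) -
        g m j * matchSum g ((B.erase j).erase m)| ≤ δ * P ^ (3 * n - 5) * S ^ n := by
      intro j hj
      obtain ⟨hjm, hjB⟩ := mem_erase.1 hj
      have h1 := card_erase_of_mem (mem_erase.2 ⟨hjm.symm, hm⟩)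
      have h2 := card_erase_of_mem hjB
      have h3 := card_pos.2 ⟨m, mem_erase.2 ⟨hjm.symm, hm⟩⟩
      obtain ⟨n, rfl⟩ : ∃ n', n = n' + 2 := ⟨n - 2, by omega⟩
      rw [← mul_sub, abs_mul]
      calc _ ≤ P * S ^ 2 * (δ * P ^ (3 * n) * S ^ n) := by
            gcongr
            · exact hgb m j
            · exact ih n (by omega) _ (by omega)
        _ = δ * P ^ (3 * n + 1) * S ^ (n + 2) := by ring
        _ = _ := by rw [show 3 * (n + 2) - 5 = 3 * n + 1 by omega]
    have h2 : |∑ j ∈ B.erase m, g m j * V ((B.erase j).erase m) -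
        ∑ j ∈ B.erase m, g m j * matchSum g ((B.erase j).erase m)| ≤
          P * (δ * P ^ (3 * n - 5) * S ^ n) := by
      rw [← sum_sub_distrib]
      refine (abs_sum_le_sum_abs _ _).trans ((sum_le_card_nsmul _ _ _ hb).trans ?_)
      rw [nsmul_eq_mul]
      have hc : ((B.erase m).card : ℝ) ≤ P := by
        refine le_trans ?_ hkP
        have := card_le_univ (B.erase m)
        rw [Fintype.card_fin] at this
        exact_mod_cast this
      gcongr
    have hn : 1 ≤ n := hB ▸ card_pos.2 ⟨m, hm⟩
    have h3 : P * (δ * P ^ (3 * n - 5) * S ^ n) ≤ δ * P ^ (3 * n - 1) * S ^ n := by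
      have : P * P ^ (3 * n - 5) ≤ P ^ (3 * n - 1) := by
        rw [← pow_succ']
        exact pow_le_pow_right₀ (by linarith) (by omega)
      calc _ = δ * (P * P ^ (3 * n - 5)) * S ^ n := by ring
        _ ≤ _ := by gcongr
    have h4 : δ * P * S ^ n ≤ δ * P ^ (3 * n - 1) * S ^ n := by
      gcongr
      exact le_self_pow₀ (by linarith) (by omega)
    rw [hB] at h1
    have h5 := (abs_sub_le (V B) _ _).trans (add_le_add h1 h2)
    refine h5.trans ?_
    calc _ ≤ 2 * (δ * P ^ (3 * n - 1) * S ^ n) := by linarith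
      _ ≤ P * (δ * P ^ (3 * n - 1) * S ^ n) := by gcongr
      _ = δ * P ^ (3 * n - 1 + 1) * S ^ n := by ring
      _ = _ := by rw [Nat.sub_add_cancel (by omega)]

/-- One step of the passage from class sums to distinct sums. -/
theorem abs_moment_step_le {P S δ L M N n E₁ E₂ W₁ W₂ T : ℝ} (hP : 8 ≤ P) (hS : 1 ≤ S)
    (hδ : 0 ≤ δ) (hδS : 1 ≤ δ * S) (hT : 1 ≤ T) (x : ℕ) (hL : |L| ≤ P) (hn0 : 0 ≤ n) (hnP : n ≤ P)
    (hN0 : 0 ≤ N) (hN : N ≤ S ^ 2) (hM : |M - N| ≤ P)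
    (hE₁ : |E₁ - W₁| ≤ δ * T * S ^ (x + 1)) (hW₁ : |W₁| ≤ T * S ^ (x + 1))
    (hE₂ : |E₂ - W₂| ≤ δ * T * S ^ x) (hW₂ : |W₂| ≤ T * S ^ x) :
    |(L - 1) * E₁ + L * ((M - n) * E₂) - L * N * W₂| ≤ P ^ 3 * (δ * T * S ^ (x + 2)) := by
  have hS0 : 0 < S := by linarith
  have hT0 : 0 ≤ T := by linarith
  have hP0 : 0 ≤ P := by linarith
  have hSS : ∀ m : ℕ, S ^ m ≤ δ * S ^ (m + 1) := by
    intro m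
    have : 0 ≤ S ^ m := by positivity
    calc S ^ m = 1 * S ^ m := (one_mul _).symm
      _ ≤ δ * S * S ^ m := by gcongr
      _ = _ := by ring
  have hSm : ∀ m : ℕ, S ^ m ≤ S ^ (m + 1) := fun m => pow_le_pow_right₀ hS (by omega)
  have e1 : |E₁| ≤ 2 * (δ * T * S ^ (x + 2)) := by
    have h1 : |E₁| ≤ |E₁ - W₁| + |W₁| := by
      have := abs_add_le (E₁ - W₁) W₁
      rwa [sub_add_cancel] at this
    have h2 : T * S ^ (x + 1) ≤ T * (δ * S ^ (x + 2)) := by gcongr; exact hSS _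
    have h3 : δ * T * S ^ (x + 1) ≤ δ * T * S ^ (x + 2) := mul_le_mul_of_nonneg_left (hSm _) (by positivity)
    linarith
  have e2 : |E₂| ≤ 2 * (δ * T * S ^ (x + 1)) := by
    have h1 : |E₂| ≤ |E₂ - W₂| + |W₂| := by
      have := abs_add_le (E₂ - W₂) W₂
      rwa [sub_add_cancel] at this
    have h2 : T * S ^ x ≤ T * (δ * S ^ (x + 1)) := by gcongr; exact hSS _
    have h3 : δ * T * S ^ x ≤ δ * T * S ^ (x + 1) := mul_le_mul_of_nonneg_left (hSm _) (by positivity)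
    linarith
  have h0 : 0 ≤ δ * T * S ^ (x + 2) := by positivity
  have hL1 : |L - 1| ≤ 2 * P := by
    have := abs_sub L 1
    rw [abs_one] at this
    linarith
  have hMn : |M - n - N| ≤ 2 * P := by
    rw [show M - n - N = M - N - n by ring]
    have := abs_sub (M - N) n
    rw [abs_of_nonneg hn0] at this
    linarith
  -- Only L·N·W₂ is a main term. The term with E₁ is smaller by S, which `1 ≤ δ * S` turns into the
  -- saving, and replacing M - n by N costs a bounded amount.
  rw [show (L - 1) * E₁ + L * ((M - n) * E₂) - L * N * W₂ =
    (L - 1) * E₁ + (L * ((M - n - N) * E₂) + L * (N * (E₂ - W₂))) by ring]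
  refine (abs_add_le _ _).trans ((add_le_add le_rfl (abs_add_le _ _)).trans ?_)
  rw [abs_mul, abs_mul, abs_mul, abs_mul, abs_mul, abs_of_nonneg hN0]
  have f3 : |E₂ - W₂| * N ≤ δ * T * S ^ (x + 2) := by
    calc _ ≤ δ * T * S ^ x * S ^ 2 := by gcongr
      _ = _ := by ring
  have f2 : |E₂| ≤ 2 * (δ * T * S ^ (x + 2)) := by
    refine e2.trans ?_
    have : δ * T * S ^ (x + 1) ≤ δ * T * S ^ (x + 2) := mul_le_mul_of_nonneg_left (hSm _) (by positivity)
    linarith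
  set Z := δ * T * S ^ (x + 2) with hZ
  calc _ ≤ 2 * P * (2 * Z) + (P * (2 * P * (2 * Z)) + P * Z) := by
        have f3' : N * |E₂ - W₂| ≤ Z := by rw [mul_comm]; exact f3
        gcongr
    _ = (5 * P + 4 * P ^ 2) * Z := by ring
    _ ≤ P ^ 3 * Z := by
        gcongr
        nlinarith [sq_nonneg P, mul_nonneg hP0 (sub_nonneg.2 hP)]

theorem abs_correctedCov_le {h : ℕ} {c : Fin k → ZMod r} {D : ℝ} {A : Finset (Fin k)} {P S : ℝ}
    (hP : 2 ≤ P) (hgb : ∀ i j, |classCov Q h (c i) (c j)| ≤ P * S ^ 2) (hD : |D| ≤ P * S ^ 2)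
    (i j : Fin k) : |correctedCov Q h c D A i j| ≤ P ^ 2 * S ^ 2 := by
  have h1 := hgb i j
  have h2 : P * S ^ 2 + P * S ^ 2 ≤ P ^ 2 * S ^ 2 := by
    have : 0 ≤ P * S ^ 2 := (abs_nonneg _).trans hD
    nlinarith
  rw [correctedCov]
  split_ifs
  · exact (abs_sub _ _).trans (by linarith)
  · rw [sub_zero]
    have := (abs_nonneg _).trans hD
    linarith

/-- The mixed moments are given by matchings, with the covariances corrected on the distinct
indices. -/
theorem abs_mixedMoment_sub_matchSum_le {h : ℕ} {c : Fin k → ZMod r} {N P S δ : ℝ}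
    (hkP : (k : ℝ) + 8 ≤ P) (hS : 1 ≤ S) (hδ : 0 ≤ δ) (hδS : 1 ≤ δ * S)
    (hgb : ∀ i j, |classCov Q h (c i) (c j)| ≤ P * S ^ 2)
    (hL : |(Q : ℝ) / Q.totient - 1| ≤ P) (hN0 : 0 ≤ N) (hN : N ≤ S ^ 2)
    (hM : ∀ i, |((classSet h (c i)).card : ℝ) - N| ≤ P)
    (hV : ∀ B : Finset (Fin k), ∀ m ∈ B, |mixedMoment Q h c ∅ B -
      ∑ j ∈ B.erase m, classCov Q h (c m) (c j) * mixedMoment Q h c ∅ ((B.erase j).erase m)| ≤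
        δ * P * S ^ B.card) (a : ℕ) :
    ∀ A B : Finset (Fin k), A.card = a → Disjoint A B →
      |mixedMoment Q h c A B -
          matchSum (correctedCov Q h c (((Q : ℝ) / Q.totient - 1) * N) A) (A ∪ B)| ≤
        δ * P ^ (3 * k + 5 * a) * S ^ (A.card + B.card) := by
  classical
  have hP0 : 0 ≤ P := by have : (0 : ℝ) ≤ k := Nat.cast_nonneg k; linarith
  have hP8 : 8 ≤ P := by have : (0 : ℝ) ≤ k := Nat.cast_nonneg k; linarith
  have hP1 : 1 ≤ P := by linarith
  have hkP' : (k : ℝ) ≤ P := by linarith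
  set L := (Q : ℝ) / Q.totient - 1 with hLdef
  have hD : |L * N| ≤ P * S ^ 2 := by
    rw [abs_mul, abs_of_nonneg hN0]; gcongr
  have hW : ∀ A X : Finset (Fin k), |matchSum (correctedCov Q h c (L * N) A) X| ≤
      P ^ (3 * k) * S ^ X.card := by
    intro A X
    refine (abs_matchSum_le (correctedCov_comm h c _ A) hkP' hP1 (by linarith) (e := 2) _ X rfl
      fun i _ j _ => abs_correctedCov_le (by linarith) hgb hD i j).trans ?_
    have : X.card ≤ k := (card_le_univ X).trans (by rw [Fintype.card_fin])
    gcongr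
  -- Indices of `A` are moved to `B` one at a time. Moving one also produces terms on `A'` and on
  -- `A'` less one index, hence the strong induction.
  induction a using Nat.strong_induction_on with
  | _ a ih =>
    intro A B hA hAB
    rcases A.eq_empty_or_nonempty with rfl | ⟨j, hj⟩
    · have e : matchSum (correctedCov Q h c (L * N) ∅) (∅ ∪ B) =
          matchSum (fun i j => classCov Q h (c i) (c j)) B := by
        rw [empty_union]
        exact matchSum_congr fun i _ j _ => by simp [correctedCov]
      have h1 := abs_moment_sub_matchSum_le (V := mixedMoment Q h c ∅)
        (g := fun i j => classCov Q h (c i) (c j)) (fun i j => classCov_comm h _ _) hkP'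
        (by linarith) (by linarith) hδ hgb (by
          have : distinctTuples h c ∅ = {0} := by
            ext d
            rw [mem_distinctTuples, mem_singleton]
            simp [funext_iff]
          simp [mixedMoment, distinctSum, this, ZMod.card, NeZero.ne Q]) hV _ B rfl
      rw [e, card_empty, zero_add]
      refine h1.trans ?_
      have : B.card ≤ k := (card_le_univ B).trans (by rw [Fintype.card_fin])
      gcongr
      omega
    obtain ⟨a, rfl⟩ : ∃ a', a = a' + 1 :=
      ⟨a - 1, by have := card_pos.2 ⟨j, hj⟩; omega⟩
    set A' := A.erase j with hA'
    have hjA : j ∉ A' := notMem_erase j A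
    have hjB : j ∉ B := disjoint_left.1 hAB hj
    have hA'c : A'.card = a := by rw [hA', card_erase_of_mem hj]; omega
    have hAe : A = insert j A' := (insert_erase hj).symm
    have hA'B : Disjoint A' B := hAB.mono_left (erase_subset _ _)
    set T := P ^ (3 * k + 5 * a) with hT
    have hT1 : 1 ≤ T := one_le_pow₀ hP1
    set x := A'.card + B.card with hx
    have h1 : |mixedMoment Q h c A' (insert j B) -
        matchSum (correctedCov Q h c (L * N) A') (A' ∪ insert j B)| ≤ δ * T * S ^ (x + 1) := by
      have := ih a (by omega) A' (insert j B) hA'c (disjoint_insert_right.2 ⟨hjA, hA'B⟩)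
      rwa [card_insert_of_notMem hjB, ← add_assoc] at this
    have h2 : ∀ i ∈ A'.filter (fun i => c i = c j),
        |((L + 1 - 2) * mixedMoment Q h c A' B + L *
          (((classSet h (c i)).card - (((A'.erase i).filter fun l => c l = c i).card : ℝ)) *
            mixedMoment Q h c (A'.erase i) B)) - L * N *
              matchSum (correctedCov Q h c (L * N) (A'.erase i)) (A'.erase i ∪ B)| ≤
          P ^ 3 * (δ * T * S ^ (x + 1)) := by
      intro i hi
      have hiA := (mem_filter.1 hi).1
      have hci := card_erase_add_one hiA
      obtain ⟨x', hx'⟩ : ∃ x', x = x' + 1 := ⟨x - 1, by omega⟩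
      have hdis : Disjoint (A'.erase i) B := hA'B.mono_left (erase_subset _ _)
      have hce : (A'.erase i ∪ B).card = x' := by
        rw [card_union_of_disjoint hdis]; omega
      have hTT : P ^ (3 * k) ≤ T := pow_le_pow_right₀ hP1 (by omega)
      rw [hx', show L + 1 - 2 = L - 1 by ring]
      refine abs_moment_step_le hP8 hS hδ hδS hT1 x' hL (Nat.cast_nonneg _) ?_ hN0 hN (hM i)
        (W₁ := matchSum (correctedCov Q h c (L * N) A') (A' ∪ B)) ?_ ?_ ?_ ?_
      · refine le_trans ?_ hkP'
        have := card_le_univ ((A'.erase i).filter fun l => c l = c i)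
        rw [Fintype.card_fin] at this
        exact_mod_cast this
      · rw [← hx']
        exact ih a (by omega) A' B hA'c hA'B
      · refine (hW A' (A' ∪ B)).trans ?_
        rw [card_union_of_disjoint hA'B, ← hx, hx']
        gcongr
      · have := ih (a - 1) (by omega) (A'.erase i) B (by omega) hdis
        refine this.trans ?_
        rw [show (A'.erase i).card + B.card = x' by omega]
        rw [hT]
        gcongr
        omega
      · refine (hW (A'.erase i) (A'.erase i ∪ B)).trans ?_
        rw [hce]
        gcongr
    rw [hAe, mixedMoment_insert h c hjA hjB, matchSum_correctedCov_insert h c _ hA'B hjA hjB,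
      card_insert_of_notMem hjA, show A'.card + 1 + B.card = x + 1 by omega,
      show ∀ p q s t : ℝ, p - q - (s - t) = (p - s) - (q - t) by intros; ring, ← sum_sub_distrib]
    refine (abs_sub _ _).trans ?_
    have h3 : |∑ i ∈ A'.filter (fun i => c i = c j),
        (((Q : ℝ) / Q.totient - 2) * mixedMoment Q h c A' B + L *
          (((classSet h (c i)).card - (((A'.erase i).filter fun l => c l = c i).card : ℝ)) *
            mixedMoment Q h c (A'.erase i) B) - L * N *
              matchSum (correctedCov Q h c (L * N) (A'.erase i)) (A'.erase i ∪ B))| ≤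
        P * (P ^ 3 * (δ * T * S ^ (x + 1))) := by
      rw [show (Q : ℝ) / Q.totient - 2 = L + 1 - 2 by rw [hLdef]; ring]
      refine (abs_sum_le_sum_abs _ _).trans ((sum_le_card_nsmul _ _ _ h2).trans ?_)
      rw [nsmul_eq_mul]
      have hc : ((A'.filter fun i => c i = c j).card : ℝ) ≤ P := by
        refine le_trans ?_ hkP'
        have := card_le_univ (A'.filter fun i => c i = c j)
        rw [Fintype.card_fin] at this
        exact_mod_cast this
      gcongr
    refine (add_le_add h1 h3).trans ?_
    have h0 : 0 ≤ δ * T * S ^ (x + 1) := by positivity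
    -- One move costs 1 + P⁴ ≤ P⁵, which explains the exponent 5a.
    calc _ = (1 + P ^ 4) * (δ * T * S ^ (x + 1)) := by ring
      _ ≤ P ^ 5 * (δ * T * S ^ (x + 1)) := by
          gcongr
          have : 1 ≤ P ^ 4 := one_le_pow₀ hP1
          nlinarith
      _ = _ := by rw [hT]; ring

end MixedMoments

/-! ### Truncated singular series as averages over `ZMod Q`. -/

section SingularSeries

theorem nuRes_le (J : Finset ℕ) {p : ℕ} (hp : 0 < p) : nuRes J p ≤ p := by
  classical
  have : NeZero p := ⟨hp.ne'⟩
  rw [nuRes]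
  exact (card_le_univ _).trans_eq (ZMod.card p)

theorem card_isUnit_add_prime (p : ℕ) [hp : Fact p.Prime] (J : Finset ℕ) [DecidablePred
    fun n : ZMod p => ∀ d ∈ J, IsUnit (n + (d : ZMod p))] :
    ((univ.filter fun n : ZMod p => ∀ d ∈ J, IsUnit (n + (d : ZMod p))).card : ℝ) =
      (p : ℝ) - nuRes J p := by
  classical
  have h1 : (univ.filter fun n : ZMod p => ∀ d ∈ J, IsUnit (n + (d : ZMod p))) =
      ((J.image fun d : ℕ => (d : ZMod p)).image fun x => -x)ᶜ := by
    ext n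
    simp only [mem_filter, mem_univ, true_and, isUnit_iff_ne_zero, mem_compl, mem_image,
      exists_exists_and_eq_and, not_exists, not_and]
    refine forall₂_congr fun d _ => not_congr ?_
    rw [add_eq_zero_iff_eq_neg, eq_comm]
  rw [h1, card_compl, card_image_of_injective _ neg_injective, ZMod.card,
    Nat.cast_sub ((card_le_univ _).trans_eq (ZMod.card p))]
  simp only [nuRes]

/-- By the Chinese remainder theorem the count factors over primes, and modulo p the excluded n are
the negatives of the residues that `J` occupies. -/
theorem card_isUnit_add (Q : ℕ) : Squarefree Q → ∀ (_ : NeZero Q) (J : Finset ℕ)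
    [DecidablePred fun n : ZMod Q => ∀ d ∈ J, IsUnit (n + (d : ZMod Q))],
    ((univ.filter fun n : ZMod Q => ∀ d ∈ J, IsUnit (n + (d : ZMod Q))).card : ℝ) =
      ∏ p ∈ Q.primeFactors, ((p : ℝ) - nuRes J p) := by
  induction Q using Nat.recOnPrimeCoprime with
  | zero => intro h; simp at h
  | prime_pow p n hp =>
    intro hsq hne J hd
    rcases pow_zero_or_one_of_squarefree hp hsq with rfl | rfl
    · have hsub : ∀ a b : ZMod (p ^ 0), a = b := by
        intro a b
        have : Subsingleton (ZMod (p ^ 0)) := by rw [pow_zero]; infer_instance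
        exact Subsingleton.elim a b
      rw [filter_true_of_mem fun n _ d _ => hsub 1 (n + (d : ZMod (p ^ 0))) ▸ isUnit_one, card_univ,
        ZMod.card]
      simp
    · have : Fact (p ^ 1).Prime := ⟨by rwa [pow_one]⟩
      rw [card_isUnit_add_prime (p ^ 1) J, Nat.primeFactors_pow _ one_ne_zero, hp.primeFactors,
        prod_singleton, pow_one]
  | coprime a b ha hb hab iha ihb =>
    intro hsq hne J hd
    classical
    have hna : NeZero a := ⟨by omega⟩
    have hnb : NeZero b := ⟨by omega⟩
    have hsa : Squarefree a := hsq.of_mul_left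
    have hsb : Squarefree b := hsq.of_mul_right
    let e := ZMod.chineseRemainder hab
    rw [hab.primeFactors_mul, prod_union hab.disjoint_primeFactors, ← iha hsa hna J,
      ← ihb hsb hnb J, ← Nat.cast_mul, ← card_product]
    congr 1
    refine card_equiv e.toEquiv fun n => ?_
    simp only [mem_filter, mem_univ, true_and, mem_product]
    rw [← forall₂_and]
    refine forall₂_congr fun d _ => ?_
    have h1 : (e (n + (d : ZMod (a * b)))) = ((e n).1 + (d : ZMod a), (e n).2 + (d : ZMod b)) := by
      rw [map_add, map_natCast]
      rfl
    change _ ↔ IsUnit ((e n).1 + (d : ZMod a)) ∧ IsUnit ((e n).2 + (d : ZMod b))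
    rw [← isUnit_map_iff e, h1, Prod.isUnit_iff]

theorem totient_ratio_eq_prod {Q : ℕ} (hQ : Q ≠ 0) :
    (Q : ℝ) / Q.totient = ∏ p ∈ Q.primeFactors, (1 - 1 / (p : ℝ))⁻¹ := by
  have h := Nat.totient_eq_mul_prod_factors Q
  have h' : (Q.totient : ℝ) = Q * ∏ p ∈ Q.primeFactors, (1 - (p : ℝ)⁻¹) := by
    have h2 := congrArg (fun x : ℚ => (x : ℝ)) h
    push_cast at h2
    exact h2
  have hQ' : (Q : ℝ) ≠ 0 := by exact_mod_cast hQ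
  rw [h', prod_inv_distrib, ← div_div, div_self hQ', one_div]
  simp_rw [one_div]

variable {Q : ℕ} [NeZero Q]

/-- The average over `ZMod Q` of a product of normalised indicator functions of units. -/
theorem sum_prod_isUnit (hQ : Squarefree Q) (J : Finset ℕ)
    [DecidablePred fun x : ZMod Q => IsUnit x] :
    (∑ n : ZMod Q, ∏ d ∈ J, (if IsUnit (n + (d : ZMod Q)) then (Q : ℝ) / Q.totient else 0)) / Q =
      ∏ p ∈ Q.primeFactors, localFactor J p := by
  classical
  have h1 : ∀ n : ZMod Q, ∏ d ∈ J,
      (if IsUnit (n + (d : ZMod Q)) then (Q : ℝ) / Q.totient else 0) =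
      if ∀ d ∈ J, IsUnit (n + (d : ZMod Q)) then ((Q : ℝ) / Q.totient) ^ J.card else 0 := by
    intro n
    split_ifs with h
    · rw [prod_congr rfl fun d hd => if_pos (h d hd), prod_const]
    · push Not at h
      obtain ⟨d, hd, hu⟩ := h
      exact prod_eq_zero hd (if_neg hu)
  simp_rw [h1]
  rw [← sum_filter, sum_const, nsmul_eq_mul, card_isUnit_add Q hQ ‹_› J,
    totient_ratio_eq_prod (NeZero.ne Q), ← prod_pow]
  have hQ' : (Q : ℝ) = ∏ p ∈ Q.primeFactors, (p : ℝ) := by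
    rw [← Nat.cast_prod, Nat.prod_primeFactors_of_squarefree hQ]
  rw [hQ', ← prod_mul_distrib, ← prod_div_distrib]
  refine prod_congr rfl fun p hp => ?_
  have hp0 : (p : ℝ) ≠ 0 := by exact_mod_cast (Nat.prime_of_mem_primeFactors hp).ne_zero
  rw [localFactor, inv_pow]
  field_simp

theorem localFactor_nonneg (J : Finset ℕ) {p : ℕ} (hp : p.Prime) : 0 ≤ localFactor J p := by
  have h2 : (2 : ℝ) ≤ p := by exact_mod_cast hp.two_le
  have h3 : (nuRes J p : ℝ) ≤ p := by exact_mod_cast nuRes_le J hp.pos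
  have h4 : (nuRes J p : ℝ) / p ≤ 1 := div_le_one_of_le₀ h3 (by linarith)
  have h5 : 1 / (p : ℝ) ≤ 1 := div_le_one_of_le₀ (by linarith) (by linarith)
  rw [localFactor]
  exact div_nonneg (by linarith) (pow_nonneg (by linarith) _)

theorem prod_localFactor_le (J : Finset ℕ) :
    ∏ p ∈ Q.primeFactors, localFactor J p ≤ ((Q : ℝ) / Q.totient) ^ J.card := by
  rw [totient_ratio_eq_prod (NeZero.ne Q), ← prod_pow]
  refine prod_le_prod (fun p hp => localFactor_nonneg J (Nat.prime_of_mem_primeFactors hp))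
    fun p hp => ?_
  have h2 : (2 : ℝ) ≤ p := by exact_mod_cast (Nat.prime_of_mem_primeFactors hp).two_le
  have h5 : 1 / (p : ℝ) ≤ 1 := div_le_one_of_le₀ (by linarith) (by linarith)
  rw [localFactor, inv_pow, ← one_div]
  have h6 : 0 ≤ (nuRes J p : ℝ) / p := by positivity
  exact div_le_div_of_nonneg_right (by linarith) (pow_nonneg (by linarith) _)

theorem one_le_totient_ratio : 1 ≤ (Q : ℝ) / Q.totient := by
  rw [one_le_div (by exact_mod_cast Nat.totient_pos.2 (NeZero.pos Q))]
  exact_mod_cast Nat.totient_le Q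

variable {k r : ℕ}

/-- Expanding the product of centred indicators over the subsets J gives the alternating sum that
defines 𝔖_{0,r}, with Euler products restricted to the primes of `Q`. -/
theorem mixedMoment_univ_empty (hQ : Squarefree Q) (h : ℕ) (c : Fin k → ZMod r) :
    mixedMoment Q h c univ ∅ = ∑ d ∈ distinctTuples h c univ, ∑ J ∈ (univ.image d).powerset,
      (-1) ^ (univ.image d \ J).card * ∏ p ∈ Q.primeFactors, localFactor J p := by
  classical
  rw [mixedMoment]
  simp_rw [prod_empty, mul_one, distinctSum]
  rw [sum_comm, sum_div]
  refine sum_congr rfl fun d hd => ?_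
  have hinj := (mem_distinctTuples.1 hd).2.2
  have e : ∀ n : ZMod Q, ∏ i, unitVar (n + (d i : ZMod Q)) = ∑ J ∈ (univ.image d).powerset,
      (-1) ^ (univ.image d \ J).card *
        ∏ m ∈ J, (if IsUnit (n + (m : ZMod Q)) then (Q : ℝ) / Q.totient else 0) := by
    intro n
    rw [← prod_image (f := fun m : ℕ => unitVar (n + (m : ZMod Q))) (g := d) hinj]
    simp_rw [unitVar, sub_eq_add_neg]
    rw [prod_add]
    refine sum_congr rfl fun J _ => ?_
    rw [prod_const, mul_comm]
  simp_rw [e]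
  rw [sum_comm, sum_div]
  refine sum_congr rfl fun J _ => ?_
  rw [← mul_sum, mul_div_assoc, sum_prod_isUnit hQ]

theorem sumR_eq (h : ℕ) (c : Fin k → ZMod r) :
    sumR r h c = ∑ d ∈ distinctTuples h c univ, singSeriesAlt r (univ.image d) := by
  classical
  rw [sumR]
  congr 1
  · ext d
    rw [mem_filter, Fintype.mem_piFinset, mem_distinctTuples]
    simp only [mem_univ, not_true, false_imp_iff, implies_true, true_and, mem_classSet,
      forall_true_left, coe_univ, Set.injOn_univ, mem_Icc]
    exact ⟨fun h => ⟨fun i => ⟨h.1 i, h.2.2 i⟩, h.2.1⟩, fun h => ⟨fun i => (h.1 i).1, h.2,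
      fun i => (h.1 i).2⟩⟩

theorem card_distinctTuples_le (h : ℕ) (c : Fin k → ZMod r) :
    (distinctTuples h c univ).card ≤ h ^ k := by
  classical
  refine (card_filter_le _ _).trans ?_
  rw [Fintype.card_piFinset]
  refine (prod_le_pow_card _ _ h fun i _ => ?_).trans_eq (by simp)
  rw [if_pos (mem_univ i), classSet]
  exact (card_filter_le _ _).trans (by simp)

end SingularSeries

/-! ### The tail of the Euler product. -/

section Tail

theorem mem_primeFactors_primeProd {r y p : ℕ} :
    p ∈ (primeProd r y).primeFactors ↔ p.Prime ∧ p ≤ y ∧ ¬ p ∣ r := by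
  rw [primeProd, Nat.primeFactors_prod fun p hp => (mem_filter.1 hp).2.1, mem_filter, mem_Icc]
  exact ⟨fun h => ⟨h.2.1, h.1.2, h.2.2⟩, fun h => ⟨⟨h.1.one_lt.le, h.2.1⟩, h.1, h.2.2⟩⟩

theorem squarefree_primeProd (r y : ℕ) : Squarefree (primeProd r y) := by
  rw [primeProd]
  refine Finset.squarefree_prod_of_pairwise_isCoprime ?_ ?_
  · intro p hp q hq hpq
    exact (Nat.coprime_iff_isRelPrime.1 ((Nat.coprime_primes (mem_filter.1 hp).2.1 (mem_filter.1 hq).2.1).2 hpq))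
  · intro p hp
    exact (mem_filter.1 hp).2.1.prime.squarefree

instance neZero_primeProd (r y : ℕ) : NeZero (primeProd r y) := ⟨(squarefree_primeProd r y).ne_zero⟩

theorem coprime_primeProd (r y : ℕ) : r.Coprime (primeProd r y) := by
  rw [primeProd]
  refine Nat.Coprime.prod_right fun p hp => ?_
  exact ((Nat.Prime.coprime_iff_not_dvd (mem_filter.1 hp).2.1).2 (mem_filter.1 hp).2.2).symm

theorem abs_localFactor_sub_one_le {J : Finset ℕ} {p : ℕ} (hp : p.Prime) (hJ : J.sup id < p) :
    |localFactor J p - 1| ≤ (J.card : ℝ) ^ 2 * 2 ^ J.card * (1 / (p : ℝ) ^ 2) := by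
  have hp2 : (2 : ℝ) ≤ (p : ℝ) := by exact_mod_cast hp.two_le
  set x : ℝ := 1 / (p : ℝ) with hx
  have hx0 : 0 ≤ x := by positivity
  have hx1 : x ≤ 1 / 2 := one_div_le_one_div_of_le two_pos hp2
  obtain ⟨b1, b2⟩ := one_sub_pow_bound x hx0 (by linarith) J.card
  have hpow : (1 / 2 : ℝ) ^ J.card ≤ (1 - x) ^ J.card :=
    pow_le_pow_left₀ (by norm_num) (by linarith) _
  have hpos : 0 < (1 - x) ^ J.card := lt_of_lt_of_le (by positivity) hpow
  have e : localFactor J p - 1 = -((1 - x) ^ J.card - (1 - J.card * x)) / (1 - x) ^ J.card := by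
    rw [localFactor, nuRes_eq_card J p hJ, div_eq_mul_one_div (J.card : ℝ), ← hx]
    field_simp
    ring
  rw [e, abs_div, abs_neg, abs_of_nonneg b1, abs_of_pos hpos, div_le_iff₀ hpos]
  have hone : 1 ≤ 2 ^ J.card * (1 - x) ^ J.card := by
    rw [← mul_pow]
    exact one_le_pow₀ (by linarith)
  have hxx : 1 / (p : ℝ) ^ 2 = x ^ 2 := by rw [hx]; ring
  rw [hxx]
  calc _ ≤ (J.card : ℝ) ^ 2 * x ^ 2 * 1 := by linarith
    _ ≤ (J.card : ℝ) ^ 2 * x ^ 2 * (2 ^ J.card * (1 - x) ^ J.card) := by gcongr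
    _ = _ := by ring

theorem abs_prod_sub_one_le {ι : Type*} (T : Finset ι) (f : ι → ℝ) (t : ℝ)
    (ht : ∑ i ∈ T, |f i - 1| ≤ t) : |∏ i ∈ T, f i - 1| ≤ t * Real.exp t := by
  have h1 := Finset.norm_prod_one_add_sub_one_le T fun i => f i - 1
  simp only [add_sub_cancel, Real.norm_eq_abs] at h1
  have h2 : Real.exp (∑ i ∈ T, |f i - 1|) ≤ Real.exp t := Real.exp_le_exp.2 ht
  have h3 : 1 - t ≤ Real.exp (-t) := by linarith [Real.add_one_le_exp (-t)]
  have h4 : Real.exp (-t) * Real.exp t = 1 := by rw [← Real.exp_add]; simp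
  nlinarith [Real.exp_pos t]

/-- Beyond y every prime exceeds all elements of `J`, so the local factors are 1 + O(1/p²) and their
product is 1 + O(1/y). The bound is proved for finite products and passes to the limit. -/
theorem abs_singSeries_sub_le {r y k : ℕ} {J : Finset ℕ} (hJ : J.sup id ≤ y) (hJk : J.card ≤ k)
    (hy : 1 ≤ y) :
    |singSeries r J - ∏ p ∈ (primeProd r y).primeFactors, localFactor J p| ≤
      (2 * k ^ 2 * 2 ^ k * Real.exp (2 * k ^ 2 * 2 ^ k)) *
        (((primeProd r y : ℕ) : ℝ) / (primeProd r y).totient) ^ k / y := by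
  classical
  set K : ℝ := 2 * k ^ 2 * 2 ^ k with hK
  set P := ∏ p ∈ (primeProd r y).primeFactors, localFactor J p with hP
  have hy' : (1 : ℝ) ≤ y := by exact_mod_cast hy
  have hP0 : 0 ≤ P := prod_nonneg fun p hp => localFactor_nonneg J (Nat.prime_of_mem_primeFactors hp)
  have hP1 : P ≤ (((primeProd r y : ℕ) : ℝ) / (primeProd r y).totient) ^ k :=
    (prod_localFactor_le J).trans (pow_le_pow_right₀ one_le_totient_ratio hJk)
  let T₀ : Finset {p : ℕ // p.Prime ∧ ¬ p ∣ r} :=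
    (primeProd r y).primeFactors.subtype fun p => p.Prime ∧ ¬ p ∣ r
  have hT₀ : ∏ p ∈ T₀, localFactor J p = P := by
    rw [hP, ← prod_subtype_of_mem (p := fun p : ℕ => p.Prime ∧ ¬ p ∣ r)]
    intro p hp
    obtain ⟨h1, -, h2⟩ := mem_primeFactors_primeProd.1 hp
    exact ⟨h1, h2⟩
  have hlim : Filter.Tendsto (fun T : Finset {p : ℕ // p.Prime ∧ ¬ p ∣ r} =>
      ∏ p ∈ T, localFactor J p) Filter.atTop (nhds (singSeries r J)) :=
    (multipliable_singSeries r J).hasProd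
  have hlim2 := (hlim.sub_const P).abs
  have hbd : |singSeries r J - P| ≤ P * (K / y * Real.exp (K / y)) := by
    refine le_of_tendsto hlim2 ?_
    filter_upwards [Filter.eventually_ge_atTop T₀] with T hT
    have h1 : ∏ p ∈ T, localFactor J p = P * ∏ p ∈ T \ T₀, localFactor J p := by
      rw [← hT₀, mul_comm, prod_sdiff hT]
    rw [h1, show P * ∏ p ∈ T \ T₀, localFactor J (p : ℕ) - P =
      P * (∏ p ∈ T \ T₀, localFactor J (p : ℕ) - 1) by ring, abs_mul, abs_of_nonneg hP0]
    refine mul_le_mul_of_nonneg_left (abs_prod_sub_one_le _ _ _ ?_) hP0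
    have hgt : ∀ p ∈ T \ T₀, y < (p : ℕ) := by
      intro p hp
      by_contra hle
      refine (mem_sdiff.1 hp).2 ?_
      rw [mem_subtype, mem_primeFactors_primeProd]
      exact ⟨p.2.1, not_lt.1 hle, p.2.2⟩
    calc ∑ p ∈ T \ T₀, |localFactor J (p : ℕ) - 1|
        ≤ ∑ p ∈ T \ T₀, (k ^ 2 * 2 ^ k : ℝ) * (1 / ((p : ℕ) : ℝ) ^ 2) := by
          refine sum_le_sum fun p hp => ?_
          refine (abs_localFactor_sub_one_le p.2.1 (hJ.trans_lt (hgt p hp))).trans ?_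
          gcongr
          norm_num
      _ = (k ^ 2 * 2 ^ k : ℝ) * ∑ p ∈ (T \ T₀).map (Function.Embedding.subtype _),
            (1 / (p : ℝ) ^ 2) := by
          rw [← mul_sum, sum_map]
          rfl
      _ ≤ (k ^ 2 * 2 ^ k : ℝ) * (2 / y) := by
          gcongr
          set T₁ := (T \ T₀).map (Function.Embedding.subtype _)
          refine le_trans ?_ (sum_inv_sq_tail (T₁.sup id) (show (0 : ℝ) < y by linarith))
          refine sum_le_sum_of_subset_of_nonneg (fun p hp => ?_) fun p _ _ => by positivity
          have hp1 : p ≤ T₁.sup id := le_sup (f := id) hp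
          obtain ⟨q, hq, rfl⟩ := mem_map.1 hp
          exact mem_filter.2 ⟨mem_Icc.2 ⟨q.2.1.one_lt.le, hp1⟩, by exact_mod_cast hgt q hq⟩
      _ = K / y := by rw [hK]; ring
  have hK0 : 0 ≤ K := by positivity
  have h2 : Real.exp (K / y) ≤ Real.exp K := Real.exp_le_exp.2 (div_le_self hK0 hy')
  calc _ ≤ P * (K / y * Real.exp (K / y)) := hbd
    _ ≤ (((primeProd r y : ℕ) : ℝ) / (primeProd r y).totient) ^ k * (K / y * Real.exp K) := by
        gcongr
    _ = _ := by ring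

/-- Truncating the singular series at `y` changes `R_k` by little. -/
theorem abs_sumR_sub_mixedMoment_le {r k y h : ℕ} (hy : 1 ≤ y) (hhy : h ≤ y) (c : Fin k → ZMod r) :
    |sumR r h c - mixedMoment (primeProd r y) h c univ ∅| ≤
      (2 ^ k * (2 * k ^ 2 * 2 ^ k * Real.exp (2 * k ^ 2 * 2 ^ k))) *
        (((primeProd r y : ℕ) : ℝ) / (primeProd r y).totient) ^ k * (h : ℝ) ^ k / y := by
  set M := (2 * k ^ 2 * 2 ^ k * Real.exp (2 * k ^ 2 * 2 ^ k)) *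
        (((primeProd r y : ℕ) : ℝ) / (primeProd r y).totient) ^ k / y with hM
  have hM0 : 0 ≤ M := by positivity
  rw [sumR_eq, mixedMoment_univ_empty (squarefree_primeProd r y), ← sum_sub_distrib]
  have key : ∀ d ∈ distinctTuples h c univ, |singSeriesAlt r (univ.image d) -
      ∑ J ∈ (univ.image d).powerset, (-1) ^ (univ.image d \ J).card *
        ∏ p ∈ (primeProd r y).primeFactors, localFactor J p| ≤ 2 ^ k * M := by
    intro d hd
    have hcard : (univ.image d).card ≤ k := card_image_le.trans (by simp)
    rw [singSeriesAlt, ← sum_sub_distrib]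
    refine (abs_sum_le_sum_abs _ _).trans ?_
    refine (sum_le_card_nsmul _ _ M fun J hJ => ?_).trans ?_
    · rw [← mul_sub, abs_mul, abs_pow, abs_neg, abs_one, one_pow, one_mul]
      have hsub := mem_powerset.1 hJ
      refine abs_singSeries_sub_le ?_ ((card_le_card hsub).trans hcard) hy
      refine Finset.sup_le fun m hm => ?_
      obtain ⟨i, -, rfl⟩ := mem_image.1 (hsub hm)
      exact (mem_classSet.1 ((mem_distinctTuples.1 hd).1 i (mem_univ i))).1.2.trans hhy
    · rw [card_powerset, nsmul_eq_mul]
      push_cast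
      gcongr
      norm_num
  refine (abs_sum_le_sum_abs _ _).trans ((sum_le_card_nsmul _ _ _ key).trans ?_)
  rw [nsmul_eq_mul]
  have hc : ((distinctTuples h c univ).card : ℝ) ≤ (h : ℝ) ^ k := by
    exact_mod_cast card_distinctTuples_le h c
  calc _ ≤ (h : ℝ) ^ k * (2 ^ k * M) := by gcongr
    _ = _ := by rw [hM]; ring

end Tail

/-! ### Bounds for divisor functions and divisor sums. -/

section DivisorBounds

/-- Compare v + 1 with p^(vε) prime by prime: once p^ε ≥ 2 there is no loss, and the fewer than `P`
smaller primes lose at most `K` each. -/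
theorem exists_card_divisors_le {ε : ℝ} (hε : 0 < ε) :
    ∃ C : ℝ, 0 < C ∧ ∀ N : ℕ, 0 < N → (N.divisors.card : ℝ) ≤ C * (N : ℝ) ^ ε := by
  set P : ℕ := ⌈(2 : ℝ) ^ (1 / ε)⌉₊ with hP
  set K : ℝ := 1 + 2 / ε with hK
  have hK1 : 1 ≤ K := by rw [hK]; have : 0 < 2 / ε := by positivity
                         linarith
  refine ⟨K ^ P, by positivity, fun N hN => ?_⟩
  have hloc : ∀ p ∈ N.primeFactors, ((N.factorization p : ℝ) + 1) ≤
      (if p < P then K else 1) * ((p : ℝ) ^ N.factorization p) ^ ε := by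
    intro p hp
    have hp2 : (2 : ℝ) ≤ p := by exact_mod_cast (Nat.prime_of_mem_primeFactors hp).two_le
    set v := N.factorization p
    have hcomm : ((p : ℝ) ^ v) ^ ε = ((p : ℝ) ^ ε) ^ v := by
      rw [← Real.rpow_natCast, ← Real.rpow_natCast, ← Real.rpow_mul (by linarith),
        ← Real.rpow_mul (by linarith), mul_comm]
    rw [hcomm]
    split_ifs with h
    · have h1 : 1 + ε / 2 ≤ (p : ℝ) ^ ε := by
        have h2 : (2 : ℝ) ^ ε ≤ (p : ℝ) ^ ε := Real.rpow_le_rpow (by norm_num) hp2 hε.le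
        rw [Real.rpow_def_of_pos two_pos] at h2
        have h3 := Real.add_one_le_exp (Real.log 2 * ε)
        have h4 := Real.log_two_gt_d9
        nlinarith
      have h2 : 1 + (v : ℝ) * (ε / 2) ≤ ((p : ℝ) ^ ε) ^ v :=
        (one_add_mul_le_pow (by linarith) v).trans (by gcongr)
      calc (v : ℝ) + 1 ≤ K * (1 + (v : ℝ) * (ε / 2)) := by
            rw [hK]
            field_simp
            have : 0 ≤ (v : ℝ) := Nat.cast_nonneg v
            nlinarith [mul_nonneg this hε.le]
        _ ≤ _ := by gcongr
    · have h1 : (2 : ℝ) ≤ (p : ℝ) ^ ε := by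
        have h2 : (2 : ℝ) ^ (1 / ε) ≤ p := (Nat.le_ceil _).trans (by exact_mod_cast not_lt.1 h)
        calc (2 : ℝ) = ((2 : ℝ) ^ (1 / ε)) ^ ε := by
              rw [← Real.rpow_mul (by norm_num), one_div_mul_cancel hε.ne', Real.rpow_one]
          _ ≤ _ := Real.rpow_le_rpow (by positivity) h2 hε.le
      rw [one_mul]
      have h3 := one_add_mul_le_pow (show (-2 : ℝ) ≤ 1 by norm_num) v
      calc (v : ℝ) + 1 ≤ (1 + 1) ^ v := by linarith
        _ ≤ _ := by gcongr; linarith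
  have hN' : (N : ℝ) = ∏ p ∈ N.primeFactors, (p : ℝ) ^ N.factorization p := by
    conv_lhs => rw [← Nat.prod_factorization_pow_eq_self hN.ne']
    rw [Nat.prod_factorization_eq_prod_primeFactors]
    push_cast
    rfl
  rw [Nat.card_divisors hN.ne']
  push_cast
  calc ∏ p ∈ N.primeFactors, ((N.factorization p : ℝ) + 1)
      ≤ ∏ p ∈ N.primeFactors, (if p < P then K else 1) * ((p : ℝ) ^ N.factorization p) ^ ε :=
        prod_le_prod (fun _ _ => by positivity) hloc
    _ = (∏ p ∈ N.primeFactors, if p < P then K else 1) * (N : ℝ) ^ ε := by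
        rw [prod_mul_distrib, Real.finsetProd_rpow _ _ fun _ _ => by positivity, ← hN']
    _ ≤ _ := by
        gcongr
        rw [← prod_filter, prod_const]
        refine pow_le_pow_right₀ hK1 ?_
        refine (card_le_card fun p hp => ?_).trans_eq (card_range P)
        exact mem_range.2 (mem_filter.1 hp).2

/-- Chebyshev's bound for the sum of log p, with p ≥ 2^j and log p ≥ j log 2. -/
theorem sum_dyadic_primes_le {j : ℕ} (hj : 1 ≤ j) :
    ∑ p ∈ (Ioc (2 ^ j) (2 ^ (j + 1))).filter Nat.Prime, 1 / (p : ℝ) ≤ 4 / j := by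
  have hlog : ∀ p ∈ (Ioc (2 ^ j) (2 ^ (j + 1))).filter Nat.Prime,
      1 / (p : ℝ) ≤ Real.log p / (j * Real.log 2 * 2 ^ j) := by
    intro p hp
    have h1 : (2 : ℝ) ^ j ≤ p := by exact_mod_cast (mem_Ioc.1 (mem_filter.1 hp).1).1.le
    have h2 : (j : ℝ) * Real.log 2 ≤ Real.log p := by
      rw [← Real.log_pow]
      exact Real.log_le_log (by positivity) h1
    have h3 : 0 < (j : ℝ) * Real.log 2 := mul_pos (by exact_mod_cast hj) (Real.log_pos one_lt_two)
    rw [div_le_div_iff₀ (by linarith [show (0 : ℝ) < 2 ^ j by positivity]) (by positivity), one_mul]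
    gcongr
  refine (sum_le_sum hlog).trans ?_
  rw [← sum_div]
  have h4 : ∑ p ∈ (Ioc (2 ^ j) (2 ^ (j + 1))).filter Nat.Prime, Real.log (p : ℝ) ≤
      2 * Real.log 2 * (2 * 2 ^ j) := by
    have h5 := Chebyshev.theta_le_log4_mul_x (x := ((2 ^ (j + 1) : ℕ) : ℝ)) (by positivity)
    rw [Chebyshev.theta_eq_theta_coe_floor, Nat.floor_natCast, Chebyshev.theta_eq_sum_primesLE_log]
      at h5
    have h6 : Real.log 4 = 2 * Real.log 2 := by
      rw [show (4 : ℝ) = 2 ^ 2 by norm_num, Real.log_pow]; norm_num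
    rw [h6] at h5
    push_cast at h5
    rw [← pow_succ']
    refine le_trans (sum_le_sum_of_subset_of_nonneg (fun p hp => ?_) fun p _ _ => ?_) h5
    · exact Nat.mem_primesLE.2 ⟨(mem_Ioc.1 (mem_filter.1 hp).1).2, (mem_filter.1 hp).2⟩
    · exact Real.log_natCast_nonneg p
  have h3 : 0 < (j : ℝ) * Real.log 2 := mul_pos (by exact_mod_cast hj) (Real.log_pos one_lt_two)
  have h7 : (0 : ℝ) < j := by exact_mod_cast hj
  rw [div_le_div_iff₀ (by positivity) h7]
  nlinarith

theorem sum_primes_le (J : ℕ) :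
    ∑ p ∈ (Icc 1 (2 ^ (J + 1))).filter Nat.Prime, 1 / (p : ℝ) ≤
      1 / 2 + 4 * ∑ j ∈ Icc 1 J, 1 / (j : ℝ) := by
  induction J with
  | zero =>
    have : (Icc 1 (2 ^ (0 + 1))).filter Nat.Prime = {2} := by decide
    rw [this]
    norm_num
  | succ J ih =>
    have h1 : (Icc 1 (2 ^ (J + 1 + 1))).filter Nat.Prime =
        (Icc 1 (2 ^ (J + 1))).filter Nat.Prime ∪
          (Ioc (2 ^ (J + 1)) (2 ^ (J + 1 + 1))).filter Nat.Prime := by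
      rw [← filter_union]
      congr 1
      ext p
      have : 2 ^ (J + 1) ≤ 2 ^ (J + 1 + 1) := Nat.pow_le_pow_right two_pos (by omega)
      have : 1 ≤ 2 ^ (J + 1) := Nat.one_le_two_pow
      simp only [mem_union, mem_Icc, mem_Ioc]
      omega
    rw [h1, sum_union, sum_Icc_succ_top (by omega)]
    · have := sum_dyadic_primes_le (j := J + 1) (by omega)
      push_cast at this ⊢
      have h2 : 4 / ((J : ℝ) + 1) = 4 * (1 / ((J : ℝ) + 1)) := by ring
      linarith
    · refine disjoint_left.2 fun p hp hq => ?_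
      have := (mem_Icc.1 (mem_filter.1 hp).1).2
      have := (mem_Ioc.1 (mem_filter.1 hq).1).1
      omega

/-- The dyadic blocks add up to a harmonic sum of length about log y, so the sum over primes is
O(log log y); this is weakened to ε log y + O(1), all that power-free losses require. -/
theorem exists_sum_primes_le {ε : ℝ} (hε : 0 < ε) : ∃ C : ℝ, ∀ y : ℕ, 1 ≤ y →
    ∑ p ∈ (Icc 1 y).filter Nat.Prime, 1 / (p : ℝ) ≤ ε * Real.log y + C := by
  refine ⟨5 + 4 * |1 + Real.log (ε / 8)|, fun y hy => ?_⟩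
  have h0 := neg_abs_le (1 + Real.log (ε / 8))
  have h0' := abs_nonneg (1 + Real.log (ε / 8))
  set J := Nat.log 2 y with hJ
  have h1 : y ≤ 2 ^ (J + 1) := (Nat.lt_pow_succ_log_self one_lt_two y).le
  have h2 : ∑ p ∈ (Icc 1 y).filter Nat.Prime, 1 / (p : ℝ) ≤
      ∑ p ∈ (Icc 1 (2 ^ (J + 1))).filter Nat.Prime, 1 / (p : ℝ) :=
    sum_le_sum_of_subset_of_nonneg (filter_subset_filter _ (Icc_subset_Icc_right h1))
      fun p _ _ => by positivity
  have h3 := sum_primes_le J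
  have h4 : ∑ j ∈ Icc 1 J, 1 / (j : ℝ) ≤ 1 + Real.log J := by
    have := harmonic_le_one_add_log J
    rw [harmonic_eq_sum_Icc] at this
    push_cast at this
    simpa only [one_div] using this
  have h5 : (J : ℝ) * Real.log 2 ≤ Real.log y := by
    rw [← Real.log_pow]
    refine Real.log_le_log (by positivity) ?_
    exact_mod_cast Nat.pow_log_le_self 2 (by omega)
  have h6 := Real.log_two_gt_d9
  have hly : 0 ≤ Real.log y := Real.log_natCast_nonneg y
  have h7 : Real.log J ≤ ε / 8 * J - 1 - Real.log (ε / 8) ∨ J = 0 := by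
    rcases Nat.eq_zero_or_pos J with h | h
    · exact Or.inr h
    · left
      have hJ' : (0 : ℝ) < J := by exact_mod_cast h
      have := Real.log_le_sub_one_of_pos (mul_pos (show 0 < ε / 8 by positivity) hJ')
      rw [Real.log_mul (by positivity) hJ'.ne'] at this
      linarith
  rcases h7 with h7 | h7
  · have h8 : (J : ℝ) ≤ 2 * Real.log y := by nlinarith [Nat.cast_nonneg (α := ℝ) J]
    nlinarith
  · have h9 : ∑ j ∈ Icc 1 J, 1 / (j : ℝ) = 0 := by rw [h7]; simp
    nlinarith [mul_nonneg hε.le hly]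

theorem divSum_eq_prod {Q : ℕ} (hQ : Squarefree Q) (m : ℕ) :
    divSum m Q = ∏ p ∈ Q.primeFactors, (1 + 2 ^ m / (p : ℝ)) := by
  let f : ArithmeticFunction ℝ := ⟨fun n => (n.divisors.card : ℝ) ^ m / (n : ℝ), by simp⟩
  have hf : f.IsMultiplicative := by
    refine ⟨by simp [f], fun {m n} hmn => ?_⟩
    simp only [f, ArithmeticFunction.coe_mk, hmn.card_divisors_mul]
    push_cast
    rw [mul_pow, div_mul_div_comm]
  rw [divSum]
  refine (hf.prodPrimeFactors_one_add_of_squarefree hQ).symm.trans (prod_congr rfl fun p hp => ?_)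
  have hp' := Nat.prime_of_mem_primeFactors hp
  simp only [f, ArithmeticFunction.coe_mk, hp'.divisors, card_pair hp'.one_lt.ne]
  norm_num

/-- The divisor sum is ∏ (1 + 2^m/p), at most the exponential of 2^m ∑ 1/p. -/
theorem exists_divSum_primeProd_le (m : ℕ) {ε : ℝ} (hε : 0 < ε) :
    ∃ C : ℝ, 0 < C ∧ ∀ r y : ℕ, 1 ≤ y → divSum m (primeProd r y) ≤ C * (y : ℝ) ^ ε := by
  obtain ⟨C, hC⟩ := exists_sum_primes_le (show 0 < ε / 2 ^ m by positivity)
  refine ⟨Real.exp (2 ^ m * C), Real.exp_pos _, fun r y hy => ?_⟩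
  have hy' : (0 : ℝ) < y := by exact_mod_cast hy
  rw [divSum_eq_prod (squarefree_primeProd r y)]
  calc ∏ p ∈ (primeProd r y).primeFactors, (1 + 2 ^ m / (p : ℝ))
      ≤ ∏ p ∈ (primeProd r y).primeFactors, Real.exp (2 ^ m * (1 / (p : ℝ))) := by
        refine prod_le_prod (fun p _ => by positivity) fun p _ => ?_
        have := Real.add_one_le_exp (2 ^ m * (1 / (p : ℝ)))
        rw [mul_one_div] at this ⊢
        linarith
    _ = Real.exp (2 ^ m * ∑ p ∈ (primeProd r y).primeFactors, 1 / (p : ℝ)) := by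
        rw [← Real.exp_sum, mul_sum]
    _ ≤ Real.exp (2 ^ m * (ε / 2 ^ m * Real.log y + C)) := by
        gcongr
        refine le_trans (sum_le_sum_of_subset_of_nonneg (fun p hp => ?_) fun p _ _ => by positivity)
          (hC y hy)
        obtain ⟨h1, h2, -⟩ := mem_primeFactors_primeProd.1 hp
        exact mem_filter.2 ⟨mem_Icc.2 ⟨h1.one_lt.le, h2⟩, h1⟩
    _ = Real.exp (2 ^ m * C) * (y : ℝ) ^ ε := by
        rw [Real.rpow_def_of_pos hy', ← Real.exp_add]
        congr 1
        field_simp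
        ring

/-- Identifies the sum in the main term with the variance Q/φ(Q) - 1 that arises from repeated
integers. -/
theorem totient_ratio_eq_one_add {Q : ℕ} (hQ : Squarefree Q) :
    (Q : ℝ) / Q.totient = 1 + sumInvTotient Q := by
  let f : ArithmeticFunction ℝ := ⟨fun n => 1 / (n.totient : ℝ), by simp⟩
  have hf : f.IsMultiplicative := by
    refine ⟨by simp [f], fun {m n} hmn => ?_⟩
    simp only [f, ArithmeticFunction.coe_mk, Nat.totient_mul hmn]
    push_cast
    rw [one_div_mul_one_div]
  have h := hf.prodPrimeFactors_one_add_of_squarefree hQ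
  rw [totient_ratio_eq_prod hQ.ne_zero]
  have h1 : ∏ p ∈ Q.primeFactors, (1 - 1 / (p : ℝ))⁻¹ = ∏ p ∈ Q.primeFactors, (1 + f p) := by
    refine prod_congr rfl fun p hp => ?_
    have hp' := Nat.prime_of_mem_primeFactors hp
    have h2 : (2 : ℝ) ≤ p := by exact_mod_cast hp'.two_le
    have h3 : (p : ℝ) - 1 ≠ 0 := by linarith
    simp only [f, ArithmeticFunction.coe_mk, Nat.totient_prime hp', Nat.cast_pred hp'.pos]
    field_simp
    ring
  have h2 : Q.divisors = insert 1 (Q.divisors.filter fun d => 1 < d) := by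
    ext d
    rw [mem_insert, mem_filter, Nat.mem_divisors]
    have := hQ.ne_zero
    rcases Nat.lt_trichotomy d 1 with hd | rfl | hd
    · have : d = 0 := by omega
      subst this
      simp
    · simp [this]
    · simp [this, hd]
      omega
  rw [h1, h, h2, sum_insert (by simp), sumInvTotient]
  congr 1
  · simp [f]
  · refine sum_congr rfl fun d hd => ?_
    have hd' := hQ.squarefree_of_dvd (Nat.mem_divisors.1 (mem_filter.1 hd).1).1
    have h3 : ((ArithmeticFunction.moebius d : ℤ) : ℝ) ^ 2 = 1 := by
      exact_mod_cast ArithmeticFunction.moebius_sq_eq_one_of_squarefree hd'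
    rw [h3]
    rfl

theorem totient_ratio_le_divSum {Q : ℕ} (hQ : Squarefree Q) :
    (Q : ℝ) / Q.totient ≤ divSum 1 Q := by
  rw [totient_ratio_eq_prod hQ.ne_zero, divSum_eq_prod hQ]
  refine prod_le_prod (fun p hp => ?_) fun p hp => ?_
  all_goals
    have h2 : (2 : ℝ) ≤ p := by exact_mod_cast (Nat.prime_of_mem_primeFactors hp).two_le
    have h3 : (0 : ℝ) < 1 - 1 / p := by
      rw [sub_pos, div_lt_one (by linarith)]
      linarith
  · exact inv_nonneg.2 h3.le
  · rw [inv_le_iff_one_le_mul₀ h3]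
    have h4 : (1 : ℝ) / p ≤ 1 / 2 := one_div_le_one_div_of_le two_pos h2
    have h5 : 0 ≤ (1 : ℝ) / p := by positivity
    rw [pow_one, div_eq_mul_one_div (2 : ℝ)]
    nlinarith

end DivisorBounds

/-! ### The moment theorem with explicit parameters. -/

section Parameters

variable {Q : ℕ} [NeZero Q] {k r : ℕ}

/-- A nonzero fraction with denominator q is at distance at least 1/q from the integers, so the
weight is at most q/φ(q), independently of h. This makes double cancellations negligible. -/
theorem fejerWeight_le_divSum (hQ : Squarefree Q) (h : ℝ) {α : ZMod Q} (hα : α ≠ 0) :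
    fejerWeight h α ≤ divSum 1 Q := by
  have ho := addOrderOf_pos_zmod α
  have hd := addOrderOf_dvd_modulus α
  have h1 : fejer h α ≤ addOrderOf α :=
    (min_le_right _ _).trans (div_zabs_le ho (addOrderOf_nsmul_eq_zero α) hα)
  have hsq := hQ.squarefree_of_dvd hd
  calc fejerWeight h α ≤ (addOrderOf α : ℝ) / (addOrderOf α).totient := by
        rw [fejerWeight]; gcongr
    _ ≤ divSum 1 (addOrderOf α) := totient_ratio_le_divSum hsq
    _ ≤ _ := sum_le_sum_of_subset_of_nonneg (Nat.divisors_subset_of_dvd (NeZero.ne Q) hd)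
        fun _ _ _ => by positivity

theorem sum_fejerWeight_sq_le {h : ℝ} (hh : 0 < h) :
    ∑ α ∈ univ.erase (0 : ZMod Q), fejerWeight h α ^ 2 ≤ 6 * h * divSum 2 Q := by
  have hmap : ∀ α ∈ univ.erase (0 : ZMod Q), addOrderOf α ∈ Q.divisors := fun α _ =>
    Nat.mem_divisors.2 ⟨addOrderOf_dvd_modulus α, NeZero.ne Q⟩
  rw [← sum_fiberwise_of_maps_to hmap, divSum, mul_sum]
  refine sum_le_sum fun q hq => ?_
  have hq0 : 0 < q := Nat.pos_of_mem_divisors hq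
  have hq0' : (0 : ℝ) < q := by exact_mod_cast hq0
  have hφ : (0 : ℝ) < q.totient := by exact_mod_cast Nat.totient_pos.2 hq0
  have h2 : ((q : ℝ) / q.totient) ^ 2 ≤ (q.divisors.card : ℝ) ^ 2 :=
    pow_le_pow_left₀ (by positivity) (div_totient_le q) 2
  calc ∑ α ∈ univ.erase (0 : ZMod Q) with addOrderOf α = q, fejerWeight h α ^ 2
      = (∑ α ∈ univ.erase (0 : ZMod Q) with addOrderOf α = q, fejer h α ^ 2) * (1 / q.totient) ^ 2 := by
        rw [sum_mul]
        refine sum_congr rfl fun α hα => ?_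
        rw [fejerWeight, (mem_filter.1 hα).2]
        ring
    _ ≤ 6 * (q * h) * (1 / q.totient) ^ 2 := by
        refine mul_le_mul_of_nonneg_right (sum_fejer_sq_le hq0 hh _ fun α hα => ?_) (by positivity)
        obtain ⟨h3, h4⟩ := mem_filter.1 hα
        exact ⟨h4 ▸ addOrderOf_nsmul_eq_zero α, ne_of_mem_erase h3⟩
    _ = 6 * h * (((q : ℝ) / q.totient) ^ 2 / q) := by field_simp
    _ ≤ _ := by gcongr

theorem mixedMoment_empty_eq_suppSum (hQ : Squarefree Q) (hr : r.Coprime Q) (h : ℕ)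
    (c : Fin k → ZMod r) (B : Finset (Fin k)) : ((mixedMoment Q h c ∅ B : ℝ) : ℂ) =
      suppSum Q (fun i => classCoeff hr h (c i)) B := by
  have h1 := sum_prod_classVar hQ hr h c B
  have hQ0 : (Q : ℂ) ≠ 0 := by exact_mod_cast NeZero.ne Q
  have h2 : distinctTuples h c (∅ : Finset (Fin k)) = {fun _ => 0} := by
    ext d
    rw [mem_distinctTuples, mem_singleton]
    simp [funext_iff]
  have h3 : mixedMoment Q h c ∅ B = (∑ n : ZMod Q, ∏ i ∈ B, classVar r h (c i) n) / Q := by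
    rw [mixedMoment]
    simp [distinctSum, h2]
  rw [h3, Complex.ofReal_div, h1, Complex.ofReal_natCast, mul_div_cancel_left₀ _ hQ0]

theorem classCov_eq_pairSum (hQ : Squarefree Q) (hr : r.Coprime Q) (h : ℕ) (c : Fin k → ZMod r)
    (i j : Fin k) : ((classCov Q h (c i) (c j) : ℝ) : ℂ) =
      pairSum (Q := Q) (fun i => classCoeff hr h (c i)) i j := by
  rw [pairSum_classCoeff hQ hr, classCov]

theorem fejerWeight_neg (h : ℝ) (α : ZMod Q) : fejerWeight h (-α) = fejerWeight h α := by
  rw [fejerWeight, fejer_neg, addOrderOf_neg, fejerWeight]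

theorem abs_classCov_le (hQ : Squarefree Q) (hr : r.Coprime Q) {h : ℕ} (hh : 0 < h)
    (c₁ c₂ : ZMod r) : |classCov Q h c₁ c₂| ≤ 6 * h * divSum 2 Q := by
  have h1 := classCov_eq_pairSum hQ hr h ![c₁, c₂] 0 1
  have h2 : |classCov Q h c₁ c₂| = ‖((classCov Q h c₁ c₂ : ℝ) : ℂ)‖ := by
    rw [Complex.norm_real, Real.norm_eq_abs]
  have h3 : ((classCov Q h c₁ c₂ : ℝ) : ℂ) =
    pairSum (Q := Q) (fun i => classCoeff hr h (![c₁, c₂] i)) 0 1 := h1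
  rw [h2, h3, pairSum]
  refine (norm_sum_le _ _).trans (le_trans (sum_le_sum fun α _ => ?_)
    (sum_fejerWeight_sq_le (by exact_mod_cast hh)))
  rw [norm_mul, sq]
  have h4 := norm_classCoeff_le hr h (![c₁, c₂] 0) α
  have h5 := norm_classCoeff_le hr h (![c₁, c₂] 1) (-α)
  rw [fejerWeight_neg] at h5
  exact mul_le_mul h4 h5 (norm_nonneg _) ((norm_nonneg _).trans h4)

/-- Rewrites the Wick error as δ·P with P = (9k²K)^(k+2), the single base used in the later
inductions. -/
theorem moment_bound_arith {K η S : ℝ} (hk : 1 ≤ k) (hK : 1 ≤ K) (hη : 0 ≤ η) (hS : 0 ≤ S)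
    (b : ℕ) : 2 * (3 * k * K ^ 5 * η) * K * (1 + (k : ℝ) ^ 2 * K) ^ (k + 1) * S ^ b ≤
      3 * k * K ^ 5 * η * (9 * k ^ 2 * K) ^ (k + 2) * S ^ b := by
  have hk' : (1 : ℝ) ≤ k := by exact_mod_cast hk
  have h1 : 1 ≤ (k : ℝ) ^ 2 * K := one_le_mul_of_one_le_of_one_le (one_le_pow₀ hk') hK
  have h2 : (1 + (k : ℝ) ^ 2 * K) ^ (k + 1) ≤ (9 * k ^ 2 * K) ^ (k + 1) := by
    gcongr
    linarith
  have h3 : 2 * K ≤ 9 * k ^ 2 * K := by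
    have : 1 ≤ (k : ℝ) ^ 2 := one_le_pow₀ hk'
    nlinarith
  calc _ = 3 * k * K ^ 5 * η * S ^ b * ((2 * K) * (1 + (k : ℝ) ^ 2 * K) ^ (k + 1)) := by ring
    _ ≤ 3 * k * K ^ 5 * η * S ^ b * ((9 * k ^ 2 * K) * (9 * k ^ 2 * K) ^ (k + 1)) := by gcongr
    _ = _ := by ring

/-- The moments over distinct tuples in terms of matchings. -/
theorem abs_mixedMoment_univ_sub_le (hQ : Squarefree Q) (hr : r.Coprime Q) (hr1 : 1 ≤ r)
    (hk : 1 ≤ k) {h : ℕ} (hh : 1 ≤ h) (c : Fin k → ZMod r) {H D K : ℝ} (hD : 1 ≤ D)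
    (hDH : D ^ (k - 1) ≤ H) (hHh : H ≤ h) (hK : 1 ≤ K)
    (hdiv : ∀ N : ℕ, 0 < N → (N : ℝ) ≤ 4 * (h : ℝ) ^ 3 → (N.divisors.card : ℝ) ≤ K)
    (hlog : (Nat.log 2 ⌊H⌋₊ + 1 : ℝ) ≤ K) (hKQ : divSum (2 * k + 4) Q ≤ K) :
    |mixedMoment Q h c univ ∅ -
        matchSum (correctedCov Q h c (((Q : ℝ) / Q.totient - 1) * (h / r)) univ) univ| ≤
      3 * k * K ^ 5 * (√(H / h) + h / H / √D) * ((9 * k ^ 2 * K) ^ (k + 2)) ^ (8 * k) *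
        √(6 * h) ^ k := by
  have hk' : (1 : ℝ) ≤ k := by exact_mod_cast hk
  have hh' : (1 : ℝ) ≤ h := by exact_mod_cast hh
  have hH1 : 1 ≤ H := (one_le_pow₀ hD).trans hDH
  set η := √(H / h) + h / H / √D with hη
  -- The saving is never better than h^(-1/2). This gives `1 ≤ η * S` and `1 ≤ η * h`, by which
  -- lower-order terms are absorbed.
  have hη1 : √(1 / h) ≤ η := by
    have : 0 ≤ h / H / √D := by positivity
    have : √(1 / h) ≤ √(H / h) := Real.sqrt_le_sqrt (by gcongr)
    linarith
  have hη0 : 0 ≤ η := (Real.sqrt_nonneg _).trans hη1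
  set S := √(6 * h) with hS
  have hS2 : S ^ 2 = 6 * h := Real.sq_sqrt (by positivity)
  have hS1 : 1 ≤ S := by rw [hS, Real.one_le_sqrt]; linarith
  have hη3 : 1 / (h : ℝ) ≤ η := by
    refine le_trans ?_ hη1
    refine Real.le_sqrt_of_sq_le ?_
    have : 1 / (h : ℝ) ≤ 1 := by rw [div_le_one (by linarith)]; exact hh'
    have : 0 ≤ 1 / (h : ℝ) := by positivity
    nlinarith
  have hη2 : 1 ≤ η * S := by
    have h1 : 1 ≤ √(1 / h) * S := by
      rw [hS, ← Real.sqrt_mul (by positivity), Real.one_le_sqrt]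
      field_simp
      norm_num
    exact h1.trans (by gcongr)
  -- The constant comes from the bound for free tuples with |B| ≤ k.
  set δ := 3 * k * K ^ 5 * η with hδ
  have hK5 : 1 ≤ K ^ 5 := one_le_pow₀ hK
  have hkK : 1 ≤ 3 * (k : ℝ) * K ^ 5 := one_le_mul_of_one_le_of_one_le (by linarith) hK5
  have hδη : η ≤ δ := le_mul_of_one_le_left hη0 hkK
  have hδ0 : 0 ≤ δ := hη0.trans hδη
  set w : ZMod Q → ℝ := fejerWeight (h : ℝ) with hw
  have hd : ∀ m, m ≤ 2 * k + 4 → divSum m Q ≤ K := fun m hm => (divSum_mono hm Q).trans hKQ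
  have hh0 : (0 : ℝ) < h := by linarith
  have hΛ : ∀ x : ZMod Q, x ≠ 0 → w x ^ 2 ≤ δ * S ^ 2 := by
    intro x hx
    have h1 : w x ≤ K := (fejerWeight_le_divSum hQ _ hx).trans (hd 1 (by omega))
    have h0 : 0 ≤ w x := fejerWeight_nonneg hh0.le x
    have h2 : K ^ 2 ≤ K ^ 5 := pow_le_pow_right₀ hK (by norm_num)
    have h3 : K ^ 2 ≤ δ * h := by
      have h4 : 1 ≤ η * h := by rwa [div_le_iff₀ hh0] at hη3
      have h5 : K ^ 5 * 1 ≤ (3 * k * K ^ 5) * (η * h) := by gcongr; nlinarith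
      calc K ^ 2 ≤ K ^ 5 * 1 := by linarith
        _ ≤ (3 * k * K ^ 5) * (η * h) := h5
        _ = _ := by ring
    rw [hS2]
    nlinarith
  have hP1 : (9 * k ^ 2 * K) ≤ (9 * (k : ℝ) ^ 2 * K) ^ (k + 2) := by
    refine le_self_pow₀ ?_ (by omega)
    exact one_le_mul_of_one_le_of_one_le (by nlinarith) hK
  have hkk : (k : ℝ) ≤ (k : ℝ) ^ 2 := le_self_pow₀ hk' (by norm_num)
  have hP2 : 9 * (k : ℝ) ≤ 9 * k ^ 2 * K := by nlinarith
  have hP3 : 9 * K ≤ 9 * k ^ 2 * K := by nlinarith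
  set P := (9 * (k : ℝ) ^ 2 * K) ^ (k + 2) with hP
  have hratio : (Q : ℝ) / Q.totient ≤ K := (totient_ratio_le_divSum hQ).trans (hd 1 (by omega))
  have hcov : ∀ i j, |classCov Q h (c i) (c j)| ≤ P * S ^ 2 := by
    intro i j
    refine (abs_classCov_le hQ hr (by omega) _ _).trans ?_
    rw [hS2, mul_comm]
    gcongr
    exact (hd 2 (by omega)).trans (by linarith)
  have hmain := abs_mixedMoment_sub_matchSum_le (Q := Q) (k := k) (h := h) (c := c) (N := (h : ℝ) / r)
    (P := P) (S := S) (δ := δ) (by linarith) hS1 hδ0 (hη2.trans (by gcongr)) hcov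
    (by rw [abs_of_nonneg (by linarith [one_le_totient_ratio (Q := Q)])]; linarith) (by positivity)
    ((div_le_self hh0.le (by exact_mod_cast hr1)).trans (by rw [hS2]; linarith))
    (fun i => (abs_card_classSet_sub_le hr1 h (c i)).trans (by linarith))
    (fun B m hm => by
      have h1 := norm_suppSum_sub_le_of_bounds (a := fun i => classCoeff hr h (c i)) (w := w)
        (fun a => fejerWeight_nonneg hh0.le a) (fejerWeight_neg _)
        (fun i x => norm_classCoeff_le hr h (c i) x) hK (by linarith) hδ0 hΛ
        (fun B => (sum_suppTuples_fejerWeight_le hQ B hh0).trans (by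
          rw [Fintype.card_fin]
          gcongr
          exact hd _ (by omega)))
        (fun B hB => by
          have hBk : B.card ≤ k := (card_le_univ B).trans_eq (Fintype.card_fin k)
          refine (sum_freeTuples_le hQ hB hD ((pow_le_pow_right₀ hD (by omega)).trans hDH) hHh hK
            hdiv hlog (by rwa [Fintype.card_fin])).trans ?_
          rw [← hη, ← hS]
          have hBk' : (B.card : ℝ) ≤ k := by exact_mod_cast hBk
          calc 3 * B.card * K ^ 5 * S ^ B.card * η ≤ 3 * k * K ^ 5 * S ^ B.card * η := by gcongr
            _ = δ * 1 * S ^ B.card := by rw [hδ]; ring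
            _ ≤ _ := by gcongr)
        ((sum_fejerWeight_sq_le hh0).trans (by
          rw [hS2, mul_comm]
          gcongr
          exact hd 2 (by omega))) hm
      rw [Fintype.card_fin] at h1
      have h2 : (((mixedMoment Q h c ∅ B - ∑ j ∈ B.erase m, classCov Q h (c m) (c j) *
          mixedMoment Q h c ∅ ((B.erase j).erase m) : ℝ)) : ℂ) =
          suppSum Q (fun i => classCoeff hr h (c i)) B - ∑ j ∈ B.erase m,
            pairSum (Q := Q) (fun i => classCoeff hr h (c i)) m j *
              suppSum Q (fun i => classCoeff hr h (c i)) ((B.erase j).erase m) := by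
        rw [Complex.ofReal_sub, Complex.ofReal_sum, mixedMoment_empty_eq_suppSum hQ hr]
        congr 1
        refine sum_congr rfl fun j _ => ?_
        rw [Complex.ofReal_mul, classCov_eq_pairSum hQ hr, mixedMoment_empty_eq_suppSum hQ hr]
      rw [← h2, Complex.norm_real, Real.norm_eq_abs] at h1
      exact h1.trans (moment_bound_arith hk hK hη0 (by linarith) B.card)) k univ ∅ (by simp)
    (disjoint_empty_right _)
  rw [union_empty, card_empty, card_univ, Fintype.card_fin, add_zero] at hmain
  refine hmain.trans (le_of_eq ?_)
  rw [← pow_mul, show 3 * k + 5 * k = 8 * k by ring, pow_mul]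

end Parameters

/-! ### Choice of parameters and the formula with a power saving. -/

section PowerSaving

variable {Q : ℕ} [NeZero Q] {k r : ℕ}

theorem mainTerm_eq_ofReal (hQ : Squarefree Q) (hr : r.Coprime Q) (h : ℕ) (c : Fin k → ZMod r) :
    mainTerm Q h r c = ((matchSum (correctedCov Q h c
      (((Q : ℝ) / Q.totient - 1) * (h / r)) univ) univ : ℝ) : ℂ) := by
  rw [mainTerm_eq_matchSum, matchSum, matchSum]
  push_cast
  refine sum_congr rfl fun σ _ => prod_congr rfl fun p _ => ?_
  rw [sumV_pair_eq hQ hr, correctedCov, classCov, totient_ratio_eq_one_add hQ]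
  by_cases hc : c p.1 = c p.2
  · simp [hc]
    ring
  · simp [hc]

/-- Separating equal and different integers in the product of two class sums; the term linear in the
centred variable vanishes because its mean is zero. -/
theorem classCov_eq (hQ : Squarefree Q) (hr : r.Coprime Q) (h : ℕ) (c₁ c₂ : ZMod r)
    [Decidable (c₁ = c₂)] :
    classCov Q h c₁ c₂ = mixedMoment Q h ![c₁, c₂] univ ∅ +
      if c₁ = c₂ then ((Q : ℝ) / Q.totient - 1) * (classSet h c₁).card else 0 := by
  have h1 := mixedMoment_insert (Q := Q) h ![c₁, c₂] (A := {0}) (B := ∅) (j := 1) (by simp) (by simp)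
  have h2 := mixedMoment_insert (Q := Q) h ![c₁, c₂] (A := ∅) (B := {1}) (j := 0) (by simp) (by simp)
  have h3 := mixedMoment_insert (Q := Q) h ![c₁, c₂] (A := ∅) (B := ∅) (j := 0) (by simp) (by simp)
  have hQ0 : (Q : ℝ) ≠ 0 := by exact_mod_cast NeZero.ne Q
  have hd : distinctTuples h ![c₁, c₂] (∅ : Finset (Fin 2)) = {fun _ => 0} := by
    ext d
    rw [mem_distinctTuples, mem_singleton]
    simp [funext_iff]
  have h4 : mixedMoment Q h ![c₁, c₂] ∅ ∅ = 1 := by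
    simp [mixedMoment, distinctSum, hd, hQ0]
  -- A single nonzero frequency cannot have sum zero.
  have h5 : mixedMoment Q h ![c₁, c₂] ∅ {0} = 0 := by
    have := mixedMoment_empty_eq_suppSum hQ hr h ![c₁, c₂] {0}
    rw [suppSum, sum_eq_zero fun α hα => ?_] at this
    · exact_mod_cast this
    · exfalso
      obtain ⟨h6, h7⟩ := mem_suppTuples.1 hα
      have h8 : α 0 ≠ 0 := (h7 0).2 (by simp)
      have h9 : α 1 = 0 := by
        by_contra h9
        simpa using (h7 1).1 h9
      rw [Fin.sum_univ_two, h9, add_zero] at h6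
      exact h8 h6
  have h6 : mixedMoment Q h ![c₁, c₂] ∅ {0, 1} = classCov Q h c₁ c₂ := by
    simp [mixedMoment, distinctSum, hd, classCov]
  have hu : (insert 1 {0} : Finset (Fin 2)) = univ := by decide
  simp only [filter_empty, sum_empty, sub_zero, insert_empty_eq] at h2 h3
  rw [hu] at h1
  rw [h1, insert_empty_eq, h2, h6, h3, h5]
  by_cases hc : c₁ = c₂
  · have hf : ({0} : Finset (Fin 2)).filter (fun i => ![c₁, c₂] i = ![c₁, c₂] 1) = {0} := by
      ext i
      fin_cases i <;> simp [hc]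
    rw [hf, sum_singleton, if_pos hc]
    simp [h4]
  · have hf : ({0} : Finset (Fin 2)).filter (fun i => ![c₁, c₂] i = ![c₁, c₂] 1) = ∅ := by
      ext i
      fin_cases i <;> simp [hc]
    rw [hf, if_neg hc]
    simp

/-- The corrected covariance is close to `R_2`. -/
theorem exists_abs_correctedCov_sub_le : ∃ C : ℝ, 0 ≤ C ∧ ∀ (r k y h : ℕ) (c : Fin k → ZMod r)
    (i j : Fin k), 1 ≤ r → 1 ≤ y → h ≤ y →
    |correctedCov (primeProd r y) h c
        ((((primeProd r y : ℕ) : ℝ) / (primeProd r y).totient - 1) * (h / r)) univ i j -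
      sumR r h ![c i, c j]| ≤
      C * (((primeProd r y : ℕ) : ℝ) / (primeProd r y).totient) ^ 2 * (h : ℝ) ^ 2 / y +
        (((primeProd r y : ℕ) : ℝ) / (primeProd r y).totient) := by
  classical
  refine ⟨2 ^ 2 * (2 * (2 : ℕ) ^ 2 * 2 ^ 2 * Real.exp (2 * (2 : ℕ) ^ 2 * 2 ^ 2)), by positivity,
    fun r k y h c i j hr hy hhy => ?_⟩
  have h1 := abs_sumR_sub_mixedMoment_le hy hhy ![c i, c j]
  have hl := one_le_totient_ratio (Q := primeProd r y)
  set L := ((primeProd r y : ℕ) : ℝ) / (primeProd r y).totient with hL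
  rw [correctedCov, classCov_eq (squarefree_primeProd r y) (coprime_primeProd r y), ← hL]
  have h2 := abs_card_classSet_sub_le hr h (c i)
  -- The correction uses h/r in place of the true number of integers in the class; they differ by at
  -- most 1, which costs at most Q/φ(Q).
  have h3 : |(if c i = c j then (L - 1) * ((classSet h (c i)).card : ℝ) else 0) -
      (if i ∈ univ ∧ j ∈ univ ∧ c i = c j then (L - 1) * ((h : ℝ) / r) else 0)| ≤ L := by
    by_cases hc : c i = c j
    · rw [if_pos hc, if_pos ⟨mem_univ _, mem_univ _, hc⟩, ← mul_sub, abs_mul,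
        abs_of_nonneg (by linarith)]
      nlinarith [abs_nonneg (((classSet h (c i)).card : ℝ) - (h : ℝ) / r)]
    · rw [if_neg hc, if_neg (fun e => hc e.2.2), sub_zero, abs_zero]
      linarith
  rw [abs_le] at h1 h3 ⊢
  constructor <;> linarith [h1.1, h1.2, h3.1, h3.2]

/-- With H = h^(1-2/(7k)) and D = h^(6/(7k)), both √(H/h) and h/(H√D) equal h^(-1/(7k)); the
constraint D^(k-1) ≤ H reads 6k - 6 ≤ 7k - 2. -/
theorem exists_parameters (hk : 1 ≤ k) {h : ℕ} (hh : 1 ≤ h) : ∃ H D : ℝ, 1 ≤ D ∧ D ^ (k - 1) ≤ H ∧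
    H ≤ h ∧ √(H / h) + h / H / √D ≤ 2 * (h : ℝ) ^ (-(1 / (7 * (k : ℝ)))) := by
  have hk' : (1 : ℝ) ≤ k := by exact_mod_cast hk
  have hh' : (1 : ℝ) ≤ h := by exact_mod_cast hh
  have hh0 : (0 : ℝ) < h := by linarith
  refine ⟨(h : ℝ) ^ (1 - 2 / (7 * (k : ℝ))), (h : ℝ) ^ (6 / (7 * (k : ℝ))),
    Real.one_le_rpow hh' (by positivity), ?_, ?_, ?_⟩
  · rw [← Real.rpow_natCast, ← Real.rpow_mul hh0.le]
    refine Real.rpow_le_rpow_of_exponent_le hh' ?_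
    rw [Nat.cast_sub hk]
    field_simp
    push_cast
    linarith
  · conv_rhs => rw [← Real.rpow_one (h : ℝ)]
    refine Real.rpow_le_rpow_of_exponent_le hh' ?_
    have : 0 ≤ 2 / (7 * (k : ℝ)) := by positivity
    linarith
  · have e1 : √((h : ℝ) ^ (1 - 2 / (7 * (k : ℝ))) / h) = (h : ℝ) ^ (-(1 / (7 * (k : ℝ)))) := by
      rw [Real.sqrt_eq_rpow, ← Real.rpow_sub_one hh0.ne', ← Real.rpow_mul hh0.le]
      congr 1
      field_simp
      ring
    have e2 : (h : ℝ) / (h : ℝ) ^ (1 - 2 / (7 * (k : ℝ))) / √((h : ℝ) ^ (6 / (7 * (k : ℝ)))) =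
        (h : ℝ) ^ (-(1 / (7 * (k : ℝ)))) := by
      rw [Real.sqrt_eq_rpow, ← Real.rpow_mul hh0.le]
      nth_rewrite 1 [← Real.rpow_one (h : ℝ)]
      rw [← Real.rpow_sub hh0, ← Real.rpow_sub hh0]
      congr 1
      field_simp
      ring
    rw [e1, e2]
    linarith

theorem sqrt_six_mul_pow (h : ℕ) : √(6 * (h : ℝ)) ^ k ≤ 6 ^ k * (h : ℝ) ^ ((k : ℝ) / 2) := by
  have h0 : (0 : ℝ) ≤ h := Nat.cast_nonneg h
  have h1 : √(6 : ℝ) ≤ 6 := by rw [Real.sqrt_le_left (by norm_num)]; norm_num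
  rw [Real.sqrt_mul (by norm_num), mul_pow, Real.sqrt_eq_rpow (h : ℝ), ← Real.rpow_natCast (_ ^ _),
    ← Real.rpow_mul h0, show (1 : ℝ) / 2 * k = k / 2 by ring]
  gcongr

/-- Three comparisons: R_k with the moment at the cutoff h^(k+1), this moment with its matching sum,
and the matching sums at the cutoffs h^(k+1) and y. All small losses are collected in one parameter
`K`, which later becomes a small power of h. -/
theorem exists_norm_sumR_sub_mainTerm_le (r k : ℕ) (hr : 1 ≤ r) (hk : 1 ≤ k) :
    ∃ (C : ℝ) (A : ℕ), ∀ (c : Fin k → ZMod r) (h y : ℕ) (K : ℝ), 1 ≤ h → h ^ 2 ≤ y →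
      y ≤ h ^ (k + 1) → 1 ≤ K →
      (∀ N : ℕ, 0 < N → (N : ℝ) ≤ 4 * (h : ℝ) ^ 3 → (N.divisors.card : ℝ) ≤ K) →
      (∀ z : ℕ, 1 ≤ z → z ≤ h ^ (k + 1) → divSum (2 * k + 4) (primeProd r z) ≤ K) →
      ‖((sumR r h c : ℝ) : ℂ) - mainTerm (primeProd r y) h r c‖ ≤
        C * K ^ A * (h : ℝ) ^ ((k : ℝ) / 2 - 1 / (7 * (k : ℝ))) := by
  obtain ⟨C₂, hC₂, hcor⟩ := exists_abs_correctedCov_sub_le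
  have hk' : (1 : ℝ) ≤ k := by exact_mod_cast hk
  set C₁ : ℝ := 2 ^ k * (2 * k ^ 2 * 2 ^ k * Real.exp (2 * k ^ 2 * 2 ^ k)) with hC₁
  set C₃ : ℝ := 3 * k * 2 * (9 * (k : ℝ) ^ 2) ^ ((k + 2) * (8 * k)) * 6 ^ k with hC₃
  set C₄ : ℝ := 2 * (C₂ + 1) * (k + 4) ^ (3 * k) * 6 ^ k with hC₄
  set A : ℕ := 5 + (k + 2) * (8 * k) + 3 * k with hA
  refine ⟨C₁ + C₃ + C₄, A, fun c h y K hh hy1 hy2 hK hdiv hKQ => ?_⟩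
  have hh' : (1 : ℝ) ≤ h := by exact_mod_cast hh
  have hh0 : (0 : ℝ) < h := by linarith
  set G := (h : ℝ) ^ ((k : ℝ) / 2 - 1 / (7 * (k : ℝ))) with hG
  have hG1 : 1 ≤ G := by
    refine Real.one_le_rpow hh' ?_
    have : 1 / (7 * (k : ℝ)) ≤ 1 / 7 := by
      apply one_div_le_one_div_of_le <;> linarith
    linarith
  have hGe : (h : ℝ) ^ ((k : ℝ) / 2) * (h : ℝ) ^ (-(1 / (7 * (k : ℝ)))) = G := by
    rw [← Real.rpow_add hh0, hG]
    congr 1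
  have hhinv : 1 / (h : ℝ) ≤ (h : ℝ) ^ (-(1 / (7 * (k : ℝ)))) := by
    rw [one_div, ← Real.rpow_neg_one]
    refine Real.rpow_le_rpow_of_exponent_le hh' ?_
    have : 1 / (7 * (k : ℝ)) ≤ 1 := by
      rw [div_le_one (by linarith)]
      linarith
    linarith
  -- At this cutoff the truncation error h^k/Y is at most 1, whereas y itself may be as small as h².
  set Y := h ^ (k + 1) with hY
  have hhpow : ∀ m : ℕ, 1 ≤ h ^ m := fun m => Nat.one_le_pow _ _ hh
  have hy : 1 ≤ y := (hhpow 2).trans hy1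
  have hyh : h ≤ y := (Nat.le_self_pow two_ne_zero h).trans hy1
  have hYh : h ≤ Y := hyh.trans hy2
  have hYsq : h ^ 2 ≤ Y := hy1.trans hy2
  have hrat : ∀ z : ℕ, 1 ≤ z → z ≤ Y →
      ((primeProd r z : ℕ) : ℝ) / (primeProd r z).totient ≤ K := fun z hz1 hz2 =>
    (totient_ratio_le_divSum (squarefree_primeProd r z)).trans
      ((divSum_mono (by omega) _).trans (hKQ z hz1 hz2))
  have hT1 : |sumR r h c - mixedMoment (primeProd r Y) h c univ ∅| ≤ C₁ * K ^ A * G := by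
    refine (abs_sumR_sub_mixedMoment_le (hhpow _) hYh c).trans ?_
    rw [← hC₁, mul_div_assoc]
    have h1 : (h : ℝ) ^ k / (Y : ℕ) ≤ 1 := by
      rw [hY, Nat.cast_pow, div_le_one (by positivity)]
      exact pow_le_pow_right₀ hh' (by omega)
    have h2 : (((primeProd r Y : ℕ) : ℝ) / (primeProd r Y).totient) ^ k ≤ K ^ A :=
      (pow_le_pow_left₀ (by positivity) (hrat Y (hhpow _) le_rfl) k).trans
        (pow_le_pow_right₀ hK (by omega))
    exact mul_le_mul (mul_le_mul_of_nonneg_left h2 (by positivity)) (h1.trans hG1) (by positivity)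
      (by positivity)
  have hT2 : |mixedMoment (primeProd r Y) h c univ ∅ - matchSum (correctedCov (primeProd r Y) h c
      ((((primeProd r Y : ℕ) : ℝ) / (primeProd r Y).totient - 1) * (h / r)) univ) univ| ≤
        C₃ * K ^ A * G := by
    obtain ⟨H, D, hD, hDH, hHh, hη⟩ := exists_parameters hk hh
    have hH1 : 1 ≤ H := (one_le_pow₀ hD).trans hDH
    refine (abs_mixedMoment_univ_sub_le (squarefree_primeProd r Y) (coprime_primeProd r Y) hr hk hh c
      hD hDH hHh hK hdiv ?_ (hKQ Y (hhpow _) le_rfl)).trans ?_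
    -- The logarithm is bounded by the divisor bound at a power of 2, whose number of divisors is
    -- its exponent plus one.
    · have h1 := hdiv (2 ^ Nat.log 2 ⌊H⌋₊) (by positivity) (by
        have h2 : 2 ^ Nat.log 2 ⌊H⌋₊ ≤ ⌊H⌋₊ :=
          Nat.pow_log_le_self 2 (Nat.floor_pos.2 hH1).ne'
        have h3 : ((2 ^ Nat.log 2 ⌊H⌋₊ : ℕ) : ℝ) ≤ h :=
          (Nat.cast_le.2 h2).trans ((Nat.floor_le (by linarith)).trans hHh)
        have h4 : (h : ℝ) ≤ (h : ℝ) ^ 3 := le_self_pow₀ hh' (by norm_num)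
        linarith)
      rw [Nat.divisors_prime_pow Nat.prime_two, card_map, card_range] at h1
      exact_mod_cast h1
    · rw [← pow_mul, mul_pow (9 * (k : ℝ) ^ 2) K]
      calc 3 * k * K ^ 5 * (√(H / h) + h / H / √D) *
            ((9 * (k : ℝ) ^ 2) ^ ((k + 2) * (8 * k)) * K ^ ((k + 2) * (8 * k))) * √(6 * h) ^ k
          ≤ 3 * k * K ^ 5 * (2 * (h : ℝ) ^ (-(1 / (7 * (k : ℝ))))) *
            ((9 * (k : ℝ) ^ 2) ^ ((k + 2) * (8 * k)) * K ^ ((k + 2) * (8 * k))) *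
            (6 ^ k * (h : ℝ) ^ ((k : ℝ) / 2)) := by
            gcongr
            exact sqrt_six_mul_pow h
        _ = C₃ * K ^ (5 + (k + 2) * (8 * k)) * G := by
            rw [hC₃, ← hGe, pow_add]
            ring
        _ ≤ C₃ * K ^ A * G := by
            gcongr
            omega
  have hT3 : |matchSum (correctedCov (primeProd r Y) h c
        ((((primeProd r Y : ℕ) : ℝ) / (primeProd r Y).totient - 1) * (h / r)) univ) univ -
      matchSum (correctedCov (primeProd r y) h c
        ((((primeProd r y : ℕ) : ℝ) / (primeProd r y).totient - 1) * (h / r)) univ) univ| ≤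
        C₄ * K ^ A * G := by
    have hS2 : √(6 * (h : ℝ)) ^ 2 = 6 * h := Real.sq_sqrt (by positivity)
    have hbd : ∀ z : ℕ, 1 ≤ z → z ≤ Y → ∀ i j, |correctedCov (primeProd r z) h c
        ((((primeProd r z : ℕ) : ℝ) / (primeProd r z).totient - 1) * (h / r)) univ i j| ≤
          ((k + 4) * K) * √(6 * (h : ℝ)) ^ 2 := by
      intro z hz1 hz2 i j
      have h1 := abs_classCov_le (squarefree_primeProd r z) (coprime_primeProd r z) hh (c i) (c j)
      have h2 : divSum 2 (primeProd r z) ≤ K := (divSum_mono (by omega) _).trans (hKQ z hz1 hz2)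
      have h3 := hrat z hz1 hz2
      have h4 := one_le_totient_ratio (Q := primeProd r z)
      have h5 : (h : ℝ) / r ≤ h := div_le_self hh0.le (by exact_mod_cast hr)
      have h6 : 0 ≤ (h : ℝ) / r := by positivity
      have h7 : (((primeProd r z : ℕ) : ℝ) / (primeProd r z).totient - 1) * (h / r) ≤ K * h := by
        gcongr
        linarith
      have h8 : 0 ≤ (((primeProd r z : ℕ) : ℝ) / (primeProd r z).totient - 1) * (h / r) :=
        mul_nonneg (by linarith) h6
      have h9 : 6 * (h : ℝ) * divSum 2 (primeProd r z) ≤ 6 * h * K := by gcongr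
      have h10 : 0 ≤ K * (h : ℝ) := by positivity
      rw [hS2, correctedCov]
      have h11 : (7 : ℝ) * (K * h) ≤ (k + 4) * K * (6 * h) := by nlinarith
      split_ifs
      · rw [abs_le] at h1 ⊢
        constructor <;> linarith [h1.1, h1.2]
      · rw [sub_zero]
        linarith
    -- R_2 does not depend on the cutoff, so for all cutoffs from h² on the corrected covariances
    -- agree up to O(K²); relative to their size h this is a factor 1/h.
    have hdiff : ∀ z : ℕ, h ^ 2 ≤ z → z ≤ Y → ∀ i j, |correctedCov (primeProd r z) h c
        ((((primeProd r z : ℕ) : ℝ) / (primeProd r z).totient - 1) * (h / r)) univ i j -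
          sumR r h ![c i, c j]| ≤ (C₂ + 1) * K ^ 2 := by
      intro z hz1 hz2 i j
      have hz0 : 1 ≤ z := (hhpow 2).trans hz1
      refine (hcor r k z h c i j hr hz0 ((Nat.le_self_pow two_ne_zero h).trans hz1)).trans ?_
      have h3 := hrat z hz0 hz2
      have h4 := one_le_totient_ratio (Q := primeProd r z)
      have h5 : (h : ℝ) ^ 2 / z ≤ 1 := by
        rw [div_le_one (by exact_mod_cast hz0)]
        exact_mod_cast hz1
      have h6 : K ≤ K ^ 2 := le_self_pow₀ hK (by norm_num)
      rw [mul_div_assoc]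
      calc _ ≤ C₂ * K ^ 2 * 1 + K := by gcongr
        _ ≤ _ := by linarith
    have hδ0 : (0 : ℝ) ≤ 2 * (C₂ + 1) * K ^ 2 / h := by positivity
    have h1 := abs_matchSum_sub_le (k := k) (correctedCov_comm h c _ univ)
      (correctedCov_comm h c _ univ) (P := (k + 4) * K) (S := √(6 * (h : ℝ)))
      (δ := 2 * (C₂ + 1) * K ^ 2 / h) (by nlinarith) (by nlinarith) (Real.sqrt_nonneg _) hδ0
      (hbd Y (hhpow _) le_rfl) (hbd y hy hy2) (fun i j => by
        have a1 := hdiff Y hYsq le_rfl i j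
        have a2 := hdiff y hy1 hy2 i j
        rw [hS2]
        have a3 : 2 * (C₂ + 1) * K ^ 2 / h * (6 * h) = 6 * (2 * ((C₂ + 1) * K ^ 2)) := by
          field_simp
        have a4 : 0 ≤ (C₂ + 1) * K ^ 2 := by positivity
        rw [a3]
        rw [abs_le] at a1 a2 ⊢
        constructor <;> linarith [a1.1, a1.2, a2.1, a2.2]) k univ (by simp)
    refine h1.trans ?_
    rw [mul_pow]
    calc 2 * (C₂ + 1) * K ^ 2 / h * (((k : ℝ) + 4) ^ (3 * k) * K ^ (3 * k)) * √(6 * (h : ℝ)) ^ k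
        = 2 * (C₂ + 1) * K ^ 2 * (1 / h) * (((k : ℝ) + 4) ^ (3 * k) * K ^ (3 * k)) *
          √(6 * (h : ℝ)) ^ k := by ring
      _ ≤ 2 * (C₂ + 1) * K ^ 2 * ((h : ℝ) ^ (-(1 / (7 * (k : ℝ))))) *
            (((k : ℝ) + 4) ^ (3 * k) * K ^ (3 * k)) * (6 ^ k * (h : ℝ) ^ ((k : ℝ) / 2)) := by
          gcongr
          exact sqrt_six_mul_pow h
      _ = C₄ * K ^ (2 + 3 * k) * G := by
          rw [hC₄, ← hGe, pow_add]
          ring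
      _ ≤ C₄ * K ^ A * G := by
          gcongr
          omega
  rw [mainTerm_eq_ofReal (squarefree_primeProd r y) (coprime_primeProd r y), ← Complex.ofReal_sub,
    Complex.norm_real, Real.norm_eq_abs]
  rw [abs_le] at hT1 hT2 hT3 ⊢
  constructor <;> linarith [hT1.1, hT1.2, hT2.1, hT2.2, hT3.1, hT3.2]

/-- The asymptotic formula for `R_k` with a power saving. -/
theorem exists_norm_sumR_sub_mainTerm_le_rpow (r k : ℕ) (hr : 1 ≤ r) (hk : 1 ≤ k) {ε : ℝ}
    (hε : 0 < ε) : ∃ C : ℝ, ∀ (c : Fin k → ZMod r) (h y : ℕ), 3 ≤ h → h ^ 2 ≤ y → y ≤ h ^ (k + 1) →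
      ‖((sumR r h c : ℝ) : ℂ) - mainTerm (primeProd r y) h r c‖ ≤
        C * (h : ℝ) ^ ((k : ℝ) / 2 - 1 / (7 * (k : ℝ)) + ε) := by
  obtain ⟨C, A, hC⟩ := exists_norm_sumR_sub_mainTerm_le r k hr hk
  -- `K` will be a constant times h^((k+4)e), so K^A costs at most h^ε.
  set e : ℝ := ε / ((k + 4) * (A + 1)) with he
  have he0 : 0 < e := by positivity
  obtain ⟨C₁, hC₁, h1⟩ := exists_card_divisors_le he0
  obtain ⟨C₂, hC₂, h2⟩ := exists_divSum_primeProd_le (2 * k + 4) he0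
  set C₀ : ℝ := 1 + C₁ * 4 ^ e + C₂ with hC₀
  have hC₁' : 0 < C₁ * (4 : ℝ) ^ e := by positivity
  refine ⟨|C| * C₀ ^ A, fun c h y hh hy1 hy2 => ?_⟩
  have hh' : (1 : ℝ) ≤ h := by exact_mod_cast (by omega : 1 ≤ h)
  have hh0 : (0 : ℝ) < h := by linarith
  have hE : 1 ≤ (h : ℝ) ^ ((k + 4) * e) := Real.one_le_rpow hh' (by positivity)
  have hK := hC c h y (C₀ * (h : ℝ) ^ ((k + 4) * e)) (by omega) hy1 hy2
    (one_le_mul_of_one_le_of_one_le (by linarith) hE)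
    (fun N hN hNh => by
      refine (h1 N hN).trans ?_
      calc C₁ * (N : ℝ) ^ e ≤ C₁ * (4 * (h : ℝ) ^ 3) ^ e := by gcongr
        _ = C₁ * 4 ^ e * (h : ℝ) ^ (3 * e) := by
            rw [Real.mul_rpow (by norm_num) (by positivity), ← Real.rpow_natCast,
              ← Real.rpow_mul hh0.le, mul_assoc]
            norm_num
        _ ≤ C₀ * (h : ℝ) ^ ((k + 4) * e) := by
            gcongr
            · linarith
            · have : (0 : ℝ) ≤ k := Nat.cast_nonneg k
              linarith)
    (fun z hz1 hz2 => by
      refine (h2 r z hz1).trans ?_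
      have hz : (z : ℝ) ≤ (h : ℝ) ^ (k + 1) := by exact_mod_cast hz2
      calc C₂ * (z : ℝ) ^ e ≤ C₂ * ((h : ℝ) ^ (k + 1)) ^ e := by gcongr
        _ = C₂ * (h : ℝ) ^ ((k + 1) * e) := by
            rw [← Real.rpow_natCast, ← Real.rpow_mul hh0.le]
            push_cast
            rfl
        _ ≤ C₀ * (h : ℝ) ^ ((k + 4) * e) := by
            gcongr
            · linarith
            · norm_num)
  refine hK.trans ?_
  rw [mul_pow, ← Real.rpow_natCast ((h : ℝ) ^ _), ← Real.rpow_mul hh0.le, Real.rpow_add hh0 _ ε]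
  have h3 : (h : ℝ) ^ ((k + 4) * e * A) ≤ (h : ℝ) ^ ε := by
    refine Real.rpow_le_rpow_of_exponent_le hh' ?_
    have : (k + 4) * e * (A + 1) = ε := by rw [he]; field_simp
    have : 0 ≤ (k + 4) * e := by positivity
    nlinarith
  calc _ ≤ |C| * (C₀ ^ A * (h : ℝ) ^ ((k + 4) * e * A)) *
        (h : ℝ) ^ ((k : ℝ) / 2 - 1 / (7 * (k : ℝ))) := by gcongr; exact le_abs_self C
    _ ≤ |C| * (C₀ ^ A * (h : ℝ) ^ ε) * (h : ℝ) ^ ((k : ℝ) / 2 - 1 / (7 * (k : ℝ))) := by gcongr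
    _ = _ := by ring

end PowerSaving

/-! ### Weights in the divisor expansion of the singular series of a pair. -/

section SieveWeights

/-- The weight of the divisor `d` in the expansion of the singular series of a pair. -/
noncomputable def pairWeight (Q d : ℕ) : ℝ :=
  ∏ p ∈ Q.primeFactors, if p ∣ d then (p : ℝ) / ((p : ℝ) - 1) ^ 2 else 1 - 1 / ((p : ℝ) - 1) ^ 2

/-- The coefficients of the expansion of `d * pairWeight Q d` over the divisors of `d`. -/
noncomputable def convCoeff (r p : ℕ) : Fin 3 → ℝ :=
  if p ∣ r then ![1, -(1 / (p : ℝ)), 0]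
  else ![1 - 1 / ((p : ℝ) - 1) ^ 2, 2 / ((p : ℝ) - 1) ^ 2, -(1 / ((p : ℝ) - 1) ^ 2)]

/-- The local factors of `d * pairWeight Q d`, extended to all `d`. -/
noncomputable def localWeight (r p d : ℕ) : ℝ :=
  ∑ s : Fin 3, if p ^ (s : ℕ) ∣ d then convCoeff r p s * (p : ℝ) ^ (s : ℕ) else 0

theorem localWeight_eq {r p : ℕ} (hp : p.Prime) (d : ℕ) : localWeight r p d =
    if p ∣ r then (if p ∣ d then 0 else 1)
    else if p ^ 2 ∣ d then 0 else if p ∣ d then p * ((p : ℝ) / ((p : ℝ) - 1) ^ 2)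
      else 1 - 1 / ((p : ℝ) - 1) ^ 2 := by
  have h2 : (2 : ℝ) ≤ p := by exact_mod_cast hp.two_le
  have h3 : (p : ℝ) - 1 ≠ 0 := by linarith
  have h4 : (p : ℝ) ≠ 0 := by linarith
  have h5 : p ^ 2 ∣ d → p ∣ d := fun h => (dvd_pow_self p two_ne_zero).trans h
  rw [localWeight, Fin.sum_univ_three]
  by_cases hr : p ∣ r <;> by_cases h1 : p ∣ d <;> by_cases h6 : p ^ 2 ∣ d <;>
    simp [convCoeff, hr, h1, h6] <;> first | (field_simp; done) | (field_simp; ring; done) | (exact absurd (h5 h6) h1)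

theorem localWeight_nonneg {r p : ℕ} (hp : p.Prime) (d : ℕ) : 0 ≤ localWeight r p d := by
  have h2 : (2 : ℝ) ≤ p := by exact_mod_cast hp.two_le
  have h3 : 1 / ((p : ℝ) - 1) ^ 2 ≤ 1 := by
    rw [div_le_one (by nlinarith)]
    nlinarith
  rw [localWeight_eq hp]
  split_ifs <;> positivity

theorem pairWeight_nonneg (Q d : ℕ) : 0 ≤ pairWeight Q d := by
  refine prod_nonneg fun p hp => ?_
  have h2 : (2 : ℝ) ≤ p := by exact_mod_cast (Nat.prime_of_mem_primeFactors hp).two_le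
  have h3 : 1 / ((p : ℝ) - 1) ^ 2 ≤ 1 := by
    rw [div_le_one (by nlinarith)]
    nlinarith
  split_ifs
  · positivity
  · linarith

/-- Sums of the pair weights over divisors, twisted by a multiplicative weight. -/
theorem sum_pairWeight_mul {Q : ℕ} (hQ : Squarefree Q) (w : ℕ → ℝ) :
    ∑ d ∈ Q.divisors, pairWeight Q d * ∏ p ∈ d.primeFactors, w p =
      ∏ p ∈ Q.primeFactors,
        ((p : ℝ) / ((p : ℝ) - 1) ^ 2 * w p + (1 - 1 / ((p : ℝ) - 1) ^ 2)) := by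
  rw [prod_add]
  have hprime : ∀ {t}, t ∈ Q.primeFactors.powerset → ∀ p ∈ t, p.Prime := fun ht p hp =>
    Nat.prime_of_mem_primeFactors (mem_powerset.1 ht hp)
  refine sum_bij' (fun d _ => d.primeFactors) (fun t _ => ∏ p ∈ t, p) ?_ ?_ ?_ ?_ ?_
  · intro d hd
    exact mem_powerset.2 (Nat.primeFactors_mono (Nat.mem_divisors.1 hd).1 hQ.ne_zero)
  · intro t ht
    refine Nat.mem_divisors.2 ⟨?_, hQ.ne_zero⟩
    rw [← Nat.prod_primeFactors_of_squarefree hQ]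
    exact prod_dvd_prod_of_subset _ _ _ (mem_powerset.1 ht)
  · intro d hd
    exact Nat.prod_primeFactors_of_squarefree (hQ.squarefree_of_dvd (Nat.mem_divisors.1 hd).1)
  · intro t ht
    exact Nat.primeFactors_prod (hprime ht)
  · intro d hd
    have hd0 := (Nat.pos_of_mem_divisors hd).ne'
    have hsub := Nat.primeFactors_mono (Nat.mem_divisors.1 hd).1 hQ.ne_zero
    have h1 : Q.primeFactors.filter (fun p => p ∣ d) = d.primeFactors := by
      ext p
      rw [mem_filter]
      refine ⟨fun h => Nat.mem_primeFactors.2 ⟨Nat.prime_of_mem_primeFactors h.1, h.2, hd0⟩,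
        fun h => ⟨hsub h, Nat.dvd_of_mem_primeFactors h⟩⟩
    have h2 : Q.primeFactors.filter (fun p => ¬ p ∣ d) = Q.primeFactors \ d.primeFactors := by
      rw [← h1, filter_not]
    rw [pairWeight, prod_ite, h1, h2, prod_mul_distrib]
    ring

variable {Q r : ℕ}

/-- The product of local weights is an extension of d ↦ d·`pairWeight Q d` from the divisors of `Q`
to all d, so that sums can run over an interval. -/
theorem prod_localWeight_of_dvd (hQ : Squarefree Q) (hr : r.Coprime Q) {d : ℕ}
    (hd : d ∣ Q) : ∏ p ∈ (Q * r).primeFactors, localWeight r p d = d * pairWeight Q d := by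
  have hsq := hQ.squarefree_of_dvd hd
  have hd0 := hsq.ne_zero
  rw [Nat.Coprime.primeFactors_mul hr.symm, prod_union hr.symm.disjoint_primeFactors]
  have h1 : ∏ p ∈ r.primeFactors, localWeight r p d = 1 := by
    refine prod_eq_one fun p hp => ?_
    have hp' := Nat.prime_of_mem_primeFactors hp
    have hpr := Nat.dvd_of_mem_primeFactors hp
    rw [localWeight_eq hp', if_pos hpr, if_neg fun h => ?_]
    exact hp'.one_lt.ne' (Nat.dvd_one.1 (hr ▸ Nat.dvd_gcd hpr (h.trans hd)))
  have h2 : (d : ℝ) = ∏ p ∈ Q.primeFactors, if p ∣ d then (p : ℝ) else 1 := by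
    rw [← prod_filter]
    have h3 : Q.primeFactors.filter (fun p => p ∣ d) = d.primeFactors := by
      ext p
      rw [mem_filter]
      refine ⟨fun h => Nat.mem_primeFactors.2 ⟨Nat.prime_of_mem_primeFactors h.1, h.2, hd0⟩,
        fun h => ⟨Nat.primeFactors_mono hd hQ.ne_zero h, Nat.dvd_of_mem_primeFactors h⟩⟩
    rw [h3, ← Nat.cast_prod, Nat.prod_primeFactors_of_squarefree hsq]
  rw [h1, mul_one, h2, pairWeight, ← prod_mul_distrib]
  refine prod_congr rfl fun p hp => ?_
  have hp' := Nat.prime_of_mem_primeFactors hp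
  have hpr : ¬ p ∣ r := fun h =>
    hp'.one_lt.ne' (Nat.dvd_one.1 (hr ▸ Nat.dvd_gcd h (Nat.dvd_of_mem_primeFactors hp)))
  have hp2 : ¬ p ^ 2 ∣ d := by
    intro h
    rw [sq] at h
    exact hp'.not_isUnit (hsq p h)
  rw [localWeight_eq hp', if_neg hpr, if_neg hp2]
  split_ifs <;> ring

/-- A d ≤ h that does not divide `Q` has a prime factor dividing r or a repeated prime factor, and
the extension vanishes there. -/
theorem prod_localWeight_of_not_dvd (hQr : Q * r ≠ 0) {h d : ℕ}
    (hp : ∀ p : ℕ, p.Prime → p ≤ h → p ∣ Q * r) (hd0 : d ≠ 0) (hdh : d ≤ h) (hd : ¬ d ∣ Q) :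
    ∏ p ∈ (Q * r).primeFactors, localWeight r p d = 0 := by
  have key : ∃ p : ℕ, p.Prime ∧ p ∣ d ∧ (p ∣ r ∨ p ^ 2 ∣ d) := by
    by_contra hno
    push Not at hno
    have hsq : Squarefree d := by
      rw [Nat.squarefree_iff_prime_squarefree]
      intro p hp' h
      exact (hno p hp' ((dvd_mul_right p p).trans h)).2 (by rwa [sq])
    refine hd ?_
    rw [← Nat.prod_primeFactors_of_squarefree hsq]
    refine Finset.prod_primes_dvd _ (fun p hp' => (Nat.prime_of_mem_primeFactors hp').prime)
      fun p hp' => ?_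
    have h1 := Nat.prime_of_mem_primeFactors hp'
    have h2 := Nat.dvd_of_mem_primeFactors hp'
    have h3 := hp p h1 ((Nat.le_of_dvd (Nat.pos_of_ne_zero hd0) h2).trans hdh)
    exact (h1.dvd_mul.1 h3).resolve_right (hno p h1 h2).1
  obtain ⟨p, hp', h1, h2⟩ := key
  refine prod_eq_zero (i := p) (Nat.mem_primeFactors.2 ⟨hp', hp p hp'
    ((Nat.le_of_dvd (Nat.pos_of_ne_zero hd0) h1).trans hdh), hQr⟩) ?_
  rw [localWeight_eq hp']
  rcases h2 with h2 | h2 <;> simp [h1, h2]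

/-- The product of the powers `p ^ σ p`. -/
def expProd {T : Finset ℕ} (σ : T → Fin 3) : ℕ := ∏ p : T, (p : ℕ) ^ (σ p : ℕ)

theorem expProd_dvd_iff {T : Finset ℕ} (hT : ∀ p ∈ T, p.Prime) (σ : T → Fin 3) (d : ℕ) :
    expProd σ ∣ d ↔ ∀ p : T, (p : ℕ) ^ (σ p : ℕ) ∣ d := by
  refine ⟨fun h p => (dvd_prod_of_mem (fun p : T => (p : ℕ) ^ (σ p : ℕ)) (mem_univ p)).trans h,
    fun h => ?_⟩
  refine Finset.prod_dvd_of_isRelPrime (fun p _ q _ hpq => ?_) fun p _ => h p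
  refine Nat.coprime_iff_isRelPrime.1 (Nat.Coprime.pow _ _ ?_)
  exact (Nat.coprime_primes (hT p p.2) (hT q q.2)).2 fun e => hpq (Subtype.ext e)

/-- The convolution method: the local weights are sums over the powers p^s dividing d with s ≤ 2, so
a weighted sum becomes a combination of plain sums over the multiples of `expProd σ`. -/
theorem sum_prod_localWeight {T : Finset ℕ} (hT : ∀ p ∈ T, p.Prime) (r X : ℕ) (f : ℕ → ℝ) :
    ∑ d ∈ Icc 1 X, (∏ p ∈ T, localWeight r p d) * f d = ∑ σ : T → Fin 3,
      (∏ p : T, convCoeff r p (σ p)) * ((expProd σ : ℝ) *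
        ∑ d ∈ (Icc 1 X).filter (fun d => expProd σ ∣ d), f d) := by
  have h1 : ∀ d, ∏ p ∈ T, localWeight r p d = ∑ σ : T → Fin 3,
      if expProd σ ∣ d then (∏ p : T, convCoeff r p (σ p)) * (expProd σ : ℝ) else 0 := by
    intro d
    rw [← prod_coe_sort]
    simp_rw [localWeight]
    rw [prod_univ_sum, Fintype.piFinset_univ]
    refine sum_congr rfl fun σ _ => ?_
    rw [prod_ite_zero]
    simp only [mem_univ, forall_true_left]
    simp only [← expProd_dvd_iff hT σ d]
    rw [prod_mul_distrib, expProd]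
    push_cast
    rfl
  simp_rw [h1, sum_mul]
  rw [sum_comm]
  refine sum_congr rfl fun σ _ => ?_
  rw [sum_filter, mul_sum, mul_sum]
  refine sum_congr rfl fun d _ => ?_
  split_ifs <;> ring

theorem sum_filter_dvd {a : ℕ} (ha : 0 < a) (X : ℕ) (f : ℕ → ℝ) :
    ∑ d ∈ (Icc 1 X).filter (fun d => a ∣ d), f d = ∑ e ∈ Icc 1 (X / a), f (a * e) := by
  refine sum_nbij' (fun d => d / a) (fun e => a * e) ?_ ?_ ?_ ?_ ?_
  · intro d hd
    obtain ⟨h1, e, rfl⟩ := mem_filter.1 hd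
    rw [mem_Icc] at h1
    rw [Nat.mul_div_cancel_left _ ha, mem_Icc, Nat.le_div_iff_mul_le ha, mul_comm e]
    exact ⟨Nat.pos_of_ne_zero (by rintro rfl; omega), h1.2⟩
  · intro e he
    rw [mem_Icc, Nat.le_div_iff_mul_le ha, mul_comm e] at he
    exact mem_filter.2 ⟨mem_Icc.2 ⟨Nat.mul_pos ha he.1, he.2⟩, dvd_mul_right _ _⟩
  · intro d hd
    exact Nat.mul_div_cancel' (mem_filter.1 hd).2
  · intro e _
    exact Nat.mul_div_cancel_left _ ha
  · intro d hd
    rw [Nat.mul_div_cancel' (mem_filter.1 hd).2]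

theorem sum_convCoeff {p : ℕ} (r : ℕ) :
    ∑ s, convCoeff r p s = if p ∣ r then 1 - 1 / (p : ℝ) else 1 := by
  rw [Fin.sum_univ_three, convCoeff]
  split_ifs <;> simp <;> ring

/-- For p not dividing r the nontrivial coefficients are O(1/p²). There is room for a factor
a^(1/4), at most p^(1/2) locally, and the sum p^(-3/2) still converges. -/
theorem sum_abs_convCoeff_le {p : ℕ} (hp : p.Prime) (r : ℕ) :
    ∑ s, |convCoeff r p s| * ((p : ℝ) ^ (1 / 4 : ℝ)) ^ (s : ℕ) ≤
      if p ∣ r then 2 else 1 + 12 * (1 / (p : ℝ) ^ (3 / 2 : ℝ)) := by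
  have h2 : (2 : ℝ) ≤ p := by exact_mod_cast hp.two_le
  have hp0 : (0 : ℝ) < p := by linarith
  set q := (p : ℝ) ^ (1 / 4 : ℝ) with hq
  have hq1 : 1 ≤ q := Real.one_le_rpow (by linarith) (by norm_num)
  have hqp : q ≤ p := by
    conv_rhs => rw [← Real.rpow_one (p : ℝ)]
    exact Real.rpow_le_rpow_of_exponent_le (by linarith) (by norm_num)
  have hq2 : q ^ 2 * (1 / (p : ℝ) ^ 2) = 1 / (p : ℝ) ^ (3 / 2 : ℝ) := by
    rw [hq, ← Real.rpow_natCast (_ ^ _), ← Real.rpow_mul hp0.le, ← Real.rpow_natCast (p : ℝ),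
      one_div ((p : ℝ) ^ _), one_div ((p : ℝ) ^ _), ← Real.rpow_neg hp0.le, ← Real.rpow_neg hp0.le,
      ← Real.rpow_add hp0]
    norm_num
  rw [Fin.sum_univ_three, convCoeff]
  split_ifs with hr
  · have h3 : |1 / (p : ℝ)| * q ≤ 1 := by
      rw [abs_of_nonneg (by positivity), one_div_mul_eq_div, div_le_one hp0]
      exact hqp
    have h4 : |(1 : ℝ)| * q ^ 0 + |-(1 / (p : ℝ))| * q ^ 1 + |(0 : ℝ)| * q ^ 2 ≤ 2 := by
      rw [abs_neg, abs_one, abs_zero, pow_one]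
      linarith
    exact h4
  · have h3 : 1 / ((p : ℝ) - 1) ^ 2 ≤ 1 := by
      rw [div_le_one (by nlinarith)]
      nlinarith
    have h4 : 1 / ((p : ℝ) - 1) ^ 2 ≤ 4 * (1 / (p : ℝ) ^ 2) := by
      rw [mul_one_div, div_le_div_iff₀ (by nlinarith) (by positivity)]
      nlinarith
    have h5 : 0 ≤ 1 / ((p : ℝ) - 1) ^ 2 := by positivity
    have e1 : 2 / ((p : ℝ) - 1) ^ 2 = 2 * (1 / ((p : ℝ) - 1) ^ 2) := by ring
    rw [e1]
    set z := 1 / ((p : ℝ) - 1) ^ 2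
    have h6 : |1 - z| * q ^ 0 + |2 * z| * q ^ 1 + |-z| * q ^ 2 ≤
        1 + 12 * (1 / (p : ℝ) ^ (3 / 2 : ℝ)) := by
      rw [abs_of_nonneg (by linarith), abs_of_nonneg (by linarith), abs_neg, abs_of_nonneg h5,
        ← hq2]
      have h7 : q ≤ q ^ 2 := le_self_pow₀ hq1 two_ne_zero
      nlinarith [mul_le_mul_of_nonneg_left h4 (sq_nonneg q), mul_le_mul_of_nonneg_left h7 h5]
    exact h6

end SieveWeights

/-! ### Asymptotics and bounds for sums of the pair weights. -/

section WeightSums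

/-- A bound for the absolute sums of the convolution coefficients. -/
noncomputable def convBound (r : ℕ) : ℝ :=
  2 ^ r.primeFactors.card * Real.exp (12 * ∑' n : ℕ, 1 / (n : ℝ) ^ (3 / 2 : ℝ))

theorem convBound_nonneg (r : ℕ) : 0 ≤ convBound r := by
  rw [convBound]
  positivity

variable {T : Finset ℕ}

theorem expProd_pos (hT : ∀ p ∈ T, p.Prime) (σ : T → Fin 3) : 0 < expProd σ :=
  prod_pos fun p _ => pow_pos (hT p p.2).pos _

theorem sum_abs_convCoeff_mul_le (hT : ∀ p ∈ T, p.Prime) {r : ℕ} (hr : 1 ≤ r) :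
    ∑ σ : T → Fin 3, |∏ p : T, convCoeff r p (σ p)| * (expProd σ : ℝ) ^ (1 / 4 : ℝ) ≤
      convBound r := by
  have h1 : ∀ σ : T → Fin 3, |∏ p : T, convCoeff r p (σ p)| * (expProd σ : ℝ) ^ (1 / 4 : ℝ) =
      ∏ p : T, |convCoeff r p (σ p)| * (((p : ℕ) : ℝ) ^ (1 / 4 : ℝ)) ^ (σ p : ℕ) := by
    intro σ
    rw [prod_mul_distrib, abs_prod, expProd]
    congr 1
    push_cast
    rw [← Real.finsetProd_rpow _ _ fun p _ => by positivity]
    refine prod_congr rfl fun p _ => ?_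
    rw [← Real.rpow_natCast, ← Real.rpow_natCast, ← Real.rpow_mul (by positivity),
      ← Real.rpow_mul (by positivity), mul_comm]
  simp_rw [h1]
  have h2 := prod_univ_sum (fun _ : T => (univ : Finset (Fin 3)))
    fun (p : T) s => |convCoeff r p s| * (((p : ℕ) : ℝ) ^ (1 / 4 : ℝ)) ^ (s : ℕ)
  rw [Fintype.piFinset_univ] at h2
  rw [← h2, prod_coe_sort T fun p => ∑ s, |convCoeff r p s| * ((p : ℝ) ^ (1 / 4 : ℝ)) ^ (s : ℕ)]
  calc ∏ p ∈ T, ∑ s, |convCoeff r p s| * ((p : ℝ) ^ (1 / 4 : ℝ)) ^ (s : ℕ)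
      ≤ ∏ p ∈ T, (if p ∣ r then 2 else 1) * Real.exp (12 * (1 / (p : ℝ) ^ (3 / 2 : ℝ))) := by
        refine prod_le_prod (fun p _ => sum_nonneg fun s _ => by positivity) fun p hp => ?_
        refine (sum_abs_convCoeff_le (hT p hp) r).trans ?_
        have h3 := Real.add_one_le_exp (12 * (1 / (p : ℝ) ^ (3 / 2 : ℝ)))
        have h4 : 0 ≤ 12 * (1 / (p : ℝ) ^ (3 / 2 : ℝ)) := by positivity
        split_ifs <;> linarith
    _ = 2 ^ (T.filter fun p => p ∣ r).card *
          Real.exp (12 * ∑ p ∈ T, 1 / (p : ℝ) ^ (3 / 2 : ℝ)) := by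
        rw [prod_mul_distrib, ← Real.exp_sum, ← mul_sum, ← prod_filter, prod_const]
    _ ≤ _ := by
        rw [convBound]
        gcongr
        · norm_num
        · intro p hp
          obtain ⟨h3, h4⟩ := mem_filter.1 hp
          exact Nat.mem_primeFactors.2 ⟨hT p h3, h4, by omega⟩
        · exact (Real.summable_one_div_nat_rpow.2 (by norm_num)).sum_le_tsum _
            fun n _ => by positivity

/-- Bounds for the weighted sums in terms of bounds for the sums over multiples. -/
theorem abs_sum_prod_localWeight_sub_le (hT : ∀ p ∈ T, p.Prime) {r : ℕ} (hr : 1 ≤ r) (X : ℕ)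
    (f : ℕ → ℝ) (M B : ℝ) (hB : 0 ≤ B) (hf : ∀ a : ℕ, 0 < a →
      |(a : ℝ) * ∑ d ∈ (Icc 1 X).filter (fun d => a ∣ d), f d - M| ≤ B * (a : ℝ) ^ (1 / 4 : ℝ)) :
    |∑ d ∈ Icc 1 X, (∏ p ∈ T, localWeight r p d) * f d -
      M * ∏ p ∈ T, (if p ∣ r then 1 - 1 / (p : ℝ) else 1)| ≤ B * convBound r := by
  have h2 := prod_univ_sum (fun _ : T => (univ : Finset (Fin 3))) fun (p : T) s => convCoeff r p s
  rw [Fintype.piFinset_univ, prod_coe_sort T fun p => ∑ s, convCoeff r p s] at h2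
  simp_rw [sum_convCoeff] at h2
  rw [sum_prod_localWeight hT, h2, mul_sum, ← sum_sub_distrib]
  refine (abs_sum_le_sum_abs _ _).trans ?_
  calc _ ≤ ∑ σ : T → Fin 3,
        B * (|∏ p : T, convCoeff r p (σ p)| * (expProd σ : ℝ) ^ (1 / 4 : ℝ)) := by
        refine sum_le_sum fun σ _ => ?_
        rw [mul_comm M, ← mul_sub, abs_mul, mul_left_comm B]
        exact mul_le_mul_of_nonneg_left (hf _ (expProd_pos hT σ)) (abs_nonneg _)
    _ ≤ _ := by
        rw [← mul_sum]
        exact mul_le_mul_of_nonneg_left (sum_abs_convCoeff_mul_le hT hr) hB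

/-- The shift from log(h/a) to log h costs log a, absorbed by 4a^(1/4); this form also covers a > h,
where the sum is empty. -/
theorem abs_harmonic_sub_log_le {h a : ℕ} (hh : 1 ≤ h) (ha : 0 < a) :
    |∑ e ∈ Icc 1 (h / a), 1 / (e : ℝ) - Real.log h| ≤ 4 * (a : ℝ) ^ (1 / 4 : ℝ) := by
  have hh0 : (0 : ℝ) < h := by exact_mod_cast hh
  have ha0 : (0 : ℝ) < a := by exact_mod_cast ha
  have e : ∑ e ∈ Icc 1 (h / a), 1 / (e : ℝ) = ((harmonic (h / a) : ℚ) : ℝ) := by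
    rw [harmonic_eq_sum_Icc]
    push_cast
    simp
  have h1 := log_add_one_le_harmonic (h / a)
  have h2 := harmonic_le_one_add_log (h / a)
  have h3 : Real.log h - Real.log a ≤ Real.log ((h / a : ℕ) + 1 : ℕ) := by
    rw [← Real.log_div hh0.ne' ha0.ne']
    refine Real.log_le_log (by positivity) ?_
    rw [div_le_iff₀ ha0]
    exact_mod_cast (Nat.lt_div_mul_add (a := h) ha).le.trans_eq (by ring)
  have h4 : Real.log ((h / a : ℕ) : ℝ) ≤ Real.log h := by
    rcases Nat.eq_zero_or_pos (h / a) with h0 | h0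
    · rw [h0, Nat.cast_zero, Real.log_zero]
      exact Real.log_natCast_nonneg h
    · exact Real.log_le_log (by exact_mod_cast h0) (by exact_mod_cast Nat.div_le_self h a)
  have h5 : Real.log a ≤ 4 * ((a : ℝ) ^ (1 / 4 : ℝ) - 1) := by
    have := Real.log_le_sub_one_of_pos (Real.rpow_pos_of_pos ha0 (1 / 4))
    rw [Real.log_rpow ha0] at this
    linarith
  have h6 : 0 ≤ Real.log a := Real.log_natCast_nonneg a
  rw [e, abs_le]
  constructor <;> linarith

variable {Q r h : ℕ}

theorem sum_divisors_pairWeight_le (hQ : Squarefree Q) (hr : r.Coprime Q) (X : ℕ) (f : ℕ → ℝ)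
    (hf : ∀ d, 0 ≤ f d) : ∑ d ∈ Q.divisors.filter (fun d => d ≤ X), d * pairWeight Q d * f d ≤
      ∑ d ∈ Icc 1 X, (∏ p ∈ (Q * r).primeFactors, localWeight r p d) * f d := by
  rw [sum_congr rfl fun d hd => by
    rw [← prod_localWeight_of_dvd hQ hr (Nat.mem_divisors.1 (mem_filter.1 hd).1).1]]
  refine sum_le_sum_of_subset_of_nonneg (fun d hd => ?_) fun d _ _ => mul_nonneg
    (prod_nonneg fun p hp => localWeight_nonneg (Nat.prime_of_mem_primeFactors hp) d) (hf d)
  obtain ⟨h1, h2⟩ := mem_filter.1 hd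
  exact mem_Icc.2 ⟨Nat.pos_of_mem_divisors h1, h2⟩

/-- The convolution method with summand 1/d: the main term is log h times the product of the
coefficient sums, which are 1 for p not dividing r and 1 - 1/p otherwise, so that φ(r)/r appears. -/
theorem abs_sum_pairWeight_sub_le (hQ : Squarefree Q) (hr : r.Coprime Q) (hr1 : 1 ≤ r)
    (hh : 1 ≤ h) (hp : ∀ p : ℕ, p.Prime → p ≤ h → p ∣ Q * r) :
    |∑ d ∈ Q.divisors.filter (fun d => d ≤ h), pairWeight Q d -
      (r.totient : ℝ) / r * Real.log h| ≤ 4 * convBound r := by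
  have hQr : Q * r ≠ 0 := mul_ne_zero hQ.ne_zero (by omega)
  have h1 := abs_sum_prod_localWeight_sub_le (T := (Q * r).primeFactors)
    (fun p hp => Nat.prime_of_mem_primeFactors hp) hr1 h (fun d => 1 / (d : ℝ)) (Real.log h) 4
    (by norm_num) fun a ha => by
      have ha0 : (a : ℝ) ≠ 0 := by exact_mod_cast ha.ne'
      rw [sum_filter_dvd ha, mul_sum]
      rw [sum_congr rfl fun e _ => show (a : ℝ) * (1 / ((a * e : ℕ) : ℝ)) = 1 / (e : ℝ) by
        push_cast; field_simp]
      exact abs_harmonic_sub_log_le hh ha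
  have h2 : ∏ p ∈ (Q * r).primeFactors, (if p ∣ r then 1 - 1 / (p : ℝ) else 1) =
      (r.totient : ℝ) / r := by
    have h3 : (Q * r).primeFactors.filter (fun p => p ∣ r) = r.primeFactors := by
      ext p
      rw [mem_filter, Nat.mem_primeFactors, Nat.mem_primeFactors]
      exact ⟨fun h => ⟨h.1.1, h.2, by omega⟩, fun h => ⟨⟨h.1, h.2.1.mul_left Q, hQr⟩, h.2.1⟩⟩
    have h4 := totient_ratio_eq_prod (Q := r) (by omega)
    rw [← prod_filter, h3, ← inv_div, h4, prod_inv_distrib, inv_inv]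
  have h3 : ∑ d ∈ Icc 1 h, (∏ p ∈ (Q * r).primeFactors, localWeight r p d) * (1 / (d : ℝ)) =
      ∑ d ∈ Q.divisors.filter (fun d => d ≤ h), pairWeight Q d := by
    symm
    refine sum_subset_zero_on_sdiff (fun d hd => ?_) (fun d hd => ?_) fun d hd => ?_
    · obtain ⟨h1, h2⟩ := mem_filter.1 hd
      exact mem_Icc.2 ⟨Nat.pos_of_mem_divisors h1, h2⟩
    · obtain ⟨h4, h5⟩ := mem_sdiff.1 hd
      obtain ⟨h6, h7⟩ := mem_Icc.1 h4
      rw [prod_localWeight_of_not_dvd hQr hp (by omega) h7, zero_mul]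
      exact fun h8 => h5 (mem_filter.2 ⟨Nat.mem_divisors.2 ⟨h8, hQ.ne_zero⟩, h7⟩)
    · obtain ⟨h4, h5⟩ := Nat.mem_divisors.1 (mem_filter.1 hd).1
      have : (d : ℝ) ≠ 0 := by
        exact_mod_cast (Nat.pos_of_mem_divisors (mem_filter.1 hd).1).ne'
      rw [prod_localWeight_of_dvd hQ hr h4]
      field_simp
  rwa [h2, h3, mul_comm (Real.log h)] at h1

theorem sum_mul_pairWeight_le (hQ : Squarefree Q) (hr : r.Coprime Q) (hr1 : 1 ≤ r) (h : ℕ) :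
    ∑ d ∈ Q.divisors.filter (fun d => d ≤ h), d * pairWeight Q d ≤ h * convBound r := by
  have h1 := abs_sum_prod_localWeight_sub_le (T := (Q * r).primeFactors)
    (fun p hp => Nat.prime_of_mem_primeFactors hp) hr1 h (fun _ => 1) 0 h
    (by positivity) fun a ha => by
      have ha1 : (1 : ℝ) ≤ a := by exact_mod_cast ha
      rw [sum_filter_dvd ha, sum_const, Nat.card_Icc, Nat.add_sub_cancel, nsmul_eq_mul, mul_one,
        sub_zero, abs_of_nonneg (by positivity)]
      have h2 : (a : ℝ) * ((h / a : ℕ) : ℝ) ≤ h := by exact_mod_cast Nat.mul_div_le h a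
      exact h2.trans (le_mul_of_one_le_right (by positivity) (Real.one_le_rpow ha1 (by norm_num)))
  rw [zero_mul, sub_zero] at h1
  have h2 := sum_divisors_pairWeight_le hQ hr h (fun _ => 1) fun _ => zero_le_one
  simp only [mul_one] at h1 h2
  exact h2.trans ((le_abs_self _).trans h1)

/-- Convolution with 1/d² on d > h: multiples of a contribute a tail of order 1/h, whatever a is. -/
theorem sum_pairWeight_div_le (hQ : Squarefree Q) (hr : r.Coprime Q) (hr1 : 1 ≤ r) (hh : 1 ≤ h) :
    ∑ d ∈ Q.divisors.filter (fun d => h < d), pairWeight Q d / d ≤ 2 / h * convBound r := by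
  have hh0 : (0 : ℝ) < h := by exact_mod_cast hh
  have h1 := abs_sum_prod_localWeight_sub_le (T := (Q * r).primeFactors)
    (fun p hp => Nat.prime_of_mem_primeFactors hp) hr1 Q
    (fun d => if h < d then 1 / (d : ℝ) ^ 2 else 0) 0 (2 / h)
    (by positivity) fun a ha => by
      have ha1 : (1 : ℝ) ≤ a := by exact_mod_cast ha
      have ha0 : (0 : ℝ) < a := by linarith
      have e : ∀ e ∈ Icc 1 (Q / a), (a : ℝ) * (if h < a * e then 1 / ((a * e : ℕ) : ℝ) ^ 2 else 0) =
          if (h : ℝ) / a < e then 1 / a * (1 / (e : ℝ) ^ 2) else 0 := by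
        intro e _
        have : h < a * e ↔ (h : ℝ) / a < e := by
          rw [div_lt_iff₀ ha0, mul_comm]
          exact_mod_cast Iff.rfl
        simp only [this]
        split_ifs
        · push_cast
          field_simp
        · ring
      rw [sum_filter_dvd ha, mul_sum, sum_congr rfl e, ← sum_filter, ← mul_sum, sub_zero,
        abs_of_nonneg (mul_nonneg (by positivity) (sum_nonneg fun _ _ => by positivity))]
      calc _ ≤ 1 / (a : ℝ) * (2 / (h / a)) := by
            gcongr
            exact sum_inv_sq_tail _ (by positivity)
        _ = 2 / h := by field_simp
        _ ≤ _ := le_mul_of_one_le_right (by positivity) (Real.one_le_rpow ha1 (by norm_num))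
  rw [zero_mul, sub_zero] at h1
  have h2 := sum_divisors_pairWeight_le hQ hr Q (fun d => if h < d then 1 / (d : ℝ) ^ 2 else 0)
    fun d => by split_ifs <;> positivity
  have h3 : ∑ d ∈ Q.divisors.filter (fun d => h < d), pairWeight Q d / d =
      ∑ d ∈ Q.divisors.filter (fun d => d ≤ Q), d * pairWeight Q d *
        (if h < d then 1 / (d : ℝ) ^ 2 else 0) := by
    rw [filter_true_of_mem fun d hd => Nat.divisor_le hd, sum_filter]
    refine sum_congr rfl fun d hd => ?_
    have : (d : ℝ) ≠ 0 := by exact_mod_cast (Nat.pos_of_mem_divisors hd).ne'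
    split_ifs
    · field_simp
    · ring
  rw [h3]
  exact h2.trans ((le_abs_self _).trans h1)

/-- The average of the pair correlation is 1; this is why the terms of order h² cancel in the
covariance. -/
theorem sum_pairWeight_div_eq (hQ : Squarefree Q) : ∑ d ∈ Q.divisors, pairWeight Q d / d = 1 := by
  have h1 := sum_pairWeight_mul hQ fun p => 1 / (p : ℝ)
  rw [prod_eq_one fun p hp => ?_] at h1
  · rw [← h1]
    refine sum_congr rfl fun d hd => ?_
    rw [prod_div_distrib, prod_const_one, ← Nat.cast_prod,
      Nat.prod_primeFactors_of_squarefree (hQ.squarefree_of_dvd (Nat.mem_divisors.1 hd).1),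
      mul_one_div]
  · have h2 : (2 : ℝ) ≤ p := by exact_mod_cast (Nat.prime_of_mem_primeFactors hp).two_le
    have h3 : (p : ℝ) - 1 ≠ 0 := by linarith
    field_simp
    ring

end WeightSums

/-! ### Asymptotics of the corrected covariance. -/

section Covariance

set_option linter.unusedSectionVars false

variable {Q : ℕ} [NeZero Q]

theorem localFactor_singleton (m : ℕ) {p : ℕ} (hp : p.Prime) : localFactor {m} p = 1 := by
  have h2 : (2 : ℝ) ≤ p := by exact_mod_cast hp.two_le
  have h3 : 1 - 1 / (p : ℝ) ≠ 0 := by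
    have : 1 / (p : ℝ) ≤ 1 / 2 := one_div_le_one_div_of_le two_pos h2
    linarith
  simp only [localFactor, nuRes, image_singleton, card_singleton, Nat.cast_one, pow_one]
  exact div_self h3

theorem localFactor_pair {m n p : ℕ} (hp : p.Prime) (hmn : m ≠ n)
    [Decidable ((m : ZMod p) = (n : ZMod p))] : localFactor {m, n} p =
      (p : ℝ) / ((p : ℝ) - 1) ^ 2 * (if (m : ZMod p) = (n : ZMod p) then 1 else 0) +
        (1 - 1 / ((p : ℝ) - 1) ^ 2) := by
  have h2 : (2 : ℝ) ≤ p := by exact_mod_cast hp.two_le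
  have h3 : (p : ℝ) - 1 ≠ 0 := by linarith
  have h4 : (p : ℝ) ≠ 0 := by linarith
  simp only [localFactor, nuRes, image_insert, image_singleton, card_pair hmn]
  split_ifs with h
  · rw [h, pair_eq_singleton, card_singleton]
    field_simp
    push_cast
    ring
  · rw [card_pair h]
    field_simp
    push_cast
    ring

theorem prod_primeFactors_ite_eq {d : ℕ} (hd : Squarefree d) (m n : ℕ)
    [∀ e : ℕ, Decidable ((m : ZMod e) = (n : ZMod e))] :
    ∏ p ∈ d.primeFactors, (if (m : ZMod p) = (n : ZMod p) then (1 : ℝ) else 0) =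
      if (m : ZMod d) = (n : ZMod d) then 1 else 0 := by
  have key : ∀ e : ℕ, (m : ZMod e) = (n : ZMod e) ↔ e ∣ ((n : ℤ) - m).natAbs := fun e => by
    rw [ZMod.natCast_eq_natCast_iff, Nat.modEq_iff_dvd, Int.natCast_dvd]
  rw [prod_ite_zero, prod_const_one]
  refine if_congr ?_ rfl rfl
  simp only [key]
  refine ⟨fun h => ?_, fun h p hp => (Nat.dvd_of_mem_primeFactors hp).trans h⟩
  rw [← Nat.prod_primeFactors_of_squarefree hd]
  exact Finset.prod_primes_dvd _ (fun p hp => (Nat.prime_of_mem_primeFactors hp).prime) h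

theorem sum_pairWeight_eq (hQ : Squarefree Q) :
    ∑ d ∈ Q.divisors, pairWeight Q d = (Q : ℝ) / Q.totient := by
  have h1 := sum_pairWeight_mul hQ fun _ => 1
  simp only [prod_const_one, mul_one] at h1
  rw [h1, totient_ratio_eq_prod hQ.ne_zero]
  refine prod_congr rfl fun p hp => ?_
  have h2 : (2 : ℝ) ≤ p := by exact_mod_cast (Nat.prime_of_mem_primeFactors hp).two_le
  have h3 : (p : ℝ) - 1 ≠ 0 := by linarith
  field_simp
  ring

/-- The covariance of two of the centred variables. -/
theorem sum_unitVar_mul (hQ : Squarefree Q) (m n : ℕ)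
    [∀ e : ℕ, Decidable ((m : ZMod e) = (n : ZMod e))] :
    (∑ x : ZMod Q, unitVar (x + (m : ZMod Q)) * unitVar (x + (n : ZMod Q))) / Q =
      (∑ d ∈ Q.divisors, pairWeight Q d * if (m : ZMod d) = (n : ZMod d) then 1 else 0) - 1 := by
  classical
  have hQ0 : (Q : ℝ) ≠ 0 := by exact_mod_cast NeZero.ne Q
  set L := (Q : ℝ) / Q.totient with hL
  set I : ℕ → ZMod Q → ℝ := fun d x => if IsUnit (x + (d : ZMod Q)) then L else 0 with hI
  have h1 : ∀ d : ℕ, (∑ x : ZMod Q, I d x) / Q = 1 := by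
    intro d
    have := sum_prod_isUnit hQ {d}
    rw [prod_eq_one fun p hp => localFactor_singleton d (Nat.prime_of_mem_primeFactors hp)] at this
    simpa only [prod_singleton] using this
  have h2 : (∑ x : ZMod Q, I m x * I n x) / Q =
      ∑ d ∈ Q.divisors, pairWeight Q d * if (m : ZMod d) = (n : ZMod d) then 1 else 0 := by
    -- For m = n the indicator is idempotent and all divisors count, giving Q/φ(Q); otherwise the
    -- average is the truncated singular series of the pair.
    by_cases hmn : m = n
    · subst hmn
      have h3 : ∀ x, I m x * I m x = L * I m x := fun x => by
        simp only [hI]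
        split_ifs <;> ring
      simp_rw [h3]
      rw [← mul_sum, mul_div_assoc, h1, mul_one, hL, ← sum_pairWeight_eq hQ]
      simp
    · have h3 := sum_prod_isUnit hQ {m, n}
      simp only [prod_pair hmn] at h3
      refine h3.trans ?_
      rw [prod_congr rfl fun p hp => localFactor_pair (Nat.prime_of_mem_primeFactors hp) hmn,
        ← sum_pairWeight_mul hQ]
      refine sum_congr rfl fun d hd => ?_
      rw [prod_primeFactors_ite_eq (hQ.squarefree_of_dvd (Nat.mem_divisors.1 hd).1)]
  have h3 : ∀ x : ZMod Q, unitVar (x + (m : ZMod Q)) * unitVar (x + (n : ZMod Q)) =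
      I m x * I n x - I m x - I n x + 1 := fun x => by
    simp only [unitVar, hI, hL]
    ring
  simp_rw [h3]
  rw [sum_add_distrib, sum_sub_distrib, sum_sub_distrib, add_div, sub_div, sub_div, h1, h1, h2,
    sum_const, card_univ, ZMod.card, nsmul_eq_mul, mul_one, div_self hQ0]
  ring

/-- The number of pairs in two residue classes modulo `r` that are congruent modulo `d`. -/
noncomputable def pairCount {r : ℕ} (h d : ℕ) (c₁ c₂ : ZMod r) : ℕ :=
  ((classSet h c₁ ×ˢ classSet h c₂).filter fun z => z.1 ≡ z.2 [MOD d]).card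

theorem classCov_eq_sum (hQ : Squarefree Q) {r : ℕ} (h : ℕ) (c₁ c₂ : ZMod r) :
    classCov Q h c₁ c₂ = ∑ d ∈ Q.divisors, pairWeight Q d * pairCount h d c₁ c₂ -
      (classSet h c₁).card * (classSet h c₂).card := by
  classical
  have h1 : classCov Q h c₁ c₂ = ∑ z ∈ classSet h c₁ ×ˢ classSet h c₂,
      ((∑ x : ZMod Q, unitVar (x + (z.1 : ZMod Q)) * unitVar (x + (z.2 : ZMod Q))) / Q) := by
    rw [classCov, ← sum_div, sum_comm]
    congr 1
    refine sum_congr rfl fun x _ => ?_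
    rw [classVar, classVar, sum_mul_sum, sum_product]
    rfl
  simp_rw [h1, sum_unitVar_mul hQ]
  rw [sum_sub_distrib, sum_comm, sum_const, card_product, nsmul_eq_mul, mul_one]
  push_cast
  congr 1
  refine sum_congr rfl fun d _ => ?_
  rw [← mul_sum, ← sum_filter, sum_const, nsmul_eq_mul, mul_one, pairCount]
  simp only [ZMod.natCast_eq_natCast_iff]

/-- Two integers in [1, h] congruent modulo d > h are equal, so only the diagonal is left. -/
theorem pairCount_of_lt {r h d : ℕ} (hd : h < d) (c₁ c₂ : ZMod r) [Decidable (c₁ = c₂)] :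
    pairCount h d c₁ c₂ = if c₁ = c₂ then (classSet h c₁).card else 0 := by
  have key : ∀ z ∈ (classSet h c₁ ×ˢ classSet h c₂).filter (fun z => z.1 ≡ z.2 [MOD d]),
      z.1 = z.2 := by
    intro z hz
    obtain ⟨h1, h2⟩ := mem_filter.1 hz
    obtain ⟨h3, h4⟩ := mem_product.1 h1
    exact Nat.ModEq.eq_of_lt_of_lt h2 ((mem_classSet.1 h3).1.2.trans_lt hd)
      ((mem_classSet.1 h4).1.2.trans_lt hd)
  rw [pairCount]
  split_ifs with hc
  · subst hc
    refine card_nbij' (fun z => z.1) (fun m => (m, m)) ?_ ?_ ?_ ?_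
    · exact fun z hz => (mem_product.1 (mem_filter.1 hz).1).1
    · exact fun m hm => mem_filter.2 ⟨mem_product.2 ⟨hm, hm⟩, rfl⟩
    · exact fun z hz => Prod.ext rfl (key z hz)
    · exact fun m _ => rfl
  · rw [card_eq_zero, eq_empty_iff_forall_notMem]
    intro z hz
    have h1 := key z hz
    obtain ⟨h3, h4⟩ := mem_product.1 (mem_filter.1 hz).1
    rw [h1] at h3
    exact hc ((mem_classSet.1 h3).2.symm.trans (mem_classSet.1 h4).2)

/-- Each class modulo d meets each class modulo r in h/(dr) + O(1) integers up to h. Writing each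
count as x plus a deviation, the products of deviations sum to O(d), and the mixed terms only
involve the class totals. -/
theorem abs_pairCount_sub_le {r h d : ℕ} (hd : 0 < d) (hr : 1 ≤ r) (hdr : d.Coprime r)
    (c₁ c₂ : ZMod r) :
    |(pairCount h d c₁ c₂ : ℝ) - (h / r : ℝ) ^ 2 / d| ≤ d + 2 * (h / d) := by
  classical
  have hne : NeZero d := ⟨hd.ne'⟩
  have hd0 : (0 : ℝ) < d := by exact_mod_cast hd
  have hr0 : (1 : ℝ) ≤ r := by exact_mod_cast hr
  set x : ℝ := (h : ℝ) / (d * r : ℕ) with hx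
  have hx' : d * x = (h : ℝ) / r := by
    rw [hx]
    push_cast
    field_simp
  have hx0 : 0 ≤ x := by positivity
  have hxd : x ≤ h / d := by
    rw [hx]
    push_cast
    gcongr
    nlinarith
  let N : ZMod r → ZMod d → ℝ := fun c u =>
    (((classSet h c).filter fun m : ℕ => (m : ZMod d) = u).card : ℝ)
  have hN : ∀ c u, |N c u - x| ≤ 1 := by
    intro c u
    have h1 := abs_card_classSet_sub_le (r := d * r) (Nat.mul_pos hd hr) h
      ((ZMod.chineseRemainder hdr).symm (u, c))
    have h2 : classSet h ((ZMod.chineseRemainder hdr).symm (u, c)) =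
        (classSet h c).filter fun m : ℕ => (m : ZMod d) = u := by
      ext m
      rw [mem_classSet, mem_filter, mem_classSet, and_assoc (a := 1 ≤ m ∧ m ≤ h)]
      refine and_congr_right fun _ => ?_
      rw [RingEquiv.eq_symm_apply, map_natCast, Prod.ext_iff, and_comm]
      rfl
    rw [h2] at h1
    exact h1
  have hsum : ∀ c, ∑ u, N c u = (classSet h c).card := by
    intro c
    simp only [N]
    rw [← Nat.cast_sum, ← card_eq_sum_card_fiberwise fun m _ => mem_univ _]
  have hcount : (pairCount h d c₁ c₂ : ℝ) = ∑ u, N c₁ u * N c₂ u := by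
    rw [pairCount, card_eq_sum_card_fiberwise (f := fun z => (z.1 : ZMod d)) (t := univ)
      fun z _ => mem_univ _, Nat.cast_sum]
    refine sum_congr rfl fun u _ => ?_
    simp only [N]
    rw [← Nat.cast_mul, ← card_product]
    congr 2
    ext z
    simp only [mem_filter, mem_product, ← ZMod.natCast_eq_natCast_iff]
    constructor
    · rintro ⟨⟨⟨h1, h2⟩, h3⟩, h4⟩
      exact ⟨⟨h1, h4⟩, h2, h3 ▸ h4⟩
    · rintro ⟨⟨h1, h2⟩, h3, h4⟩
      exact ⟨⟨⟨h1, h3⟩, h2.trans h4.symm⟩, h2⟩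
  have hexp : ∑ u, N c₁ u * N c₂ u - (h / r : ℝ) ^ 2 / d =
      ∑ u, (N c₁ u - x) * (N c₂ u - x) + x * ((classSet h c₁).card - (h : ℝ) / r) +
        x * ((classSet h c₂).card - (h : ℝ) / r) := by
    have h1 : ∀ u, (N c₁ u - x) * (N c₂ u - x) = N c₁ u * N c₂ u - x * N c₁ u - x * N c₂ u + x ^ 2 :=
      fun u => by ring
    simp_rw [h1]
    rw [sum_add_distrib, sum_sub_distrib, sum_sub_distrib, ← mul_sum, ← mul_sum, hsum, hsum,
      sum_const, card_univ, ZMod.card, nsmul_eq_mul, ← hx']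
    field_simp
    ring
  rw [hcount, hexp]
  have h1 : |∑ u, (N c₁ u - x) * (N c₂ u - x)| ≤ d := by
    refine (abs_sum_le_sum_abs _ _).trans ((sum_le_card_nsmul _ _ 1 fun u _ => ?_).trans ?_)
    · rw [abs_mul]
      exact mul_le_one₀ (hN c₁ u) (abs_nonneg _) (hN c₂ u)
    · simp
  have h2 : ∀ c : ZMod r, |x * ((classSet h c).card - (h : ℝ) / r)| ≤ h / d := by
    intro c
    rw [abs_mul, abs_of_nonneg hx0]
    exact (mul_le_of_le_one_right hx0 (abs_card_classSet_sub_le hr h c)).trans hxd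
  have h3 := h2 c₁
  have h4 := h2 c₂
  rw [abs_le] at h1 h3 h4 ⊢
  constructor <;> linarith [h1.1, h1.2, h3.1, h3.2, h4.1, h4.2]

/-- The asymptotic formula for the corrected covariance. -/
theorem abs_correctedCov_sub_log_le {k r h : ℕ} (hQ : Squarefree Q) (hr : r.Coprime Q) (hr1 : 1 ≤ r)
    (hh : 1 ≤ h) (hp : ∀ p : ℕ, p.Prime → p ≤ h → p ∣ Q * r) (c : Fin k → ZMod r) (i j : Fin k)
    [Decidable (c i = c j)] :
    |correctedCov Q h c (((Q : ℝ) / Q.totient - 1) * (h / r)) univ i j -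
      (if c i = c j then -((h / r : ℝ) * ((r.totient : ℝ) / r * Real.log h)) else 0)| ≤
      (7 * convBound r + 6) * h + Q / Q.totient := by
  have hh' : (1 : ℝ) ≤ h := by exact_mod_cast hh
  have hr0 : (1 : ℝ) ≤ r := by exact_mod_cast hr1
  set x : ℝ := (h : ℝ) / r with hx
  have hx0 : 0 ≤ x := by positivity
  have hxh : x ≤ h := div_le_self (by linarith) hr0
  set C := convBound r with hC
  have hC0 : 0 ≤ C := convBound_nonneg r
  set L := (Q : ℝ) / Q.totient with hL
  set N₁ : ℝ := ((classSet h (c i)).card : ℝ) with hN₁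
  set N₂ : ℝ := ((classSet h (c j)).card : ℝ) with hN₂
  have hn1 : |N₁ - x| ≤ 1 := abs_card_classSet_sub_le hr1 h (c i)
  have hn2 : |N₂ - x| ≤ 1 := abs_card_classSet_sub_le hr1 h (c j)
  set D₁ := Q.divisors.filter (fun d => d ≤ h) with hD₁
  set D₂ := Q.divisors.filter (fun d => h < d) with hD₂
  have hsplit : ∀ f : ℕ → ℝ, ∑ d ∈ Q.divisors, f d = ∑ d ∈ D₁, f d + ∑ d ∈ D₂, f d := by
    intro f
    rw [← sum_filter_add_sum_filter_not Q.divisors (fun d => d ≤ h)]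
    simp only [not_le, hD₁, hD₂]
  set G := ∑ d ∈ D₁, pairWeight Q d with hG
  set G' := ∑ d ∈ D₂, pairWeight Q d with hG'
  set W := ∑ d ∈ D₁, pairWeight Q d / d with hW
  set W' := ∑ d ∈ D₂, pairWeight Q d / d with hW'
  have hGL : G + G' = L := by rw [hL, ← sum_pairWeight_eq hQ, hsplit]
  have hWW : W + W' = 1 := by rw [← sum_pairWeight_div_eq hQ, hsplit]
  have hG0 : 0 ≤ G := sum_nonneg fun d _ => pairWeight_nonneg Q d
  have hG0' : 0 ≤ G' := sum_nonneg fun d _ => pairWeight_nonneg Q d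
  have hW0 : 0 ≤ W := sum_nonneg fun d _ => div_nonneg (pairWeight_nonneg Q d) (Nat.cast_nonneg d)
  have hW0' : 0 ≤ W' := sum_nonneg fun d _ => div_nonneg (pairWeight_nonneg Q d) (Nat.cast_nonneg d)
  have hWt : W' ≤ 2 / h * C := sum_pairWeight_div_le hQ hr hr1 hh
  have hlog : |G - (r.totient : ℝ) / r * Real.log h| ≤ 4 * C := abs_sum_pairWeight_sub_le hQ hr hr1 hh hp
  have hE : |∑ d ∈ D₁, pairWeight Q d * pairCount h d (c i) (c j) - x ^ 2 * W| ≤ h * C + 2 * h := by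
    rw [hW, mul_sum, ← sum_sub_distrib]
    refine (abs_sum_le_sum_abs _ _).trans ?_
    calc _ ≤ ∑ d ∈ D₁, (d * pairWeight Q d + 2 * h * (pairWeight Q d / d)) := by
          refine sum_le_sum fun d hd => ?_
          have hd' := (mem_filter.1 hd).1
          have h1 := abs_pairCount_sub_le (h := h) (Nat.pos_of_mem_divisors hd') hr1
            (hr.coprime_dvd_right (Nat.mem_divisors.1 hd').1).symm (c i) (c j)
          rw [show x ^ 2 * (pairWeight Q d / d) = pairWeight Q d * (x ^ 2 / d) by ring, ← mul_sub,
            abs_mul, abs_of_nonneg (pairWeight_nonneg Q d)]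
          refine (mul_le_mul_of_nonneg_left h1 (pairWeight_nonneg Q d)).trans (le_of_eq ?_)
          ring
      _ = ∑ d ∈ D₁, d * pairWeight Q d + 2 * h * W := by rw [sum_add_distrib, ← mul_sum]
      _ ≤ _ := by
          have h1 := sum_mul_pairWeight_le hQ hr hr1 h
          have h2 : 2 * (h : ℝ) * W ≤ 2 * h * 1 := by gcongr; linarith
          linarith
  set E := ∑ d ∈ D₁, pairWeight Q d * pairCount h d (c i) (c j) - x ^ 2 * W with hEdef
  have hcov : classCov Q h (c i) (c j) = E + x ^ 2 * W + (if c i = c j then N₁ * G' else 0) -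
      N₁ * N₂ := by
    rw [classCov_eq_sum hQ, hsplit, hEdef]
    have h1 : ∑ d ∈ D₂, pairWeight Q d * (pairCount h d (c i) (c j) : ℝ) =
        if c i = c j then N₁ * G' else 0 := by
      rw [sum_congr rfl fun d hd => by rw [pairCount_of_lt (mem_filter.1 hd).2]]
      split_ifs
      · rw [← sum_mul, mul_comm]
      · simp
    rw [h1]
    ring
  -- The terms of order h² cancel because the weights over d sum to 1 and the part d > h is O(1/h).
  have hxW : |x ^ 2 * W - N₁ * N₂| ≤ 2 * C * h + 3 * h := by
    have h1 : x ^ 2 * W' ≤ 2 * C * h := by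
      calc x ^ 2 * W' ≤ (h : ℝ) ^ 2 * (2 / h * C) := by gcongr
        _ = 2 * C * h := by field_simp
    have h2 : 0 ≤ x ^ 2 * W' := by positivity
    have h3 : |(N₁ - x) * (N₂ - x)| ≤ 1 := by
      rw [abs_mul]
      exact mul_le_one₀ hn1 (abs_nonneg _) hn2
    have h4 : |x * (N₁ - x)| ≤ h := by
      rw [abs_mul, abs_of_nonneg hx0]
      exact (mul_le_of_le_one_right hx0 hn1).trans hxh
    have h5 : |x * (N₂ - x)| ≤ h := by
      rw [abs_mul, abs_of_nonneg hx0]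
      exact (mul_le_of_le_one_right hx0 hn2).trans hxh
    have h6 : x ^ 2 * W - N₁ * N₂ = -(x ^ 2 * W') - (N₁ - x) * (N₂ - x) - x * (N₁ - x) -
        x * (N₂ - x) := by
      rw [show W = 1 - W' by linarith]
      ring
    rw [h6]
    rw [abs_le] at h3 h4 h5 ⊢
    constructor <;> linarith [h3.1, h3.2, h4.1, h4.2, h5.1, h5.2]
  -- The diagonal terms carry the weights with d > h, that is, L minus the weights with d ≤ h.
  -- Subtracting the correction (L - 1)x removes L and leaves minus x times the sum over d ≤ h, the
  -- source of the negative logarithm.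
  have hdiag : |N₁ * G' - (L - 1) * x + x * ((r.totient : ℝ) / r * Real.log h)| ≤
      L + h + 4 * C * h := by
    have h1 : |(N₁ - x) * G'| ≤ L := by
      rw [abs_mul, abs_of_nonneg hG0']
      exact (mul_le_of_le_one_left hG0' hn1).trans (by linarith)
    have h2 : |x * (G - (r.totient : ℝ) / r * Real.log h)| ≤ 4 * C * h := by
      rw [abs_mul, abs_of_nonneg hx0]
      calc _ ≤ (h : ℝ) * (4 * C) := by gcongr
        _ = _ := by ring
    have h3 : N₁ * G' - (L - 1) * x + x * ((r.totient : ℝ) / r * Real.log h) =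
        (N₁ - x) * G' + x - x * (G - (r.totient : ℝ) / r * Real.log h) := by
      rw [← hGL]
      ring
    rw [h3]
    rw [abs_le] at h1 h2 ⊢
    constructor <;> linarith [h1.1, h1.2, h2.1, h2.2]
  have hL0 : 0 ≤ L := by positivity
  have hCh : 0 ≤ C * h := by positivity
  rw [correctedCov, hcov]
  by_cases hc : c i = c j
  · rw [if_pos hc, if_pos hc, if_pos ⟨mem_univ i, mem_univ j, hc⟩]
    rw [abs_le] at hE hxW hdiag ⊢
    constructor <;> linarith [hE.1, hE.2, hxW.1, hxW.2, hdiag.1, hdiag.2]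
  · rw [if_neg hc, if_neg hc, if_neg fun e => hc e.2.2]
    rw [abs_le] at hE hxW ⊢
    constructor <;> linarith [hE.1, hE.2, hxW.1, hxW.2]

end Covariance

/-! ### The formula in terms of pairings within classes. -/

section Pairings

variable {k r : ℕ}

theorem matchSum_mul {R : Type*} [CommRing R] {g : Fin k → Fin k → R}
    (hg : ∀ i j, g i j = g j i) (M : R) (n : ℕ) : ∀ X : Finset (Fin k), X.card = n →
      matchSum (fun i j => M * g i j) X = M ^ (n / 2) * matchSum g X := by
  induction n using Nat.strong_induction_on with
  | _ n ih =>
    intro X hX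
    rcases X.eq_empty_or_nonempty with rfl | ⟨m, hm⟩
    · rw [card_empty] at hX
      subst hX
      simp [matchSum_empty]
    · rw [matchSum_recursion (fun i j => by rw [hg]) hm, matchSum_recursion hg hm, mul_sum]
      refine sum_congr rfl fun j hj => ?_
      have h1 : ((X.erase j).erase m).card = n - 2 := by
        rw [card_erase_of_mem (mem_erase.2 ⟨(ne_of_mem_erase hj).symm, hm⟩),
          card_erase_of_mem (mem_of_mem_erase hj), hX]
        omega
      have h2 : 2 ≤ n := by
        rw [← hX, ← card_pair (ne_of_mem_erase hj)]
        exact card_le_card (by simp [insert_subset_iff, hm, mem_of_mem_erase hj])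
      rw [ih (n - 2) (by omega) _ h1, show n / 2 = (n - 2) / 2 + 1 by omega, pow_succ]
      ring

/-- The product over a matching is nonzero only if all its pairs lie in a common class. For odd k
both sides vanish, so the rounded exponent does no harm. -/
theorem numEqualPairings_mul_pow (c : Fin k → ZMod r) [∀ i j, Decidable (c i = c j)] (M : ℝ) :
    (numEqualPairings c : ℝ) * M ^ (k / 2) =
      matchSum (fun i j => M * if c i = c j then 1 else 0) univ := by
  classical
  rw [matchSum_mul (fun i j => by simp [eq_comm]) M k univ (by simp), mul_comm, matchSum]
  congr 1
  simp_rw [prod_ite_zero, prod_const_one]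
  rw [← sum_filter, sum_const, nsmul_eq_mul, mul_one, numEqualPairings]
  congr!

/-- Half of the saving h^(-1/(7k)) is spent on ε; the other half beats 1/log h, and (log h)^(k/2 -
1) is at least 1/log h for every k, also for k = 1. -/
theorem rpow_le_log_rpow (hk : 1 ≤ k) {h : ℕ} (hh : 3 ≤ h) :
    (h : ℝ) ^ ((k : ℝ) / 2 - 1 / (7 * (k : ℝ)) + 1 / (14 * k)) ≤
      14 * k * ((h : ℝ) ^ ((k : ℝ) / 2) * Real.log (h : ℝ) ^ ((k : ℝ) / 2 - 1)) := by
  have hk' : (1 : ℝ) ≤ k := by exact_mod_cast hk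
  have hh' : (3 : ℝ) ≤ h := by exact_mod_cast hh
  have hh0 : (0 : ℝ) < h := by linarith
  have hl : 1 ≤ Real.log h := by
    rw [Real.le_log_iff_exp_le hh0]
    linarith [Real.exp_one_lt_d9]
  set e : ℝ := 1 / (14 * k) with he
  have he0 : 0 < e := by positivity
  have h1 : Real.log h ≤ 14 * k * (h : ℝ) ^ e := by
    have := Real.log_le_rpow_div hh0.le he0
    rwa [he, div_div_eq_mul_div, div_one, mul_comm] at this
  have h2 : (Real.log h)⁻¹ ≤ Real.log (h : ℝ) ^ ((k : ℝ) / 2 - 1) := by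
    rw [← Real.rpow_neg_one]
    refine Real.rpow_le_rpow_of_exponent_le hl ?_
    linarith
  have h3 : (k : ℝ) / 2 - 1 / (7 * (k : ℝ)) + e = k / 2 + -e := by
    rw [he]
    field_simp
    ring
  rw [h3, Real.rpow_add hh0, Real.rpow_neg hh0.le]
  have h4 : ((h : ℝ) ^ e)⁻¹ ≤ 14 * k * Real.log (h : ℝ) ^ ((k : ℝ) / 2 - 1) := by
    have h5 : ((h : ℝ) ^ e)⁻¹ ≤ 14 * k * (Real.log h)⁻¹ := by
      rw [inv_le_iff_one_le_mul₀ (by positivity), mul_right_comm, ← div_eq_mul_inv,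
        one_le_div (by linarith)]
      exact h1
    exact h5.trans (by gcongr)
  calc _ ≤ (h : ℝ) ^ ((k : ℝ) / 2) * (14 * k * Real.log (h : ℝ) ^ ((k : ℝ) / 2 - 1)) := by gcongr
    _ = _ := by ring

theorem sqrt_mul_log_pow {h : ℕ} (hh : 3 ≤ h) : 1 / Real.log h * √(h * Real.log h) ^ k =
    (h : ℝ) ^ ((k : ℝ) / 2) * Real.log (h : ℝ) ^ ((k : ℝ) / 2 - 1) := by
  have hh' : (3 : ℝ) ≤ h := by exact_mod_cast hh
  have hl : 0 < Real.log h := Real.log_pos (by linarith)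
  rw [Real.sqrt_eq_rpow, ← Real.rpow_natCast, ← Real.rpow_mul (by positivity),
    show (1 : ℝ) / 2 * k = k / 2 by ring, Real.mul_rpow (by positivity) hl.le,
    Real.rpow_sub_one hl.ne']
  field_simp

/-- The asymptotic formula for `R_k` in terms of pairings. -/
theorem exists_abs_sumR_sub_numEqualPairings_le (r k : ℕ) (hr : 1 ≤ r) (hk : 1 ≤ k) (κ : ℝ) :
    ∃ C : ℝ, ∀ (c : Fin k → ZMod r) (h : ℕ), 3 ≤ h →
      |sumR r h c - (numEqualPairings c : ℝ) *
          (1 / (r : ℝ) * (-((h : ℝ) * ((Nat.totient r : ℝ) / (r : ℝ)) * Real.log (h : ℝ))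
            + κ * (h : ℝ))) ^ (k / 2)| ≤
        C * ((h : ℝ) ^ ((k : ℝ) / 2) * Real.log (h : ℝ) ^ ((k : ℝ) / 2 - 1)) := by
  classical
  have hk' : (1 : ℝ) ≤ k := by exact_mod_cast hk
  have hr' : (1 : ℝ) ≤ r := by exact_mod_cast hr
  obtain ⟨C₁, hC₁⟩ := exists_norm_sumR_sub_mainTerm_le_rpow r k hr hk
    (show (0 : ℝ) < 1 / (14 * k) by positivity)
  -- With exponent 1/(k+1) the ratio Q/φ(Q) at the cutoff h^(k+1) is O(h), the accuracy to which the
  -- covariances are known.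
  obtain ⟨C₂, hC₂, hdiv⟩ := exists_divSum_primeProd_le 1 (show (0 : ℝ) < 1 / (k + 1) by positivity)
  have hcb := convBound_nonneg r
  set B : ℝ := 7 * convBound r + 6 + C₂ + |κ| with hB
  have hB0 : 6 ≤ B := by linarith [abs_nonneg κ]
  set P : ℝ := k + 2 + 2 * B with hP
  refine ⟨|C₁| * (14 * k) + B * P ^ (3 * k), fun c h hh => ?_⟩
  have hh' : (3 : ℝ) ≤ h := by exact_mod_cast hh
  have hh0 : (0 : ℝ) < h := by linarith
  have hl : 1 ≤ Real.log h := by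
    rw [Real.le_log_iff_exp_le hh0]
    linarith [Real.exp_one_lt_d9]
  set Y := h ^ (k + 1) with hY
  have hY1 : h ≤ Y := Nat.le_self_pow (by omega) h
  have hpow : (Y : ℝ) ^ (1 / ((k : ℝ) + 1)) = h := by
    rw [hY, Nat.cast_pow, ← Real.rpow_natCast, ← Real.rpow_mul hh0.le]
    push_cast
    rw [mul_one_div_cancel (by positivity), Real.rpow_one]
  set Q := primeProd r Y with hQdef
  have hQ := squarefree_primeProd r Y
  have hQr := coprime_primeProd r Y
  have hratio : (Q : ℝ) / Q.totient ≤ C₂ * h := by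
    have h1 := hdiv r Y (by omega)
    rw [hpow] at h1
    exact (totient_ratio_le_divSum hQ).trans h1
  have hprime : ∀ p : ℕ, p.Prime → p ≤ h → p ∣ Q * r := by
    intro p hp hph
    by_cases hpr : p ∣ r
    · exact hpr.mul_left Q
    · exact (Nat.dvd_of_mem_primeFactors
        (mem_primeFactors_primeProd.2 ⟨hp, hph.trans hY1, hpr⟩)).mul_right r
  set D : ℝ := ((Q : ℝ) / Q.totient - 1) * (h / r) with hD
  set M : ℝ := 1 / (r : ℝ) * (-((h : ℝ) * ((Nat.totient r : ℝ) / (r : ℝ)) * Real.log (h : ℝ))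
            + κ * (h : ℝ)) with hM
  have hφ : (r.totient : ℝ) / r ≤ 1 := by
    rw [div_le_one (by linarith)]
    exact_mod_cast Nat.totient_le r
  have hφ0 : 0 ≤ (r.totient : ℝ) / r := by positivity
  have hlh : (h : ℝ) ≤ h * Real.log h := le_mul_of_one_le_right hh0.le hl
  have hr1 : 1 / (r : ℝ) ≤ 1 := by rw [div_le_one (by linarith)]; exact hr'
  have hr2 : 0 ≤ 1 / (r : ℝ) := by positivity
  set x : ℝ := (h / r : ℝ) * ((r.totient : ℝ) / r * Real.log h) with hx
  have hx0 : 0 ≤ x := by positivity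
  have hxh : x ≤ h * Real.log h := by
    have h1 : (h : ℝ) / r ≤ h := div_le_self hh0.le hr'
    have h2 : (r.totient : ℝ) / r * Real.log h ≤ Real.log h :=
      mul_le_of_le_one_left (by linarith) hφ
    exact mul_le_mul h1 h2 (by positivity) hh0.le
  have hMx : |M + x| ≤ |κ| * h := by
    have h1 : M + x = 1 / r * (κ * h) := by
      rw [hM, hx]
      ring
    rw [h1, abs_mul, abs_mul, abs_of_nonneg hr2, abs_of_nonneg hh0.le]
    exact mul_le_of_le_one_left (by positivity) hr1
  -- The term `κ * h` is absorbed into O(h), so any constant may stand in place of C_0(r).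
  have hent : ∀ i j, |correctedCov Q h c D univ i j - M * (if c i = c j then 1 else 0)| ≤ B * h := by
    intro i j
    have h1 := abs_correctedCov_sub_log_le hQ hQr hr (by omega) hprime c i j
    rw [← hx] at h1
    have h2 : 0 ≤ |κ| * h := by positivity
    by_cases hc : c i = c j
    · rw [if_pos hc] at h1 ⊢
      rw [abs_le] at h1 hMx ⊢
      constructor <;> linarith [h1.1, h1.2, hMx.1, hMx.2]
    · rw [if_neg hc] at h1 ⊢
      rw [abs_le] at h1 ⊢
      constructor <;> linarith [h1.1, h1.2]
  have hS2 : √(h * Real.log h) ^ 2 = h * Real.log h := Real.sq_sqrt (by positivity)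
  have hMb : |M| ≤ h * Real.log h + |κ| * h := by
    rw [abs_le] at hMx ⊢
    constructor <;> linarith [hMx.1, hMx.2]
  have hκB : |κ| ≤ B := by linarith
  have hBh : B * h ≤ B * (h * Real.log h) := by gcongr
  have hκh : |κ| * h ≤ B * (h * Real.log h) := by gcongr
  have hPh : P * (h * Real.log h) = (k + 2) * (h * Real.log h) + 2 * (B * (h * Real.log h)) := by
    rw [hP]; ring
  have hkh : 1 * (h * Real.log h) ≤ (k + 2) * (h * Real.log h) := by gcongr; linarith
  have hgb' : ∀ i j, |M * (if c i = c j then 1 else 0)| ≤ P * √(h * Real.log h) ^ 2 := by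
    intro i j
    have h0 : 0 ≤ B * (h * Real.log h) := by positivity
    rw [hS2, hPh]
    split_ifs
    · rw [mul_one]
      linarith
    · rw [mul_zero, abs_zero]
      linarith
  have hgb : ∀ i j, |correctedCov Q h c D univ i j| ≤ P * √(h * Real.log h) ^ 2 := by
    intro i j
    have h1 := hent i j
    have h0 : 0 ≤ B * (h * Real.log h) := by positivity
    have h2 : |M * (if c i = c j then 1 else 0)| ≤ h * Real.log h + |κ| * h := by
      split_ifs
      · rwa [mul_one]
      · rw [mul_zero, abs_zero]
        positivity
    rw [hS2, hPh]
    rw [abs_le] at h1 h2 ⊢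
    constructor <;> linarith [h1.1, h1.2, h2.1, h2.2]
  -- Normalizing by S² = h log h turns the entrywise error O(h) into the relative error 1/log h.
  have hcomp := abs_matchSum_sub_le (k := k) (correctedCov_comm h c D univ)
    (g' := fun i j => M * if c i = c j then 1 else 0) (fun i j => by simp [eq_comm])
    (P := P) (S := √(h * Real.log h)) (δ := B * (1 / Real.log h)) (by linarith) (by linarith)
    (Real.sqrt_nonneg _) (by positivity) hgb hgb' (fun i j => by
      rw [hS2]
      refine (hent i j).trans (le_of_eq ?_)
      field_simp) k univ (by simp)
  rw [numEqualPairings_mul_pow]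
  have hmain := hC₁ c h Y hh (Nat.pow_le_pow_right (by omega) (by omega)) le_rfl
  rw [mainTerm_eq_ofReal hQ hQr, ← Complex.ofReal_sub, Complex.norm_real, Real.norm_eq_abs] at hmain
  set G := (h : ℝ) ^ ((k : ℝ) / 2) * Real.log (h : ℝ) ^ ((k : ℝ) / 2 - 1) with hG
  have h1 : C₁ * (h : ℝ) ^ ((k : ℝ) / 2 - 1 / (7 * (k : ℝ)) + 1 / (14 * k)) ≤
      |C₁| * (14 * k * G) :=
    mul_le_mul (le_abs_self _) (rpow_le_log_rpow hk hh) (by positivity) (abs_nonneg _)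
  have h2 : B * (1 / Real.log h) * P ^ (3 * k) * √(h * Real.log h) ^ k = B * P ^ (3 * k) * G := by
    rw [hG, ← sqrt_mul_log_pow hh]
    ring
  rw [h2] at hcomp
  refine (abs_sub_le _ _ _).trans ((add_le_add (hmain.trans h1) hcomp).trans (le_of_eq ?_))
  ring

end Pairings
theorem theorem2 (r k : ℕ) (hr : 1 ≤ r) (hk : 1 ≤ k) :
    (∀ ε : ℝ, 0 < ε → ∃ C : ℝ, ∀ (c : Fin k → ZMod r) (h y : ℕ),
      3 ≤ h → h ^ 2 ≤ y → y ≤ h ^ (k + 1) →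
        ‖((sumR r h c : ℝ) : ℂ) - mainTerm (primeProd r y) h r c‖ ≤
          C * (h : ℝ) ^ ((k : ℝ) / 2 - 1 / (7 * (k : ℝ)) + ε)) ∧
    (∃ C : ℝ, ∀ (c : Fin k → ZMod r) (h : ℕ), 3 ≤ h →
      |sumR r h c - (numEqualPairings c : ℝ) *
          (1 / (r : ℝ) * (-((h : ℝ) * ((Nat.totient r : ℝ) / (r : ℝ)) * Real.log (h : ℝ))
            + constC0 r * (h : ℝ))) ^ (k / 2)| ≤
        C * ((h : ℝ) ^ ((k : ℝ) / 2) * Real.log (h : ℝ) ^ ((k : ℝ) / 2 - 1))) :=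
  ⟨fun _ hε => exists_norm_sumR_sub_mainTerm_le_rpow r k hr hk hε,
    exists_abs_sumR_sub_numEqualPairings_le r k hr hk (constC0 r)⟩
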